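/- Let $k$ be a field and $(H,\mathcal R)$ a quasitriangular Hopf algebra over $k$, $\mathcal R=\mathcal R^{(1)}\otimes\mathcal R^{(2)}$. Let $A$ be a Hopf algebra with a duality pairing $\langle\ ,\ \rangle:H\otimes A\to k$, such that $r(a,b)=\langle \mathcal R^{(1)},a\rangle\langle \mathcal R^{(2)},b\rangle$ makes $A$ dual quasitriangular, i.e. $b_{(1)}a_{(1)}\,r(a_{(2)},b_{(2)})=r(a_{(1)},b_{(1)})\,a_{(2)}b_{(2)}$ for all $a,b\in A$ (this is automatic if the pairing separates the elements of $A$). Let $B$ be a Hopf algebra in the braided category ${}^A\mathcal M$ of left $A$-comodules, regarded as a right $H$-module by $b\triangleleft h=\langle h,b^{(1)}\rangle b^{(2)}$ for the coaction $b\mapsto b^{(1)}\otimes b^{(2)}$, and let $C$ be a Hopf algebra in the braided category $\mathcal M_H$ of right $H$-modules, with braiding $\Psi(v\otimes w)=w\triangleleft\mathcal R^{(1)}\otimes v\triangleleft\mathcal R^{(2)}$ in both cases. Assume that the braided antipode of $C$ is invertible, and let ${\rm ev}:C\otimes B\to k$ be an $H$-invariant categorical duality pairing: ${\rm ev}(cd,b)={\rm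 ev}(d,b_{(1)}){\rm ev}(c,b_{(2)})$, ${\rm ev}(c,ab)={\rm ev}(c_{(2)},a){\rm ev}(c_{(1)},b)$, ${\rm ev}(1,b)=\epsilon(b)$, ${\rm ev}(c,1)=\epsilon(c)$ (braided coproducts). Regard $C$ as a braided group of left modules of $H^{\rm op}$ (with quasitriangular structure $\mathcal R_{21}$) and $B$ as a braided group of right comodules of $A^{\rm cop}$. The bosonisation $X=C\rtimes H^{\rm op}$ and the dual bosonisation $Y=A^{\rm cop}\ltimes B$ are then Hopf algebras, dually paired by $$\langle c\otimes h,a\otimes b\rangle=\langle \mathcal R'^{-(2)}\cdot h_{(1)},a\rangle\,{\rm ev}\big(\underline S^{-1}c,(\mathcal R'^{-(1)}\cdot h_{(2)})\triangleright b\big),$$ where $\mathcal R'=\mathcal R_{21}$, the products are taken in $H^{\rm op}$ and $h\triangleright b=b\triangleleft h$. Let $D(X,Y)$ be their generalised quantum double: the space $X\otimes Y$ with tensor product unit, counit and coproduct and the product $$(x\otimes y)(x'\otimes y')=x'_{(2)}x\otimes y_{(2)}y'\,\langle x'_{(1)},Sy_{(1)}\rangle\langle x'_{(3)},y_{(3)}\rangle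 .$$ Let $\bar C$ be the space $C$ with the opposite product, the left $H$-action $h\triangleright c=c\triangleleft Sh$, the coproduct $c_{\bar{(1)}}\otimes c_{\bar{(2)}}=c_{(1)}\triangleleft\mathcal R^{-(1)}\otimes c_{(2)}\triangleleft\mathcal R^{-(2)}$ and the antipode $\bar S=\underline S^{-1}$, and let $U(\bar C,H,B)$ be the double-bosonisation: the space $\bar C\otimes H\otimes B$ with tensor product unit and counit, and (with $\mathcal R_1,\mathcal R_2$ copies of $\mathcal R$) $$\begin{aligned}(c\otimes h\otimes b)(d\otimes g\otimes a)=\ &c\,(h_{(1)}\mathcal R_1^{(2)}\triangleright d_{\bar{(2)}})\otimes h_{(2)}\mathcal R_2^{(2)}\mathcal R_1^{-(1)}g_{(1)}\otimes(b_{(2)}\triangleleft\mathcal R_2^{-(1)}g_{(2)})\,a\\ &\cdot{\rm ev}(\mathcal R_1^{(1)}\triangleright d_{\bar{(1)}},b_{(1)}\triangleleft\mathcal R_2^{(1)})\ {\rm ev}(\mathcal R_1^{-(2)}\triangleright\bar S d_{\bar{(3)}},b_{(3)}\triangleleft\mathcal R_2^{-(2)}),\\ \Delta(c\otimes h\otimes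 b)=\ &c_{\bar{(1)}}\otimes\mathcal R^{-(1)}h_{(1)}\otimes b_{(1)}\triangleleft\mathcal R^{(1)}\otimes\mathcal R^{-(2)}\triangleright c_{\bar{(2)}}\otimes h_{(2)}\mathcal R^{(2)}\otimes b_{(2)},\end{aligned}$$ where, in the last line, $\mathcal R^{-1}$ and $\mathcal R$ denote independent copies. Theorem. $D(X,Y)$ and $U(\bar C,H,B)$ are Hopf algebras, and $$\pi(c\otimes h\otimes a\otimes b)=c\triangleleft Sh_{(1)}\otimes h_{(2)}\mathcal R^{(2)}\langle a,\mathcal R^{(1)}\rangle\otimes b$$ is a surjective Hopf algebra map $\pi:D(C\rtimes H^{\rm op},A^{\rm cop}\ltimes B)\to U(\bar C,H,B)$. If $H,A,B,C$ are finite-dimensional and $\langle\ ,\ \rangle$ and ${\rm ev}$ are non-degenerate, then the pairing of $X$ and $Y$ is non-degenerate; the element $\mathcal R_D=\sum_i (f^i\otimes 1)\otimes(1\otimes e_i)$, for a basis $\{e_i\}$ of $Y$ and its dual basis $\{f^i\}$ of $X$, is a quasitriangular structure on $D(X,Y)$; the element $\mathcal R_U=\sum_a(f^a\otimes\mathcal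 R_2^{(1)}\mathcal R_1^{(1)}\otimes1)\otimes(1\otimes\mathcal R_1^{(2)}\otimes\underline Se_a\triangleleft\mathcal R_2^{(2)})$, for a basis $\{e_a\}$ of $B$ and its dual basis $\{f^a\}$ of $C$ under ${\rm ev}$, is a quasitriangular structure on $U(\bar C,H,B)$; and $(\pi\otimes\pi)(\mathcal R_D)=\mathcal R_U$. -/

import Mathlib

open scoped TensorProduct

noncomputable section

namespace DoubleBosonisation

/-! ## Tensor bookkeeping -/

section Tensor

variable {k : Type*} [Field k]

/-- Apply `f : Y ⊗ X' → Z ⊗ W` to the two middle factors: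
`(x ⊗ y) ⊗ (x' ⊗ y') ↦ (x ⊗ f(y ⊗ x')⁽¹⁾) ⊗ (f(y ⊗ x')⁽²⁾ ⊗ y')`. -/
def midMap {X Y X' Y' Z W : Type*}
    [AddCommGroup X] [Module k X] [AddCommGroup Y] [Module k Y]
    [AddCommGroup X'] [Module k X'] [AddCommGroup Y'] [Module k Y']
    [AddCommGroup Z] [Module k Z] [AddCommGroup W] [Module k W]
    (f : Y ⊗[k] X' →ₗ[k] Z ⊗[k] W) :
    (X ⊗[k] Y) ⊗[k] (X' ⊗[k] Y') →ₗ[k] (X ⊗[k] Z) ⊗[k] (W ⊗[k] Y') :=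
  (TensorProduct.assoc k X Z (W ⊗[k] Y')).symm.toLinearMap ∘ₗ
    LinearMap.lTensor X
      ((TensorProduct.assoc k Z W Y').toLinearMap ∘ₗ LinearMap.rTensor Y' f ∘ₗ
        (TensorProduct.assoc k Y X' Y').symm.toLinearMap) ∘ₗ
    (TensorProduct.assoc k X Y (X' ⊗[k] Y')).toLinearMap

/-- Interchange of the two middle factors: `(x ⊗ y) ⊗ (z ⊗ w) ↦ (x ⊗ z) ⊗ (y ⊗ w)`. -/
abbrev interchange {X Y Z W : Type*}
    [AddCommGroup X] [Module k X] [AddCommGroup Y] [Module k Y]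
    [AddCommGroup Z] [Module k Z] [AddCommGroup W] [Module k W] :
    (X ⊗[k] Y) ⊗[k] (Z ⊗[k] W) →ₗ[k] (X ⊗[k] Z) ⊗[k] (Y ⊗[k] W) :=
  (TensorProduct.tensorTensorTensorComm k X Y Z W).toLinearMap

/-- The transposition `x ⊗ y ↦ y ⊗ x`. -/
abbrev tswap {X Y : Type*} [AddCommGroup X] [Module k X] [AddCommGroup Y] [Module k Y] :
    X ⊗[k] Y →ₗ[k] Y ⊗[k] X :=
  (TensorProduct.comm k X Y).toLinearMap

/-- `x ↦ x ⊗ y` for a fixed `y`. -/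
abbrev tensorRight (X : Type*) {Y : Type*} [AddCommGroup X] [Module k X] [AddCommGroup Y]
    [Module k Y] (y : Y) : X →ₗ[k] X ⊗[k] Y :=
  (TensorProduct.mk k X Y).flip y

/-- `y ↦ x ⊗ y` for a fixed `x`. -/
abbrev tensorLeft {X : Type*} (Y : Type*) [AddCommGroup X] [Module k X] [AddCommGroup Y]
    [Module k Y] (x : X) : Y →ₗ[k] X ⊗[k] Y :=
  TensorProduct.mk k X Y x

/-- For `t = t⁽¹⁾ ⊗ t⁽²⁾` and a bilinear form `⟨ , ⟩`, the map `y ↦ ⟨t⁽¹⁾, y⟩ t⁽²⁾`. -/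
def slice {X Y Z : Type*} [AddCommGroup X] [Module k X] [AddCommGroup Y] [Module k Y]
    [AddCommGroup Z] [Module k Z] (P : X ⊗[k] Y →ₗ[k] k) (t : X ⊗[k] Z) : Y →ₗ[k] Z :=
  (TensorProduct.rid k Z).toLinearMap ∘ₗ LinearMap.lTensor Z P ∘ₗ
    (TensorProduct.assoc k Z X Y).toLinearMap ∘ₗ tensorLeft Y (tswap t)

/-- `t ∈ X ⊗ Y` is the canonical element (coevaluation) of the bilinear form `P`:
`⟨t⁽¹⁾, y⟩ t⁽²⁾ = y` and `t⁽¹⁾ ⟨x, t⁽²⁾⟩ = x`. That is, `t = ∑ fᵃ ⊗ eₐ` for a basis `eₐ` of `Y`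
and the dual basis `fᵃ` of `X`. -/
structure IsCanonicalElement {X Y : Type*} [AddCommGroup X] [Module k X] [AddCommGroup Y]
    [Module k Y] (P : X ⊗[k] Y →ₗ[k] k) (t : X ⊗[k] Y) : Prop where
  right : slice P t = LinearMap.id
  left : slice (P ∘ₗ tswap) (tswap t) = LinearMap.id

open Classical in
/-- The inverse of a bijective linear map (and `0` for a map that is not bijective). -/
def linInv {X : Type*} [AddCommGroup X] [Module k X] (f : X →ₗ[k] X) : X →ₗ[k] X :=
  if h : Function.Bijective f then (LinearEquiv.ofBijective f h).symm.toLinearMap else 0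

end Tensor

/-! ## Bialgebras and Hopf algebras, ordinary and braided, through their structure maps -/

/-- The structure maps of a bialgebra, without any axiom. -/
structure BialgData (k V : Type*) [Field k] [AddCommGroup V] [Module k V] where
  /-- the product -/
  mul : V ⊗[k] V →ₗ[k] V
  /-- the unit -/
  one : V
  /-- the coproduct -/
  comul : V →ₗ[k] V ⊗[k] V
  /-- the counit -/
  counit : V →ₗ[k] k

/-- The structure maps of a Hopf algebra, without any axiom. -/
structure HopfData (k V : Type*) [Field k] [AddCommGroup V] [Module k V] extends
    BialgData k V where
  /-- the antipode -/
  antipode : V →ₗ[k] V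

section Hopf

variable {k V W : Type*} [Field k] [AddCommGroup V] [Module k V] [AddCommGroup W] [Module k W]

/-- The structure maps of a Hopf algebra in the sense of Mathlib. -/
def HopfData.of (k H : Type*) [Field k] [Ring H] [HopfAlgebra k H] : HopfData k H where
  mul := LinearMap.mul' k H
  one := 1
  comul := Coalgebra.comul
  counit := Coalgebra.counit
  antipode := HopfAlgebra.antipode k

/-- The opposite product. -/
def BialgData.op (X : BialgData k V) : BialgData k V where
  mul := X.mul ∘ₗ tswap
  one := X.one
  comul := X.comul
  counit := X.counit

/-- The opposite coproduct. -/
def BialgData.cop (X : BialgData k V) : BialgData k V where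
  mul := X.mul
  one := X.one
  comul := tswap ∘ₗ X.comul
  counit := X.counit

/-- `X^op`: the opposite product, with antipode `S⁻¹`. -/
def HopfData.op (X : HopfData k V) : HopfData k V :=
  { X.toBialgData.op with antipode := linInv X.antipode }

/-- `X^cop`: the opposite coproduct, with antipode `S⁻¹`. -/
def HopfData.cop (X : HopfData k V) : HopfData k V :=
  { X.toBialgData.cop with antipode := linInv X.antipode }

/-- The product `(x ⊗ y)(z ⊗ w) = x · Ψ(y ⊗ z) · w` of the tensor square defined by `Ψ`. -/
def BialgData.sqMul (X : BialgData k V) (Ψ : V ⊗[k] V →ₗ[k] V ⊗[k] V) :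
    (V ⊗[k] V) ⊗[k] (V ⊗[k] V) →ₗ[k] V ⊗[k] V :=
  TensorProduct.map X.mul X.mul ∘ₗ midMap Ψ

/-- The axioms of a bialgebra whose coproduct is multiplicative for the braided tensor product
algebra defined by the braiding `Ψ` of `V` with itself. -/
structure BialgData.IsBraidedBialgebra (X : BialgData k V) (Ψ : V ⊗[k] V →ₗ[k] V ⊗[k] V) :
    Prop where
  mul_assoc : ∀ x y z : V, X.mul (X.mul (x ⊗ₜ y) ⊗ₜ z) = X.mul (x ⊗ₜ X.mul (y ⊗ₜ z))
  one_mul : ∀ x : V, X.mul (X.one ⊗ₜ x) = x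
  mul_one : ∀ x : V, X.mul (x ⊗ₜ X.one) = x
  coassoc : ∀ x : V, TensorProduct.assoc k V V V (LinearMap.rTensor V X.comul (X.comul x)) =
    LinearMap.lTensor V X.comul (X.comul x)
  counit_comul : ∀ x : V, TensorProduct.lid k V (LinearMap.rTensor V X.counit (X.comul x)) = x
  comul_counit : ∀ x : V, TensorProduct.rid k V (LinearMap.lTensor V X.counit (X.comul x)) = x
  comul_mul : ∀ x y : V, X.comul (X.mul (x ⊗ₜ y)) = X.sqMul Ψ (X.comul x ⊗ₜ X.comul y)
  comul_one : X.comul X.one = X.one ⊗ₜ X.one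
  counit_mul : ∀ x y : V, X.counit (X.mul (x ⊗ₜ y)) = X.counit x * X.counit y
  counit_one : X.counit X.one = 1

/-- An ordinary bialgebra: the braiding is the transposition. -/
def BialgData.IsBialgebra (X : BialgData k V) : Prop := X.IsBraidedBialgebra tswap

/-- `S` is an antipode: the convolution inverse of the identity. -/
structure BialgData.IsAntipode (X : BialgData k V) (S : V →ₗ[k] V) : Prop where
  left : ∀ x : V, X.mul (LinearMap.rTensor V S (X.comul x)) = X.counit x • X.one
  right : ∀ x : V, X.mul (LinearMap.lTensor V S (X.comul x)) = X.counit x • X.one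

/-- A homomorphism of bialgebras. -/
structure BialgData.IsHom (X : BialgData k V) (Y : BialgData k W) (f : V →ₗ[k] W) : Prop where
  map_mul : ∀ x y : V, f (X.mul (x ⊗ₜ y)) = Y.mul (f x ⊗ₜ f y)
  map_one : f X.one = Y.one
  map_comul : ∀ x : V, Y.comul (f x) = TensorProduct.map f f (X.comul x)
  map_counit : ∀ x : V, Y.counit (f x) = X.counit x

/-- A duality pairing of bialgebras: `⟨xx', y⟩ = ⟨x, y₍₁₎⟩⟨x', y₍₂₎⟩`,
`⟨x, yy'⟩ = ⟨x₍₁₎, y⟩⟨x₍₂₎, y'⟩`, `⟨1, y⟩ = ε(y)`, `⟨x, 1⟩ = ε(x)`. -/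
structure IsHopfPairing (X : BialgData k V) (Y : BialgData k W) (P : V ⊗[k] W →ₗ[k] k) :
    Prop where
  mul_left : ∀ (x x' : V) (y : W), P (X.mul (x ⊗ₜ x') ⊗ₜ y) =
    LinearMap.mul' k k (TensorProduct.map P P (interchange ((x ⊗ₜ x') ⊗ₜ Y.comul y)))
  mul_right : ∀ (x : V) (y y' : W), P (x ⊗ₜ Y.mul (y ⊗ₜ y')) =
    LinearMap.mul' k k (TensorProduct.map P P (interchange (X.comul x ⊗ₜ (y ⊗ₜ y'))))
  one_left : ∀ y : W, P (X.one ⊗ₜ y) = Y.counit y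
  one_right : ∀ x : V, P (x ⊗ₜ Y.one) = X.counit x

/-- `R₁₃R₂₃ = R⁽¹⁾ ⊗ R'⁽¹⁾ ⊗ R⁽²⁾R'⁽²⁾`. -/
def BialgData.r13r23 (X : BialgData k V) (R : V ⊗[k] V) : (V ⊗[k] V) ⊗[k] V :=
  LinearMap.lTensor (V ⊗[k] V) X.mul (interchange (R ⊗ₜ R))

/-- `R₁₃R₁₂ = R⁽¹⁾R'⁽¹⁾ ⊗ R'⁽²⁾ ⊗ R⁽²⁾`. -/
def BialgData.r13r12 (X : BialgData k V) (R : V ⊗[k] V) : V ⊗[k] (V ⊗[k] V) :=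
  TensorProduct.map X.mul tswap (interchange (R ⊗ₜ R))

/-- `R` is a quasitriangular structure with inverse `Rinv`. -/
structure BialgData.IsQuasitriangular (X : BialgData k V) (R Rinv : V ⊗[k] V) : Prop where
  mul_inv : X.sqMul tswap (R ⊗ₜ Rinv) = X.one ⊗ₜ X.one
  inv_mul : X.sqMul tswap (Rinv ⊗ₜ R) = X.one ⊗ₜ X.one
  comul_left : LinearMap.rTensor V X.comul R = X.r13r23 R
  comul_right : LinearMap.lTensor V X.comul R = X.r13r12 R
  quasicocomm : ∀ x : V, X.sqMul tswap (tswap (X.comul x) ⊗ₜ R) = X.sqMul tswap (R ⊗ₜ X.comul x)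

/-- The quasicommutativity axiom `b₍₁₎ a₍₁₎ r(a₍₂₎, b₍₂₎) = r(a₍₁₎, b₍₁₎) a₍₂₎ b₍₂₎` of a dual
quasitriangular structure `r` on `X`. -/
def BialgData.IsQuasicommutative (X : BialgData k V) (r : V ⊗[k] V →ₗ[k] k) : Prop :=
  ∀ a b : V,
    TensorProduct.rid k V (TensorProduct.map (X.mul ∘ₗ tswap) r
      (interchange (X.comul a ⊗ₜ X.comul b))) =
    TensorProduct.lid k V (TensorProduct.map r X.mul
      (interchange (X.comul a ⊗ₜ X.comul b)))

/-- `r(a, b) = ⟨R⁽¹⁾, a⟩⟨R⁽²⁾, b⟩`, for a pairing `⟨ , ⟩` of `V` with `W` and `R ∈ V ⊗ V`. -/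
def evalForm (P : V ⊗[k] W →ₗ[k] k) (R : V ⊗[k] V) : W ⊗[k] W →ₗ[k] k :=
  LinearMap.mul' k k ∘ₗ TensorProduct.map P P ∘ₗ interchange ∘ₗ tensorLeft (W ⊗[k] W) R

/-- The structure on `X ⊗ Y` with product and coproduct twisted by `τ : Y ⊗ X → X ⊗ Y` and
`σ : X ⊗ Y → Y ⊗ X`: `(x ⊗ y)(x' ⊗ y') = x · τ(y ⊗ x') · y'` and
`Δ(x ⊗ y) = x₍₁₎ ⊗ σ(x₍₂₎ ⊗ y₍₁₎) ⊗ y₍₂₎`, with tensor product unit and counit. -/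
def BialgData.twist (X : BialgData k V) (Y : BialgData k W)
    (τ : W ⊗[k] V →ₗ[k] V ⊗[k] W) (σ : V ⊗[k] W →ₗ[k] W ⊗[k] V) : BialgData k (V ⊗[k] W) where
  mul := TensorProduct.map X.mul Y.mul ∘ₗ midMap τ
  one := X.one ⊗ₜ Y.one
  comul := midMap σ ∘ₗ TensorProduct.map X.comul Y.comul
  counit := LinearMap.mul' k k ∘ₗ TensorProduct.map X.counit Y.counit

/-- The same with the antipode `τ ∘ (S_Y ⊗ S_X) ∘ σ`. -/
def HopfData.twist (X : HopfData k V) (Y : HopfData k W)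
    (τ : W ⊗[k] V →ₗ[k] V ⊗[k] W) (σ : V ⊗[k] W →ₗ[k] W ⊗[k] V) : HopfData k (V ⊗[k] W) :=
  { X.toBialgData.twist Y.toBialgData τ σ with
    antipode := τ ∘ₗ TensorProduct.map Y.antipode X.antipode ∘ₗ σ }

end Hopf

/-! ## Modules, comodules and braided groups -/

section Braided

variable {k H A C B : Type*} [Field k] [AddCommGroup H] [Module k H] [AddCommGroup A] [Module k A]
  [AddCommGroup C] [Module k C] [AddCommGroup B] [Module k B]

/-- The action `(v ⊗ w) ◁ h = v ◁ h₍₁₎ ⊗ w ◁ h₍₂₎` on a tensor product. -/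
def tensorAct (𝓗 : BialgData k H) (actC : C ⊗[k] H →ₗ[k] C) (actB : B ⊗[k] H →ₗ[k] B) :
    (C ⊗[k] B) ⊗[k] H →ₗ[k] C ⊗[k] B :=
  TensorProduct.map actC actB ∘ₗ interchange ∘ₗ LinearMap.lTensor (C ⊗[k] B) 𝓗.comul

/-- The coaction `v ⊗ w ↦ v⁽¹⁾w⁽¹⁾ ⊗ v⁽²⁾ ⊗ w⁽²⁾` on a tensor square. -/
def tensorCoact (𝓐 : BialgData k A) (β : B →ₗ[k] A ⊗[k] B) :
    B ⊗[k] B →ₗ[k] A ⊗[k] (B ⊗[k] B) :=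
  LinearMap.rTensor (B ⊗[k] B) 𝓐.mul ∘ₗ interchange ∘ₗ TensorProduct.map β β

/-- The braiding `Ψ(v ⊗ w) = w ◁ R⁽¹⁾ ⊗ v ◁ R⁽²⁾` of a right module with itself. -/
def braiding (act : C ⊗[k] H →ₗ[k] C) (R : H ⊗[k] H) : C ⊗[k] C →ₗ[k] C ⊗[k] C :=
  TensorProduct.map act act ∘ₗ interchange ∘ₗ tensorRight (C ⊗[k] C) R ∘ₗ tswap

/-- `c ◁ h` defines a right module of the algebra `𝓗`. -/
structure IsRightModule (𝓗 : BialgData k H) (act : C ⊗[k] H →ₗ[k] C) : Prop where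
  act_one : ∀ c : C, act (c ⊗ₜ 𝓗.one) = c
  act_mul : ∀ (c : C) (h g : H), act (c ⊗ₜ 𝓗.mul (h ⊗ₜ g)) = act (act (c ⊗ₜ h) ⊗ₜ g)

/-- `β(b) = b⁽¹⁾ ⊗ b⁽²⁾` defines a left comodule of the coalgebra `𝓐`. -/
structure IsLeftComodule (𝓐 : BialgData k A) (β : B →ₗ[k] A ⊗[k] B) : Prop where
  counit : ∀ b : B, TensorProduct.lid k B (LinearMap.rTensor B 𝓐.counit (β b)) = b
  coassoc : ∀ b : B, TensorProduct.assoc k A A B (LinearMap.rTensor B 𝓐.comul (β b)) =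
    LinearMap.lTensor A β (β b)

/-- The right action `b ◁ h = ⟨h, b⁽¹⁾⟩ b⁽²⁾` defined by a left coaction of `A`. -/
def evalAct (pair : H ⊗[k] A →ₗ[k] k) (β : B →ₗ[k] A ⊗[k] B) : B ⊗[k] H →ₗ[k] B :=
  (TensorProduct.lid k B).toLinearMap ∘ₗ LinearMap.rTensor B pair ∘ₗ
    (TensorProduct.assoc k H A B).symm.toLinearMap ∘ₗ LinearMap.lTensor H β ∘ₗ tswap

/-- `𝓒` is a Hopf algebra in the braided category of right modules of the quasitriangular Hopf
algebra `(𝓗, R)`: a right module whose structure maps intertwine the action, and a braided Hopf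
algebra for the braiding of that category. -/
structure IsModuleBraidedGroup (𝓗 : BialgData k H) (R : H ⊗[k] H) (act : C ⊗[k] H →ₗ[k] C)
    (𝓒 : HopfData k C) : Prop where
  isRightModule : IsRightModule 𝓗 act
  mul_act : 𝓒.mul ∘ₗ tensorAct 𝓗 act act = act ∘ₗ LinearMap.rTensor H 𝓒.mul
  one_act : ∀ h : H, act (𝓒.one ⊗ₜ h) = 𝓗.counit h • 𝓒.one
  comul_act : 𝓒.comul ∘ₗ act = tensorAct 𝓗 act act ∘ₗ LinearMap.rTensor H 𝓒.comul
  counit_act : ∀ (c : C) (h : H), 𝓒.counit (act (c ⊗ₜ h)) = 𝓒.counit c * 𝓗.counit h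
  antipode_act : 𝓒.antipode ∘ₗ act = act ∘ₗ LinearMap.rTensor H 𝓒.antipode
  isBraidedBialgebra : 𝓒.IsBraidedBialgebra (braiding act R)
  isAntipode : 𝓒.IsAntipode 𝓒.antipode

/-- `𝓑` is a Hopf algebra in the braided category of left comodules of `𝓐`, where `(𝓗, R)` is a
quasitriangular Hopf algebra dually paired with `𝓐`: a left comodule whose structure maps
intertwine the coaction, and a braided Hopf algebra for the braiding
`Ψ(v ⊗ w) = w ◁ R⁽¹⁾ ⊗ v ◁ R⁽²⁾`, with `b ◁ h = ⟨h, b⁽¹⁾⟩ b⁽²⁾`. -/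
structure IsComoduleBraidedGroup (𝓐 : BialgData k A) (pair : H ⊗[k] A →ₗ[k] k) (R : H ⊗[k] H)
    (β : B →ₗ[k] A ⊗[k] B) (𝓑 : HopfData k B) : Prop where
  isLeftComodule : IsLeftComodule 𝓐 β
  coact_mul : β ∘ₗ 𝓑.mul = LinearMap.lTensor A 𝓑.mul ∘ₗ tensorCoact 𝓐 β
  coact_one : β 𝓑.one = 𝓐.one ⊗ₜ 𝓑.one
  coact_comul : LinearMap.lTensor A 𝓑.comul ∘ₗ β = tensorCoact 𝓐 β ∘ₗ 𝓑.comul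
  coact_counit : ∀ b : B, TensorProduct.rid k A (LinearMap.lTensor A 𝓑.counit (β b)) =
    𝓑.counit b • 𝓐.one
  coact_antipode : β ∘ₗ 𝓑.antipode = LinearMap.lTensor A 𝓑.antipode ∘ₗ β
  isBraidedBialgebra : 𝓑.IsBraidedBialgebra (braiding (evalAct pair β) R)
  isAntipode : 𝓑.IsAntipode 𝓑.antipode

/-- `ev : C ⊗ B → k` is a categorical duality pairing of braided groups in the category of right
`𝓗`-modules: `ev(c ◁ h₍₁₎, b ◁ h₍₂₎) = ε(h) ev(c, b)`, `ev(cd, b) = ev(d, b₍₁₎) ev(c, b₍₂₎)`,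
`ev(c, ab) = ev(c₍₂₎, a) ev(c₍₁₎, b)`, `ev(1, b) = ε(b)`, `ev(c, 1) = ε(c)`. -/
structure IsCategoricalPairing (𝓗 : BialgData k H) (actC : C ⊗[k] H →ₗ[k] C)
    (actB : B ⊗[k] H →ₗ[k] B) (𝓒 : BialgData k C) (𝓑 : BialgData k B)
    (ev : C ⊗[k] B →ₗ[k] k) : Prop where
  invariant : ∀ (c : C) (b : B) (h : H),
    ev (tensorAct 𝓗 actC actB ((c ⊗ₜ b) ⊗ₜ h)) = ev (c ⊗ₜ b) * 𝓗.counit h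
  mul_left : ∀ (c d : C) (b : B), ev (𝓒.mul (c ⊗ₜ d) ⊗ₜ b) =
    LinearMap.mul' k k (TensorProduct.map ev ev (interchange ((d ⊗ₜ c) ⊗ₜ 𝓑.comul b)))
  mul_right : ∀ (c : C) (a b : B), ev (c ⊗ₜ 𝓑.mul (a ⊗ₜ b)) =
    LinearMap.mul' k k (TensorProduct.map ev ev (interchange (tswap (𝓒.comul c) ⊗ₜ (a ⊗ₜ b))))
  one_left : ∀ b : B, ev (𝓒.one ⊗ₜ b) = 𝓑.counit b
  one_right : ∀ c : C, ev (c ⊗ₜ 𝓑.one) = 𝓒.counit c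

end Braided

/-! ## Bosonisations -/

section Bosonisation

variable {k H A C B : Type*} [Field k] [AddCommGroup H] [Module k H] [AddCommGroup A] [Module k A]
  [AddCommGroup C] [Module k C] [AddCommGroup B] [Module k B]

/-- `h ⊗ c ↦ h₍₁₎ ▷ c ⊗ h₍₂₎`. -/
def smash (𝓗 : BialgData k H) (act : H ⊗[k] C →ₗ[k] C) : H ⊗[k] C →ₗ[k] C ⊗[k] H :=
  LinearMap.rTensor H act ∘ₗ (TensorProduct.rightComm k H H C).toLinearMap ∘ₗ
    LinearMap.rTensor C 𝓗.comul

/-- `c ⊗ h ↦ R⁽²⁾h ⊗ R⁽¹⁾ ▷ c`. -/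
def cosmash (𝓗 : BialgData k H) (R : H ⊗[k] H) (act : H ⊗[k] C →ₗ[k] C) :
    C ⊗[k] H →ₗ[k] H ⊗[k] C :=
  TensorProduct.map 𝓗.mul act ∘ₗ interchange ∘ₗ tensorLeft (H ⊗[k] C) (tswap R) ∘ₗ tswap

/-- The bosonisation `C ⋊ H` of a braided group `C` of left modules of `(H, R)`:
`(c ⊗ h)(d ⊗ g) = c(h₍₁₎ ▷ d) ⊗ h₍₂₎g`, `Δ(c ⊗ h) = c₍₁₎ ⊗ R⁽²⁾h₍₁₎ ⊗ R⁽¹⁾ ▷ c₍₂₎ ⊗ h₍₂₎`,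
`S(c ⊗ h) = (1 ⊗ S(R⁽²⁾h))(S(R⁽¹⁾ ▷ c) ⊗ 1)`. -/
def leftBosonisation (𝓒 : HopfData k C) (𝓗 : HopfData k H) (R : H ⊗[k] H)
    (act : H ⊗[k] C →ₗ[k] C) : HopfData k (C ⊗[k] H) :=
  𝓒.twist 𝓗 (smash 𝓗.toBialgData act) (cosmash 𝓗.toBialgData R act)

/-- The bosonisation `H ⋉ B` of a braided group `B` of right modules of `(H, R)`:
`(h ⊗ b)(g ⊗ a) = hg₍₁₎ ⊗ (b ◁ g₍₂₎)a`, `Δ(h ⊗ b) = h₍₁₎ ⊗ b₍₁₎ ◁ R⁽¹⁾ ⊗ h₍₂₎R⁽²⁾ ⊗ b₍₂₎`. -/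
def rightBosonisation (𝓗 : BialgData k H) (𝓑 : BialgData k B) (R : H ⊗[k] H)
    (act : B ⊗[k] H →ₗ[k] B) : BialgData k (H ⊗[k] B) :=
  𝓗.twist 𝓑
    (LinearMap.lTensor H act ∘ₗ (TensorProduct.leftComm k B H H).toLinearMap ∘ₗ
      LinearMap.lTensor B 𝓗.comul)
    (TensorProduct.map act 𝓗.mul ∘ₗ interchange ∘ₗ tensorRight (B ⊗[k] H) R ∘ₗ tswap)

/-- The left action `h ▷ b = b⁽¹⁾ ⟨h, b⁽²⁾⟩` defined by a right coaction `b ↦ b⁽¹⁾ ⊗ b⁽²⁾`. -/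
def coevalAct (pair : H ⊗[k] A →ₗ[k] k) (γ : B →ₗ[k] B ⊗[k] A) : H ⊗[k] B →ₗ[k] B :=
  (TensorProduct.rid k B).toLinearMap ∘ₗ LinearMap.lTensor B pair ∘ₗ
    (TensorProduct.leftComm k H B A).toLinearMap ∘ₗ LinearMap.lTensor H γ

/-- The dual bosonisation `A ⋉ B` of a braided group `B` of right comodules of `A`, where `A` is
dually paired with `(H, R)`:
`(a ⊗ b)(d ⊗ c) = ad₍₁₎ ⊗ (R⁽¹⁾ ▷ b) c ⟨R⁽²⁾, d₍₂₎⟩`,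
`Δ(a ⊗ b) = a₍₁₎ ⊗ b₍₁₎⁽¹⁾ ⊗ a₍₂₎ b₍₁₎⁽²⁾ ⊗ b₍₂₎`,
`S(a ⊗ b) = (1 ⊗ S b⁽¹⁾)(S(a b⁽²⁾) ⊗ 1)`, where `h ▷ b = b⁽¹⁾ ⟨h, b⁽²⁾⟩`. -/
def dualBosonisation (𝓐 : HopfData k A) (𝓑 : HopfData k B) (pair : H ⊗[k] A →ₗ[k] k)
    (R : H ⊗[k] H) (γ : B →ₗ[k] B ⊗[k] A) : HopfData k (A ⊗[k] B) :=
  𝓐.twist 𝓑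
    (LinearMap.lTensor A (coevalAct pair γ) ∘ₗ (TensorProduct.assoc k A H B).toLinearMap ∘ₗ
      LinearMap.rTensor B (LinearMap.lTensor A (slice pair (tswap R)) ∘ₗ 𝓐.comul) ∘ₗ tswap)
    (LinearMap.lTensor B 𝓐.mul ∘ₗ (TensorProduct.leftComm k A B A).toLinearMap ∘ₗ
      LinearMap.lTensor A γ)

/-- The duality pairing of `C ⋊ H` with `A ⋉ B`:
`⟨c ⊗ h, a ⊗ b⟩ = ⟨R⁻⁽²⁾h₍₁₎, a⟩ ev(S⁻¹c, R⁻⁽¹⁾h₍₂₎ ▷ b)`. -/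
def bosonisationPairing (𝓒 : HopfData k C) (𝓗 : BialgData k H) (Rinv : H ⊗[k] H)
    (pair : H ⊗[k] A →ₗ[k] k) (γ : B →ₗ[k] B ⊗[k] A) (ev : C ⊗[k] B →ₗ[k] k) :
    (C ⊗[k] H) ⊗[k] (A ⊗[k] B) →ₗ[k] k :=
  ev ∘ₗ
    LinearMap.lTensor C ((TensorProduct.lid k B).toLinearMap ∘ₗ
      TensorProduct.map pair (coevalAct pair γ) ∘ₗ interchange) ∘ₗ
    (TensorProduct.assoc k C (H ⊗[k] H) (A ⊗[k] B)).toLinearMap ∘ₗ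
    LinearMap.rTensor (A ⊗[k] B)
      (TensorProduct.map (linInv 𝓒.antipode)
        (𝓗.sqMul tswap ∘ₗ tensorLeft (H ⊗[k] H) (tswap Rinv) ∘ₗ 𝓗.comul))

end Bosonisation

/-! ## The generalised quantum double -/

section Double

variable {k X Y : Type*} [Field k] [AddCommGroup X] [Module k X] [AddCommGroup Y] [Module k Y]

/-- `x ⊗ y ↦ (x₍₁₎ ⊗ y₍₁₎) ⊗ ((x₍₂₎ ⊗ y₍₂₎) ⊗ (x₍₃₎ ⊗ y₍₃₎))`. -/
def splitThree (𝓧 : BialgData k X) (𝓨 : BialgData k Y) :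
    X ⊗[k] Y →ₗ[k] (X ⊗[k] Y) ⊗[k] ((X ⊗[k] Y) ⊗[k] (X ⊗[k] Y)) :=
  LinearMap.lTensor (X ⊗[k] Y) interchange ∘ₗ interchange ∘ₗ
    TensorProduct.map (LinearMap.lTensor X 𝓧.comul ∘ₗ 𝓧.comul)
      (LinearMap.lTensor Y 𝓨.comul ∘ₗ 𝓨.comul)

/-- The generalised quantum double `D(𝓧, 𝓨)` of a dual pair of Hopf algebras, on `X ⊗ Y`, with
tensor product unit, coproduct and counit, and with the product
`(x ⊗ y)(x' ⊗ y') = x'₍₂₎x ⊗ y₍₂₎y' ⟨x'₍₁₎, S y₍₁₎⟩⟨x'₍₃₎, y₍₃₎⟩`. -/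
def generalisedDouble (𝓧 : HopfData k X) (𝓨 : HopfData k Y) (P : X ⊗[k] Y →ₗ[k] k) :
    BialgData k (X ⊗[k] Y) :=
  𝓧.toBialgData.op.twist 𝓨.toBialgData
    ((TensorProduct.lid k (X ⊗[k] Y)).toLinearMap ∘ₗ
      TensorProduct.map (P ∘ₗ LinearMap.lTensor X 𝓨.antipode)
        ((TensorProduct.rid k (X ⊗[k] Y)).toLinearMap ∘ₗ LinearMap.lTensor (X ⊗[k] Y) P) ∘ₗ
      splitThree 𝓧.toBialgData 𝓨.toBialgData ∘ₗ tswap)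
    tswap

/-- Drinfeld's element `∑ (fᵃ ⊗ 1) ⊗ (1 ⊗ eₐ)` of the double, from the canonical element
`t = ∑ fᵃ ⊗ eₐ` of the pairing. -/
def doubleR (𝓧 : BialgData k X) (𝓨 : BialgData k Y) (t : X ⊗[k] Y) :
    (X ⊗[k] Y) ⊗[k] (X ⊗[k] Y) :=
  TensorProduct.map (tensorRight X 𝓨.one) (tensorLeft Y 𝓧.one) t

end Double

/-! ## The double-bosonisation -/

section DoubleBoson

variable {k H A C B : Type*} [Field k] [AddCommGroup H] [Module k H] [AddCommGroup A] [Module k A]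
  [AddCommGroup C] [Module k C] [AddCommGroup B] [Module k B]

/-- The left action `h ▷ c = c ◁ S h`. -/
def barAct (𝓗 : HopfData k H) (act : C ⊗[k] H →ₗ[k] C) : H ⊗[k] C →ₗ[k] C :=
  act ∘ₗ LinearMap.lTensor C 𝓗.antipode ∘ₗ tswap

/-- The braided group `C̄`: the space of `C` with the opposite product, the coproduct
`c ↦ c₍₁₎ ◁ R⁻⁽¹⁾ ⊗ c₍₂₎ ◁ R⁻⁽²⁾`, and the antipode `S⁻¹`. -/
def bar (𝓒 : HopfData k C) (Rinv : H ⊗[k] H) (act : C ⊗[k] H →ₗ[k] C) : HopfData k C where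
  mul := 𝓒.mul ∘ₗ tswap
  one := 𝓒.one
  comul := TensorProduct.map act act ∘ₗ interchange ∘ₗ tensorRight (C ⊗[k] C) Rinv ∘ₗ 𝓒.comul
  counit := 𝓒.counit
  antipode := linInv 𝓒.antipode

/-- `c ⊗ b ↦ ⟨T⁽¹⁾ ▷ c, b ◁ T'⁽¹⁾⟩ T⁽²⁾ ⊗ T'⁽²⁾`, with `T'` a second copy of `T`. -/
def crossForm (T : H ⊗[k] H) (actC : H ⊗[k] C →ₗ[k] C) (actB : B ⊗[k] H →ₗ[k] B)
    (ev : C ⊗[k] B →ₗ[k] k) : C ⊗[k] B →ₗ[k] H ⊗[k] H :=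
  (TensorProduct.lid k (H ⊗[k] H)).toLinearMap ∘ₗ
    LinearMap.rTensor (H ⊗[k] H)
      (ev ∘ₗ TensorProduct.map (actC ∘ₗ tswap) actB ∘ₗ interchange) ∘ₗ
    (TensorProduct.assoc k (C ⊗[k] B) (H ⊗[k] H) (H ⊗[k] H)).symm.toLinearMap ∘ₗ
    tensorRight (C ⊗[k] B) (interchange (T ⊗ₜ T))

/-- The reordering `b c` of `b ∈ B` and `c ∈ C̄` in the double-bosonisation:
`b ⊗ c ↦ R₁⁽²⁾ ▷ c₍₂₎ ⊗ R₂⁽²⁾R₁⁻⁽¹⁾ ⊗ b₍₂₎ ◁ R₂⁻⁽¹⁾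
⟨R₁⁽¹⁾ ▷ c₍₁₎, b₍₁₎ ◁ R₂⁽¹⁾⟩ ⟨R₁⁻⁽²⁾ ▷ S c₍₃₎, b₍₃₎ ◁ R₂⁻⁽²⁾⟩`,
with the coproduct and the antipode of `C̄`. -/
def crossRelation (𝓗 : BialgData k H) (R Rinv : H ⊗[k] H) (𝓒' : HopfData k C)
    (𝓑 : BialgData k B) (actC : H ⊗[k] C →ₗ[k] C) (actB : B ⊗[k] H →ₗ[k] B)
    (ev : C ⊗[k] B →ₗ[k] k) : B ⊗[k] C →ₗ[k] C ⊗[k] (H ⊗[k] B) :=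
  TensorProduct.map actC
      (LinearMap.rTensor B 𝓗.mul ∘ₗ (TensorProduct.assoc k H H B).symm.toLinearMap) ∘ₗ
    interchange ∘ₗ
    LinearMap.lTensor (H ⊗[k] H) ((TensorProduct.assoc k C H B).toLinearMap ∘ₗ
      LinearMap.lTensor (C ⊗[k] H) actB ∘ₗ interchange) ∘ₗ
    TensorProduct.map (crossForm R actC actB ev)
      (LinearMap.lTensor (C ⊗[k] B)
        (crossForm (tswap Rinv) actC actB ev ∘ₗ LinearMap.rTensor B 𝓒'.antipode)) ∘ₗ
    splitThree 𝓒'.toBialgData 𝓑 ∘ₗ tswap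

/-- `(c ⊗ h) ⊗ (g ⊗ b) ↦ c ⊗ hg ⊗ b`. -/
def merge (𝓗 : BialgData k H) : (C ⊗[k] H) ⊗[k] (H ⊗[k] B) →ₗ[k] C ⊗[k] (H ⊗[k] B) :=
  LinearMap.lTensor C
      (LinearMap.rTensor B 𝓗.mul ∘ₗ (TensorProduct.assoc k H H B).symm.toLinearMap) ∘ₗ
    (TensorProduct.assoc k C H (H ⊗[k] B)).toLinearMap

/-- The double-bosonisation `U(C̄, H, B)` on `C ⊗ H ⊗ B`, for braided groups `C`, `B` of right
`H`-modules paired by `ev`. In terms of the bosonisations `C̄ ⋊ H̄` and `H ⋉ B`, where `H̄` is `H`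
with the quasitriangular structure `R₂₁⁻¹`,
`(c ⊗ h ⊗ b)(d ⊗ g ⊗ a) = c (h₍₁₎ ▷ dᵢ) ⊗ h₍₂₎ rᵢ g₍₁₎ ⊗ (bᵢ ◁ g₍₂₎) a`
if `dᵢ ⊗ rᵢ ⊗ bᵢ` is the reordering of `b ⊗ d`, and
`Δ(c ⊗ h ⊗ b) = c₍₁₎ ⊗ R⁻⁽¹⁾h₍₁₎ ⊗ b₍₁₎ ◁ R⁽¹⁾ ⊗ R⁻⁽²⁾ ▷ c₍₂₎ ⊗ h₍₂₎R⁽²⁾ ⊗ b₍₂₎`,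
with the coproduct of `C̄`. -/
def doubleBosonisation (𝓗 : HopfData k H) (R Rinv : H ⊗[k] H) (𝓒 : HopfData k C)
    (𝓑 : BialgData k B) (actC : C ⊗[k] H →ₗ[k] C) (actB : B ⊗[k] H →ₗ[k] B)
    (ev : C ⊗[k] B →ₗ[k] k) : BialgData k (C ⊗[k] (H ⊗[k] B)) :=
  let 𝓒' := bar 𝓒 Rinv actC
  let actC' := barAct 𝓗 actC
  let CH := (leftBosonisation 𝓒' 𝓗 (tswap Rinv) actC').toBialgData
  let HB := rightBosonisation 𝓗.toBialgData 𝓑 R actB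
  { mul := merge 𝓗.toBialgData ∘ₗ
      TensorProduct.map
        (CH.mul ∘ₗ LinearMap.lTensor (C ⊗[k] H) (tensorRight C 𝓗.one)) HB.mul ∘ₗ
      midMap (crossRelation 𝓗.toBialgData R Rinv 𝓒' 𝓑 actC' actB ev) ∘ₗ
      LinearMap.rTensor (C ⊗[k] (H ⊗[k] B)) (TensorProduct.assoc k C H B).symm.toLinearMap
    one := 𝓒.one ⊗ₜ (𝓗.one ⊗ₜ 𝓑.one)
    comul := TensorProduct.map (merge 𝓗.toBialgData) (merge 𝓗.toBialgData) ∘ₗ interchange ∘ₗ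
      TensorProduct.map (CH.comul ∘ₗ tensorRight C 𝓗.one) HB.comul
    counit := LinearMap.mul' k k ∘ₗ TensorProduct.map 𝓒.counit
      (LinearMap.mul' k k ∘ₗ TensorProduct.map 𝓗.counit 𝓑.counit) }

/-- The element
`∑ (fᵃ ⊗ R₂⁽¹⁾R₁⁽¹⁾ ⊗ 1) ⊗ (1 ⊗ R₁⁽²⁾ ⊗ S eₐ ◁ R₂⁽²⁾)` of `U ⊗ U`,
from the canonical element `t = ∑ fᵃ ⊗ eₐ` of the pairing of `C` and `B`. -/
def doubleBosonisationR (𝓗 : BialgData k H) (R : H ⊗[k] H) (𝓒 : BialgData k C)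
    (𝓑 : HopfData k B) (actB : B ⊗[k] H →ₗ[k] B) (t : C ⊗[k] B) :
    (C ⊗[k] (H ⊗[k] B)) ⊗[k] (C ⊗[k] (H ⊗[k] B)) :=
  TensorProduct.map
    (LinearMap.lTensor C (tensorRight H 𝓑.one))
    (tensorLeft (H ⊗[k] B) 𝓒.one ∘ₗ LinearMap.lTensor H actB ∘ₗ
      (TensorProduct.leftComm k B H H).toLinearMap ∘ₗ
      LinearMap.rTensor (H ⊗[k] H) 𝓑.antipode)
    (interchange (t ⊗ₜ 𝓗.r13r12 R))

end DoubleBoson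

/-! ## The double of the bosonisations and the projection -/

section Projection

variable {k H A C B : Type*} [Field k] [AddCommGroup H] [Module k H] [AddCommGroup A] [Module k A]
  [AddCommGroup C] [Module k C] [AddCommGroup B] [Module k B]

/-- `C ⋊ H^op`, for a braided group `C` of right `H`-modules, viewed as left `H^op`-modules; the
quasitriangular structure of `H^op` is `R₂₁`. -/
def leftFactor (𝓗 : HopfData k H) (R : H ⊗[k] H) (𝓒 : HopfData k C)
    (act : C ⊗[k] H →ₗ[k] C) : HopfData k (C ⊗[k] H) :=
  leftBosonisation 𝓒 𝓗.op (tswap R) (act ∘ₗ tswap)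

/-- `A^cop ⋉ B`, for a braided group `B` of left `A`-comodules, viewed as right
`A^cop`-comodules; `A^cop` is dually paired with `H^op`. -/
def rightFactor (𝓐 : HopfData k A) (R : H ⊗[k] H) (pair : H ⊗[k] A →ₗ[k] k) (𝓑 : HopfData k B)
    (β : B →ₗ[k] A ⊗[k] B) : HopfData k (A ⊗[k] B) :=
  dualBosonisation 𝓐.cop 𝓑 pair (tswap R) (tswap ∘ₗ β)

/-- The pairing of `C ⋊ H^op` with `A^cop ⋉ B`. -/
def factorPairing (𝓗 : HopfData k H) (Rinv : H ⊗[k] H) (pair : H ⊗[k] A →ₗ[k] k)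
    (𝓒 : HopfData k C) (β : B →ₗ[k] A ⊗[k] B) (ev : C ⊗[k] B →ₗ[k] k) :
    (C ⊗[k] H) ⊗[k] (A ⊗[k] B) →ₗ[k] k :=
  bosonisationPairing 𝓒 𝓗.op.toBialgData (tswap Rinv) pair (tswap ∘ₗ β) ev

/-- `π(c ⊗ h ⊗ a ⊗ b) = c ◁ S h₍₁₎ ⊗ h₍₂₎ R⁽²⁾ ⟨R⁽¹⁾, a⟩ ⊗ b`. -/
def projection (𝓗 : HopfData k H) (R : H ⊗[k] H) (pair : H ⊗[k] A →ₗ[k] k)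
    (act : C ⊗[k] H →ₗ[k] C) : (C ⊗[k] H) ⊗[k] (A ⊗[k] B) →ₗ[k] C ⊗[k] (H ⊗[k] B) :=
  merge 𝓗.toBialgData ∘ₗ
    TensorProduct.map (smash 𝓗.toBialgData (barAct 𝓗 act) ∘ₗ tswap)
      (LinearMap.rTensor B (slice pair R))

end Projection

end DoubleBosonisation

end

/-! Write `X` for `C ⋊ H^op`, `Y` for `A^cop ⋉ B`, `D` for their double and `U` for the
double-bosonisation. The element `R` defines a map `a ↦ ⟨R⁽¹⁾, a⟩ R⁽²⁾` from `A` to `H` that is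
multiplicative and anticomultiplicative (`slice_mul`, `slice_comul`). So `D`, which is built from
`C`, `H`, `A` and `B`, has a candidate quotient in which `A` is absorbed into `H`, and `π` is the
quotient map. No axiom of `U` is checked on its own formulas: once `π` is known to be surjective and
to carry the structure maps of `D` to those of `U`, the axioms descend (`IsHom.isBialgebra`,
`IsHom.isAntipode`, `IsHom.isQuasitriangular`).

`X`, `Y` and `D` are tensor products twisted by a distributive law `τ` in the product and a dual law
`σ` in the coproduct. Associativity, coassociativity and the antipode follow for all such laws
(`IsAlg.twist`, `IsCoalg.twist`, `IsAntipode.twist`), and multiplicativity of the coproduct needs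
testing on generators only (`twist_map_mul`). The decisive relation is quasi-cocommutativity of `H`
for `X`, quasicommutativity of `A` for `Y`, and for `D` the fact that pairing with `S y` is
convolution inverse to pairing with `y`. The antipodes of `H^op` and `A^cop` are inverses of
antipodes. They exist because the Drinfeld element makes `S²` inner on `H` and, by evaluation,
coinner on `A` (`QTri.bijective_antipode`, `QComm.bijective_antipode`).

The pairing of `X` and `Y` is governed by the form `ev(S⁻¹c, b)`. The braided antipode reverses
products and coproducts up to `R`, so this form is an unreversed pairing up to a copy of `R⁻¹`
(`invPairing`). The reversal rules themselves are read off from the ordinary antipode of `X` along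
the projection `c ⊗ h ↦ c ◁ S h`. The multiplicativity axioms of the pairing then become two
identities in `H` (`QTri.mul_left_identity`, `QTri.mul_right_identity`).

Multiplicativity of `π` compares the reordering of `Y` past `X` in `D` with the one in `U`. Since
the former is a distributive law, it is enough to move `A` past `X`, `B` past `H`, and `B` past `C`.
In the last case both sides reduce by Yang–Baxter arguments to one common expression
(`QTri.reorder_cross_sw`, `QTri.cross_relation_sw`). The cases are assembled in
`projection_factorTwist`.

The antipode descends because replacing `a ∈ A` by its image in `H` is compatible with the
antipodes, so that `π ∘ S_D` depends only on the image under `π`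
(`projection_factorDoubleAntipode`).

In the non-degenerate case the canonical element of `X` and `Y` is written explicitly from those of
`C`, `B` and of `H`, `A` (`factorCanonical`). Under `π ⊗ π` the canonical element of `H` and `A` is
contracted to a copy of `R`, and the braided antipode slides from `C` to `B` by adjointness. The
result is the stated structure on `U` (`map_projection_doubleR`). -/

set_option linter.unusedSectionVars false
set_option linter.unusedSimpArgs false
set_option maxSynthPendingDepth 8

noncomputable section

namespace DoubleBosonisation

/-! ### Sweedler calculus for tensors. -/

section Sweedler

variable {k : Type*} [Field k]
variable {U V W Z Z' : Type*} [AddCommGroup U] [Module k U] [AddCommGroup V] [Module k V]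
  [AddCommGroup W] [Module k W] [AddCommGroup Z] [Module k Z] [AddCommGroup Z'] [Module k Z']

/-- `f` is `k`-linear. -/
@[fun_prop]
structure Lin (k : Type*) [Field k] {V W : Type*} [AddCommGroup V] [Module k V] [AddCommGroup W]
    [Module k W] (f : V → W) : Prop where
  add : ∀ x y, f (x + y) = f x + f y
  smul : ∀ (a : k) x, f (a • x) = a • f x

-- These closure rules let `fun_prop` discharge the linearity side conditions of the Sweedler
-- rewrite rules.
@[fun_prop] theorem Lin.id : Lin k (fun x : V => x) := ⟨fun _ _ => rfl, fun _ _ => rfl⟩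

@[fun_prop] theorem Lin.comp {f : V → W} {g : W → Z} (hg : Lin k g) (hf : Lin k f) :
    Lin k (fun x => g (f x)) :=
  ⟨fun x y => by rw [hf.add, hg.add], fun a x => by rw [hf.smul, hg.smul]⟩

@[fun_prop] theorem Lin.linearMap (g : W →ₗ[k] Z) {f : V → W} (hf : Lin k f) :
    Lin k (fun x => g (f x)) :=
  ⟨fun x y => by rw [hf.add, map_add], fun a x => by rw [hf.smul, map_smul]⟩

@[fun_prop] theorem Lin.linearEquiv (g : W ≃ₗ[k] Z) {f : V → W} (hf : Lin k f) :
    Lin k (fun x => g (f x)) :=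
  ⟨fun x y => by rw [hf.add, map_add], fun a x => by rw [hf.smul, map_smul]⟩

@[fun_prop] theorem Lin.tmul_left {f : V → W} (hf : Lin k f) (z : Z) :
    Lin k (fun x => f x ⊗ₜ[k] z) :=
  ⟨fun x y => by rw [hf.add, TensorProduct.add_tmul], fun a x => by
    rw [hf.smul, TensorProduct.smul_tmul']⟩

@[fun_prop] theorem Lin.tmul_right {f : V → W} (hf : Lin k f) (z : Z) :
    Lin k (fun x => z ⊗ₜ[k] f x) :=
  ⟨fun x y => by rw [hf.add, TensorProduct.tmul_add], fun a x => by
    rw [hf.smul, TensorProduct.tmul_smul]⟩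

@[fun_prop] theorem Lin.smul_left {f : V → k} (hf : Lin k f) (z : Z) : Lin k (fun x => f x • z) :=
  ⟨fun x y => by rw [hf.add, add_smul], fun a x => by rw [hf.smul, smul_assoc]⟩

@[fun_prop] theorem Lin.smul_right {f : V → Z} (hf : Lin k f) (a : k) :
    Lin k (fun x => a • f x) :=
  ⟨fun x y => by rw [hf.add, smul_add], fun b x => by rw [hf.smul, smul_comm]⟩

@[fun_prop] theorem Lin.mul_left {A : Type*} [Ring A] [Algebra k A] {f : V → A} (hf : Lin k f)
    (z : A) : Lin k (fun x => f x * z) :=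
  ⟨fun x y => by rw [hf.add, add_mul], fun a x => by rw [hf.smul, smul_mul_assoc]⟩

@[fun_prop] theorem Lin.mul_right {A : Type*} [Ring A] [Algebra k A] {f : V → A} (hf : Lin k f)
    (z : A) : Lin k (fun x => z * f x) :=
  ⟨fun x y => by rw [hf.add, mul_add], fun a x => by rw [hf.smul, mul_smul_comm]⟩

/-- `f` is `k`-bilinear. -/
structure Lin₂ (k : Type*) [Field k] {V W Z : Type*} [AddCommGroup V] [Module k V]
    [AddCommGroup W] [Module k W] [AddCommGroup Z] [Module k Z] (f : V → W → Z) : Prop where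
  left : ∀ y, Lin k (fun x => f x y)
  right : ∀ x, Lin k (fun y => f x y)

/-- Indexing by `Fin n` gives representations of a uniform shape, so that one can be chosen for
every tensor. -/
theorem exists_fin_repr (t : V ⊗[k] W) :
    ∃ (n : ℕ) (x : Fin n → V) (y : Fin n → W), t = ∑ i, x i ⊗ₜ[k] y i := by
  induction t using TensorProduct.induction_on with
  | zero => exact ⟨0, Fin.elim0, Fin.elim0, by simp⟩
  | tmul x y => exact ⟨1, fun _ => x, fun _ => y, by simp⟩
  | add s t hs ht =>
    obtain ⟨n, x, y, rfl⟩ := hs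
    obtain ⟨m, x', y', rfl⟩ := ht
    exact ⟨n + m, Fin.append x x', Fin.append y y', by simp [Fin.sum_univ_add]⟩

/-- Sweedler summation: `sw t F = ∑ F(t⁽¹⁾, t⁽²⁾)` for `t = ∑ t⁽¹⁾ ⊗ t⁽²⁾`. -/
def sw (t : V ⊗[k] W) (F : V → W → Z) : Z :=
  ∑ i, F ((exists_fin_repr t).choose_spec.choose i)
    ((exists_fin_repr t).choose_spec.choose_spec.choose i)

theorem sw_eta (t : V ⊗[k] W) : sw t (fun x y => x ⊗ₜ[k] y) = t :=
  (exists_fin_repr t).choose_spec.choose_spec.choose_spec.symm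

/-- A Sweedler sum is a finite sum over a chosen representation, so additive maps and interchanges
of sums need no bilinearity of `F`. Evaluation on a pure tensor does need it, because the chosen
representation of `x ⊗ y` need not be the obvious one. -/
theorem sw_map {G : Type*} [FunLike G Z Z'] [AddMonoidHomClass G Z Z'] (g : G) (t : V ⊗[k] W)
    (F : V → W → Z) : g (sw t F) = sw t (fun x y => g (F x y)) := map_sum g _ _

theorem sw_tmul_left (t : V ⊗[k] W) (F : V → W → Z) (z : Z') :
    (sw t F) ⊗ₜ[k] z = sw t (fun x y => F x y ⊗ₜ[k] z) := TensorProduct.sum_tmul _ _ _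

theorem sw_tmul_right (t : V ⊗[k] W) (F : V → W → Z) (z : Z') :
    z ⊗ₜ[k] (sw t F) = sw t (fun x y => z ⊗ₜ[k] F x y) := TensorProduct.tmul_sum _ _ _

theorem sw_smul_left (t : V ⊗[k] W) (F : V → W → k) (z : Z) :
    (sw t F) • z = sw t (fun x y => F x y • z) := Finset.sum_smul

theorem sw_smul_right (t : V ⊗[k] W) (F : V → W → Z) (a : k) :
    a • (sw t F) = sw t (fun x y => a • F x y) := Finset.smul_sum

theorem sw_mul_left {A : Type*} [Ring A] (t : V ⊗[k] W) (F : V → W → A) (z : A) :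
    (sw t F) * z = sw t (fun x y => F x y * z) := Finset.sum_mul _ _ _

theorem sw_mul_right {A : Type*} [Ring A] (t : V ⊗[k] W) (F : V → W → A) (z : A) :
    z * (sw t F) = sw t (fun x y => z * F x y) := Finset.mul_sum _ _ _

theorem sw_comm {V' W' : Type*} [AddCommGroup V'] [Module k V'] [AddCommGroup W'] [Module k W']
    (t : V ⊗[k] W) (s : V' ⊗[k] W') (F : V → W → V' → W' → Z) :
    sw t (fun x y => sw s (fun a b => F x y a b)) = sw s (fun a b => sw t (fun x y => F x y a b)) :=
  Finset.sum_comm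

/-- For bilinear `F` the sum does not depend on the chosen representation. The rules that evaluate
or replace the tensor rest on this. -/
theorem Lin₂.sw_eq {F : V → W → Z} (h : Lin₂ k F) (t : V ⊗[k] W) :
    sw t F = TensorProduct.lift (LinearMap.mk₂ k F (fun x x' y => (h.left y).add x x')
      (fun a x y => (h.left y).smul a x) (fun x y y' => (h.right x).add y y')
      (fun a x y => (h.right x).smul a y)) t := by
  conv_rhs => rw [← sw_eta t, sw_map]
  simp

@[fun_prop] theorem Lin.sw_arg {f : U → V ⊗[k] W} {F : V → W → Z} (hf : Lin k f)
    (hl : ∀ y, Lin k (fun x => F x y)) (hr : ∀ x, Lin k (fun y => F x y)) :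
    Lin k (fun x => sw (f x) F) := by
  have h : Lin₂ k F := ⟨hl, hr⟩
  simp only [h.sw_eq]
  fun_prop

@[fun_prop] theorem Lin.sw_fun {F : U → V → W → Z} (t : V ⊗[k] W)
    (h : ∀ x y, Lin k (fun u => F u x y)) :
    Lin k (fun u => sw t (fun x y => F u x y)) :=
  ⟨fun x y => by simp only [(h _ _).add]; exact Finset.sum_add_distrib,
   fun a x => by simp only [(h _ _).smul]; exact Finset.smul_sum.symm⟩

theorem sw_tmul {F : V → W → Z} (x : V) (y : W) (hl : ∀ y, Lin k (fun x => F x y))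
    (hr : ∀ x, Lin k (fun y => F x y)) : sw (x ⊗ₜ[k] y) F = F x y := by
  have h : Lin₂ k F := ⟨hl, hr⟩
  simp [h.sw_eq]

theorem sw_sw {V' W' : Type*} [AddCommGroup V'] [Module k V'] [AddCommGroup W'] [Module k W']
    {F : V → W → V' ⊗[k] W'} {G : V' → W' → Z} (t : V ⊗[k] W)
    (hl : ∀ y, Lin k (fun x => G x y))
    (hr : ∀ x, Lin k (fun y => G x y)) :
    sw (sw t F) G = sw t (fun x y => sw (F x y) G) := by
  have h : Lin₂ k G := ⟨hl, hr⟩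
  simp only [h.sw_eq, sw_map]

theorem sw_smul_arg {F : V → W → Z} (a : k) (t : V ⊗[k] W)
    (hl : ∀ y, Lin k (fun x => F x y)) (hr : ∀ x, Lin k (fun y => F x y)) :
    sw (a • t) F = a • sw t F := by
  have h : Lin₂ k F := ⟨hl, hr⟩
  simp only [h.sw_eq, map_smul]

/-- Two linear functions on a tensor product agree if they agree on pure tensors. -/
theorem Lin.ext_tmul {f g : V ⊗[k] W → Z} (hf : Lin k f) (hg : Lin k g)
    (h : ∀ x y, f (x ⊗ₜ y) = g (x ⊗ₜ y)) : ∀ t, f t = g t := by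
  intro t
  induction t using TensorProduct.induction_on with
  -- `Lin` has no field for the value at zero, which is obtained from homogeneity with the scalar
  -- `0`.
  | zero => rw [← zero_smul k (0 : V ⊗[k] W), hf.smul, hg.smul, zero_smul, zero_smul]
  | tmul x y => exact h x y
  | add s t hs ht => rw [hf.add, hg.add, hs, ht]

theorem sw_congr {t : V ⊗[k] W} {F G : V → W → Z} (h : ∀ x y, F x y = G x y) :
    sw t F = sw t G := by
  have : F = G := funext fun x => funext (h x)
  rw [this]

theorem sw_map_tensor {V' W' : Type*} [AddCommGroup V'] [Module k V'] [AddCommGroup W']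
    [Module k W'] (t : V ⊗[k] W) (f : V →ₗ[k] V') (g : W →ₗ[k] W') (F : V' → W' → Z)
    (hl : ∀ y, Lin k (fun x => F x y)) (hr : ∀ x, Lin k (fun y => F x y)) :
    sw (TensorProduct.map f g t) F = sw t fun x y => F (f x) (g y) := by
  conv_lhs => rw [← sw_eta t]
  simp (disch := fun_prop) only [sw_map, TensorProduct.map_tmul, sw_sw, sw_tmul]

theorem sw_tswap (t : V ⊗[k] W) (F : W → V → Z)
    (hl : ∀ y, Lin k (fun x => F x y)) (hr : ∀ x, Lin k (fun y => F x y)) :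
    sw (tswap t) F = sw t fun x y => F y x := by
  conv_lhs => rw [← sw_eta t]
  simp (disch := fun_prop) only [sw_map, LinearEquiv.coe_coe, TensorProduct.comm_tmul, sw_sw,
    sw_tmul]

theorem rTensor_eq_sw (f : V →ₗ[k] U) (t : V ⊗[k] W) :
    LinearMap.rTensor W f t = sw t fun x y => f x ⊗ₜ y := by
  conv_lhs => rw [← sw_eta t]
  simp only [sw_map, LinearMap.rTensor_tmul]

theorem lTensor_eq_sw (f : W →ₗ[k] U) (t : V ⊗[k] W) :
    LinearMap.lTensor V f t = sw t fun x y => x ⊗ₜ f y := by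
  conv_lhs => rw [← sw_eta t]
  simp only [sw_map, LinearMap.lTensor_tmul]

theorem map_eq_sw {V' W' : Type*} [AddCommGroup V'] [Module k V'] [AddCommGroup W']
    [Module k W'] (f : V →ₗ[k] V') (g : W →ₗ[k] W') (t : V ⊗[k] W) :
    TensorProduct.map f g t = sw t fun x y => f x ⊗ₜ g y := by
  conv_lhs => rw [← sw_eta t]
  simp only [sw_map, TensorProduct.map_tmul]

theorem tswap_eq_sw (t : V ⊗[k] W) : tswap t = sw t fun x y => y ⊗ₜ x := by
  conv_lhs => rw [← sw_eta t]
  simp only [sw_map, LinearEquiv.coe_coe, TensorProduct.comm_tmul]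

/-- Triple tensors equal to each other give equal Sweedler sums. -/
theorem sw₃_congr {V₁ V₂ V₃ : Type*} [AddCommGroup V₁] [Module k V₁] [AddCommGroup V₂]
    [Module k V₂] [AddCommGroup V₃] [Module k V₃] {s t : V₁ ⊗[k] (V₂ ⊗[k] V₃)} (h : s = t)
    (F : V₁ → V₂ → V₃ → Z) :
    (sw s fun x u => sw u fun y z => F x y z) = sw t fun x u => sw u fun y z => F x y z := by
  rw [h]

theorem assoc_rTensor_eq_sw {V₁ V₂ V₃ V₄ : Type*} [AddCommGroup V₁] [Module k V₁]
    [AddCommGroup V₂] [Module k V₂] [AddCommGroup V₃] [Module k V₃] [AddCommGroup V₄]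
    [Module k V₄] (f : V₁ →ₗ[k] V₂ ⊗[k] V₃) (t : V₁ ⊗[k] V₄) :
    TensorProduct.assoc k V₂ V₃ V₄ (LinearMap.rTensor V₄ f t) =
      sw t fun x z => sw (f x) fun p q => p ⊗ₜ (q ⊗ₜ z) := by
  rw [rTensor_eq_sw, sw_map]
  refine sw_congr fun x z => ?_
  conv_lhs => rw [← sw_eta (f x)]
  simp only [sw_map, sw_tmul_left, TensorProduct.assoc_tmul]

theorem lTensor_comul_eq_sw {V₁ V₂ V₃ V₄ : Type*} [AddCommGroup V₁] [Module k V₁]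
    [AddCommGroup V₂] [Module k V₂] [AddCommGroup V₃] [Module k V₃] [AddCommGroup V₄]
    [Module k V₄] (f : V₄ →ₗ[k] V₂ ⊗[k] V₃) (t : V₁ ⊗[k] V₄) :
    LinearMap.lTensor V₁ f t = sw t fun x z => sw (f z) fun p q => x ⊗ₜ (p ⊗ₜ q) := by
  rw [lTensor_eq_sw]
  refine sw_congr fun x z => ?_
  conv_lhs => rw [← sw_eta (f z)]
  simp only [sw_tmul_right]

/-- Coassociativity in Sweedler form, for comodules and coalgebras. -/
theorem coassoc_sw {A B : Type*} [AddCommGroup A] [Module k A] [AddCommGroup B] [Module k B]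
    {δ : A →ₗ[k] A ⊗[k] A} {β : B →ₗ[k] A ⊗[k] B}
    (h : ∀ b, TensorProduct.assoc k A A B (LinearMap.rTensor B δ (β b)) = LinearMap.lTensor A β (β b))
    (b : B) {F : A → A → B → Z} (h1 : ∀ y z, Lin k (fun x => F x y z))
    (h2 : ∀ x z, Lin k (fun y => F x y z)) (h3 : ∀ x y, Lin k (fun z => F x y z)) :
    (sw (β b) fun a c => sw (δ a) fun p q => F p q c) =
      sw (β b) fun p c => sw (β c) fun q r => F p q r := by
  have := sw₃_congr (h b) F
  rw [assoc_rTensor_eq_sw, lTensor_comul_eq_sw] at this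
  simpa (disch := fun_prop) only [sw_sw, sw_tmul] using this

theorem midMap_tmul {X Y X' Y' Z W : Type*}
    [AddCommGroup X] [Module k X] [AddCommGroup Y] [Module k Y]
    [AddCommGroup X'] [Module k X'] [AddCommGroup Y'] [Module k Y']
    [AddCommGroup Z] [Module k Z] [AddCommGroup W] [Module k W]
    (f : Y ⊗[k] X' →ₗ[k] Z ⊗[k] W) (x : X) (y : Y) (x' : X') (y' : Y') :
    midMap f ((x ⊗ₜ y) ⊗ₜ (x' ⊗ₜ y')) = sw (f (y ⊗ₜ x')) fun p q => (x ⊗ₜ p) ⊗ₜ (q ⊗ₜ y') := by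
  simp only [midMap, LinearMap.comp_apply, LinearEquiv.coe_coe, TensorProduct.assoc_tmul,
    TensorProduct.assoc_symm_tmul, LinearMap.lTensor_tmul, LinearMap.rTensor_tmul]
  conv_lhs => rw [← sw_eta (f (y ⊗ₜ x'))]
  simp only [sw_map, sw_tmul_left, sw_tmul_right, TensorProduct.assoc_tmul,
    TensorProduct.assoc_symm_tmul]

theorem midMap_eq_sw {X Y X' Y' Z W : Type*}
    [AddCommGroup X] [Module k X] [AddCommGroup Y] [Module k Y]
    [AddCommGroup X'] [Module k X'] [AddCommGroup Y'] [Module k Y']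
    [AddCommGroup Z] [Module k Z] [AddCommGroup W] [Module k W]
    (f : Y ⊗[k] X' →ₗ[k] Z ⊗[k] W) (s : X ⊗[k] Y) (t : X' ⊗[k] Y') :
    midMap f (s ⊗ₜ t) = sw s fun x y => sw t fun x' y' =>
      sw (f (y ⊗ₜ x')) fun p q => (x ⊗ₜ p) ⊗ₜ (q ⊗ₜ y') := by
  conv_lhs => rw [← sw_eta s, ← sw_eta t]
  simp only [sw_map, sw_tmul_left, sw_tmul_right, midMap_tmul]
  rw [sw_comm]

theorem interchange_eq_sw {X Y X' Y' : Type*}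
    [AddCommGroup X] [Module k X] [AddCommGroup Y] [Module k Y]
    [AddCommGroup X'] [Module k X'] [AddCommGroup Y'] [Module k Y']
    (s : X ⊗[k] Y) (t : X' ⊗[k] Y') :
    interchange (s ⊗ₜ t) = sw s fun x y => sw t fun x' y' => (x ⊗ₜ x') ⊗ₜ (y ⊗ₜ[k] y') := by
  conv_lhs => rw [← sw_eta s, ← sw_eta t]
  simp only [sw_map, sw_tmul_left, sw_tmul_right, LinearEquiv.coe_coe,
    TensorProduct.tensorTensorTensorComm_tmul]
  rw [sw_comm]

theorem slice_apply (P : U ⊗[k] V →ₗ[k] k) (t : U ⊗[k] W) (v : V) :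
    slice P t v = sw t fun x y => P (x ⊗ₜ v) • y := by
  simp only [slice, LinearMap.comp_apply, TensorProduct.mk_apply]
  conv_lhs => rw [← sw_eta t]
  simp [sw_map, sw_tmul_left]

theorem mul_map_interchange {V' W' : Type*} [AddCommGroup V'] [Module k V'] [AddCommGroup W']
    [Module k W'] (P : V ⊗[k] W →ₗ[k] k) (Q : V' ⊗[k] W' →ₗ[k] k) (s : V ⊗[k] V')
    (t : W ⊗[k] W') :
    LinearMap.mul' k k (TensorProduct.map P Q (interchange (s ⊗ₜ t))) =
      sw s fun x x' => sw t fun y y' => P (x ⊗ₜ y) * Q (x' ⊗ₜ y') := by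
  rw [interchange_eq_sw]
  simp only [sw_map, TensorProduct.map_tmul, LinearMap.mul'_apply]

end Sweedler

/-! ### Algebras, coalgebras and twisted tensor products. -/

section Structures

variable {k V W Z : Type*} [Field k] [AddCommGroup V] [Module k V] [AddCommGroup W] [Module k W]
  [AddCommGroup Z] [Module k Z]

/-- The algebra axioms. -/
structure BialgData.IsAlg (X : BialgData k V) : Prop where
  assoc : ∀ x y z : V, X.mul (X.mul (x ⊗ₜ y) ⊗ₜ z) = X.mul (x ⊗ₜ X.mul (y ⊗ₜ z))
  one_mul : ∀ x : V, X.mul (X.one ⊗ₜ x) = x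
  mul_one : ∀ x : V, X.mul (x ⊗ₜ X.one) = x

/-- The coalgebra axioms. -/
structure BialgData.IsCoalg (X : BialgData k V) : Prop where
  coassoc : ∀ x : V, TensorProduct.assoc k V V V (LinearMap.rTensor V X.comul (X.comul x)) =
    LinearMap.lTensor V X.comul (X.comul x)
  counit_comul : ∀ x : V, TensorProduct.lid k V (LinearMap.rTensor V X.counit (X.comul x)) = x
  comul_counit : ∀ x : V, TensorProduct.rid k V (LinearMap.lTensor V X.counit (X.comul x)) = x

namespace BialgData

variable {X : BialgData k V} {Y : BialgData k W}

theorem IsBraidedBialgebra.isAlg {Ψ} (h : X.IsBraidedBialgebra Ψ) : X.IsAlg :=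
  ⟨h.mul_assoc, h.one_mul, h.mul_one⟩

theorem IsBraidedBialgebra.isCoalg {Ψ} (h : X.IsBraidedBialgebra Ψ) : X.IsCoalg :=
  ⟨h.coassoc, h.counit_comul, h.comul_counit⟩

theorem IsCoalg.coassoc_sw (h : X.IsCoalg) (x : V) {F : V → V → V → Z}
    (h1 : ∀ y z, Lin k (fun x => F x y z)) (h2 : ∀ x z, Lin k (fun y => F x y z))
    (h3 : ∀ x y, Lin k (fun z => F x y z)) :
    (sw (X.comul x) fun a c => sw (X.comul a) fun p q => F p q c) =
      sw (X.comul x) fun p c => sw (X.comul c) fun q r => F p q r :=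
  DoubleBosonisation.coassoc_sw h.coassoc x h1 h2 h3

/-- This shape arises when the outer two legs of a threefold coproduct are split again, as when two
reorderings in the double are composed. -/
theorem IsCoalg.coassoc₅_sw (h : X.IsCoalg) (x : V) {F : V → V → V → V → V → Z}
    (h1 : ∀ b c d e, Lin k (fun a => F a b c d e)) (h2 : ∀ a c d e, Lin k (fun b => F a b c d e))
    (h3 : ∀ a b d e, Lin k (fun c => F a b c d e)) (h4 : ∀ a b c e, Lin k (fun d => F a b c d e))
    (h5 : ∀ a b c d, Lin k (fun e => F a b c d e)) :
    (sw (X.comul x) fun a r => sw (X.comul r) fun c s => sw (X.comul a) fun p q =>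
      sw (X.comul s) fun u v => F p q c u v) =
    sw (X.comul x) fun p a => sw (X.comul a) fun q b => sw (X.comul b) fun c d =>
      sw (X.comul d) fun u v => F p q c u v := by
  rw [sw_congr fun a r => sw_comm (X.comul r) (X.comul a) _]
  simp (disch := fun_prop) only [h.coassoc_sw]

theorem IsCoalg.counit_smul (h : X.IsCoalg) (x : V) {F : V → Z} (hF : Lin k F) :
    (sw (X.comul x) fun a b => X.counit a • F b) = F x := by
  conv_rhs => rw [← h.counit_comul x, rTensor_eq_sw]
  -- Bundling `F` allows it to be moved past the sum and the scalars.
  have : F = (IsLinearMap.mk' F ⟨hF.add, hF.smul⟩ : V →ₗ[k] Z) := rfl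
  rw [this]
  simp only [sw_map, TensorProduct.lid_tmul, map_smul]

theorem IsCoalg.smul_counit (h : X.IsCoalg) (x : V) {F : V → Z} (hF : Lin k F) :
    (sw (X.comul x) fun a b => X.counit b • F a) = F x := by
  conv_rhs => rw [← h.comul_counit x, lTensor_eq_sw]
  have : F = (IsLinearMap.mk' F ⟨hF.add, hF.smul⟩ : V →ₗ[k] Z) := rfl
  rw [this]
  simp only [sw_map, TensorProduct.rid_tmul, map_smul]

theorem IsAntipode.left_sw {S : V →ₗ[k] V} (h : X.IsAntipode S) (x : V) {F : V → Z}
    (hF : Lin k F) : (sw (X.comul x) fun a b => F (X.mul (S a ⊗ₜ b))) =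
      X.counit x • F X.one := by
  rw [← hF.smul, ← h.left x, rTensor_eq_sw]
  have : F = (IsLinearMap.mk' F ⟨hF.add, hF.smul⟩ : V →ₗ[k] Z) := rfl
  rw [this]
  simp only [sw_map]

theorem IsAntipode.right_sw {S : V →ₗ[k] V} (h : X.IsAntipode S) (x : V) {F : V → Z}
    (hF : Lin k F) : (sw (X.comul x) fun a b => F (X.mul (a ⊗ₜ S b))) =
      X.counit x • F X.one := by
  rw [← hF.smul, ← h.right x, lTensor_eq_sw]
  have : F = (IsLinearMap.mk' F ⟨hF.add, hF.smul⟩ : V →ₗ[k] Z) := rfl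
  rw [this]
  simp only [sw_map]

theorem sqMul_eq_sw (X : BialgData k V) (Ψ : V ⊗[k] V →ₗ[k] V ⊗[k] V) (s t : V ⊗[k] V) :
    X.sqMul Ψ (s ⊗ₜ t) = sw s fun a b => sw t fun c d => sw (Ψ (b ⊗ₜ c)) fun p q =>
      X.mul (a ⊗ₜ p) ⊗ₜ X.mul (q ⊗ₜ d) := by
  simp only [sqMul, LinearMap.comp_apply, midMap_eq_sw, sw_map, TensorProduct.map_tmul]

theorem sqMul_tswap_eq_sw (X : BialgData k V) (s t : V ⊗[k] V) :
    X.sqMul tswap (s ⊗ₜ t) = sw s fun a b => sw t fun c d =>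
      X.mul (a ⊗ₜ c) ⊗ₜ X.mul (b ⊗ₜ d) := by
  simp (disch := fun_prop) only [sqMul_eq_sw, sw_tswap, sw_tmul]

/-- Uniqueness of convolution inverses. -/
theorem conv_inverse_unique (hX : X.IsCoalg) (hY : Y.IsAlg) {f g h : V →ₗ[k] W}
    (hfg : ∀ x, (sw (X.comul x) fun a b => Y.mul (f a ⊗ₜ g b)) = X.counit x • Y.one)
    (hgh : ∀ x, (sw (X.comul x) fun a b => Y.mul (g a ⊗ₜ h b)) = X.counit x • Y.one) (x : V) :
    f x = h x := by
  -- Both sides are the convolution product `f * g * h`, bracketed in the two possible ways.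
  have h1 : f x = sw (X.comul x) fun a b => Y.mul (f a ⊗ₜ
      sw (X.comul b) fun b c => Y.mul (g b ⊗ₜ h c)) := by
    simp only [hgh, map_smul, TensorProduct.tmul_smul, hY.mul_one]
    rw [hX.smul_counit x (F := fun a => f a) (by fun_prop)]
  have h2 : h x = sw (X.comul x) fun a b => Y.mul ((
      sw (X.comul a) fun b c => Y.mul (f b ⊗ₜ g c)) ⊗ₜ h b) := by
    simp only [hfg, map_smul, ← TensorProduct.smul_tmul', hY.one_mul]
    rw [hX.counit_smul x (F := fun a => h a) (by fun_prop)]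
  rw [h1, h2]
  simp (disch := fun_prop) only [sw_tmul_left, sw_tmul_right, sw_map, hX.coassoc_sw, hY.assoc]

/-! ### Twisted tensor products -/

theorem twist_mul (X : BialgData k V) (Y : BialgData k W)
    (τ : W ⊗[k] V →ₗ[k] V ⊗[k] W) (σ : V ⊗[k] W →ₗ[k] W ⊗[k] V) (x x' : V) (y y' : W) :
    (X.twist Y τ σ).mul ((x ⊗ₜ y) ⊗ₜ (x' ⊗ₜ y')) =
      sw (τ (y ⊗ₜ x')) fun p q => X.mul (x ⊗ₜ p) ⊗ₜ Y.mul (q ⊗ₜ y') := by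
  simp only [twist, LinearMap.comp_apply, midMap_tmul, sw_map, TensorProduct.map_tmul]

theorem twist_comul (X : BialgData k V) (Y : BialgData k W)
    (τ : W ⊗[k] V →ₗ[k] V ⊗[k] W) (σ : V ⊗[k] W →ₗ[k] W ⊗[k] V) (x : V) (y : W) :
    (X.twist Y τ σ).comul (x ⊗ₜ y) = sw (X.comul x) fun x₁ x₂ => sw (Y.comul y) fun y₁ y₂ =>
      sw (σ (x₂ ⊗ₜ y₁)) fun q p => (x₁ ⊗ₜ q) ⊗ₜ (p ⊗ₜ y₂) := by
  simp only [twist, LinearMap.comp_apply, TensorProduct.map_tmul, midMap_eq_sw]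

theorem twist_counit (X : BialgData k V) (Y : BialgData k W)
    (τ : W ⊗[k] V →ₗ[k] V ⊗[k] W) (σ : V ⊗[k] W →ₗ[k] W ⊗[k] V) (x : V) (y : W) :
    (X.twist Y τ σ).counit (x ⊗ₜ y) = X.counit x * Y.counit y := by
  simp [twist]

theorem twist_one (X : BialgData k V) (Y : BialgData k W)
    (τ : W ⊗[k] V →ₗ[k] V ⊗[k] W) (σ : V ⊗[k] W →ₗ[k] W ⊗[k] V) :
    (X.twist Y τ σ).one = X.one ⊗ₜ Y.one := rfl

/-- `τ` is compatible with the products: a distributive law. -/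
structure IsAlgTwist (X : BialgData k V) (Y : BialgData k W) (τ : W ⊗[k] V →ₗ[k] V ⊗[k] W) :
    Prop where
  tmul_one : ∀ y, τ (y ⊗ₜ X.one) = X.one ⊗ₜ y
  one_tmul : ∀ x, τ (Y.one ⊗ₜ x) = x ⊗ₜ Y.one
  mul_tmul : ∀ y y' x, τ (Y.mul (y ⊗ₜ y') ⊗ₜ x) = sw (τ (y' ⊗ₜ x)) fun p q =>
    sw (τ (y ⊗ₜ p)) fun p' q' => p' ⊗ₜ Y.mul (q' ⊗ₜ q)
  tmul_mul : ∀ y x x', τ (y ⊗ₜ X.mul (x ⊗ₜ x')) = sw (τ (y ⊗ₜ x)) fun p q =>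
    sw (τ (q ⊗ₜ x')) fun p' q' => X.mul (p ⊗ₜ p') ⊗ₜ q'

/-- `σ` is compatible with the coproducts. -/
structure IsCoalgTwist (X : BialgData k V) (Y : BialgData k W)
    (σ : V ⊗[k] W →ₗ[k] W ⊗[k] V) : Prop where
  counit_left : ∀ x y, (sw (σ (x ⊗ₜ y)) fun q p => Y.counit q • p) = Y.counit y • x
  counit_right : ∀ x y, (sw (σ (x ⊗ₜ y)) fun q p => X.counit p • q) = X.counit x • y
  comul_left : ∀ x y, (sw (σ (x ⊗ₜ y)) fun q p => sw (Y.comul q) fun q₁ q₂ =>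
      q₁ ⊗ₜ[k] (q₂ ⊗ₜ[k] p)) = sw (Y.comul y) fun y₁ y₂ => sw (σ (x ⊗ₜ y₁)) fun q p =>
      sw (σ (p ⊗ₜ y₂)) fun q' p' => q ⊗ₜ (q' ⊗ₜ p')
  comul_right : ∀ x y, (sw (σ (x ⊗ₜ y)) fun q p => sw (X.comul p) fun p₁ p₂ =>
      q ⊗ₜ[k] (p₁ ⊗ₜ[k] p₂)) = sw (X.comul x) fun x₁ x₂ => sw (σ (x₂ ⊗ₜ y)) fun q p =>
      sw (σ (x₁ ⊗ₜ q)) fun q' p' => q' ⊗ₜ (p' ⊗ₜ p)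

section Twist

variable {τ : W ⊗[k] V →ₗ[k] V ⊗[k] W} {σ : V ⊗[k] W →ₗ[k] W ⊗[k] V}

theorem IsCoalgTwist.counit_left_sw (h : IsCoalgTwist X Y σ) (x : V) (y : W) {F : V → Z}
    (hF : Lin k F) : (sw (σ (x ⊗ₜ y)) fun q p => Y.counit q • F p) = Y.counit y • F x := by
  have : F = (IsLinearMap.mk' F ⟨hF.add, hF.smul⟩ : V →ₗ[k] Z) := rfl
  rw [this, ← map_smul, ← h.counit_left x y]
  simp only [sw_map, map_smul]

theorem IsCoalgTwist.counit_right_sw (h : IsCoalgTwist X Y σ) (x : V) (y : W) {F : W → Z}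
    (hF : Lin k F) : (sw (σ (x ⊗ₜ y)) fun q p => X.counit p • F q) = X.counit x • F y := by
  have : F = (IsLinearMap.mk' F ⟨hF.add, hF.smul⟩ : W →ₗ[k] Z) := rfl
  rw [this, ← map_smul, ← h.counit_right x y]
  simp only [sw_map, map_smul]

theorem IsCoalgTwist.comul_left_sw (h : IsCoalgTwist X Y σ) (x : V) (y : W) {F : W → W → V → Z}
    (h1 : ∀ y z, Lin k (fun x => F x y z)) (h2 : ∀ x z, Lin k (fun y => F x y z))
    (h3 : ∀ x y, Lin k (fun z => F x y z)) :
    (sw (σ (x ⊗ₜ y)) fun q p => sw (Y.comul q) fun q₁ q₂ => F q₁ q₂ p) =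
      sw (Y.comul y) fun y₁ y₂ => sw (σ (x ⊗ₜ y₁)) fun q p =>
        sw (σ (p ⊗ₜ y₂)) fun q' p' => F q q' p' := by
  simpa (disch := fun_prop) only [sw_sw, sw_tmul] using sw₃_congr (h.comul_left x y) F

theorem IsCoalgTwist.comul_right_sw (h : IsCoalgTwist X Y σ) (x : V) (y : W) {F : W → V → V → Z}
    (h1 : ∀ y z, Lin k (fun x => F x y z)) (h2 : ∀ x z, Lin k (fun y => F x y z))
    (h3 : ∀ x y, Lin k (fun z => F x y z)) :
    (sw (σ (x ⊗ₜ y)) fun q p => sw (X.comul p) fun p₁ p₂ => F q p₁ p₂) =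
      sw (X.comul x) fun x₁ x₂ => sw (σ (x₂ ⊗ₜ y)) fun q p =>
        sw (σ (x₁ ⊗ₜ q)) fun q' p' => F q' p' p := by
  simpa (disch := fun_prop) only [sw_sw, sw_tmul] using sw₃_congr (h.comul_right x y) F

/-- The two product laws for `τ` bring either bracketing of a triple product to the same sum, up to
the order of summation. -/
theorem IsAlg.twist (hX : X.IsAlg) (hY : Y.IsAlg) (hτ : IsAlgTwist X Y τ) :
    (X.twist Y τ σ).IsAlg where
  assoc a b c := by
    revert a; refine Lin.ext_tmul (by fun_prop) (by fun_prop) fun x y => ?_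
    revert b; refine Lin.ext_tmul (by fun_prop) (by fun_prop) fun x' y' => ?_
    revert c; refine Lin.ext_tmul (by fun_prop) (by fun_prop) fun x'' y'' => ?_
    simp (disch := fun_prop) only [twist_mul, sw_tmul_left, sw_tmul_right, sw_map, hτ.mul_tmul,
      hτ.tmul_mul, sw_sw, sw_tmul, hX.assoc, hY.assoc]
    rw [sw_comm]
  one_mul a := by
    revert a; refine Lin.ext_tmul (by fun_prop) (by fun_prop) fun x y => ?_
    simp (disch := fun_prop) only [twist_one, twist_mul, hτ.one_tmul, sw_tmul, hX.one_mul,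
      hY.one_mul]
  mul_one a := by
    revert a; refine Lin.ext_tmul (by fun_prop) (by fun_prop) fun x y => ?_
    simp (disch := fun_prop) only [twist_one, twist_mul, hτ.tmul_one, sw_tmul, hX.mul_one,
      hY.mul_one]

theorem IsCoalg.twist (hX : X.IsCoalg) (hY : Y.IsCoalg) (hσ : IsCoalgTwist X Y σ) :
    (X.twist Y τ σ).IsCoalg where
  coassoc a := by
    revert a; refine Lin.ext_tmul (by fun_prop) (by fun_prop) fun x y => ?_
    rw [assoc_rTensor_eq_sw, lTensor_comul_eq_sw]
    simp (disch := fun_prop) only [twist_comul, sw_sw, sw_tmul, hX.coassoc_sw, hY.coassoc_sw,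
      hσ.comul_left_sw, hσ.comul_right_sw, sw_comm (X.comul _) (Y.comul _),
      sw_comm (σ _) (X.comul _), sw_comm (σ _) (Y.comul _)]
    iterate 5 refine sw_congr fun _ _ => ?_
    exact sw_comm _ _ _
  counit_comul a := by
    revert a; refine Lin.ext_tmul (by fun_prop) (by fun_prop) fun x y => ?_
    rw [rTensor_eq_sw]
    simp (disch := fun_prop) only [twist_comul, sw_sw, sw_tmul, sw_map, TensorProduct.lid_tmul,
      twist_counit, mul_smul, ← sw_smul_right, hX.counit_smul, hσ.counit_left_sw, hY.counit_smul]
  comul_counit a := by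
    revert a; refine Lin.ext_tmul (by fun_prop) (by fun_prop) fun x y => ?_
    rw [lTensor_eq_sw]
    simp (disch := fun_prop) only [twist_comul, sw_sw, sw_tmul, sw_map, TensorProduct.rid_tmul,
      twist_counit, mul_smul, smul_comm (X.counit _) (Y.counit _), ← sw_smul_right, hX.smul_counit,
      hσ.counit_right_sw, hY.smul_counit]


/-- A linear map out of a twisted tensor product is multiplicative if it is so on generators. -/
theorem twist_map_mul {E : BialgData k Z}
    (hE : ∀ x y z : Z, E.mul (E.mul (x ⊗ₜ y) ⊗ₜ z) = E.mul (x ⊗ₜ E.mul (y ⊗ₜ z)))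
    (f : V ⊗[k] W →ₗ[k] Z)
    (hf : ∀ x y, f (x ⊗ₜ y) = E.mul (f (x ⊗ₜ Y.one) ⊗ₜ f (X.one ⊗ₜ y)))
    (hfX : ∀ x x', f (X.mul (x ⊗ₜ x') ⊗ₜ Y.one) = E.mul (f (x ⊗ₜ Y.one) ⊗ₜ f (x' ⊗ₜ Y.one)))
    (hfY : ∀ y y', f (X.one ⊗ₜ Y.mul (y ⊗ₜ y')) = E.mul (f (X.one ⊗ₜ y) ⊗ₜ f (X.one ⊗ₜ y')))
    (hfτ : ∀ x y, f (τ (y ⊗ₜ x)) = E.mul (f (X.one ⊗ₜ y) ⊗ₜ f (x ⊗ₜ Y.one))) :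
    ∀ a b, f ((X.twist Y τ σ).mul (a ⊗ₜ b)) = E.mul (f a ⊗ₜ f b) := by
  intro a b
  revert a; refine Lin.ext_tmul (by fun_prop) (by fun_prop) fun x y => ?_
  revert b; refine Lin.ext_tmul (by fun_prop) (by fun_prop) fun x' y' => ?_
  -- The product is `x · τ(y ⊗ x') · y'`, so only the reordered middle is not yet split into
  -- generators.
  have key : f ((X.twist Y τ σ).mul ((x ⊗ₜ y) ⊗ₜ (x' ⊗ₜ y'))) =
      E.mul (f (x ⊗ₜ Y.one) ⊗ₜ E.mul (f (τ (y ⊗ₜ x')) ⊗ₜ f (X.one ⊗ₜ y'))) := by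
    conv_rhs => rw [← sw_eta (τ (y ⊗ₜ x'))]
    simp only [twist_mul, sw_map, sw_tmul_left, sw_tmul_right]
    refine sw_congr fun p q => ?_
    rw [hf, hfX, hfY, hf p q]
    simp only [hE]
  rw [key, hfτ, hf x y, hf x' y']
  simp only [hE]

theorem twist_mul_inl (hY : Y.IsAlg) (hτ : IsAlgTwist X Y τ) (x x' : V) (y : W) :
    (X.twist Y τ σ).mul ((x ⊗ₜ Y.one) ⊗ₜ (x' ⊗ₜ y)) = X.mul (x ⊗ₜ x') ⊗ₜ y := by
  simp (disch := fun_prop) only [twist_mul, hτ.one_tmul, sw_tmul, hY.one_mul]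

theorem twist_mul_inr (hX : X.IsAlg) (hτ : IsAlgTwist X Y τ) (x : V) (y y' : W) :
    (X.twist Y τ σ).mul ((x ⊗ₜ y) ⊗ₜ (X.one ⊗ₜ y')) = x ⊗ₜ Y.mul (y ⊗ₜ y') := by
  simp (disch := fun_prop) only [twist_mul, hτ.tmul_one, sw_tmul, hX.mul_one]

theorem twist_mul_inr_inl (hX : X.IsAlg) (hY : Y.IsAlg) (x : V) (y : W) :
    (X.twist Y τ σ).mul ((X.one ⊗ₜ y) ⊗ₜ (x ⊗ₜ Y.one)) = τ (y ⊗ₜ x) := by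
  simp (disch := fun_prop) only [twist_mul, hX.one_mul, hY.mul_one, sw_eta]

/-- The antipode is the product `S(q) S(p)` of elements of the two subalgebras, where `q ⊗ p = σ(x ⊗
y)`. In the left axiom the two factors from `X` meet first and collapse, in the right axiom those
from `Y`; the compatibility of `σ` with the corresponding coproduct brings them together.
Multiplicativity of the coproduct plays no role, so this applies before the twist is known to be a
bialgebra. -/
theorem IsAntipode.twist (hX : X.IsAlg) (hY : Y.IsAlg) (hτ : IsAlgTwist X Y τ) (hσ : IsCoalgTwist X Y σ) {SX : V →ₗ[k] V} {SY : W →ₗ[k] W}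
    (hSX : X.IsAntipode SX) (hSY : Y.IsAntipode SY) :
    (X.twist Y τ σ).IsAntipode (τ ∘ₗ TensorProduct.map SY SX ∘ₗ σ) := by
  have hE : (X.twist Y τ σ).IsAlg := hX.twist hY hτ
  have hS : ∀ x y, (τ ∘ₗ TensorProduct.map SY SX ∘ₗ σ) (x ⊗ₜ y) = sw (σ (x ⊗ₜ y)) fun q p =>
      (X.twist Y τ σ).mul ((X.one ⊗ₜ SY q) ⊗ₜ (SX p ⊗ₜ Y.one)) := by
    intro x y
    simp only [LinearMap.comp_apply, twist_mul_inr_inl hX hY, map_eq_sw, sw_map]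
  have hm : ∀ x y, x ⊗ₜ y = (X.twist Y τ σ).mul ((x ⊗ₜ Y.one) ⊗ₜ (X.one ⊗ₜ y)) := by
    intro x y
    rw [twist_mul_inl hY hτ, hX.mul_one]
  refine ⟨fun a => ?_, fun a => ?_⟩
  · revert a; refine Lin.ext_tmul (by fun_prop) (by fun_prop) fun x y => ?_
    rw [rTensor_eq_sw]
    have h1 : ∀ p q p' y₂, (X.twist Y τ σ).mul ((X.twist Y τ σ).mul ((X.one ⊗ₜ SY q) ⊗ₜ
        (SX p ⊗ₜ Y.one)) ⊗ₜ (p' ⊗ₜ y₂)) = (X.twist Y τ σ).mul ((X.one ⊗ₜ SY q) ⊗ₜ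
        (X.mul (SX p ⊗ₜ p') ⊗ₜ y₂)) := by
      intro p q p' y₂
      rw [hE.assoc, twist_mul_inl hY hτ]
    simp (disch := fun_prop) only [twist_comul, sw_sw, sw_tmul, sw_map, hS, sw_tmul_left, h1,
      twist_counit, twist_one]
    have h2 : ∀ q p y₂, (sw (X.comul p) fun p₁ p₂ => (X.twist Y τ σ).mul ((X.one ⊗ₜ SY q) ⊗ₜ
        (X.mul (SX p₁ ⊗ₜ p₂) ⊗ₜ y₂))) = X.counit p • (X.one ⊗ₜ Y.mul (SY q ⊗ₜ y₂)) := by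
      intro q p y₂
      rw [hSX.left_sw p (F := fun v => (X.twist Y τ σ).mul ((X.one ⊗ₜ SY q) ⊗ₜ (v ⊗ₜ y₂)))
        (by fun_prop), twist_mul_inr hX hτ]
    simp (disch := fun_prop) only [sw_comm (X.comul _) (Y.comul _), ← hσ.comul_right_sw, h2,
      hσ.counit_right_sw, ← sw_smul_right]
    rw [hSY.left_sw y (F := fun w => X.one ⊗ₜ w) (by fun_prop), mul_smul]
  · revert a; refine Lin.ext_tmul (by fun_prop) (by fun_prop) fun x y => ?_
    rw [lTensor_eq_sw]
    have h1 : ∀ p q p' y₂, (X.twist Y τ σ).mul ((p' ⊗ₜ y₂) ⊗ₜ (X.twist Y τ σ).mul ((X.one ⊗ₜ SY q)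
        ⊗ₜ (SX p ⊗ₜ Y.one))) = (X.twist Y τ σ).mul ((p' ⊗ₜ Y.mul (y₂ ⊗ₜ SY q)) ⊗ₜ
        (SX p ⊗ₜ Y.one)) := by
      intro p q p' y₂
      rw [← hE.assoc, twist_mul_inr hX hτ]
    simp (disch := fun_prop) only [twist_comul, sw_sw, sw_tmul, sw_map, hS, sw_tmul_right, h1,
      twist_counit, twist_one]
    have h2 : ∀ q p x₁, (sw (Y.comul q) fun q₁ q₂ => (X.twist Y τ σ).mul (
        (x₁ ⊗ₜ Y.mul (q₁ ⊗ₜ SY q₂)) ⊗ₜ (SX p ⊗ₜ Y.one))) =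
        Y.counit q • (X.mul (x₁ ⊗ₜ SX p) ⊗ₜ Y.one) := by
      intro q p x₁
      rw [hSY.right_sw q (F := fun v => (X.twist Y τ σ).mul ((x₁ ⊗ₜ v) ⊗ₜ (SX p ⊗ₜ Y.one)))
        (by fun_prop), twist_mul_inl hY hτ]
    simp (disch := fun_prop) only [← hσ.comul_left_sw, h2, hσ.counit_left_sw, ← sw_smul_right]
    rw [hSX.right_sw x (F := fun w => w ⊗ₜ Y.one) (by fun_prop), mul_comm, mul_smul]

end Twist
end BialgData
end Structures

/-! ### Ordinary Hopf algebras: antipodes and opposite products. -/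

section HopfTheory

variable {k V W Z : Type*} [Field k] [AddCommGroup V] [Module k V] [AddCommGroup W] [Module k W]
  [AddCommGroup Z] [Module k Z]

namespace BialgData

variable {X : BialgData k V} {Y : BialgData k W}

theorem isAlgTwist_tswap (X : BialgData k V) (Y : BialgData k W) : IsAlgTwist X Y tswap where
  tmul_one y := by simp
  one_tmul x := by simp
  mul_tmul y y' x := by
    simp (disch := fun_prop) only [sw_tswap, sw_tmul, LinearEquiv.coe_coe, TensorProduct.comm_tmul]
  tmul_mul y y' x := by
    simp (disch := fun_prop) only [sw_tswap, sw_tmul, LinearEquiv.coe_coe, TensorProduct.comm_tmul]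

theorem isCoalgTwist_tswap (X : BialgData k V) (Y : BialgData k W) : IsCoalgTwist X Y tswap where
  counit_left x y := by simp (disch := fun_prop) only [sw_tswap, sw_tmul]
  counit_right x y := by simp (disch := fun_prop) only [sw_tswap, sw_tmul]
  comul_left x y := by simp (disch := fun_prop) only [sw_tswap, sw_tmul]
  comul_right x y := by simp (disch := fun_prop) only [sw_tswap, sw_tmul]

theorem sw_twist_tswap_comul (τ : W ⊗[k] V →ₗ[k] V ⊗[k] W) (x : V) (y : W)
    {F : V ⊗[k] W → V ⊗[k] W → Z} (hl : ∀ y, Lin k (fun x => F x y))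
    (hr : ∀ x, Lin k (fun y => F x y)) :
    sw ((X.twist Y τ tswap).comul (x ⊗ₜ y)) F = sw (X.comul x) fun x₁ x₂ =>
      sw (Y.comul y) fun y₁ y₂ => F (x₁ ⊗ₜ y₁) (x₂ ⊗ₜ y₂) := by
  simp (disch := fun_prop) only [twist_comul, sw_sw, sw_tswap, sw_tmul]

/-- The algebra structure of the tensor product. -/
theorem twist_tswap_mul (σ : V ⊗[k] W →ₗ[k] W ⊗[k] V) (x x' : V) (y y' : W) :
    (X.twist Y tswap σ).mul ((x ⊗ₜ y) ⊗ₜ (x' ⊗ₜ y')) = X.mul (x ⊗ₜ x') ⊗ₜ Y.mul (y ⊗ₜ y') := by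
  simp (disch := fun_prop) only [twist_mul, sw_tswap, sw_tmul]

theorem IsBialgebra.comul_mul_sw (h : X.IsBialgebra) (x y : V) :
    X.comul (X.mul (x ⊗ₜ y)) = sw (X.comul x) fun x₁ x₂ => sw (X.comul y) fun y₁ y₂ =>
      X.mul (x₁ ⊗ₜ y₁) ⊗ₜ X.mul (x₂ ⊗ₜ y₂) := by
  rw [h.comul_mul, sqMul_tswap_eq_sw]

theorem sw_op_mul (x y : V) : X.op.mul (x ⊗ₜ y) = X.mul (y ⊗ₜ x) := by
  simp [BialgData.op]

theorem IsAlg.op (h : X.IsAlg) : X.op.IsAlg where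
  assoc x y z := by simp only [sw_op_mul, h.assoc]
  one_mul x := by rw [sw_op_mul]; exact h.mul_one x
  mul_one x := by rw [sw_op_mul]; exact h.one_mul x

theorem IsBialgebra.op (h : X.IsBialgebra) : X.op.IsBialgebra where
  mul_assoc := h.isAlg.op.assoc
  one_mul := h.isAlg.op.one_mul
  mul_one := h.isAlg.op.mul_one
  coassoc := h.coassoc
  counit_comul := h.counit_comul
  comul_counit := h.comul_counit
  comul_mul x y := by
    rw [sqMul_tswap_eq_sw]
    simp only [sw_op_mul]
    simp only [BialgData.op]
    rw [h.comul_mul_sw, sw_comm]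
  comul_one := h.comul_one
  counit_mul x y := by rw [sw_op_mul, mul_comm]; exact h.counit_mul y x
  counit_one := h.counit_one

section Antipode

variable {S : V →ₗ[k] V}

theorem IsAntipode.map_one (h : X.IsBialgebra) (hS : X.IsAntipode S) : S X.one = X.one := by
  have := hS.left X.one
  rwa [h.comul_one, LinearMap.rTensor_tmul, h.mul_one, h.counit_one, one_smul] at this

/-- Both sides are convolution inverse to the product, as maps from the coalgebra `X ⊗ X` to `X`. -/
theorem IsAntipode.map_mul (h : X.IsBialgebra) (hS : X.IsAntipode S) (x y : V) :
    S (X.mul (x ⊗ₜ y)) = X.mul (S y ⊗ₜ S x) := by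
  have key := conv_inverse_unique (X := X.twist X tswap tswap) (Y := X)
    (h.isCoalg.twist h.isCoalg (isCoalgTwist_tswap X X)) h.isAlg
    (f := S ∘ₗ X.mul) (g := X.mul) (h := X.mul ∘ₗ tswap ∘ₗ TensorProduct.map S S) ?_ ?_ (x ⊗ₜ y)
  · simpa using key
  · refine Lin.ext_tmul (by fun_prop) (by fun_prop) fun x y => ?_
    simp (disch := fun_prop) only [sw_twist_tswap_comul, LinearMap.comp_apply, twist_counit]
    rw [← h.counit_mul, ← hS.left_sw _ (F := fun x => x) (by fun_prop), h.comul_mul_sw]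
    simp (disch := fun_prop) only [sw_sw, sw_tmul]
  · refine Lin.ext_tmul (by fun_prop) (by fun_prop) fun x y => ?_
    simp (disch := fun_prop) only [sw_twist_tswap_comul, LinearMap.comp_apply, twist_counit,
      TensorProduct.map_tmul, LinearEquiv.coe_coe, TensorProduct.comm_tmul]
    have h1 : ∀ a b c d, X.mul (X.mul (a ⊗ₜ b) ⊗ₜ X.mul (c ⊗ₜ d)) =
      X.mul (a ⊗ₜ X.mul (X.mul (b ⊗ₜ c) ⊗ₜ d)) := fun a b c d => by simp only [h.mul_assoc]
    have h2 : ∀ a d, (sw (X.comul y) fun b c => X.mul (a ⊗ₜ X.mul (X.mul (b ⊗ₜ S c) ⊗ₜ d))) =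
        X.counit y • X.mul (a ⊗ₜ d) := by
      intro a d
      rw [hS.right_sw y (F := fun w => X.mul (a ⊗ₜ X.mul (w ⊗ₜ d))) (by fun_prop), h.one_mul]
    simp only [h1, h2, ← sw_smul_right]
    rw [hS.right_sw x (F := fun x => x) (by fun_prop), mul_comm, mul_smul]

theorem IsAntipode.counit_antipode (h : X.IsBialgebra) (hS : X.IsAntipode S) (x : V) :
    X.counit (S x) = X.counit x := by
  have h1 := hS.left_sw x (F := X.counit) (by fun_prop)
  simp only [h.counit_mul, h.counit_one, smul_eq_mul, mul_one] at h1
  rw [← h1, ← h.isCoalg.smul_counit x (F := fun x => X.counit (S x)) (by fun_prop)]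
  simp only [smul_eq_mul, mul_comm]

/-- Both sides are convolution inverse to the coproduct, as maps from `X` to the algebra `X ⊗ X`. -/
theorem IsAntipode.comul_antipode (h : X.IsBialgebra) (hS : X.IsAntipode S) (x : V) :
    X.comul (S x) = sw (X.comul x) fun x₁ x₂ => S x₂ ⊗ₜ S x₁ := by
  have hA := h.isAlg.twist (σ := tswap) h.isAlg (isAlgTwist_tswap X X)
  have key := conv_inverse_unique (X := X) (Y := X.twist X tswap tswap) h.isCoalg hA
    (f := X.comul ∘ₗ S) (g := X.comul) (h := tswap ∘ₗ TensorProduct.map S S ∘ₗ X.comul) ?_ ?_ x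
  · rw [LinearMap.comp_apply] at key
    rw [key]
    simp only [LinearMap.comp_apply, map_eq_sw, sw_map, LinearEquiv.coe_coe,
      TensorProduct.comm_tmul]
  · intro x
    have h1 : ∀ a b, (X.twist X tswap tswap).mul ((X.comul ∘ₗ S) a ⊗ₜ X.comul b) =
      X.comul (X.mul (S a ⊗ₜ b)) := fun a b => (h.comul_mul _ _).symm
    simp only [h1]
    rw [hS.left_sw x (F := X.comul) (by fun_prop), h.comul_one]
    rfl
  · intro x
    simp (disch := fun_prop) only [LinearMap.comp_apply, map_eq_sw, sw_map, LinearEquiv.coe_coe,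
      TensorProduct.comm_tmul, sw_tmul_right]
    have h1 : ∀ a b c, (X.twist X tswap tswap).mul (X.comul a ⊗ₜ (S c ⊗ₜ S b)) =
        sw (X.comul a) fun p q => X.mul (p ⊗ₜ S c) ⊗ₜ X.mul (q ⊗ₜ S b) := by
      intro a b c
      conv_lhs => rw [← sw_eta (X.comul a)]
      simp only [sw_map, sw_tmul_left, twist_tswap_mul]
    have h2 : ∀ c d : V, (sw (X.comul c) fun b r => sw (X.comul r) fun e f =>
        X.mul (d ⊗ₜ S f) ⊗ₜ[k] X.mul (b ⊗ₜ S e)) = X.mul (d ⊗ₜ S c) ⊗ₜ X.one := by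
      intro c d
      rw [← h.isCoalg.coassoc_sw c (F := fun b e f => X.mul (d ⊗ₜ S f) ⊗ₜ X.mul (b ⊗ₜ S e))
        (by fun_prop) (by fun_prop) (by fun_prop)]
      have : ∀ a f, (sw (X.comul a) fun b e => X.mul (d ⊗ₜ S f) ⊗ₜ[k] X.mul (b ⊗ₜ S e)) =
          X.counit a • X.mul (d ⊗ₜ S f) ⊗ₜ X.one := fun a f =>
        hS.right_sw a (F := fun v => X.mul (d ⊗ₜ S f) ⊗ₜ v) (by fun_prop)
      simp (disch := fun_prop) only [this, h.isCoalg.counit_smul]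
    simp only [h1]
    rw [sw_congr fun a b => sw_comm (X.comul b) (X.comul a) _]
    simp (disch := fun_prop) only [h.isCoalg.coassoc_sw, h2]
    exact hS.right_sw x (F := fun v => v ⊗ₜ X.one) (by fun_prop)

/-- An inverse of the antipode is an antipode for the opposite product. -/
theorem IsAntipode.op (h : X.IsBialgebra) (hS : X.IsAntipode S) {S' : V →ₗ[k] V}
    (h1 : ∀ x, S (S' x) = x) (h2 : ∀ x, S' (S x) = x) : X.op.IsAntipode S' := by
  have hinj : Function.Injective S := Function.LeftInverse.injective h2
  refine ⟨fun x => hinj ?_, fun x => hinj ?_⟩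
  · have := hS.right_sw x (F := fun x => x) (by fun_prop)
    rw [rTensor_eq_sw]
    simp only [sw_map, sw_op_mul, hS.map_mul h, h1]
    simpa only [BialgData.op, map_smul, hS.map_one h] using this
  · have := hS.left_sw x (F := fun x => x) (by fun_prop)
    rw [lTensor_eq_sw]
    simp only [sw_map, sw_op_mul, hS.map_mul h, h1]
    simpa only [BialgData.op, map_smul, hS.map_one h] using this

end Antipode
end BialgData
end HopfTheory

/-! ### Hopf pairings and adjointness of antipodes. -/

section Pairing

variable {k X Y Z : Type*} [Field k] [AddCommGroup X] [Module k X] [AddCommGroup Y] [Module k Y]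
  [AddCommGroup Z] [Module k Z] {𝓧 : BialgData k X} {𝓨 : BialgData k Y} {P : X ⊗[k] Y →ₗ[k] k}

namespace IsHopfPairing

theorem mul_left_sw (h : IsHopfPairing 𝓧 𝓨 P) (x x' : X) (y : Y) : P (𝓧.mul (x ⊗ₜ x') ⊗ₜ y) =
    sw (𝓨.comul y) fun y₁ y₂ => P (x ⊗ₜ y₁) * P (x' ⊗ₜ y₂) := by
  rw [h.mul_left, mul_map_interchange]
  simp (disch := fun_prop) only [sw_tmul]

theorem mul_right_sw (h : IsHopfPairing 𝓧 𝓨 P) (x : X) (y y' : Y) : P (x ⊗ₜ 𝓨.mul (y ⊗ₜ y')) =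
    sw (𝓧.comul x) fun x₁ x₂ => P (x₁ ⊗ₜ y) * P (x₂ ⊗ₜ y') := by
  rw [h.mul_right, mul_map_interchange]
  simp (disch := fun_prop) only [sw_tmul]

end IsHopfPairing

/-- With the ground field as target algebra, uniqueness of convolution inverses applies to bilinear
forms, and the generator test for multiplicativity applies to counits. -/
theorem isAlg_field : (HopfData.of k k).IsAlg where
  assoc x y z := by simp [HopfData.of, mul_assoc]
  one_mul x := by simp [HopfData.of]
  mul_one x := by simp [HopfData.of]

/-- The antipodes are adjoint under a Hopf pairing. -/
theorem IsHopfPairing.antipode_adjoint (h : IsHopfPairing 𝓧 𝓨 P) (hX : 𝓧.IsCoalg)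
    (hY : 𝓨.IsCoalg) {SX : X →ₗ[k] X} {SY : Y →ₗ[k] Y} (hSX : 𝓧.IsAntipode SX)
    (hSY : 𝓨.IsAntipode SY) (x : X) (y : Y) : P (SX x ⊗ₜ y) = P (x ⊗ₜ SY y) := by
  have hk : ∀ a b : k, (HopfData.of k k).mul (a ⊗ₜ b) = a * b := fun a b => rfl
  -- Both forms are convolution inverse to `P` on the tensor product coalgebra.
  have key := BialgData.conv_inverse_unique (X := 𝓧.twist 𝓨 tswap tswap)
    (Y := (HopfData.of k k).toBialgData)
    (hX.twist hY (BialgData.isCoalgTwist_tswap 𝓧 𝓨)) isAlg_field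
    (f := P ∘ₗ LinearMap.rTensor Y SX) (g := P) (h := P ∘ₗ LinearMap.lTensor X SY) ?_ ?_ (x ⊗ₜ y)
  · simpa using key
  · refine Lin.ext_tmul (by fun_prop) (by fun_prop) fun x y => ?_
    simp (disch := fun_prop) only [BialgData.sw_twist_tswap_comul, LinearMap.comp_apply, hk,
      BialgData.twist_counit, LinearMap.rTensor_tmul, ← h.mul_left_sw]
    rw [hSX.left_sw x (F := fun x => P (x ⊗ₜ y)) (by fun_prop), h.one_left, mul_smul]
    simp [HopfData.of]
  · refine Lin.ext_tmul (by fun_prop) (by fun_prop) fun x y => ?_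
    simp (disch := fun_prop) only [BialgData.sw_twist_tswap_comul, LinearMap.comp_apply, hk,
      BialgData.twist_counit, LinearMap.lTensor_tmul, sw_comm (𝓧.comul _) (𝓨.comul _),
      ← h.mul_right_sw]
    rw [hSY.right_sw y (F := fun y => P (x ⊗ₜ y)) (by fun_prop), h.one_right, mul_comm, mul_smul]
    simp [HopfData.of]

end Pairing

/-! ### Bialgebras from a distributive law that is a coalgebra map. -/

section Bicrossed

variable {k X Y Z : Type*} [Field k] [AddCommGroup X] [Module k X] [AddCommGroup Y] [Module k Y]
  [AddCommGroup Z] [Module k Z] {𝓧 : BialgData k X} {𝓨 : BialgData k Y}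

/-- A tensor product coalgebra with product twisted by a distributive law that is a coalgebra map
is a bialgebra. -/
theorem BialgData.IsBialgebra.twist_tswap (hX : 𝓧.IsBialgebra) (hY : 𝓨.IsBialgebra)
    {τ : Y ⊗[k] X →ₗ[k] X ⊗[k] Y} (hτ : IsAlgTwist 𝓧 𝓨 τ)
    (hΔ : ∀ x y, interchange (TensorProduct.map 𝓧.comul 𝓨.comul (τ (y ⊗ₜ x))) =
      sw (𝓧.comul x) fun x₁ x₂ => sw (𝓨.comul y) fun y₁ y₂ => τ (y₁ ⊗ₜ x₁) ⊗ₜ τ (y₂ ⊗ₜ x₂))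
    (hε : ∀ x y, LinearMap.mul' k k (TensorProduct.map 𝓧.counit 𝓨.counit (τ (y ⊗ₜ x))) =
      𝓧.counit x * 𝓨.counit y) : (𝓧.twist 𝓨 τ tswap).IsBialgebra := by
  -- `D` is made opaque so that rewriting uses only its values on generators.
  obtain ⟨D, hD⟩ : ∃ D, D = 𝓧.twist 𝓨 τ tswap := ⟨_, rfl⟩
  have hA : D.IsAlg := hD ▸ hX.isAlg.twist hY.isAlg hτ
  have hC : D.IsCoalg := hD ▸ hX.isCoalg.twist hY.isCoalg (BialgData.isCoalgTwist_tswap _ _)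
  have hE : (D.twist D tswap tswap).IsAlg := hA.twist hA (BialgData.isAlgTwist_tswap _ _)
  have h0 : ∀ a b c d, (D.twist D tswap tswap).mul ((a ⊗ₜ b) ⊗ₜ (c ⊗ₜ d)) =
      D.mul (a ⊗ₜ c) ⊗ₜ D.mul (b ⊗ₜ d) := fun a b c d => BialgData.twist_tswap_mul _ a c b d
  have h3 : ∀ x y, D.comul (x ⊗ₜ y) = sw (𝓧.comul x) fun x₁ x₂ =>
      sw (𝓨.comul y) fun y₁ y₂ => (x₁ ⊗ₜ y₁) ⊗ₜ (x₂ ⊗ₜ y₂) := by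
    intro x y
    simp (disch := fun_prop) only [hD, BialgData.twist_comul, sw_tswap, sw_tmul]
  have h1 : ∀ x, D.comul (x ⊗ₜ 𝓨.one) = sw (𝓧.comul x) fun x₁ x₂ =>
      (x₁ ⊗ₜ 𝓨.one) ⊗ₜ (x₂ ⊗ₜ 𝓨.one) := by
    intro x
    simp (disch := fun_prop) only [h3, hY.comul_one, sw_tmul]
  have h2 : ∀ y, D.comul (𝓧.one ⊗ₜ y) = sw (𝓨.comul y) fun y₁ y₂ =>
      (𝓧.one ⊗ₜ y₁) ⊗ₜ (𝓧.one ⊗ₜ y₂) := by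
    intro x
    simp (disch := fun_prop) only [h3, hX.comul_one, sw_tmul]
  have hΔ' : ∀ t, D.comul t = interchange (TensorProduct.map 𝓧.comul 𝓨.comul t) := by
    refine Lin.ext_tmul (by fun_prop) (by fun_prop) fun x y => ?_
    rw [h3, TensorProduct.map_tmul, interchange_eq_sw]
  have hl : ∀ x x' y, D.mul ((x ⊗ₜ 𝓨.one) ⊗ₜ (x' ⊗ₜ y)) = 𝓧.mul (x ⊗ₜ x') ⊗ₜ y :=
    hD ▸ BialgData.twist_mul_inl hY.isAlg hτ
  have hr : ∀ x y y', D.mul ((x ⊗ₜ y) ⊗ₜ (𝓧.one ⊗ₜ y')) = x ⊗ₜ 𝓨.mul (y ⊗ₜ y') :=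
    hD ▸ BialgData.twist_mul_inr hX.isAlg hτ
  have hrl : ∀ x y, D.mul ((𝓧.one ⊗ₜ y) ⊗ₜ (x ⊗ₜ 𝓨.one)) = τ (y ⊗ₜ x) :=
    hD ▸ BialgData.twist_mul_inr_inl hX.isAlg hY.isAlg
  have h4 : ∀ x y, D.counit (x ⊗ₜ y) = 𝓧.counit x * 𝓨.counit y := hD ▸ twist_counit 𝓧 𝓨 τ tswap
  have h5 : D.one = 𝓧.one ⊗ₜ 𝓨.one := hD ▸ rfl
  rw [← hD]
  refine ⟨hA.assoc, hA.one_mul, hA.mul_one, hC.coassoc, hC.counit_comul, hC.comul_counit, ?_, ?_,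
    ?_, ?_⟩
  -- Of the four conditions on generators only the one for `y · x` involves `τ`, and there it is
  -- `hΔ`.
  · have := BialgData.twist_map_mul (X := 𝓧) (Y := 𝓨) (τ := τ) (σ := tswap) hE.assoc D.comul
      (fun x y => ?_) (fun x x' => ?_) (fun y y' => ?_) (fun x y => ?_)
    · exact hD ▸ this
    · simp only [h1, h2, h3, h0, sw_tmul_left, sw_tmul_right, sw_map, hl, hX.mul_one, hY.one_mul]
      rw [sw_comm]
    · simp only [hX.comul_mul_sw, h1, h0, sw_tmul_left, sw_tmul_right, sw_map, hl]
      simp (disch := fun_prop) only [sw_sw, sw_tmul]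
      rw [sw_comm]
    · simp only [hY.comul_mul_sw, h2, h0, sw_tmul_left, sw_tmul_right, sw_map, hr]
      simp (disch := fun_prop) only [sw_sw, sw_tmul]
      rw [sw_comm]
    · simp only [h1, h2, h0, sw_tmul_left, sw_tmul_right, sw_map, hrl, hΔ', hΔ]
  · rw [h5, h3, hX.comul_one]
    simp (disch := fun_prop) only [hY.comul_one, sw_tmul]
  · have hc : ∀ t, D.counit t = LinearMap.mul' k k (TensorProduct.map 𝓧.counit 𝓨.counit t) := by
      refine Lin.ext_tmul (by fun_prop) (by fun_prop) fun x y => ?_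
      rw [h4, TensorProduct.map_tmul, LinearMap.mul'_apply]
    have hk : ∀ a b : k, (HopfData.of k k).mul (a ⊗ₜ b) = a * b := fun a b => rfl
    have := BialgData.twist_map_mul (X := 𝓧) (Y := 𝓨) (τ := τ) (σ := tswap) (isAlg_field (k := k)).assoc D.counit
      (fun x y => ?_) (fun x x' => ?_) (fun y y' => ?_) (fun x y => ?_)
    · exact hD ▸ this
    · simp only [hk, h4, hX.counit_one, hY.counit_one, mul_one, one_mul]
    · simp only [hk, h4, hX.counit_mul, hY.counit_one, mul_one]
    · simp only [hk, h4, hY.counit_mul, hX.counit_one, one_mul]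
    · simp only [hc, hε, hk, TensorProduct.map_tmul, LinearMap.mul'_apply, hX.counit_one,
        hY.counit_one, mul_one, one_mul, mul_comm]
  · rw [h5, h4, hX.counit_one, hY.counit_one, mul_one]

end Bicrossed

/-! ### The generalised quantum double is a bialgebra. -/

section Double

variable {k X Y Z : Type*} [Field k] [AddCommGroup X] [Module k X] [AddCommGroup Y] [Module k Y]
  [AddCommGroup Z] [Module k Z] {𝓧 : HopfData k X} {𝓨 : HopfData k Y} {P : X ⊗[k] Y →ₗ[k] k}

theorem splitThree_tmul (𝓧 : BialgData k X) (𝓨 : BialgData k Y) (x : X) (y : Y) :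
    splitThree 𝓧 𝓨 (x ⊗ₜ y) = sw (𝓧.comul x) fun x₁ r => sw (𝓧.comul r) fun x₂ x₃ =>
      sw (𝓨.comul y) fun y₁ s => sw (𝓨.comul s) fun y₂ y₃ =>
        (x₁ ⊗ₜ y₁) ⊗ₜ ((x₂ ⊗ₜ y₂) ⊗ₜ (x₃ ⊗ₜ y₃)) := by
  simp only [splitThree, LinearMap.comp_apply, TensorProduct.map_tmul, lTensor_comul_eq_sw]
  simp (disch := fun_prop) only [interchange_eq_sw, sw_sw, sw_tmul, sw_map,
    LinearMap.lTensor_tmul, LinearEquiv.coe_coe, TensorProduct.tensorTensorTensorComm_tmul,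
    sw_tmul_left, sw_tmul_right, sw_comm (𝓨.comul _) (𝓧.comul _)]

/-- The reordering map `y ⊗ x ↦ x₍₂₎ ⊗ y₍₂₎ ⟨x₍₁₎, S y₍₁₎⟩⟨x₍₃₎, y₍₃₎⟩` of the double. -/
def doubleTwist (𝓧 : BialgData k X) (𝓨 : HopfData k Y) (P : X ⊗[k] Y →ₗ[k] k) :
    Y ⊗[k] X →ₗ[k] X ⊗[k] Y :=
  (TensorProduct.lid k (X ⊗[k] Y)).toLinearMap ∘ₗ
    TensorProduct.map (P ∘ₗ LinearMap.lTensor X 𝓨.antipode)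
      ((TensorProduct.rid k (X ⊗[k] Y)).toLinearMap ∘ₗ LinearMap.lTensor (X ⊗[k] Y) P) ∘ₗ
    splitThree 𝓧 𝓨.toBialgData ∘ₗ tswap

theorem generalisedDouble_eq (𝓧 : HopfData k X) (𝓨 : HopfData k Y) (P : X ⊗[k] Y →ₗ[k] k) :
    generalisedDouble 𝓧 𝓨 P =
      𝓧.toBialgData.op.twist 𝓨.toBialgData (doubleTwist 𝓧.toBialgData 𝓨 P) tswap := rfl

theorem doubleTwist_tmul (𝓧 : BialgData k X) (𝓨 : HopfData k Y) (P : X ⊗[k] Y →ₗ[k] k) (y : Y)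
    (x : X) : doubleTwist 𝓧 𝓨 P (y ⊗ₜ x) =
      sw (𝓧.comul x) fun x₁ r => sw (𝓧.comul r) fun x₂ x₃ =>
      sw (𝓨.comul y) fun y₁ s => sw (𝓨.comul s) fun y₂ y₃ =>
        P (x₁ ⊗ₜ 𝓨.antipode y₁) • P (x₃ ⊗ₜ y₃) • (x₂ ⊗ₜ y₂) := by
  simp only [doubleTwist, LinearMap.comp_apply, LinearEquiv.coe_coe, TensorProduct.comm_tmul,
    splitThree_tmul, sw_map, TensorProduct.map_tmul, LinearMap.lTensor_tmul,
    TensorProduct.lid_tmul, TensorProduct.rid_tmul, TensorProduct.smul_tmul']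

/-- The pairing turns a product on one side into a coproduct on the other, so a composite of two
reorderings splits the remaining element into five legs. The antipode of `Y` reverses products,
which matches the nesting of the legs, and it reverses coproducts, which matches the opposite
product on `X`. -/
theorem isAlgTwist_doubleTwist (hX : 𝓧.IsBialgebra) (hY : 𝓨.IsBialgebra)
    (hSY : 𝓨.IsAntipode 𝓨.antipode) (hP : IsHopfPairing 𝓧.toBialgData 𝓨.toBialgData P) :
    BialgData.IsAlgTwist 𝓧.toBialgData.op 𝓨.toBialgData (doubleTwist 𝓧.toBialgData 𝓨 P) where
  tmul_one y := by
    change doubleTwist 𝓧.toBialgData 𝓨 P (y ⊗ₜ 𝓧.one) = 𝓧.one ⊗ₜ y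
    simp (disch := fun_prop) only [doubleTwist_tmul, hX.comul_one, sw_tmul, hP.one_left,
      hSY.counit_antipode hY, ← sw_smul_right, hY.isCoalg.counit_smul, hY.isCoalg.smul_counit]
  one_tmul x := by
    simp (disch := fun_prop) only [doubleTwist_tmul, hY.comul_one, sw_tmul, hSY.map_one hY,
      hP.one_right, ← sw_smul_right, hX.isCoalg.counit_smul, hX.isCoalg.smul_counit]
  mul_tmul y y' x := by
    simp (disch := fun_prop) only [doubleTwist_tmul, hY.comul_mul_sw, sw_sw, sw_tmul,
      hSY.map_mul hY, hP.mul_right_sw, sw_smul_left, sw_smul_right, hX.isCoalg.coassoc_sw,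
      hY.isCoalg.coassoc_sw, sw_comm (𝓨.comul _) (𝓧.comul _), mul_smul, sw_map, map_smul,
      sw_smul_arg, hX.isCoalg.coassoc₅_sw]
    iterate 4 refine sw_congr fun _ _ => ?_
    rw [sw_comm (𝓨.comul y) (𝓨.comul y')]
    refine sw_congr fun _ b => ?_
    simp only [sw_comm (𝓨.comul b) _]
    iterate 3 refine sw_congr fun _ _ => ?_
    module
  tmul_mul y x x' := by
    simp (disch := fun_prop) only [doubleTwist_tmul, BialgData.sw_op_mul, hX.comul_mul_sw, sw_sw,
      sw_tmul, hSY.comul_antipode hY,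
      hP.mul_left_sw, sw_smul_left, sw_smul_right, hX.isCoalg.coassoc_sw,
      hY.isCoalg.coassoc_sw, sw_comm (𝓧.comul _) (𝓨.comul _), mul_smul, sw_map, map_smul,
      sw_smul_arg, hY.isCoalg.coassoc₅_sw]
    iterate 4 refine sw_congr fun _ _ => ?_
    rw [sw_comm (𝓧.comul x') (𝓧.comul x)]
    refine sw_congr fun _ b => ?_
    simp only [sw_comm (𝓧.comul b) _]
    iterate 3 refine sw_congr fun _ _ => ?_
    module

/-- `⟨x₍₁₎, y₍₁₎⟩⟨x₍₂₎, S y₍₂₎⟩ = ε(x)ε(y)` inside a Sweedler sum. -/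
theorem pair_antipode_cancel (hX : 𝓧.IsBialgebra) (hY : 𝓨.IsBialgebra)
    (hSY : 𝓨.IsAntipode 𝓨.antipode) (hP : IsHopfPairing 𝓧.toBialgData 𝓨.toBialgData P)
    {G : X → Y → Z} (hl : ∀ y, Lin k (fun x => G x y)) (hr : ∀ x, Lin k (fun y => G x y))
    (x : X) (y : Y) :
    (sw (𝓧.comul x) fun p r => sw (𝓧.comul r) fun q r' => sw (𝓨.comul y) fun u s =>
      sw (𝓨.comul s) fun v s' => P (p ⊗ₜ u) • P (q ⊗ₜ 𝓨.antipode v) • G r' s') = G x y := by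
  have h0 : ∀ m n, (sw (𝓧.comul m) fun p q => sw (𝓨.comul n) fun u v =>
      P (p ⊗ₜ u) * P (q ⊗ₜ 𝓨.antipode v)) = 𝓧.counit m * 𝓨.counit n := by
    intro m n
    rw [sw_comm]
    simp only [← hP.mul_right_sw]
    rw [hSY.right_sw n (F := fun y => P (m ⊗ₜ y)) (by fun_prop), hP.one_right, mul_comm,
      smul_eq_mul]
  rw [← hX.isCoalg.coassoc_sw x (F := fun p q r' => sw (𝓨.comul y) fun u s =>
      sw (𝓨.comul s) fun v s' => P (p ⊗ₜ u) • P (q ⊗ₜ 𝓨.antipode v) • G r' s')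
      (by fun_prop) (by fun_prop) (by fun_prop)]
  simp (disch := fun_prop) only [← hY.isCoalg.coassoc_sw]
  simp only [sw_comm (𝓧.comul _) (𝓨.comul y), smul_smul, ← sw_smul_left, h0]
  simp (disch := fun_prop) only [mul_smul, hX.isCoalg.counit_smul, sw_comm (𝓨.comul _) (𝓧.comul _),
    ← sw_smul_right, hY.isCoalg.counit_smul]

/-- Comultiplying a reordered element produces two adjacent middle legs. Between them the cancelling
pair of `pair_antipode_cancel` is inserted; its two evaluations are the inner ones of two separate
reorderings. -/
theorem isBialgebra_generalisedDouble (hX : 𝓧.IsBialgebra) (hY : 𝓨.IsBialgebra)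
    (hSY : 𝓨.IsAntipode 𝓨.antipode) (hP : IsHopfPairing 𝓧.toBialgData 𝓨.toBialgData P) :
    (generalisedDouble 𝓧 𝓨 P).IsBialgebra := by
  refine BialgData.IsBialgebra.twist_tswap hX.op hY (isAlgTwist_doubleTwist hX hY hSY hP)
    (fun x y => ?_) (fun x y => ?_)
  · change interchange (TensorProduct.map 𝓧.comul 𝓨.comul (doubleTwist 𝓧.toBialgData 𝓨 P (y ⊗ₜ x)))
      = sw (𝓧.comul x) fun x₁ x₂ => sw (𝓨.comul y) fun y₁ y₂ =>
        doubleTwist 𝓧.toBialgData 𝓨 P (y₁ ⊗ₜ x₁) ⊗ₜ doubleTwist 𝓧.toBialgData 𝓨 P (y₂ ⊗ₜ x₂)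
    -- Six legs on each side: `a, b, p` belong to the first reordering and `q, c, d` to the second,
    -- with `p` and `q` the inserted pair.
    trans sw (𝓧.comul x) fun a x => sw (𝓧.comul x) fun b x => sw (𝓨.comul y) fun e y =>
      sw (𝓨.comul y) fun f y => P (a ⊗ₜ 𝓨.antipode e) •
        sw (𝓧.comul x) fun p x => sw (𝓧.comul x) fun q x => sw (𝓨.comul y) fun u y =>
        sw (𝓨.comul y) fun v y => P (p ⊗ₜ u) • P (q ⊗ₜ 𝓨.antipode v) •
          sw (𝓧.comul x) fun c d => sw (𝓨.comul y) fun g h => P (d ⊗ₜ h) •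
            (b ⊗ₜ[k] f) ⊗ₜ[k] (c ⊗ₜ[k] g)
    · simp (disch := fun_prop) only [pair_antipode_cancel hX hY hSY hP]
      simp (disch := fun_prop) only [doubleTwist_tmul, sw_map, map_smul, TensorProduct.map_tmul,
        interchange_eq_sw, sw_tmul_left, sw_tmul_right, sw_smul_right,
        TensorProduct.tmul_smul, ← TensorProduct.smul_tmul', hX.isCoalg.coassoc_sw,
        hY.isCoalg.coassoc_sw, sw_comm (𝓨.comul _) (𝓧.comul _)]
    · simp only [doubleTwist_tmul]
      simp only [sw_tmul_left]
      simp (disch := fun_prop) only [sw_tmul_right, sw_smul_right,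
        TensorProduct.tmul_smul, ← TensorProduct.smul_tmul', hX.isCoalg.coassoc_sw,
        hY.isCoalg.coassoc_sw, sw_comm (𝓨.comul _) (𝓧.comul _)]
      iterate 10 refine sw_congr fun _ _ => ?_
      module
  · change LinearMap.mul' k k (TensorProduct.map 𝓧.counit 𝓨.counit
      (doubleTwist 𝓧.toBialgData 𝓨 P (y ⊗ₜ x))) = 𝓧.counit x * _
    have h1 : ∀ a b c d : k, a • b • (c * d) = c • d • (a * b) := fun a b c d => by
      simp only [smul_eq_mul]; ring
    simp only [doubleTwist_tmul, sw_map, map_smul, TensorProduct.map_tmul,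
      LinearMap.mul'_apply, h1]
    simp (disch := fun_prop) only [hX.isCoalg.counit_smul, ← sw_smul_right,
      hY.isCoalg.counit_smul, sw_comm (𝓧.comul _) (𝓨.comul _), ← hP.mul_right_sw]
    rw [hSY.left_sw y (F := fun y => P (x ⊗ₜ y)) (by fun_prop), hP.one_right, mul_comm, smul_eq_mul]

end Double

/-! ### Sweedler rules for Hopf algebras of Mathlib. -/

section MathlibHopf

variable {k H Z : Type*} [Field k] [Ring H] [HopfAlgebra k H] [AddCommGroup Z] [Module k Z]

local notation "δ" => Coalgebra.comul (R := k)
local notation "ε" => Coalgebra.counit (R := k)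
local notation "S" => HopfAlgebra.antipode k

theorem of_mul (x y : H) : (HopfData.of k H).mul (x ⊗ₜ y) = x * y := rfl
theorem of_one : (HopfData.of k H).one = 1 := rfl
theorem of_comul : (HopfData.of k H).comul = δ := rfl
theorem of_counit : (HopfData.of k H).counit = ε := rfl
theorem of_antipode : (HopfData.of k H).antipode = S := rfl

theorem isBialgebra_of : (HopfData.of k H).IsBialgebra where
  mul_assoc x y z := by simp only [of_mul, mul_assoc]
  one_mul x := by simp only [of_mul, of_one, one_mul]
  mul_one x := by simp only [of_mul, of_one, mul_one]
  coassoc x := Coalgebra.coassoc_apply x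
  counit_comul x := by simp [of_comul, of_counit]
  comul_counit x := by simp [of_comul, of_counit]
  comul_mul x y := by
    rw [BialgData.sqMul_tswap_eq_sw]
    simp only [of_mul, of_comul, Bialgebra.comul_mul]
    conv_lhs => rw [← sw_eta (δ x), ← sw_eta (δ y)]
    simp only [sw_mul_left, sw_mul_right, Algebra.TensorProduct.tmul_mul_tmul]
    rw [sw_comm]
  comul_one := by simp [of_comul, of_one, Algebra.TensorProduct.one_def]
  counit_mul x y := by simp [of_mul, of_counit]
  counit_one := by simp [of_one, of_counit]

theorem isAntipode_of : (HopfData.of k H).IsAntipode (HopfData.of k H).antipode where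
  left x := by
    simp only [of_one, of_counit, of_comul, of_antipode]
    rw [← Algebra.algebraMap_eq_smul_one]
    exact HopfAlgebra.mul_antipode_rTensor_comul_apply x
  right x := by
    simp only [of_one, of_counit, of_comul, of_antipode]
    rw [← Algebra.algebraMap_eq_smul_one]
    exact HopfAlgebra.mul_antipode_lTensor_comul_apply x

theorem comul_coassoc_sw (x : H) {F : H → H → H → Z}
    (h1 : ∀ y z, Lin k (fun x => F x y z)) (h2 : ∀ x z, Lin k (fun y => F x y z))
    (h3 : ∀ x y, Lin k (fun z => F x y z)) :
    (sw (δ x) fun a c => sw (δ a) fun p q => F p q c) =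
      sw (δ x) fun p c => sw (δ c) fun q r => F p q r :=
  (isBialgebra_of (k := k)).isCoalg.coassoc_sw x h1 h2 h3

theorem counit_smul_sw (x : H) {F : H → Z} (hF : Lin k F) :
    (sw (δ x) fun a b => ε a • F b) = F x :=
  (isBialgebra_of (k := k)).isCoalg.counit_smul x hF

theorem smul_counit_sw (x : H) {F : H → Z} (hF : Lin k F) :
    (sw (δ x) fun a b => ε b • F a) = F x :=
  (isBialgebra_of (k := k)).isCoalg.smul_counit x hF

theorem antipode_left_sw (x : H) {F : H → Z} (hF : Lin k F) :
    (sw (δ x) fun a b => F (S a * b)) = ε x • F 1 :=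
  isAntipode_of.left_sw x hF

theorem antipode_right_sw (x : H) {F : H → Z} (hF : Lin k F) :
    (sw (δ x) fun a b => F (a * S b)) = ε x • F 1 :=
  isAntipode_of.right_sw x hF

theorem comul_mul_eq_sw (x y : H) : δ (x * y) = sw (δ x) fun x₁ x₂ => sw (δ y) fun y₁ y₂ =>
    (x₁ * y₁) ⊗ₜ[k] (x₂ * y₂) := isBialgebra_of.comul_mul_sw x y

theorem comul_antipode_eq_sw (x : H) : δ (S x) = sw (δ x) fun x₁ x₂ => S x₂ ⊗ₜ[k] S x₁ :=
  isAntipode_of.comul_antipode isBialgebra_of x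

theorem antipode_mul_rev (x y : H) : S (x * y) = S y * S x :=
  isAntipode_of.map_mul isBialgebra_of x y

theorem counit_antipode' (x : H) : ε (S x) = ε x :=
  isAntipode_of.counit_antipode isBialgebra_of x

theorem antipode_one' : S (1 : H) = 1 := isAntipode_of.map_one (isBialgebra_of (k := k))

theorem comul_one' : δ (1 : H) = 1 ⊗ₜ 1 := (isBialgebra_of (k := k) (H := H)).comul_one

/-- Equal tensors give equal Sweedler sums. -/
theorem sw_eq_of_mul {R T : H ⊗[k] H} {x : H ⊗[k] H} (h : R * T = x) {F : H → H → Z}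
    (h1 : ∀ y, Lin k (fun x => F x y)) (h2 : ∀ x, Lin k (fun y => F x y)) :
    (sw R fun a b => sw T fun c d => F (a * c) (b * d)) = sw x F := by
  rw [← h]
  conv_rhs => rw [← sw_eta R, ← sw_eta T]
  simp (disch := fun_prop) only [sw_mul_left, sw_mul_right, Algebra.TensorProduct.tmul_mul_tmul,
    sw_sw, sw_tmul]
  rw [sw_comm]

end MathlibHopf

/-! ### Quasitriangular structures, Yang–Baxter, and the Drinfeld element. -/

section Quasitriangular

variable {k H Z : Type*} [Field k] [Ring H] [HopfAlgebra k H] [AddCommGroup Z] [Module k Z]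
  {R T : H ⊗[k] H}

local notation "δ" => Coalgebra.comul (R := k)
local notation "ε" => Coalgebra.counit (R := k)
local notation "S" => HopfAlgebra.antipode k

theorem sqMul_of (s t : H ⊗[k] H) : (HopfData.of k H).sqMul tswap (s ⊗ₜ t) = s * t := by
  rw [BialgData.sqMul_tswap_eq_sw]
  simp only [of_mul]
  rw [sw_eq_of_mul rfl (F := fun a b => a ⊗ₜ[k] b) (by fun_prop) (by fun_prop), sw_eta]

/-- The axioms of a quasitriangular structure on a Hopf algebra, for Sweedler sums. -/
structure QTri (R T : H ⊗[k] H) : Prop where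
  mul_inv : R * T = 1
  inv_mul : T * R = 1
  comul_left : LinearMap.lTensor H tswap (TensorProduct.assoc k H H H (LinearMap.rTensor H δ R)) =
    sw R fun a b => sw R fun c d => a ⊗ₜ[k] ((b * d) ⊗ₜ[k] c)
  comul_right : LinearMap.lTensor H δ R = sw R fun a b => sw R fun c d =>
    (a * c) ⊗ₜ[k] (d ⊗ₜ[k] b)
  quasi : ∀ h, tswap (δ h) * R = R * δ h

theorem BialgData.IsQuasitriangular.qTri
    (h : (HopfData.of k H).IsQuasitriangular R T) : QTri R T where
  mul_inv := by rw [← sqMul_of]; exact h.mul_inv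
  inv_mul := by rw [← sqMul_of]; exact h.inv_mul
  comul_left := by
    rw [← of_comul, h.comul_left, BialgData.r13r23, interchange_eq_sw]
    simp only [sw_map, LinearMap.lTensor_tmul, of_mul, TensorProduct.assoc_tmul,
      LinearEquiv.coe_coe, TensorProduct.comm_tmul]
  comul_right := by
    rw [← of_comul, h.comul_right, BialgData.r13r12, interchange_eq_sw]
    simp only [sw_map, TensorProduct.map_tmul, of_mul, LinearEquiv.coe_coe,
      TensorProduct.comm_tmul]
  quasi x := by simpa only [sqMul_of, of_comul] using h.quasicocomm x

namespace QTri

theorem mul_inv_sw (h : QTri R T) {F : H → H → Z} (h1 : ∀ y, Lin k (fun x => F x y))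
    (h2 : ∀ x, Lin k (fun y => F x y)) :
    (sw R fun a b => sw T fun c d => F (a * c) (b * d)) = F 1 1 := by
  rw [sw_eq_of_mul h.mul_inv h1 h2, Algebra.TensorProduct.one_def, sw_tmul _ _ h1 h2]

theorem inv_mul_sw (h : QTri R T) {F : H → H → Z} (h1 : ∀ y, Lin k (fun x => F x y))
    (h2 : ∀ x, Lin k (fun y => F x y)) :
    (sw T fun a b => sw R fun c d => F (a * c) (b * d)) = F 1 1 := by
  rw [sw_eq_of_mul h.inv_mul h1 h2, Algebra.TensorProduct.one_def, sw_tmul _ _ h1 h2]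

theorem comul_left_sw (h : QTri R T) {F : H → H → H → Z}
    (h1 : ∀ y z, Lin k (fun x => F x y z)) (h2 : ∀ x z, Lin k (fun y => F x y z))
    (h3 : ∀ x y, Lin k (fun z => F x y z)) :
    (sw R fun a b => sw (δ a) fun p q => F p q b) = sw R fun a b => sw R fun c d =>
      F a c (b * d) := by
  have := sw₃_congr h.comul_left fun x y z => F x z y
  rw [assoc_rTensor_eq_sw] at this
  simpa (disch := fun_prop) only [sw_sw, sw_tmul, sw_map, LinearMap.lTensor_tmul,
    LinearEquiv.coe_coe, TensorProduct.comm_tmul] using this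

theorem comul_right_sw (h : QTri R T) {F : H → H → H → Z}
    (h1 : ∀ y z, Lin k (fun x => F x y z)) (h2 : ∀ x z, Lin k (fun y => F x y z))
    (h3 : ∀ x y, Lin k (fun z => F x y z)) :
    (sw R fun a b => sw (δ b) fun p q => F a p q) = sw R fun a b => sw R fun c d =>
      F (a * c) d b := by
  have := sw₃_congr h.comul_right F
  rw [lTensor_comul_eq_sw] at this
  simpa (disch := fun_prop) only [sw_sw, sw_tmul] using this

theorem quasi_sw (hR : QTri R T) (h : H) {F : H → H → Z}
    (h1 : ∀ y, Lin k (fun x => F x y)) (h2 : ∀ x, Lin k (fun y => F x y)) :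
    (sw (δ h) fun p q => sw R fun a b => F (q * a) (p * b)) =
      sw (δ h) fun p q => sw R fun a b => F (a * p) (b * q) := by
  rw [sw_comm (δ h) R (fun p q a b => F (a * p) (b * q)), sw_eq_of_mul (hR.quasi h).symm h1 h2,
    ← sw_eq_of_mul rfl h1 h2]
  simp (disch := fun_prop) only [sw_tswap]

theorem quasi_inv_sw (hR : QTri R T) (h : H) {F : H → H → Z}
    (h1 : ∀ y, Lin k (fun x => F x y)) (h2 : ∀ x, Lin k (fun y => F x y)) :
    (sw (δ h) fun p q => sw T fun a b => F (p * a) (q * b)) =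
      sw (δ h) fun p q => sw T fun a b => F (a * q) (b * p) := by
  have : δ h * T = T * tswap (δ h) := by
    have := hR.quasi h
    calc _ = (T * R) * δ h * T := by rw [hR.inv_mul, one_mul]
      _ = T * tswap (δ h) * (R * T) := by rw [mul_assoc T R, ← this]; simp only [mul_assoc]
      _ = _ := by rw [hR.mul_inv, mul_one]
  rw [sw_eq_of_mul this h1 h2, ← sw_eq_of_mul rfl h1 h2]
  simp (disch := fun_prop) only [sw_tswap]
  rw [sw_comm]

/-- Applying `ε` to the first leg of `(Δ ⊗ id)R = R₁₃R₂₃` gives `R = (1 ⊗ e)R` with `e = (ε ⊗ id)R`,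
and `R` is invertible. -/
theorem counit_left (h : QTri R T) : (sw R fun a b => ε a • b) = (1 : H) := by
  have h0 : R = sw R fun a b => sw R fun c d => ε a • c ⊗ₜ[k] (b * d) := by
    rw [← h.comul_left_sw (F := fun a c e => ε a • c ⊗ₜ[k] e) (by fun_prop) (by fun_prop)
      (by fun_prop)]
    simp (disch := fun_prop) only [counit_smul_sw, sw_eta]
  have h1 : (1 : H) ⊗ₜ[k] (sw R fun a b => ε a • b) * R = R := by
    conv_rhs => rw [h0]
    conv_lhs => enter [2]; rw [← sw_eta R]
    simp only [sw_tmul_right, sw_mul_left, sw_mul_right, Algebra.TensorProduct.tmul_mul_tmul,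
      one_mul, TensorProduct.tmul_smul, smul_mul_assoc]
    rw [sw_comm]
  have h2 : (1 : H) ⊗ₜ[k] (sw R fun a b => ε a • b) = 1 ⊗ₜ 1 := by
    have := congrArg (· * T) h1
    simpa only [mul_assoc, h.mul_inv, mul_one, ← Algebra.TensorProduct.one_def] using this
  have := congrArg (fun t => TensorProduct.lid k H (LinearMap.rTensor H ε t)) h2
  simpa using this

theorem counit_right (h : QTri R T) : (sw R fun a b => ε b • a) = (1 : H) := by
  have h0 : R = sw R fun a b => sw R fun c d => ε b • (a * c) ⊗ₜ[k] d := by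
    rw [← h.comul_right_sw (F := fun a c e => ε e • a ⊗ₜ[k] c) (by fun_prop) (by fun_prop)
      (by fun_prop)]
    simp (disch := fun_prop) only [smul_counit_sw, sw_eta]
  have h1 : (sw R fun a b => ε b • a) ⊗ₜ[k] (1 : H) * R = R := by
    conv_rhs => rw [h0]
    conv_lhs => enter [2]; rw [← sw_eta R]
    simp only [sw_tmul_left, sw_mul_left, sw_mul_right, Algebra.TensorProduct.tmul_mul_tmul,
      one_mul, ← TensorProduct.smul_tmul', smul_mul_assoc]
    rw [sw_comm]
  have h2 : (sw R fun a b => ε b • a) ⊗ₜ[k] (1 : H) = 1 ⊗ₜ 1 := by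
    have := congrArg (· * T) h1
    simpa only [mul_assoc, h.mul_inv, mul_one, ← Algebra.TensorProduct.one_def] using this
  have := congrArg (fun t => TensorProduct.rid k H (LinearMap.lTensor H ε t)) h2
  simpa using this

theorem counit_left_sw (h : QTri R T) {F : H → Z} (hF : Lin k F) :
    (sw R fun a b => ε a • F b) = F 1 := by
  have : F = (IsLinearMap.mk' F ⟨hF.add, hF.smul⟩ : H →ₗ[k] Z) := rfl
  rw [← h.counit_left, this]
  simp only [sw_map, map_smul]

theorem counit_right_sw (h : QTri R T) {F : H → Z} (hF : Lin k F) :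
    (sw R fun a b => ε b • F a) = F 1 := by
  have : F = (IsLinearMap.mk' F ⟨hF.add, hF.smul⟩ : H →ₗ[k] Z) := rfl
  rw [← h.counit_right, this]
  simp only [sw_map, map_smul]

/-- `(S ⊗ id)R` is a left inverse of `R`, since their product is a contraction of `(Δ ⊗ id)R`. -/
theorem antipode_left (h : QTri R T) : (sw R fun a b => S a ⊗ₜ[k] b) = T := by
  refine left_inv_eq_right_inv (a := R) ?_ h.mul_inv
  conv_lhs => enter [2]; rw [← sw_eta R]
  simp only [sw_mul_left, sw_mul_right, Algebra.TensorProduct.tmul_mul_tmul]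
  rw [sw_comm, ← h.comul_left_sw (F := fun a c e => (S a * c) ⊗ₜ[k] e) (by fun_prop) (by fun_prop)
      (by fun_prop)]
  have : ∀ a b : H, (sw (δ a) fun p q => (S p * q) ⊗ₜ[k] b) = ε a • (1 : H) ⊗ₜ b := fun a b =>
    antipode_left_sw a (F := fun z => z ⊗ₜ[k] b) (by fun_prop)
  simp (disch := fun_prop) only [this, h.counit_left_sw]
  rfl

theorem antipode_left_eq_sw (h : QTri R T) {F : H → H → Z} (h1 : ∀ y, Lin k (fun x => F x y))
    (h2 : ∀ x, Lin k (fun y => F x y)) : (sw R fun a b => F (S a) b) = sw T F := by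
  rw [← h.antipode_left]
  simp (disch := fun_prop) only [sw_sw, sw_tmul]

theorem comul_left_inv_sw (h : QTri R T) {F : H → H → H → Z}
    (h1 : ∀ y z, Lin k (fun x => F x y z)) (h2 : ∀ x z, Lin k (fun y => F x y z))
    (h3 : ∀ x y, Lin k (fun z => F x y z)) :
    (sw T fun a b => sw (δ a) fun p q => F p q b) = sw T fun a b => sw T fun c d =>
      F a c (d * b) := by
  simp (disch := fun_prop) only [← h.antipode_left_eq_sw, comul_antipode_eq_sw, sw_sw, sw_tmul]
  rw [h.comul_left_sw (F := fun p q b => F (S q) (S p) b) (by fun_prop) (by fun_prop)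
      (by fun_prop), sw_comm]

theorem comul_right_inv_sw (h : QTri R T) {F : H → H → H → Z}
    (h1 : ∀ y z, Lin k (fun x => F x y z)) (h2 : ∀ x z, Lin k (fun y => F x y z))
    (h3 : ∀ x y, Lin k (fun z => F x y z)) :
    (sw T fun a b => sw (δ b) fun p q => F a p q) = sw T fun a b => sw T fun c d =>
      F (a * c) b d := by
  simp (disch := fun_prop) only [← h.antipode_left_eq_sw]
  rw [h.comul_right_sw (F := fun p q b => F (S p) q b) (by fun_prop) (by fun_prop)
      (by fun_prop), sw_comm]
  simp only [antipode_mul_rev]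

theorem counit_left_inv_sw (h : QTri R T) {F : H → Z} (hF : Lin k F) :
    (sw T fun a b => ε a • F b) = F 1 := by
  simp (disch := fun_prop) only [← h.antipode_left_eq_sw, counit_antipode', h.counit_left_sw]

theorem counit_right_inv_sw (h : QTri R T) {F : H → Z} (hF : Lin k F) :
    (sw T fun a b => ε b • F a) = F 1 := by
  simp (disch := fun_prop) only [← h.antipode_left_eq_sw]
  rw [h.counit_right_sw (F := fun x => F (S x)) (by fun_prop), antipode_one']

/-- `(id ⊗ S)R⁻¹` is a right inverse of `R⁻¹`, by contraction of `(id ⊗ Δ)R⁻¹`. -/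
theorem antipode_right (h : QTri R T) : (sw T fun a b => a ⊗ₜ[k] S b) = R := by
  refine (left_inv_eq_right_inv h.mul_inv ?_).symm
  conv_lhs => enter [1]; rw [← sw_eta T]
  simp only [sw_mul_left, sw_mul_right, Algebra.TensorProduct.tmul_mul_tmul]
  rw [sw_comm, ← h.comul_right_inv_sw (F := fun a c e => a ⊗ₜ[k] (c * S e)) (by fun_prop)
    (by fun_prop) (by fun_prop)]
  have : ∀ a b : H, (sw (δ a) fun p q => b ⊗ₜ[k] (p * S q)) = ε a • b ⊗ₜ (1 : H) := fun a b =>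
    antipode_right_sw a (F := fun z => b ⊗ₜ[k] z) (by fun_prop)
  simp (disch := fun_prop) only [this]
  exact h.counit_right_inv_sw (F := fun x => x ⊗ₜ[k] (1 : H)) (by fun_prop)

theorem antipode_right_eq_sw (h : QTri R T) {F : H → H → Z} (h1 : ∀ y, Lin k (fun x => F x y))
    (h2 : ∀ x, Lin k (fun y => F x y)) : (sw T fun a b => F a (S b)) = sw R F := by
  rw [← h.antipode_right]
  simp (disch := fun_prop) only [sw_sw, sw_tmul]

theorem antipode_antipode_eq_sw (h : QTri R T) {F : H → H → Z} (h1 : ∀ y, Lin k (fun x => F x y))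
    (h2 : ∀ x, Lin k (fun y => F x y)) : (sw R fun a b => F (S a) (S b)) = sw R F := by
  rw [h.antipode_left_eq_sw (F := fun a b => F a (S b)) (by fun_prop) (by fun_prop),
    h.antipode_right_eq_sw h1 h2]


/-- Two of the three copies of `R⁻¹` form `(Δ ⊗ id)R⁻¹`, and the third exchanges `Δ` with the
opposite coproduct. -/
theorem yangBaxter_inv_sw (h : QTri R T) {F : H → H → H → Z}
    (h1 : ∀ y z, Lin k (fun x => F x y z)) (h2 : ∀ x z, Lin k (fun y => F x y z))
    (h3 : ∀ x y, Lin k (fun z => F x y z)) :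
    (sw T fun a b => sw T fun c d => sw T fun e f => F (a * c) (b * e) (d * f)) =
      sw T fun a b => sw T fun c d => sw T fun e f => F (c * a) (e * b) (f * d) := by
  trans sw T fun a b => sw T fun c d => sw (δ c) fun p q => F (a * q) (b * p) d
  · refine sw_congr fun a b => ?_
    rw [h.comul_left_inv_sw (F := fun p q d => F (a * q) (b * p) d) (by fun_prop) (by fun_prop)
      (by fun_prop), sw_comm]
  · rw [sw_comm T T]
    simp only [sw_comm T (δ _)]
    have := fun c d => (h.quasi_inv_sw c (F := fun x y => F x y d) (by fun_prop)
      (by fun_prop)).symm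
    simp only [this]
    rw [h.comul_left_inv_sw (F := fun p q d => sw T fun a b => F (p * a) (q * b) d) (by fun_prop)
      (by fun_prop) (by fun_prop)]
    conv_rhs => rw [sw_comm T T, sw_congr fun _ _ => sw_comm T T _]

variable (k) in
/-- The Drinfeld element `S(R⁽²⁾)R⁽¹⁾`. -/
def drinfeld (R : H ⊗[k] H) : H :=
  sw R fun a b => S b * a

variable (k) in
/-- The inverse `R⁽²⁾S²(R⁽¹⁾)` of the Drinfeld element. -/
def drinfeldInv (R : H ⊗[k] H) : H :=
  sw R fun a b => b * S (S a)

/-- Quasi-cocommutativity for `h₍₁₎` is contracted by `x ⊗ y ↦ S(y)x` and multiplied by `S²(h₍₂₎)`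
on the left. One side collapses to `S²(h)u` and the other to `uh`, where `u` is the Drinfeld
element. -/
theorem drinfeld_mul (hR : QTri R T) (h : H) : drinfeld k R * h = S (S h) * drinfeld k R := by
  have h0 : (sw (δ h) fun x y => sw (δ x) fun p q => sw R fun a b =>
      S (S y) * (S (p * b) * (q * a))) = sw (δ h) fun x y => sw (δ x) fun p q => sw R fun a b =>
      S (S y) * (S (b * q) * (a * p)) := sw_congr fun x y =>
    hR.quasi_sw x (F := fun u v => S (S y) * (S v * u)) (by fun_prop) (by fun_prop)
  have h1 : ∀ x y, (sw (δ x) fun p q => sw R fun a b => S (S y) * (S (p * b) * (q * a))) =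
      ε x • (S (S y) * drinfeld k R) := by
    intro x y
    rw [sw_comm]
    simp only [drinfeld, antipode_mul_rev, sw_mul_right, sw_smul_right]
    refine sw_congr fun a b => ?_
    have := antipode_left_sw (k := k) x (F := fun z => S (S y) * (S b * (z * a))) (by fun_prop)
    simpa only [mul_assoc, one_mul] using this
  simp (disch := fun_prop) only [h1, counit_smul_sw] at h0
  rw [h0]
  simp (disch := fun_prop) only [comul_coassoc_sw]
  have h2 : ∀ p : H, ∀ c, (sw (δ c) fun q r => sw R fun a b => S (S r) * (S (b * q) * (a * p))) =
      ε c • (drinfeld k R * p) := by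
    intro p c
    rw [sw_comm]
    simp only [drinfeld, antipode_mul_rev, sw_mul_left, sw_smul_right]
    refine sw_congr fun a b => ?_
    have := antipode_right_sw (k := k) c (F := fun z => S z * (S b * (a * p))) (by fun_prop)
    simpa only [mul_assoc, one_mul, antipode_mul_rev, antipode_one'] using this
  simp (disch := fun_prop) only [h2, smul_counit_sw]

/-- This one value yields both inverse laws, because the Drinfeld element moves past `R⁽¹⁾` at the
cost of `S²`. -/
theorem drinfeld_aux (hR : QTri R T) : (sw R fun a b => b * (drinfeld k R * a)) = 1 := by
  simp only [drinfeld, sw_mul_left, sw_mul_right]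
  have : ∀ c d : H, (sw R fun a b => c * (S b * a * d)) = sw R fun a b => c * S b * (a * d) := by
    intro c d; simp only [mul_assoc]
  simp only [this]
  rw [← hR.antipode_right_eq_sw (F := fun d c => sw R fun a b => c * S b * (a * d)) (by fun_prop)
    (by fun_prop), sw_comm]
  simp only [← antipode_mul_rev]
  rw [hR.mul_inv_sw (F := fun x y => S y * x) (by fun_prop) (by fun_prop), antipode_one', mul_one]

theorem drinfeldInv_mul (hR : QTri R T) : drinfeldInv k R * drinfeld k R = 1 := by
  rw [← hR.drinfeld_aux, drinfeldInv, sw_mul_left]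
  simp only [mul_assoc, ← hR.drinfeld_mul]

theorem drinfeld_mul_inv (hR : QTri R T) : drinfeld k R * drinfeldInv k R = 1 := by
  rw [← hR.drinfeld_aux, ← hR.antipode_antipode_eq_sw (F := fun a b => b * (drinfeld k R * a))
    (by fun_prop) (by fun_prop), ← hR.antipode_antipode_eq_sw
    (F := fun a b => S b * (drinfeld k R * S a)) (by fun_prop) (by fun_prop), drinfeldInv,
    sw_mul_right]
  refine sw_congr fun a b => ?_
  rw [← mul_assoc, hR.drinfeld_mul, mul_assoc]

/-- `S²` is conjugation by the invertible Drinfeld element, so `S` is injective and surjective. -/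
theorem bijective_antipode (hR : QTri R T) : Function.Bijective (S : H →ₗ[k] H) := by
  have h1 : ∀ h : H, S (S h) = drinfeld k R * h * drinfeldInv k R := fun h => by
    rw [hR.drinfeld_mul, mul_assoc, hR.drinfeld_mul_inv, mul_one]
  refine ⟨fun x y hxy => ?_, fun y => ⟨S (drinfeldInv k R * y * drinfeld k R), ?_⟩⟩
  · have h2 : ∀ h : H, drinfeldInv k R * S (S h) * drinfeld k R = h := fun h => by
      rw [mul_assoc, ← hR.drinfeld_mul, ← mul_assoc, hR.drinfeldInv_mul, one_mul]
    rw [← h2 x, ← h2 y]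
    congr 3
  · rw [h1]
    simp only [← mul_assoc, hR.drinfeld_mul_inv, one_mul]
    rw [mul_assoc, hR.drinfeld_mul_inv, mul_one]

end QTri

end Quasitriangular

/-! ### Inverses of bijective linear maps. -/

section LinInv

variable {k X : Type*} [Field k] [AddCommGroup X] [Module k X] {f : X →ₗ[k] X}

theorem linInv_apply_self (h : Function.Bijective f) (x : X) : linInv f (f x) = x := by
  rw [linInv, dif_pos h]
  exact (LinearEquiv.ofBijective f h).symm_apply_apply x

theorem self_linInv_apply (h : Function.Bijective f) (x : X) : f (linInv f x) = x := by
  rw [linInv, dif_pos h]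
  exact (LinearEquiv.ofBijective f h).apply_symm_apply x

end LinInv

/-! ### The map from `A` to `H` defined by `R`, and the antipode of `A`. -/

section Dual

variable {k H A Z : Type*} [Field k] [Ring H] [HopfAlgebra k H] [Ring A] [HopfAlgebra k A]
  [AddCommGroup Z] [Module k Z] {R T : H ⊗[k] H} {pair : H ⊗[k] A →ₗ[k] k}

local notation "δ" => Coalgebra.comul (R := k)
local notation "ε" => Coalgebra.counit (R := k)
local notation "S" => HopfAlgebra.antipode k

/-- A duality pairing of Hopf algebras, for Sweedler sums. -/
structure DualPair (pair : H ⊗[k] A →ₗ[k] k) : Prop where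
  mul_left : ∀ (h h' : H) (a : A), pair ((h * h') ⊗ₜ a) =
    sw (δ a) fun a₁ a₂ => pair (h ⊗ₜ a₁) * pair (h' ⊗ₜ a₂)
  mul_right : ∀ (h : H) (a a' : A), pair (h ⊗ₜ (a * a')) =
    sw (δ h) fun h₁ h₂ => pair (h₁ ⊗ₜ a) * pair (h₂ ⊗ₜ a')
  one_left : ∀ a : A, pair (1 ⊗ₜ a) = ε a
  one_right : ∀ h : H, pair (h ⊗ₜ 1) = ε h
  antipode : ∀ (h : H) (a : A), pair (S h ⊗ₜ a) = pair (h ⊗ₜ S a)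

theorem IsHopfPairing.dualPair
    (h : IsHopfPairing (HopfData.of k H).toBialgData (HopfData.of k A).toBialgData pair) :
    DualPair pair where
  mul_left := h.mul_left_sw
  mul_right := h.mul_right_sw
  one_left := h.one_left
  one_right := h.one_right
  antipode := h.antipode_adjoint isBialgebra_of.isCoalg isBialgebra_of.isCoalg isAntipode_of
    isAntipode_of

/-- This is the formula `(Δ ⊗ id)R = R₁₃R₂₃`, evaluated in the first two legs. -/
theorem slice_mul (hR : QTri R T) (hp : DualPair pair) (a b : A) :
    slice pair R (a * b) = slice pair R a * slice pair R b := by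
  simp only [slice_apply, hp.mul_right, sw_smul_left]
  rw [hR.comul_left_sw (F := fun p q y => (pair (p ⊗ₜ a) * pair (q ⊗ₜ b)) • y) (by fun_prop)
    (by fun_prop) (by fun_prop)]
  simp only [sw_mul_left, sw_mul_right, smul_mul_assoc, mul_smul_comm, sw_smul_right]
  rw [sw_comm]
  refine sw_congr fun _ _ => sw_congr fun _ _ => ?_
  module

theorem slice_one (hR : QTri R T) (hp : DualPair pair) : slice pair R 1 = 1 := by
  simp only [slice_apply, hp.one_right]
  exact hR.counit_left_sw (F := fun x => x) (by fun_prop)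

/-- The formula `(id ⊗ Δ)R = R₁₃R₁₂` reverses the legs, so evaluation is a coalgebra map from
`A^cop`. -/
theorem slice_comul (hR : QTri R T) (hp : DualPair pair) (a : A) :
    δ (slice pair R a) = sw (δ a) fun a₁ a₂ => slice pair R a₂ ⊗ₜ slice pair R a₁ := by
  simp only [slice_apply, sw_map, map_smul]
  have h0 : ∀ x y : H, pair (x ⊗ₜ a) • δ y = sw (δ y) fun p q => pair (x ⊗ₜ a) • p ⊗ₜ[k] q := by
    intro x y
    rw [← sw_smul_right, sw_eta]
  simp only [h0]
  rw [hR.comul_right_sw (F := fun x p q => pair (x ⊗ₜ a) • p ⊗ₜ[k] q) (by fun_prop) (by fun_prop)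
    (by fun_prop)]
  simp only [hp.mul_left, sw_smul_left, sw_tmul_left, sw_tmul_right, sw_comm R (δ a),
    ← TensorProduct.smul_tmul', TensorProduct.tmul_smul, sw_smul_right]
  refine sw_congr fun _ _ => sw_congr fun _ _ => sw_congr fun _ _ => ?_
  module

theorem slice_counit (hR : QTri R T) (hp : DualPair pair) (a : A) :
    ε (slice pair R a) = ε a := by
  simp only [slice_apply, sw_map, map_smul]
  have : ∀ x y : H, pair (x ⊗ₜ a) • ε y = ε y • pair (x ⊗ₜ a) := fun x y => by
    rw [smul_eq_mul, smul_eq_mul, mul_comm]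
  simp (disch := fun_prop) only [this, hR.counit_right_sw, hp.one_left]

theorem slice_antipode (hR : QTri R T) (hp : DualPair pair) (a : A) :
    S (slice pair R (S a)) = slice pair R a := by
  simp only [slice_apply, sw_map, map_smul, ← hp.antipode]
  rw [hR.antipode_antipode_eq_sw (F := fun x y => pair (x ⊗ₜ a) • y) (by fun_prop) (by fun_prop)]

/-- `a` and `b` quasicommute up to the form `⟨R⁽¹⁾, a⟩⟨R⁽²⁾, b⟩`. -/
def QComm (pair : H ⊗[k] A →ₗ[k] k) (R : H ⊗[k] H) : Prop := ∀ a b : A,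
  (sw (δ a) fun a₁ a₂ => sw (δ b) fun b₁ b₂ => pair (slice pair R a₂ ⊗ₜ b₂) • (b₁ * a₁)) =
    sw (δ a) fun a₁ a₂ => sw (δ b) fun b₁ b₂ => pair (slice pair R a₁ ⊗ₜ b₁) • (a₂ * b₂)

theorem evalForm_apply (a b : A) :
    evalForm pair R (a ⊗ₜ b) = pair (slice pair R a ⊗ₜ b) := by
  simp only [evalForm, LinearMap.comp_apply, TensorProduct.mk_apply, slice_apply,
    interchange_eq_sw]
  simp (disch := fun_prop) only [sw_tmul, sw_map, sw_tmul_left, TensorProduct.map_tmul,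
    LinearMap.mul'_apply, map_smul, smul_eq_mul, ← TensorProduct.smul_tmul']

theorem BialgData.IsQuasicommutative.qComm
    (h : (HopfData.of k A).IsQuasicommutative (evalForm pair R)) : QComm pair R := by
  intro a b
  simpa only [interchange_eq_sw, of_comul, sw_map, TensorProduct.map_tmul, TensorProduct.lid_tmul,
    TensorProduct.rid_tmul, LinearMap.comp_apply, LinearEquiv.coe_coe, TensorProduct.comm_tmul,
    of_mul, evalForm_apply] using h a b

theorem QComm.sw_eq (h : QComm pair R) (a b : A) {F : A → Z} (hF : Lin k F) :
    (sw (δ a) fun a₁ a₂ => sw (δ b) fun b₁ b₂ => pair (slice pair R a₂ ⊗ₜ b₂) • F (b₁ * a₁)) =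
    sw (δ a) fun a₁ a₂ => sw (δ b) fun b₁ b₂ => pair (slice pair R a₁ ⊗ₜ b₁) • F (a₂ * b₂) := by
  have : F = (IsLinearMap.mk' F ⟨hF.add, hF.smul⟩ : A →ₗ[k] Z) := rfl
  rw [this]
  simpa only [sw_map, map_smul] using
    congrArg (IsLinearMap.mk' F ⟨hF.add, hF.smul⟩ : A →ₗ[k] Z) (h a b)

/-- The square of the antipode of `A` is implemented by the Drinfeld element. -/
theorem QComm.drinfeld_pair (h : QComm pair R) (hp : DualPair pair) (a : A) :
    pair (QTri.drinfeld k R ⊗ₜ a) • (1 : A) =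
      sw (δ a) fun p q => sw (δ q) fun u v => pair (QTri.drinfeld k R ⊗ₜ u) • (v * S p) := by
  have h0 : ∀ a, pair (QTri.drinfeld k R ⊗ₜ a) =
      sw (δ a) fun p q => pair (slice pair R q ⊗ₜ S p) := by
    intro a
    simp only [QTri.drinfeld, slice_apply, sw_tmul_left, sw_map, hp.mul_left, hp.antipode,
      ← TensorProduct.smul_tmul', map_smul]
    rw [sw_comm]
    refine sw_congr fun _ _ => sw_congr fun _ _ => ?_
    rw [smul_eq_mul, mul_comm]
  -- Quasicommutativity is applied to `a₍₂₎` and `S a₍₁₎`. One side collapses by the antipode axiom,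
  -- the other assembles values of the Drinfeld element.
  have h1 : (sw (δ a) fun x y => sw (δ y) fun a₁ a₂ => sw (δ (S x)) fun b₁ b₂ =>
      pair (slice pair R a₂ ⊗ₜ b₂) • (b₁ * a₁)) = sw (δ a) fun x y => sw (δ y) fun a₁ a₂ =>
      sw (δ (S x)) fun b₁ b₂ => pair (slice pair R a₁ ⊗ₜ b₁) • (a₂ * b₂) :=
    sw_congr fun x y => h y (S x)
  simp (disch := fun_prop) only [comul_antipode_eq_sw, sw_sw, sw_tmul] at h1
  have h2 : (sw (δ a) fun x y => sw (δ y) fun a₁ a₂ => sw (δ x) fun p q =>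
      pair (slice pair R a₂ ⊗ₜ S p) • (S q * a₁)) = pair (QTri.drinfeld k R ⊗ₜ a) • 1 := by
    rw [sw_congr fun x y => sw_comm (δ y) (δ x) _]
    simp (disch := fun_prop) only [comul_coassoc_sw]
    have h3 : ∀ m p a₂ : A, (sw (δ m) fun q a₁ => pair (slice pair R a₂ ⊗ₜ S p) • (S q * a₁)) =
        ε m • pair (slice pair R a₂ ⊗ₜ S p) • (1 : A) := fun m p a₂ =>
      antipode_left_sw m (F := fun z => pair (slice pair R a₂ ⊗ₜ S p) • z) (by fun_prop)
    have h4 : ∀ p c : A, (sw (δ c) fun q y => sw (δ y) fun a₁ a₂ =>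
        pair (slice pair R a₂ ⊗ₜ S p) • (S q * a₁)) = pair (slice pair R c ⊗ₜ S p) • (1 : A) := by
      intro p c
      rw [← comul_coassoc_sw c (F := fun q a₁ a₂ => pair (slice pair R a₂ ⊗ₜ S p) • (S q * a₁))
        (by fun_prop) (by fun_prop) (by fun_prop)]
      simp (disch := fun_prop) only [h3, counit_smul_sw]
    simp only [h4, ← sw_smul_left, ← h0]
  rw [← h2, h1]
  rw [sw_congr fun x y => sw_comm (δ y) (δ x) _]
  simp (disch := fun_prop) only [comul_coassoc_sw, h0, sw_smul_left]

/-- The factor `S p` in `drinfeld_pair` cancels against `S²` of the leg before it, which leaves the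
Drinfeld element evaluated on the other side. -/
theorem QComm.drinfeld_mul (h : QComm pair R) (hp : DualPair pair) (a : A) :
    (sw (δ a) fun p q => pair (QTri.drinfeld k R ⊗ₜ p) • q) =
      sw (δ a) fun p q => pair (QTri.drinfeld k R ⊗ₜ q) • S (S p) := by
  have h0 : ∀ p q : A, pair (QTri.drinfeld k R ⊗ₜ q) • S (S p) =
      pair (QTri.drinfeld k R ⊗ₜ q) • (1 : A) * S (S p) := fun p q => by
    rw [smul_mul_assoc, one_mul]
  simp only [h0, h.drinfeld_pair hp, sw_mul_left, smul_mul_assoc, mul_assoc, ← antipode_mul_rev]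
  have h3 : ∀ m u v : A, (sw (δ m) fun p q => pair (QTri.drinfeld k R ⊗ₜ u) • (v * S (S p * q))) =
        ε m • pair (QTri.drinfeld k R ⊗ₜ u) • v := fun m u v => by
    rw [antipode_left_sw m (F := fun z => pair (QTri.drinfeld k R ⊗ₜ u) • (v * S z)) (by fun_prop),
      antipode_one', mul_one]
  rw [← comul_coassoc_sw a (F := fun p q r => sw (δ r) fun u v =>
      pair (QTri.drinfeld k R ⊗ₜ u) • (v * S (S p * q))) (by fun_prop) (by fun_prop) (by fun_prop),
    sw_congr fun x y => sw_comm (δ x) (δ y) _]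
  simp (disch := fun_prop) only [h3, ← sw_smul_right, counit_smul_sw]

/-- Contracting the Drinfeld element with the right or left leg of the coproduct gives bijections
`f'` and `g'` of `A`, with inverses `f` and `g` from the inverse element. Since `g' = S² ∘ f'`, the
map `S²` is bijective. This supplies the antipode of `A^cop` without any separability of the
pairing. -/
theorem QComm.bijective_antipode (h : QComm pair R) (hR : QTri R T) (hp : DualPair pair) :
    Function.Bijective (S : A →ₗ[k] A) := by
  let f : A → A := fun a => sw (δ a) fun p q => pair (QTri.drinfeldInv k R ⊗ₜ q) • p
  let g : A → A := fun a => sw (δ a) fun p q => pair (QTri.drinfeldInv k R ⊗ₜ p) • q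
  let f' : A → A := fun a => sw (δ a) fun p q => pair (QTri.drinfeld k R ⊗ₜ q) • p
  let g' : A → A := fun a => sw (δ a) fun p q => pair (QTri.drinfeld k R ⊗ₜ p) • q
  have h1 : ∀ a, f (f' a) = a := fun a => by
    simp (disch := fun_prop) only [f, f', sw_map, map_smul, sw_sw, sw_smul_arg, sw_smul_right,
      comul_coassoc_sw, smul_smul]
    simp (disch := fun_prop) only [mul_comm (pair (QTri.drinfeld k R ⊗ₜ _)), ← sw_smul_left, ← hp.mul_left,
      hR.drinfeldInv_mul,
      hp.one_left, smul_counit_sw]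
  have h2 : ∀ a, f' (f a) = a := fun a => by
    simp (disch := fun_prop) only [f, f', sw_map, map_smul, sw_sw, sw_smul_arg, sw_smul_right,
      comul_coassoc_sw, smul_smul]
    simp (disch := fun_prop) only [mul_comm, ← sw_smul_left, ← hp.mul_left, hR.drinfeld_mul_inv,
      hp.one_left, smul_counit_sw]
  have h3 : ∀ a, g (g' a) = a := fun a => by
    simp (disch := fun_prop) only [g, g', sw_map, map_smul, sw_sw, sw_smul_arg, sw_smul_right,
      ← comul_coassoc_sw, smul_smul]
    simp (disch := fun_prop) only [mul_comm, ← sw_smul_left, ← hp.mul_left, hR.drinfeld_mul_inv,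
      hp.one_left, counit_smul_sw]
  have h4 : ∀ a, g' a = S (S (f' a)) := fun a => by
    simp only [f', g', sw_map, map_smul, h.drinfeld_mul hp]
  have h5 : ∀ a, g' (g a) = a := fun a => by
    simp (disch := fun_prop) only [g, g', sw_map, map_smul, sw_sw, sw_smul_arg, sw_smul_right,
      ← comul_coassoc_sw, smul_smul]
    simp (disch := fun_prop) only [mul_comm (pair (QTri.drinfeld k R ⊗ₜ _)), ← sw_smul_left, ← hp.mul_left,
      hR.drinfeldInv_mul,
      hp.one_left, counit_smul_sw]
  have h6 : ∀ a, S (S a) = g' (f a) := fun a => by rw [h4, h2]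
  refine ⟨fun x y hxy => ?_, fun y => ⟨S (f' (g y)), by rw [← h4, h5]⟩⟩
  have h7 : ∀ a, f' (g (S (S a))) = a := fun a => by rw [h6, h3, h2]
  rw [← h7 x, ← h7 y, hxy]

end Dual

/-! ### Braided groups of right modules. -/

section Module

variable {k H C B Z : Type*} [Field k] [Ring H] [HopfAlgebra k H] [AddCommGroup C] [Module k C]
  [AddCommGroup B] [Module k B] [AddCommGroup Z] [Module k Z] {R T : H ⊗[k] H}
  {act : C ⊗[k] H →ₗ[k] C} {𝓒 : HopfData k C}

local notation "δ" => Coalgebra.comul (R := k)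
local notation "ε" => Coalgebra.counit (R := k)
local notation "S" => HopfAlgebra.antipode k

theorem tensorAct_eq_sw (actC : C ⊗[k] H →ₗ[k] C) (actB : B ⊗[k] H →ₗ[k] B) (t : C ⊗[k] B)
    (h : H) : tensorAct (HopfData.of k H).toBialgData actC actB (t ⊗ₜ h) = sw t fun c b =>
      sw (δ h) fun p q => actC (c ⊗ₜ p) ⊗ₜ actB (b ⊗ₜ q) := by
  simp only [tensorAct, LinearMap.comp_apply, LinearMap.lTensor_tmul, interchange_eq_sw, of_comul,
    sw_map, TensorProduct.map_tmul]

theorem braiding_tmul (act : C ⊗[k] H →ₗ[k] C) (R : H ⊗[k] H) (v w : C) :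
    braiding act R (v ⊗ₜ w) = sw R fun x y => act (w ⊗ₜ x) ⊗ₜ act (v ⊗ₜ y) := by
  simp (disch := fun_prop) only [braiding, LinearMap.comp_apply, LinearEquiv.coe_coe,
    TensorProduct.comm_tmul, LinearMap.flip_apply, TensorProduct.mk_apply, interchange_eq_sw,
    sw_tmul, sw_map, TensorProduct.map_tmul]

namespace IsModuleBraidedGroup

variable (hC : IsModuleBraidedGroup (HopfData.of k H).toBialgData R act 𝓒)
include hC

theorem act_one' (c : C) : act (c ⊗ₜ 1) = c := hC.isRightModule.act_one c

theorem act_act (c : C) (h g : H) : act (act (c ⊗ₜ h) ⊗ₜ g) = act (c ⊗ₜ (h * g)) :=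
  (hC.isRightModule.act_mul c h g).symm

theorem mul_act_sw (c d : C) (h : H) : act (𝓒.mul (c ⊗ₜ d) ⊗ₜ h) =
    sw (δ h) fun p q => 𝓒.mul (act (c ⊗ₜ p) ⊗ₜ act (d ⊗ₜ q)) := by
  have := LinearMap.congr_fun hC.mul_act ((c ⊗ₜ d) ⊗ₜ h)
  simp only [LinearMap.comp_apply, LinearMap.rTensor_tmul] at this
  rw [← this, tensorAct_eq_sw]
  simp (disch := fun_prop) only [sw_tmul, sw_map]

theorem one_act' (h : H) : act (𝓒.one ⊗ₜ h) = ε h • 𝓒.one := hC.one_act h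

theorem comul_act_sw (c : C) (h : H) : 𝓒.comul (act (c ⊗ₜ h)) = sw (𝓒.comul c) fun c₁ c₂ =>
    sw (δ h) fun p q => act (c₁ ⊗ₜ p) ⊗ₜ act (c₂ ⊗ₜ q) := by
  have := LinearMap.congr_fun hC.comul_act (c ⊗ₜ h)
  simp only [LinearMap.comp_apply, LinearMap.rTensor_tmul, tensorAct_eq_sw] at this
  exact this

theorem counit_act' (c : C) (h : H) : 𝓒.counit (act (c ⊗ₜ h)) = 𝓒.counit c * ε h :=
  hC.counit_act c h

theorem antipode_act' (c : C) (h : H) : 𝓒.antipode (act (c ⊗ₜ h)) = act (𝓒.antipode c ⊗ₜ h) :=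
  LinearMap.congr_fun hC.antipode_act (c ⊗ₜ h)

theorem comul_mul_sw (c d : C) : 𝓒.comul (𝓒.mul (c ⊗ₜ d)) = sw (𝓒.comul c) fun c₁ c₂ =>
    sw (𝓒.comul d) fun d₁ d₂ => sw R fun x y =>
      𝓒.mul (c₁ ⊗ₜ act (d₁ ⊗ₜ x)) ⊗ₜ 𝓒.mul (act (c₂ ⊗ₜ y) ⊗ₜ d₂) := by
  rw [hC.isBraidedBialgebra.comul_mul, BialgData.sqMul_eq_sw]
  simp (disch := fun_prop) only [braiding_tmul, sw_sw, sw_tmul]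

theorem isAlg : 𝓒.IsAlg := hC.isBraidedBialgebra.isAlg

theorem isCoalg : 𝓒.IsCoalg := hC.isBraidedBialgebra.isCoalg

theorem linInv_antipode_act (hS : Function.Bijective 𝓒.antipode) (c : C) (h : H) :
    linInv 𝓒.antipode (act (c ⊗ₜ h)) = act (linInv 𝓒.antipode c ⊗ₜ h) := by
  rw [← self_linInv_apply hS c, ← hC.antipode_act', linInv_apply_self hS, self_linInv_apply hS]

end IsModuleBraidedGroup

end Module

/-! ### Braided groups of left comodules. -/

section Comodule

variable {k H A B Z : Type*} [Field k] [Ring H] [HopfAlgebra k H] [Ring A] [HopfAlgebra k A]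
  [AddCommGroup B] [Module k B] [AddCommGroup Z] [Module k Z] {R T : H ⊗[k] H}
  {pair : H ⊗[k] A →ₗ[k] k} {β : B →ₗ[k] A ⊗[k] B} {𝓑 : HopfData k B}

local notation "δ" => Coalgebra.comul (R := k)
local notation "ε" => Coalgebra.counit (R := k)
local notation "S" => HopfAlgebra.antipode k

theorem evalAct_tmul (pair : H ⊗[k] A →ₗ[k] k) (β : B →ₗ[k] A ⊗[k] B) (b : B) (h : H) :
    evalAct pair β (b ⊗ₜ h) = sw (β b) fun a b' => pair (h ⊗ₜ a) • b' := by
  simp only [evalAct, LinearMap.comp_apply, LinearEquiv.coe_coe, TensorProduct.comm_tmul,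
    LinearMap.lTensor_tmul]
  conv_lhs => rw [← sw_eta (β b)]
  simp only [sw_tmul_right, sw_map, TensorProduct.assoc_symm_tmul, LinearMap.rTensor_tmul,
    TensorProduct.lid_tmul]

theorem tensorCoact_eq_sw (t : B ⊗[k] B) :
    tensorCoact (HopfData.of k A).toBialgData β t = sw t fun b c => sw (β b) fun a b' =>
      sw (β c) fun a' c' => (a * a') ⊗ₜ (b' ⊗ₜ c') := by
  simp only [tensorCoact, LinearMap.comp_apply, map_eq_sw, sw_map, interchange_eq_sw,
    LinearMap.rTensor_tmul, of_mul]

namespace IsComoduleBraidedGroup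

variable (hB : IsComoduleBraidedGroup (HopfData.of k A).toBialgData pair R β 𝓑)
include hB

theorem coact_coassoc_sw (b : B) {F : A → A → B → Z} (h1 : ∀ y z, Lin k (fun x => F x y z))
    (h2 : ∀ x z, Lin k (fun y => F x y z)) (h3 : ∀ x y, Lin k (fun z => F x y z)) :
    (sw (β b) fun a c => sw (δ a) fun p q => F p q c) =
      sw (β b) fun p c => sw (β c) fun q r => F p q r :=
  coassoc_sw hB.isLeftComodule.coassoc b h1 h2 h3

theorem coact_counit_smul (b : B) {F : B → Z} (hF : Lin k F) :
    (sw (β b) fun a c => ε a • F c) = F b := by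
  have : F = (IsLinearMap.mk' F ⟨hF.add, hF.smul⟩ : B →ₗ[k] Z) := rfl
  conv_rhs => rw [← hB.isLeftComodule.counit b, rTensor_eq_sw]
  rw [this]
  simp only [sw_map, TensorProduct.lid_tmul, map_smul, of_counit]

theorem coact_mul_sw (b c : B) : β (𝓑.mul (b ⊗ₜ c)) = sw (β b) fun a b' => sw (β c) fun a' c' =>
    (a * a') ⊗ₜ 𝓑.mul (b' ⊗ₜ c') := by
  have := LinearMap.congr_fun hB.coact_mul (b ⊗ₜ c)
  simp (disch := fun_prop) only [LinearMap.comp_apply, tensorCoact_eq_sw, sw_tmul, sw_map,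
    LinearMap.lTensor_tmul] at this
  exact this

theorem coact_one' : β 𝓑.one = 1 ⊗ₜ 𝓑.one := hB.coact_one

theorem coact_comul_sw (b : B) {F : A → B → B → Z} (h1 : ∀ y z, Lin k (fun x => F x y z))
    (h2 : ∀ x z, Lin k (fun y => F x y z)) (h3 : ∀ x y, Lin k (fun z => F x y z)) :
    (sw (β b) fun a b' => sw (𝓑.comul b') fun c d => F a c d) =
      sw (𝓑.comul b) fun c d => sw (β c) fun a c' => sw (β d) fun a' d' => F (a * a') c' d' := by
  have := sw₃_congr (LinearMap.congr_fun hB.coact_comul b) F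
  simpa (disch := fun_prop) only [LinearMap.comp_apply, tensorCoact_eq_sw, lTensor_comul_eq_sw,
    sw_sw, sw_tmul] using this

theorem coact_counit_sw (b : B) {F : A → Z} (hF : Lin k F) :
    (sw (β b) fun a c => 𝓑.counit c • F a) = 𝓑.counit b • F 1 := by
  have : F = (IsLinearMap.mk' F ⟨hF.add, hF.smul⟩ : A →ₗ[k] Z) := rfl
  rw [← hF.smul, ← of_one (k := k) (H := A), ← hB.coact_counit b, lTensor_eq_sw, this]
  simp only [sw_map, TensorProduct.rid_tmul, map_smul]

theorem coact_antipode_sw (b : B) : β (𝓑.antipode b) = sw (β b) fun a b' => a ⊗ₜ 𝓑.antipode b' := by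
  have := LinearMap.congr_fun hB.coact_antipode b
  simpa only [LinearMap.comp_apply, lTensor_eq_sw] using this

/-- A braided group of comodules is one of modules. -/
theorem isModuleBraidedGroup (hp : DualPair pair) :
    IsModuleBraidedGroup (HopfData.of k H).toBialgData R (evalAct pair β) 𝓑 where
  isRightModule :=
    { act_one := fun b => by
        simp only [evalAct_tmul, of_one, hp.one_left]
        exact hB.coact_counit_smul b (F := fun b => b) (by fun_prop)
      act_mul := fun b h g => by
        simp (disch := fun_prop) only [evalAct_tmul, of_mul, hp.mul_left, sw_smul_left, sw_map,
          sw_tmul_left, map_smul, ← TensorProduct.smul_tmul', sw_smul_right, smul_smul]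
        rw [hB.coact_coassoc_sw b (F := fun p q r => (pair (h ⊗ₜ p) * pair (g ⊗ₜ q)) • r)
          (by fun_prop) (by fun_prop) (by fun_prop)] }
  mul_act := by
    refine TensorProduct.ext' fun t h => ?_
    revert t; refine Lin.ext_tmul (by fun_prop) (by fun_prop) fun b c => ?_
    simp (disch := fun_prop) only [LinearMap.comp_apply, tensorAct_eq_sw, sw_tmul, sw_map,
      LinearMap.rTensor_tmul, evalAct_tmul, hB.coact_mul_sw, sw_sw, hp.mul_right, sw_smul_left,
      sw_tmul_left, sw_tmul_right, ← TensorProduct.smul_tmul', TensorProduct.tmul_smul,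
      sw_smul_right, map_smul, sw_comm (δ h) (β _), smul_smul]
    rw [sw_comm (β b) (β c)]
    iterate 3 refine sw_congr fun _ _ => ?_
    rw [mul_comm]
  one_act h := by
    simp (disch := fun_prop) only [evalAct_tmul, hB.coact_one', sw_tmul, hp.one_right, of_counit]
  comul_act := by
    refine TensorProduct.ext' fun b h => ?_
    simp (disch := fun_prop) only [LinearMap.comp_apply, tensorAct_eq_sw, sw_tmul, sw_map,
      LinearMap.rTensor_tmul, evalAct_tmul, sw_tmul_left, sw_tmul_right,
      ← TensorProduct.smul_tmul', TensorProduct.tmul_smul, sw_smul_right, map_smul,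
      sw_comm (δ h) (β _), smul_smul]
    have : ∀ a b', pair (h ⊗ₜ a) • 𝓑.comul b' = sw (𝓑.comul b') fun c d =>
        pair (h ⊗ₜ a) • c ⊗ₜ[k] d := fun a b' => by rw [← sw_smul_right, sw_eta]
    simp only [this]
    rw [hB.coact_comul_sw b (F := fun a c d => pair (h ⊗ₜ a) • c ⊗ₜ[k] d)
          (by fun_prop) (by fun_prop) (by fun_prop)]
    simp only [hp.mul_right, sw_smul_left]
    refine sw_congr fun c d => ?_
    rw [sw_comm (β c) (β d)]
    iterate 3 refine sw_congr fun _ _ => ?_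
    rw [mul_comm]
  counit_act b h := by
    simp only [evalAct_tmul, sw_map, map_smul, of_counit]
    have : ∀ a b', pair (h ⊗ₜ a) • 𝓑.counit b' = 𝓑.counit b' • pair (h ⊗ₜ a) := fun a b' =>
      mul_comm _ _
    simp only [this]
    rw [hB.coact_counit_sw b (F := fun a => pair (h ⊗ₜ a)) (by fun_prop), hp.one_right, smul_eq_mul]
  antipode_act := by
    refine TensorProduct.ext' fun b h => ?_
    simp (disch := fun_prop) only [LinearMap.comp_apply, LinearMap.rTensor_tmul, evalAct_tmul,
      sw_map, map_smul, hB.coact_antipode_sw, sw_sw, sw_tmul]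
  isBraidedBialgebra := hB.isBraidedBialgebra
  isAntipode := hB.isAntipode

end IsComoduleBraidedGroup

end Comodule

/-- The form in which the transposition appears once `simp` has removed the coercion from linear
equivalences to linear maps. -/
theorem sw_tensorComm {k V W Z : Type*} [Field k] [AddCommGroup V] [Module k V] [AddCommGroup W]
    [Module k W] [AddCommGroup Z] [Module k Z] (t : V ⊗[k] W) (F : W → V → Z)
    (hl : ∀ y, Lin k (fun x => F x y)) (hr : ∀ x, Lin k (fun y => F x y)) :
    sw (TensorProduct.comm k V W t) F = sw t fun x y => F y x :=
  sw_tswap t F hl hr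

/-! ### The bosonisation of `C` by `H^op`. -/

section LeftFactor

variable {k H C Z : Type*} [Field k] [Ring H] [HopfAlgebra k H] [AddCommGroup C] [Module k C]
  [AddCommGroup Z] [Module k Z] {R T : H ⊗[k] H}
  {act : C ⊗[k] H →ₗ[k] C} {𝓒 : HopfData k C}

local notation "δ" => Coalgebra.comul (R := k)
local notation "ε" => Coalgebra.counit (R := k)
local notation "S" => HopfAlgebra.antipode k

theorem smash_tmul (𝓗 : BialgData k H) (act : H ⊗[k] C →ₗ[k] C) (h : H) (c : C) :
    smash 𝓗 act (h ⊗ₜ c) = sw (𝓗.comul h) fun p q => act (p ⊗ₜ c) ⊗ₜ q := by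
  simp only [smash, LinearMap.comp_apply, LinearMap.rTensor_tmul, LinearEquiv.coe_coe]
  conv_lhs => rw [← sw_eta (𝓗.comul h)]
  simp only [sw_tmul_left, sw_map, TensorProduct.rightComm_tmul, LinearMap.rTensor_tmul]

theorem cosmash_tmul (𝓗 : BialgData k H) (R : H ⊗[k] H) (act : H ⊗[k] C →ₗ[k] C) (h : H) (c : C) :
    cosmash 𝓗 R act (c ⊗ₜ h) = sw R fun x y => 𝓗.mul (y ⊗ₜ h) ⊗ₜ act (x ⊗ₜ c) := by
  simp (disch := fun_prop) only [cosmash, LinearMap.comp_apply, LinearEquiv.coe_coe,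
    TensorProduct.comm_tmul, TensorProduct.mk_apply, interchange_eq_sw, sw_tmul, sw_map,
    TensorProduct.map_tmul, sw_tensorComm]

variable (R act) in
/-- The reordering `h ⊗ c ↦ c ◁ h₍₁₎ ⊗ h₍₂₎` in `C ⋊ H^op`. -/
abbrev leftTwist : H ⊗[k] C →ₗ[k] C ⊗[k] H :=
  smash (HopfData.of k H).op.toBialgData (act ∘ₗ tswap)

variable (R act) in
/-- The braiding `c ⊗ h ↦ hR⁽¹⁾ ⊗ c ◁ R⁽²⁾` in the coproduct of `C ⋊ H^op`. -/
abbrev leftCotwist : C ⊗[k] H →ₗ[k] H ⊗[k] C :=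
  cosmash (HopfData.of k H).op.toBialgData (tswap R) (act ∘ₗ tswap)

theorem leftTwist_tmul (h : H) (c : C) :
    leftTwist act (h ⊗ₜ c) = sw (δ h) fun p q => act (c ⊗ₜ p) ⊗ₜ q := by
  simp only [leftTwist, smash_tmul, LinearMap.comp_apply, LinearEquiv.coe_coe,
    TensorProduct.comm_tmul]
  rfl

theorem op_mul (x y : H) : (HopfData.of k H).op.mul (x ⊗ₜ y) = y * x := rfl

theorem leftCotwist_tmul (h : H) (c : C) :
    leftCotwist R act (c ⊗ₜ h) = sw R fun x y => (h * x) ⊗ₜ act (c ⊗ₜ y) := by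
  simp (disch := fun_prop) only [leftCotwist, cosmash_tmul, LinearMap.comp_apply,
    LinearEquiv.coe_coe, TensorProduct.comm_tmul, sw_tensorComm, op_mul]

theorem isAlgTwist_leftTwist
    (hC : IsModuleBraidedGroup (HopfData.of k H).toBialgData R act 𝓒) :
    BialgData.IsAlgTwist 𝓒.toBialgData (HopfData.of k H).op.toBialgData (leftTwist act) where
  tmul_one h := by
    simp (disch := fun_prop) only [leftTwist_tmul, hC.one_act', ← TensorProduct.smul_tmul',
      counit_smul_sw]
  one_tmul c := by
    change leftTwist act (1 ⊗ₜ c) = c ⊗ₜ 1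
    simp (disch := fun_prop) only [leftTwist_tmul, comul_one', sw_tmul, hC.act_one']
  mul_tmul h h' c := by
    simp (disch := fun_prop) only [leftTwist_tmul, op_mul, comul_mul_eq_sw, sw_sw, sw_tmul,
      hC.act_act]
  tmul_mul h c d := by
    simp (disch := fun_prop) only [leftTwist_tmul, hC.mul_act_sw, sw_sw, sw_tmul, sw_tmul_left,
      comul_coassoc_sw]

/-- The formulas for `(Δ ⊗ id)R` and `(id ⊗ Δ)R` are the two compatibilities with coproducts, and
the counit values of `R` give the other two. -/
theorem isCoalgTwist_leftCotwist (hR : QTri R T)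
    (hC : IsModuleBraidedGroup (HopfData.of k H).toBialgData R act 𝓒) :
    BialgData.IsCoalgTwist 𝓒.toBialgData (HopfData.of k H).op.toBialgData
      (leftCotwist R act) where
  counit_left c h := by
    change _ = ε h • c
    change (sw _ fun q p => ε q • p) = _
    have (x y : H) : ε (h * x) • act (c ⊗ₜ y) = ε h • ε x • act (c ⊗ₜ y) := by
      rw [Bialgebra.counit_mul, mul_smul]
    simp (disch := fun_prop) only [leftCotwist_tmul, sw_sw, sw_tmul, this, hC.act_one',
      ← sw_smul_right, hR.counit_left_sw]
  counit_right c h := by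
    simp (disch := fun_prop) only [leftCotwist_tmul, sw_sw, sw_tmul, hC.counit_act', mul_smul,
      ← sw_smul_right, hR.counit_right_sw, mul_one]
  comul_left c h := by
    change (sw _ fun q p => sw (δ q) fun q₁ q₂ => q₁ ⊗ₜ[k] (q₂ ⊗ₜ[k] p)) = sw (δ h) _
    simp (disch := fun_prop) only [leftCotwist_tmul, comul_mul_eq_sw, sw_sw, sw_tmul, hC.act_act,
      sw_comm R (δ _), hR.comul_left_sw]
  comul_right c h := by
    simp (disch := fun_prop) only [leftCotwist_tmul, hC.comul_act_sw, sw_sw, sw_tmul,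
      sw_comm R (𝓒.comul _), hR.comul_right_sw, mul_assoc]

variable (R act 𝓒) in
/-- The Hopf algebra `C ⋊ H^op`. -/
abbrev leftAlg : BialgData k (C ⊗[k] H) :=
  𝓒.toBialgData.twist (HopfData.of k H).op.toBialgData (leftTwist act) (leftCotwist R act)

theorem leftAlg_mul (c d : C) (h g : H) : (leftAlg R act 𝓒).mul ((c ⊗ₜ h) ⊗ₜ (d ⊗ₜ g)) =
    sw (δ h) fun p q => 𝓒.mul (c ⊗ₜ act (d ⊗ₜ p)) ⊗ₜ (g * q) := by
  simp (disch := fun_prop) only [leftAlg, BialgData.twist_mul, leftTwist_tmul, sw_sw, sw_tmul,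
    op_mul]

theorem leftAlg_comul (c : C) (h : H) : (leftAlg R act 𝓒).comul (c ⊗ₜ h) =
    sw (𝓒.comul c) fun c₁ c₂ => sw (δ h) fun p q => sw R fun x y =>
      (c₁ ⊗ₜ (p * x)) ⊗ₜ (act (c₂ ⊗ₜ y) ⊗ₜ q) := by
  simp (disch := fun_prop) only [leftAlg, BialgData.twist_comul, leftCotwist_tmul, sw_sw, sw_tmul]
  rfl

theorem leftAlg_counit (c : C) (h : H) :
    (leftAlg R act 𝓒).counit (c ⊗ₜ h) = 𝓒.counit c * ε h := by
  simp only [leftAlg, BialgData.twist_counit]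
  rfl

theorem leftAlg_one : (leftAlg R act 𝓒).one = 𝓒.one ⊗ₜ 1 := rfl

theorem isAlg_leftAlg (hC : IsModuleBraidedGroup (HopfData.of k H).toBialgData R act 𝓒) :
    (leftAlg R act 𝓒).IsAlg :=
  hC.isAlg.twist isBialgebra_of.op.isAlg (isAlgTwist_leftTwist hC)

theorem isCoalg_leftAlg (hR : QTri R T)
    (hC : IsModuleBraidedGroup (HopfData.of k H).toBialgData R act 𝓒) :
    (leftAlg R act 𝓒).IsCoalg :=
  hC.isCoalg.twist isBialgebra_of.op.isCoalg (isCoalgTwist_leftCotwist hR hC)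

theorem leftAlg_mul_inl (hC : IsModuleBraidedGroup (HopfData.of k H).toBialgData R act 𝓒)
    (c d : C) (g : H) : (leftAlg R act 𝓒).mul ((c ⊗ₜ 1) ⊗ₜ (d ⊗ₜ g)) = 𝓒.mul (c ⊗ₜ d) ⊗ₜ g := by
  simp (disch := fun_prop) only [leftAlg_mul, comul_one', sw_tmul, hC.act_one', mul_one]

theorem leftAlg_mul_inr (hC : IsModuleBraidedGroup (HopfData.of k H).toBialgData R act 𝓒)
    (c : C) (h g : H) :
    (leftAlg R act 𝓒).mul ((c ⊗ₜ h) ⊗ₜ (𝓒.one ⊗ₜ g)) = c ⊗ₜ (g * h) := by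
  simp (disch := fun_prop) only [leftAlg_mul, hC.one_act', ← TensorProduct.smul_tmul',
    TensorProduct.tmul_smul, map_smul, counit_smul_sw, hC.isAlg.mul_one]

/-- The tensor square algebra. -/
theorem sq_mul_sw {V : Type*} [AddCommGroup V] [Module k V] (X : BialgData k V) (a b c d : V) :
    (X.twist X tswap tswap).mul ((a ⊗ₜ b) ⊗ₜ (c ⊗ₜ d)) = X.mul (a ⊗ₜ c) ⊗ₜ X.mul (b ⊗ₜ d) :=
  BialgData.twist_tswap_mul _ a c b d

/-- Checked on generators. For two elements of `C` the coproducts of the two legs of `R` combine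
into the braiding in the coproduct of `C`. For `h` past `c` the legs of `h` must cross `R`, and this
is quasi-cocommutativity. -/
theorem isBialgebra_leftAlg (hR : QTri R T)
    (hC : IsModuleBraidedGroup (HopfData.of k H).toBialgData R act 𝓒) :
    (leftAlg R act 𝓒).IsBialgebra := by
  have hA := isAlg_leftAlg hC
  have hCo := isCoalg_leftAlg hR hC
  have hE := hA.twist (σ := tswap) hA (BialgData.isAlgTwist_tswap _ _)
  have h1 : 𝓒.comul 𝓒.one = 𝓒.one ⊗ₜ 𝓒.one := hC.isBraidedBialgebra.comul_one
  have hi (c : C) : (leftAlg R act 𝓒).comul (c ⊗ₜ 1) = sw (𝓒.comul c) fun c₁ c₂ =>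
      sw R fun x y => (c₁ ⊗ₜ x) ⊗ₜ (act (c₂ ⊗ₜ y) ⊗ₜ 1) := by
    simp (disch := fun_prop) only [leftAlg_comul, comul_one', sw_tmul, one_mul]
  have hj (h : H) : (leftAlg R act 𝓒).comul (𝓒.one ⊗ₜ h) = sw (δ h) fun p q =>
      (𝓒.one ⊗ₜ p) ⊗ₜ (𝓒.one ⊗ₜ q) := by
    simp (disch := fun_prop) only [leftAlg_comul, h1, sw_tmul, hC.one_act',
      ← TensorProduct.smul_tmul', TensorProduct.tmul_smul, hR.counit_right_sw, mul_one]
  refine ⟨hA.assoc, hA.one_mul, hA.mul_one, hCo.coassoc, hCo.counit_comul, hCo.comul_counit,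
    ?_, ?_, ?_, ?_⟩
  · refine BialgData.twist_map_mul (X := 𝓒.toBialgData) (Y := (HopfData.of k H).op.toBialgData)
      (τ := leftTwist act) (σ := leftCotwist R act) hE.assoc (leftAlg R act 𝓒).comul ?_ ?_ ?_ ?_
    · intro c h
      change _ = BialgData.mul _ ((leftAlg R act 𝓒).comul (c ⊗ₜ 1) ⊗ₜ _)
      simp (disch := fun_prop) only [leftAlg_comul, hi, hj, sw_tmul_left, sw_tmul_right, sw_map,
        sq_mul_sw, leftAlg_mul_inr hC, mul_one, sw_comm R (δ _)]
      rw [sw_comm]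
    · intro c d
      change (leftAlg R act 𝓒).comul (𝓒.mul (c ⊗ₜ d) ⊗ₜ 1) = BialgData.mul _
        ((leftAlg R act 𝓒).comul (c ⊗ₜ 1) ⊗ₜ (leftAlg R act 𝓒).comul (d ⊗ₜ 1))
      simp only [hi, sw_tmul_left]
      simp only [sw_tmul_right, sw_map, sq_mul_sw, leftAlg_mul_inl hC]
      simp (disch := fun_prop) only [hC.comul_mul_sw, leftAlg_mul, hC.mul_act_sw,
        hC.act_act, sw_sw, sw_tmul, sw_tmul_left, sw_tmul_right, sw_comm R (𝓒.comul _)]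
      refine sw_congr fun c₁ c₂ => sw_congr fun d₁ d₂ => ?_
      rw [sw_comm R R (fun x y x_1 y_1 => sw (δ x) _)]
      simp (disch := fun_prop) only [hR.comul_left_sw, hR.comul_right_sw]
      rw [sw_comm R R]
    · intro h g
      change (leftAlg R act 𝓒).comul (𝓒.one ⊗ₜ (g * h)) = BialgData.mul _
        ((leftAlg R act 𝓒).comul (𝓒.one ⊗ₜ h) ⊗ₜ (leftAlg R act 𝓒).comul (𝓒.one ⊗ₜ g))
      simp only [hj, sw_tmul_left, sw_tmul_right, sw_map, sq_mul_sw, leftAlg_mul_inr hC]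
      simp (disch := fun_prop) only [comul_mul_eq_sw, sw_sw, sw_tmul]
    · intro c h
      change _ = BialgData.mul _
        ((leftAlg R act 𝓒).comul (𝓒.one ⊗ₜ h) ⊗ₜ (leftAlg R act 𝓒).comul (c ⊗ₜ 1))
      simp only [hi, hj, sw_tmul_left]
      simp only [sw_tmul_right, sw_map, sq_mul_sw, leftTwist_tmul]
      simp (disch := fun_prop) only [leftAlg_mul, leftAlg_comul, hC.comul_act_sw, sw_sw, sw_tmul,
        sw_tmul_left, sw_tmul_right, hC.act_act, hC.isAlg.one_mul, one_mul,
        sw_comm (δ _) (𝓒.comul _), comul_coassoc_sw, sw_comm R (δ _)]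
      refine sw_congr fun c₁ c₂ => ?_
      rw [sw_congr fun x y => sw_comm (δ y) (δ x) _]
      simp (disch := fun_prop) only [comul_coassoc_sw]
      refine sw_congr fun p c => ?_
      rw [← comul_coassoc_sw c (F := fun q p₁ q₁ => sw R fun x y => (act (c₁ ⊗ₜ p) ⊗ₜ (p₁ * x)) ⊗ₜ
          (act (c₂ ⊗ₜ (q * y)) ⊗ₜ q₁)) (by fun_prop) (by fun_prop) (by fun_prop),
        ← comul_coassoc_sw c (F := fun q p₁ q₁ => sw R fun x y => (act (c₁ ⊗ₜ p) ⊗ₜ (x * q)) ⊗ₜ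
          (act (c₂ ⊗ₜ (y * p₁)) ⊗ₜ q₁)) (by fun_prop) (by fun_prop) (by fun_prop)]
      refine sw_congr fun m q => ?_
      exact hR.quasi_sw m (F := fun x y => (act (c₁ ⊗ₜ p) ⊗ₜ x) ⊗ₜ (act (c₂ ⊗ₜ y) ⊗ₜ q))
        (by fun_prop) (by fun_prop)
  · rw [leftAlg_one, hj, comul_one']
    simp (disch := fun_prop) only [sw_tmul]
  · intro a b
    revert a; refine Lin.ext_tmul (by fun_prop) (by fun_prop) fun c h => ?_
    revert b; refine Lin.ext_tmul (by fun_prop) (by fun_prop) fun d g => ?_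
    simp (disch := fun_prop) only [leftAlg_mul, sw_map, leftAlg_counit,
      hC.isBraidedBialgebra.counit_mul, hC.counit_act', Bialgebra.counit_mul]
    have h0 (x y : H) : 𝓒.counit c * (𝓒.counit d * ε x) * (ε g * ε y) =
        ε x • (ε y * (𝓒.counit c * 𝓒.counit d * ε g)) := by rw [smul_eq_mul]; ring
    simp (disch := fun_prop) only [h0, counit_smul_sw]
    ring
  · rw [leftAlg_one, leftAlg_counit, hC.isBraidedBialgebra.counit_one, Bialgebra.counit_one,
      mul_one]

theorem isAntipode_leftFactor (hR : QTri R T)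
    (hC : IsModuleBraidedGroup (HopfData.of k H).toBialgData R act 𝓒) :
    (leftAlg R act 𝓒).IsAntipode (leftFactor (HopfData.of k H) R 𝓒 act).antipode :=
  BialgData.IsAntipode.twist hC.isAlg isBialgebra_of.op.isAlg (isAlgTwist_leftTwist hC)
    (isCoalgTwist_leftCotwist hR hC) hC.isAntipode
    (isAntipode_of.op isBialgebra_of (self_linInv_apply hR.bijective_antipode)
      (linInv_apply_self hR.bijective_antipode))

theorem linInv_antipode_mul (hR : QTri R T) (x y : H) : linInv (S : H →ₗ[k] H) (x * y) =
    linInv (S : H →ₗ[k] H) y * linInv (S : H →ₗ[k] H) x := by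
  apply hR.bijective_antipode.1
  simp only [self_linInv_apply hR.bijective_antipode, antipode_mul_rev]

theorem linInv_antipode_left_sw (hR : QTri R T) (x : H) {F : H → Z} (hF : Lin k F) :
    (sw (δ x) fun a b => F (linInv S b * a)) = ε x • F 1 :=
  (isAntipode_of.op isBialgebra_of (self_linInv_apply hR.bijective_antipode)
      (linInv_apply_self hR.bijective_antipode)).right_sw x hF

theorem linInv_antipode_right_sw (hR : QTri R T) (x : H) {F : H → Z} (hF : Lin k F) :
    (sw (δ x) fun a b => F (b * linInv S a)) = ε x • F 1 :=
  (isAntipode_of.op isBialgebra_of (self_linInv_apply hR.bijective_antipode)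
      (linInv_apply_self hR.bijective_antipode)).left_sw x hF

theorem bijective_leftTwist (hC : IsModuleBraidedGroup (HopfData.of k H).toBialgData R act 𝓒) :
    Function.Bijective (leftTwist act) := by
  let g : C ⊗[k] H → H ⊗[k] C := fun t => sw t fun c h => sw (δ h) fun p q =>
    q ⊗ₜ act (c ⊗ₜ S p)
  have hg : Lin k g := by fun_prop
  refine Function.bijective_iff_has_inverse.mpr ⟨g, ?_, ?_⟩
  · refine Lin.ext_tmul (by fun_prop) (by fun_prop) fun h c => ?_
    simp (disch := fun_prop) only [g, leftTwist_tmul, sw_sw, sw_tmul, hC.act_act]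
    rw [← comul_coassoc_sw h (F := fun p q r => r ⊗ₜ[k] act (c ⊗ₜ (p * S q)))
      (by fun_prop) (by fun_prop) (by fun_prop)]
    have h0 (a b : H) : (sw (δ a) fun p q => b ⊗ₜ[k] act (c ⊗ₜ (p * S q))) =
        ε a • b ⊗ₜ act (c ⊗ₜ 1) :=
      antipode_right_sw a (F := fun z => b ⊗ₜ[k] act (c ⊗ₜ z)) (by fun_prop)
    simp (disch := fun_prop) only [h0, counit_smul_sw, hC.act_one']
  · refine Lin.ext_tmul (by fun_prop) (by fun_prop) fun c h => ?_
    simp (disch := fun_prop) only [g, leftTwist_tmul, sw_sw, sw_tmul, hC.act_act, sw_map]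
    rw [← comul_coassoc_sw h (F := fun p q r => act (c ⊗ₜ (S p * q)) ⊗ₜ[k] r)
      (by fun_prop) (by fun_prop) (by fun_prop)]
    have h0 (a b : H) : (sw (δ a) fun p q => act (c ⊗ₜ (S p * q)) ⊗ₜ[k] b) =
        ε a • act (c ⊗ₜ 1) ⊗ₜ b :=
      antipode_left_sw a (F := fun z => act (c ⊗ₜ z) ⊗ₜ[k] b) (by fun_prop)
    simp (disch := fun_prop) only [h0, counit_smul_sw, hC.act_one']

theorem bijective_leftCotwist (hR : QTri R T)
    (hC : IsModuleBraidedGroup (HopfData.of k H).toBialgData R act 𝓒) :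
    Function.Bijective (leftCotwist R act) := by
  let g : H ⊗[k] C → C ⊗[k] H := fun t => sw t fun h c => sw T fun x y =>
    act (c ⊗ₜ y) ⊗ₜ (h * x)
  have hg : Lin k g := by fun_prop
  refine Function.bijective_iff_has_inverse.mpr ⟨g, ?_, ?_⟩
  · refine Lin.ext_tmul (by fun_prop) (by fun_prop) fun c h => ?_
    simp (disch := fun_prop) only [g, leftCotwist_tmul, sw_sw, sw_tmul, hC.act_act, mul_assoc]
    rw [hR.mul_inv_sw (F := fun x y => act (c ⊗ₜ y) ⊗ₜ (h * x)) (by fun_prop) (by fun_prop),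
      mul_one, hC.act_one']
  · refine Lin.ext_tmul (by fun_prop) (by fun_prop) fun h c => ?_
    simp (disch := fun_prop) only [g, leftCotwist_tmul, sw_sw, sw_tmul, hC.act_act, sw_map,
      mul_assoc]
    rw [hR.inv_mul_sw (F := fun x y => (h * x) ⊗ₜ act (c ⊗ₜ y)) (by fun_prop) (by fun_prop),
      mul_one, hC.act_one']

theorem bijective_linInv {X : Type*} [AddCommGroup X] [Module k X] {f : X →ₗ[k] X}
    (h : Function.Bijective f) : Function.Bijective (linInv f) := by
  rw [linInv, dif_pos h]
  exact (LinearEquiv.ofBijective f h).symm.bijective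

/-- The antipode is a composite of bijections: the braiding with `R`, inverted by `R⁻¹`; the two
antipodes; and the reordering, inverted by means of `S`. The double uses `X` with its opposite
product, so the inverse of this antipode is needed. -/
theorem bijective_antipode_leftFactor (hR : QTri R T)
    (hC : IsModuleBraidedGroup (HopfData.of k H).toBialgData R act 𝓒)
    (hS : Function.Bijective 𝓒.antipode) :
    Function.Bijective (leftFactor (HopfData.of k H) R 𝓒 act).antipode := by
  have h : (leftFactor (HopfData.of k H) R 𝓒 act).antipode = leftTwist act ∘ₗ
      (TensorProduct.congr (LinearEquiv.ofBijective _ (bijective_linInv hR.bijective_antipode))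
        (LinearEquiv.ofBijective _ hS)).toLinearMap ∘ₗ leftCotwist R act := rfl
  rw [h]
  exact (bijective_leftTwist hC).comp
    ((LinearEquiv.bijective (TensorProduct.congr
      (LinearEquiv.ofBijective _ (bijective_linInv hR.bijective_antipode))
      (LinearEquiv.ofBijective _ hS))).comp (bijective_leftCotwist hR hC))

end LeftFactor

/-! ### The dual bosonisation of `B` by `A^cop`. -/

section RightFactor

variable {k H A B Z : Type*} [Field k] [Ring H] [HopfAlgebra k H] [Ring A] [HopfAlgebra k A]
  [AddCommGroup B] [Module k B] [AddCommGroup Z] [Module k Z] {R T : H ⊗[k] H}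
  {pair : H ⊗[k] A →ₗ[k] k} {β : B →ₗ[k] A ⊗[k] B} {𝓑 : HopfData k B}

local notation "δ" => Coalgebra.comul (R := k)
local notation "ε" => Coalgebra.counit (R := k)
local notation "S" => HopfAlgebra.antipode k

theorem coevalAct_tmul (pair : H ⊗[k] A →ₗ[k] k) (β : B →ₗ[k] A ⊗[k] B) (b : B) (h : H) :
    coevalAct pair (tswap ∘ₗ β) (h ⊗ₜ b) = evalAct pair β (b ⊗ₜ h) := by
  rw [evalAct_tmul]
  simp only [coevalAct, LinearMap.comp_apply, LinearEquiv.coe_coe, LinearMap.lTensor_tmul]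
  conv_lhs => rw [← sw_eta (β b)]
  simp only [sw_tmul_right, sw_map, TensorProduct.comm_tmul, LinearMap.lTensor_tmul,
    TensorProduct.rid_tmul, TensorProduct.leftComm_tmul]

/-- The reordering in `A^cop ⋉ B`. -/
def rightTwist (R : H ⊗[k] H) (pair : H ⊗[k] A →ₗ[k] k) (β : B →ₗ[k] A ⊗[k] B) :
    B ⊗[k] A →ₗ[k] A ⊗[k] B :=
  LinearMap.lTensor A (coevalAct pair (tswap ∘ₗ β)) ∘ₗ
    (TensorProduct.assoc k A H B).toLinearMap ∘ₗ
    LinearMap.rTensor B (LinearMap.lTensor A (slice pair (tswap (tswap R))) ∘ₗ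
      (HopfData.of k A).cop.comul) ∘ₗ tswap

/-- The braiding in the coproduct of `A^cop ⋉ B`. -/
def rightCotwist (β : B →ₗ[k] A ⊗[k] B) : A ⊗[k] B →ₗ[k] B ⊗[k] A :=
  LinearMap.lTensor B (HopfData.of k A).cop.mul ∘ₗ (TensorProduct.leftComm k A B A).toLinearMap ∘ₗ
      LinearMap.lTensor A (tswap ∘ₗ β)

theorem tswap_tswap {V W : Type*} [AddCommGroup V] [Module k V] [AddCommGroup W] [Module k W]
    (t : V ⊗[k] W) : tswap (tswap t) = t :=
  (TensorProduct.comm k V W).symm_apply_apply t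

theorem sw_cop_comul (a : A) {F : A → A → Z} (hl : ∀ y, Lin k (fun x => F x y))
    (hr : ∀ x, Lin k (fun y => F x y)) :
    sw ((HopfData.of k A).cop.comul a) F = sw (δ a) fun p q => F q p := by
  change sw (tswap (δ a)) F = _
  simp (disch := fun_prop) only [sw_tswap]

theorem rightTwist_tmul (a : A) (b : B) : rightTwist R pair β (b ⊗ₜ a) =
    sw (δ a) fun p q => q ⊗ₜ evalAct pair β (b ⊗ₜ slice pair R p) := by
  simp only [rightTwist, LinearMap.comp_apply, LinearEquiv.coe_coe, TensorProduct.comm_tmul,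
    LinearMap.rTensor_tmul]
  -- The quasitriangular structure of `H^op` is `R₂₁` and the dual bosonisation transposes once
  -- more, so the two transpositions cancel.
  rw [show ∀ t : H ⊗[k] H, (TensorProduct.comm k H H) ((TensorProduct.comm k H H) t) = t from
    tswap_tswap]
  have : (HopfData.of k A).cop.comul a = sw (δ a) fun p q => q ⊗ₜ p := tswap_eq_sw (δ a)
  rw [this]
  simp only [sw_map, sw_tmul_left, LinearMap.lTensor_tmul, TensorProduct.assoc_tmul,
    coevalAct_tmul]

theorem rightCotwist_tmul (a : A) (b : B) : rightCotwist β (a ⊗ₜ b) =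
    sw (β b) fun u v => v ⊗ₜ (a * u) := by
  simp only [rightCotwist, LinearMap.comp_apply, LinearMap.lTensor_tmul, LinearEquiv.coe_coe]
  conv_lhs => rw [← sw_eta (β b)]
  simp only [sw_map, sw_tmul_right, LinearMap.lTensor_tmul, TensorProduct.comm_tmul,
    TensorProduct.leftComm_tmul]
  rfl

theorem isAlg_cop : (HopfData.of k A).cop.IsAlg :=
  ⟨isBialgebra_of.mul_assoc, isBialgebra_of.one_mul, isBialgebra_of.mul_one⟩

theorem BialgData.IsCoalg.cop {V : Type*} [AddCommGroup V] [Module k V] {X : BialgData k V}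
    (h : X.IsCoalg) : X.cop.IsCoalg where
  coassoc x := by
    rw [assoc_rTensor_eq_sw, lTensor_comul_eq_sw]
    simp (disch := fun_prop) only [BialgData.cop, LinearMap.comp_apply, sw_tswap, h.coassoc_sw]
  counit_comul x := by
    rw [rTensor_eq_sw]
    simp (disch := fun_prop) only [BialgData.cop, LinearMap.comp_apply, sw_tswap, sw_map,
      TensorProduct.lid_tmul, h.smul_counit]
  comul_counit x := by
    rw [lTensor_eq_sw]
    simp (disch := fun_prop) only [BialgData.cop, LinearMap.comp_apply, sw_tswap, sw_map,
      TensorProduct.rid_tmul, h.counit_smul]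

theorem cop_mul (x y : A) : (HopfData.of k A).cop.mul (x ⊗ₜ y) = x * y := rfl

/-- `A` acts on `B` through its image in `H`; the product and coproduct rules of `slice` turn the
module algebra axioms over `H` into a distributive law. -/
theorem isAlgTwist_rightTwist (hR : QTri R T) (hp : DualPair pair)
    (hB : IsComoduleBraidedGroup (HopfData.of k A).toBialgData pair R β 𝓑) :
    BialgData.IsAlgTwist (HopfData.of k A).cop.toBialgData 𝓑.toBialgData
      (rightTwist R pair β) := by
  have hM := hB.isModuleBraidedGroup hp
  refine ⟨fun b => ?_, fun a => ?_, fun b b' a => ?_, fun b a a' => ?_⟩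
  · change rightTwist R pair β (b ⊗ₜ 1) = 1 ⊗ₜ b
    simp (disch := fun_prop) only [rightTwist_tmul, comul_one', sw_tmul, slice_one hR hp,
      hM.act_one']
  · simp (disch := fun_prop) only [rightTwist_tmul, hM.one_act', slice_counit hR hp,
      TensorProduct.tmul_smul, counit_smul_sw]
  · simp (disch := fun_prop) only [rightTwist_tmul, hM.mul_act_sw, slice_comul hR hp, sw_sw,
      sw_tmul, sw_tmul_right, comul_coassoc_sw]
  · simp (disch := fun_prop) only [rightTwist_tmul, cop_mul, comul_mul_eq_sw, sw_sw, sw_tmul,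
      slice_mul hR hp, hM.act_act]

theorem isCoalgTwist_rightCotwist
    (hB : IsComoduleBraidedGroup (HopfData.of k A).toBialgData pair R β 𝓑) :
    BialgData.IsCoalgTwist (HopfData.of k A).cop.toBialgData 𝓑.toBialgData (rightCotwist β) where
  counit_left a b := by
    simp (disch := fun_prop) only [rightCotwist_tmul, sw_sw, sw_tmul]
    rw [hB.coact_counit_sw b (F := fun u => a * u) (by fun_prop), mul_one]
  counit_right a b := by
    change _ = ε a • b
    change (sw _ fun q p => ε p • q) = _
    simp (disch := fun_prop) only [rightCotwist_tmul, sw_sw, sw_tmul, Bialgebra.counit_mul,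
      mul_smul, ← sw_smul_right]
    rw [hB.coact_counit_smul b (F := fun u => u) (by fun_prop)]
  comul_left a b := by
    simp (disch := fun_prop) only [rightCotwist_tmul, sw_sw, sw_tmul]
    rw [hB.coact_comul_sw b (F := fun u v w => v ⊗ₜ (w ⊗ₜ (a * u))) (by fun_prop) (by fun_prop)
      (by fun_prop)]
    simp only [mul_assoc]
  comul_right a b := by
    simp (disch := fun_prop) only [rightCotwist_tmul, sw_sw, sw_tmul, sw_cop_comul,
      comul_mul_eq_sw, sw_comm (β _) (δ _)]
    simp (disch := fun_prop) only [sw_comm (δ _) (β _), hB.coact_coassoc_sw]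

theorem IsComoduleBraidedGroup.coact_act_sw
    (hB : IsComoduleBraidedGroup (HopfData.of k A).toBialgData pair R β 𝓑) (b : B) (h : H)
    {F : A → B → Z} (hl : ∀ y, Lin k (fun x => F x y)) (hr : ∀ x, Lin k (fun y => F x y)) :
    (sw (β b) fun u v => F u (evalAct pair β (v ⊗ₜ h))) = sw (β b) fun u v =>
      sw (δ u) fun u₁ u₂ => pair (h ⊗ₜ u₂) • F u₁ v := by
  have h0 (u : A) (v : B) : F u (evalAct pair β (v ⊗ₜ h)) =
      sw (β v) fun p q => pair (h ⊗ₜ p) • F u q := by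
    have : F u = (IsLinearMap.mk' (F u) ⟨(hr u).add, (hr u).smul⟩ : B →ₗ[k] Z) := rfl
    rw [this]
    simp only [evalAct_tmul, sw_map, map_smul]
  rw [hB.coact_coassoc_sw b (F := fun u₁ u₂ v => pair (h ⊗ₜ u₂) • F u₁ v) (by fun_prop)
    (by fun_prop) (by fun_prop)]
  simp only [h0]

variable (R pair β 𝓑) in
/-- The Hopf algebra `A^cop ⋉ B`. -/
abbrev rightAlg : BialgData k (A ⊗[k] B) :=
  (HopfData.of k A).cop.toBialgData.twist 𝓑.toBialgData (rightTwist R pair β) (rightCotwist β)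

theorem rightAlg_mul (a d : A) (b c : B) : (rightAlg R pair β 𝓑).mul ((a ⊗ₜ b) ⊗ₜ (d ⊗ₜ c)) =
    sw (δ d) fun p q => (a * q) ⊗ₜ 𝓑.mul (evalAct pair β (b ⊗ₜ slice pair R p) ⊗ₜ c) := by
  simp (disch := fun_prop) only [rightAlg, BialgData.twist_mul, rightTwist_tmul, sw_sw, sw_tmul,
    cop_mul]

theorem rightAlg_comul (a : A) (b : B) : (rightAlg R pair β 𝓑).comul (a ⊗ₜ b) =
    sw (δ a) fun a₁ a₂ => sw (𝓑.comul b) fun b₁ b₂ => sw (β b₁) fun u v =>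
      (a₂ ⊗ₜ v) ⊗ₜ ((a₁ * u) ⊗ₜ b₂) := by
  simp (disch := fun_prop) only [rightAlg, BialgData.twist_comul, rightCotwist_tmul, sw_sw, sw_tmul,
    sw_cop_comul]

theorem rightAlg_counit (a : A) (b : B) :
    (rightAlg R pair β 𝓑).counit (a ⊗ₜ b) = ε a * 𝓑.counit b := by
  simp only [rightAlg, BialgData.twist_counit]
  rfl

theorem rightAlg_one : (rightAlg R pair β 𝓑).one = 1 ⊗ₜ 𝓑.one := rfl

theorem isAlg_rightAlg (hR : QTri R T) (hp : DualPair pair)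
    (hB : IsComoduleBraidedGroup (HopfData.of k A).toBialgData pair R β 𝓑) :
    (rightAlg R pair β 𝓑).IsAlg :=
  isAlg_cop.twist hB.isBraidedBialgebra.isAlg (isAlgTwist_rightTwist hR hp hB)

theorem isCoalg_rightAlg
    (hB : IsComoduleBraidedGroup (HopfData.of k A).toBialgData pair R β 𝓑) :
    (rightAlg R pair β 𝓑).IsCoalg :=
  isBialgebra_of.isCoalg.cop.twist hB.isBraidedBialgebra.isCoalg (isCoalgTwist_rightCotwist hB)

/-- For two elements of `B` the coaction in the coproduct, fed into `slice`, produces the copy of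
`R` in the braiding. For `b` past `a` the element of `A` split off by the coaction must be exchanged
with legs of `a`, which is quasicommutativity. -/
theorem isBialgebra_rightAlg (hR : QTri R T) (hp : DualPair pair) (hA : QComm pair R)
    (hB : IsComoduleBraidedGroup (HopfData.of k A).toBialgData pair R β 𝓑) :
    (rightAlg R pair β 𝓑).IsBialgebra := by
  have hM := hB.isModuleBraidedGroup hp
  have hBA := hM.isAlg
  have hAl := isAlg_rightAlg hR hp hB
  have hCo := isCoalg_rightAlg hB
  have hE := hAl.twist (σ := tswap) hAl (BialgData.isAlgTwist_tswap _ _)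
  have h1 : 𝓑.comul 𝓑.one = 𝓑.one ⊗ₜ 𝓑.one := hB.isBraidedBialgebra.comul_one
  have hi (a : A) : (rightAlg R pair β 𝓑).comul (a ⊗ₜ 𝓑.one) = sw (δ a) fun p q =>
      (q ⊗ₜ 𝓑.one) ⊗ₜ (p ⊗ₜ 𝓑.one) := by
    simp (disch := fun_prop) only [rightAlg_comul, h1, sw_tmul, hB.coact_one', mul_one]
  have hj (b : B) : (rightAlg R pair β 𝓑).comul (1 ⊗ₜ b) = sw (𝓑.comul b) fun b₁ b₂ =>
      sw (β b₁) fun u v => (1 ⊗ₜ v) ⊗ₜ (u ⊗ₜ b₂) := by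
    simp (disch := fun_prop) only [rightAlg_comul, comul_one', sw_tmul, one_mul]
  have hm (a d : A) (b : B) : (rightAlg R pair β 𝓑).mul ((a ⊗ₜ 𝓑.one) ⊗ₜ (d ⊗ₜ b)) =
      (a * d) ⊗ₜ b := by
    simp (disch := fun_prop) only [rightAlg_mul, hM.one_act', slice_counit hR hp, map_smul,
      ← TensorProduct.smul_tmul', TensorProduct.tmul_smul, counit_smul_sw, hBA.one_mul]
  have hn (a : A) (b c : B) : (rightAlg R pair β 𝓑).mul ((a ⊗ₜ b) ⊗ₜ (1 ⊗ₜ c)) =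
      a ⊗ₜ 𝓑.mul (b ⊗ₜ c) := by
    simp (disch := fun_prop) only [rightAlg_mul, comul_one', sw_tmul, slice_one hR hp, hM.act_one',
      mul_one]
  have hβ (b : B) (h : H) : β (evalAct pair β (b ⊗ₜ h)) = sw (β b) fun p q => sw (δ p) fun u v =>
      pair (h ⊗ₜ u) • v ⊗ₜ q := by
    rw [hB.coact_coassoc_sw b (F := fun u v q => pair (h ⊗ₜ u) • v ⊗ₜ[k] q) (by fun_prop)
      (by fun_prop) (by fun_prop)]
    simp only [evalAct_tmul, sw_map, map_smul, ← sw_smul_right, sw_eta]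
  refine ⟨hAl.assoc, hAl.one_mul, hAl.mul_one, hCo.coassoc, hCo.counit_comul, hCo.comul_counit,
    ?_, ?_, ?_, ?_⟩
  · refine BialgData.twist_map_mul (X := (HopfData.of k A).cop.toBialgData) (Y := 𝓑.toBialgData)
      (τ := rightTwist R pair β) (σ := rightCotwist β) hE.assoc (rightAlg R pair β 𝓑).comul
      ?_ ?_ ?_ ?_
    · intro a b
      change _ = BialgData.mul _ (_ ⊗ₜ (rightAlg R pair β 𝓑).comul (1 ⊗ₜ b))
      simp only [hi, hj, sw_tmul_left]
      simp only [rightAlg_comul, sw_tmul_right, sw_map, sq_mul_sw, hm, mul_one]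
    · intro a d
      change (rightAlg R pair β 𝓑).comul ((a * d) ⊗ₜ 𝓑.one) = _
      simp only [hi, sw_tmul_left]
      simp (disch := fun_prop) only [comul_mul_eq_sw, sw_sw, sw_tmul, sw_tmul_right, sw_map,
        sq_mul_sw, hm]
    · intro b c
      change (rightAlg R pair β 𝓑).comul (1 ⊗ₜ _) = BialgData.mul _ (
        (rightAlg R pair β 𝓑).comul (1 ⊗ₜ b) ⊗ₜ (rightAlg R pair β 𝓑).comul (1 ⊗ₜ c))
      simp only [hj, sw_tmul_left]
      simp (disch := fun_prop) only [sw_tmul_right, sw_map, sq_mul_sw, hn]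
      simp (disch := fun_prop) only [hM.comul_mul_sw, hB.coact_mul_sw, hβ, sw_sw, sw_tmul,
        rightAlg_mul, sw_smul_arg, sw_tmul_right, slice_apply, sw_map, map_smul,
        TensorProduct.tmul_smul, ← TensorProduct.smul_tmul', sw_tmul_left]
      refine sw_congr fun _ _ => ?_
      simp only [sw_comm R (β _), sw_comm R (δ _), sw_comm (β _) (𝓑.comul c)]
    · intro a b
      change _ = BialgData.mul _ ((rightAlg R pair β 𝓑).comul (1 ⊗ₜ b) ⊗ₜ
        (rightAlg R pair β 𝓑).comul (a ⊗ₜ 𝓑.one))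
      simp only [hi, hj, sw_tmul_left]
      simp only [sw_tmul_right, sw_map, sq_mul_sw, rightTwist_tmul]
      simp (disch := fun_prop) only [rightAlg_mul, rightAlg_comul, hM.comul_act_sw, sw_sw, sw_tmul,
        sw_tmul_left, sw_tmul_right, hBA.mul_one, one_mul, slice_comul hR hp, hβ, sw_smul_arg]
      simp (disch := fun_prop) only [sw_comm (δ (_ : A)) (𝓑.comul _), sw_comm (δ (_ : A)) (β _),
        comul_coassoc_sw]
      refine sw_congr fun b₁ b₂ => ?_
      have hr (p q r s : A) : (sw (β b₁) fun u v => (s ⊗ₜ[k] evalAct pair β (v ⊗ₜ slice pair R r)) ⊗ₜ[k]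
          ((u * q) ⊗ₜ[k] evalAct pair β (b₂ ⊗ₜ slice pair R p))) = sw (β b₁) fun u v =>
          sw (δ u) fun u₁ u₂ => pair (slice pair R r ⊗ₜ u₂) • (s ⊗ₜ v) ⊗ₜ
          ((u₁ * q) ⊗ₜ evalAct pair β (b₂ ⊗ₜ slice pair R p)) := by
        have := hB.coact_act_sw b₁ (slice pair R r) (F := fun (u : A) (v : B) => (s ⊗ₜ[k] v) ⊗ₜ[k]
          ((u * q) ⊗ₜ[k] evalAct pair β (b₂ ⊗ₜ slice pair R p))) (by fun_prop) (by fun_prop)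
        exact this
      conv_rhs => simp only [sw_comm (β _) (δ _), hr]
      conv_lhs => simp only [sw_comm (β _) (δ _)]
      rw [sw_congr fun x y => sw_comm (δ y) (δ x) _]
      simp (disch := fun_prop) only [comul_coassoc_sw]
      refine sw_congr fun p c => ?_
      rw [← comul_coassoc_sw c (F := fun y₁ x₁ y => sw (β b₁) fun u v => sw (δ u) fun u₁ u₂ =>
          pair (slice pair R y₁ ⊗ₜ u₁) • (y ⊗ₜ v) ⊗ₜ
            ((x₁ * u₂) ⊗ₜ evalAct pair β (b₂ ⊗ₜ slice pair R p)))
          (by fun_prop) (by fun_prop) (by fun_prop),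
        ← comul_coassoc_sw c (F := fun q r s => sw (β b₁) fun u v => sw (δ u) fun u₁ u₂ =>
          pair (slice pair R r ⊗ₜ u₂) • (s ⊗ₜ v) ⊗ₜ
            ((u₁ * q) ⊗ₜ evalAct pair β (b₂ ⊗ₜ slice pair R p)))
          (by fun_prop) (by fun_prop) (by fun_prop)]
      refine sw_congr fun m y => ?_
      simp only [sw_comm (δ m) (β b₁)]
      refine sw_congr fun u v => ?_
      exact (hA.sw_eq m u (F := fun z => (y ⊗ₜ v) ⊗ₜ
        (z ⊗ₜ evalAct pair β (b₂ ⊗ₜ slice pair R p))) (by fun_prop)).symm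
  · rw [rightAlg_one, hj, h1]
    simp (disch := fun_prop) only [sw_tmul, hB.coact_one']
  · intro a b
    revert a; refine Lin.ext_tmul (k := k) (V := A) (W := B) (by fun_prop) (by fun_prop) fun a b' => ?_
    revert b; refine Lin.ext_tmul (k := k) (V := A) (W := B) (by fun_prop) (by fun_prop) fun d c => ?_
    simp (disch := fun_prop) only [rightAlg_mul, sw_map, rightAlg_counit,
      hM.isBraidedBialgebra.counit_mul, hM.counit_act', slice_counit hR hp, Bialgebra.counit_mul]
    have h0 (x y : A) : ε a * ε y * (𝓑.counit b' * ε x * 𝓑.counit c) =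
        ε x • (ε y * (ε a * 𝓑.counit b' * 𝓑.counit c)) := by rw [smul_eq_mul]; ring
    simp (disch := fun_prop) only [h0, counit_smul_sw]
    ring
  · rw [rightAlg_one, rightAlg_counit, hM.isBraidedBialgebra.counit_one, Bialgebra.counit_one,
      mul_one]

/-- The antipode of `A^cop` is the inverse antipode, and its two axioms are those of `A^op` with
left and right exchanged. -/
theorem isAntipode_rightFactor (hR : QTri R T) (hp : DualPair pair) (hA : QComm pair R)
    (hB : IsComoduleBraidedGroup (HopfData.of k A).toBialgData pair R β 𝓑) :
    (rightAlg R pair β 𝓑).IsAntipode (rightFactor (HopfData.of k A) R pair 𝓑 β).antipode := by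
  refine BialgData.IsAntipode.twist isAlg_cop hB.isBraidedBialgebra.isAlg
    (isAlgTwist_rightTwist hR hp hB) (isCoalgTwist_rightCotwist hB)
    ?_ hB.isAntipode
  have hop := (isAntipode_of (k := k) (H := A)).op isBialgebra_of
    (self_linInv_apply (hA.bijective_antipode hR hp))
    (linInv_apply_self (hA.bijective_antipode hR hp))
  refine ⟨fun x => ?_, fun x => ?_⟩
  · rw [rTensor_eq_sw]
    simp (disch := fun_prop) only [sw_cop_comul, sw_map]
    have := hop.right x
    rw [lTensor_eq_sw] at this
    simp only [sw_map] at this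
    exact this
  · rw [lTensor_eq_sw]
    simp (disch := fun_prop) only [sw_cop_comul, sw_map]
    have := hop.left x
    rw [rTensor_eq_sw] at this
    simp only [sw_map] at this
    exact this

end RightFactor

/-! ### The inverse antipode on the legs of `R`. -/

section InverseAntipode

variable {k H Z : Type*} [Field k] [Ring H] [HopfAlgebra k H] [AddCommGroup Z] [Module k Z]
  {R T : H ⊗[k] H}

local notation "δ" => Coalgebra.comul (R := k)
local notation "ε" => Coalgebra.counit (R := k)
local notation "S" => HopfAlgebra.antipode k
local notation "S'" => linInv (HopfAlgebra.antipode k)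

namespace QTri

theorem antipode_antipode_inv_eq_sw (h : QTri R T) {F : H → H → Z}
    (h1 : ∀ y, Lin k (fun x => F x y)) (h2 : ∀ x, Lin k (fun y => F x y)) :
    (sw T fun a b => F (S a) (S b)) = sw T F := by
  rw [h.antipode_right_eq_sw (F := fun a b => F (S a) b) (by fun_prop) (by fun_prop),
    h.antipode_left_eq_sw h1 h2]

theorem linInv_antipode_inv_eq_sw (h : QTri R T) {F : H → H → Z}
    (h1 : ∀ y, Lin k (fun x => F x y)) (h2 : ∀ x, Lin k (fun y => F x y)) :
    (sw T fun a b => F (S' a) (S' b)) = sw T F := by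
  rw [← h.antipode_antipode_inv_eq_sw (F := fun a b => F (S' a) (S' b)) (by fun_prop)
    (by fun_prop)]
  simp only [linInv_apply_self h.bijective_antipode]

theorem linInv_antipode_right_eq_sw (h : QTri R T) {F : H → H → Z}
    (h1 : ∀ y, Lin k (fun x => F x y)) (h2 : ∀ x, Lin k (fun y => F x y)) :
    (sw R fun a b => F a (S' b)) = sw T F := by
  rw [← h.antipode_right_eq_sw (F := fun a b => F a (S' b)) (by fun_prop) (by fun_prop)]
  simp only [linInv_apply_self h.bijective_antipode]

theorem linInv_antipode_left_eq_sw (h : QTri R T) {F : H → H → Z}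
    (h1 : ∀ y, Lin k (fun x => F x y)) (h2 : ∀ x, Lin k (fun y => F x y)) :
    (sw R fun a b => F (S' a) b) = sw R fun a b => F a (S b) := by
  rw [← h.antipode_antipode_eq_sw (F := fun a b => F (S' a) b) (by fun_prop) (by fun_prop)]
  simp only [linInv_apply_self h.bijective_antipode]

end QTri

end InverseAntipode

/-! ### Braided antipodes, read off from the bosonisation. -/

section BraidedAntipode

variable {k H C B Z : Type*} [Field k] [Ring H] [HopfAlgebra k H] [AddCommGroup C] [Module k C]
  [AddCommGroup B] [Module k B] [AddCommGroup Z] [Module k Z] {R T : H ⊗[k] H}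
  {act : C ⊗[k] H →ₗ[k] C} {𝓒 : HopfData k C}

local notation "δ" => Coalgebra.comul (R := k)
local notation "ε" => Coalgebra.counit (R := k)
local notation "S" => HopfAlgebra.antipode k
local notation "S'" => linInv (HopfAlgebra.antipode k)

variable (act) in
/-- The projection `c ⊗ h ↦ c ◁ S h` of `C ⋊ H^op` to `C`. -/
def leftProj : C ⊗[k] H →ₗ[k] C := act ∘ₗ LinearMap.lTensor C S

theorem leftProj_tmul (c : C) (h : H) : leftProj act (c ⊗ₜ h) = act (c ⊗ₜ S h) := rfl

theorem leftFactor_antipode_tmul (c : C) (h : H) :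
    (leftFactor (HopfData.of k H) R 𝓒 act).antipode (c ⊗ₜ h) = sw R fun x y =>
      leftTwist act (S' (h * x) ⊗ₜ 𝓒.antipode (act (c ⊗ₜ y))) := by
  change (leftTwist act ∘ₗ TensorProduct.map (HopfData.of k H).op.antipode 𝓒.antipode ∘ₗ
    leftCotwist R act) (c ⊗ₜ h) = _
  simp only [LinearMap.comp_apply, leftCotwist_tmul, sw_map, TensorProduct.map_tmul]
  rfl

theorem leftProj_leftTwist (hC : IsModuleBraidedGroup (HopfData.of k H).toBialgData R act 𝓒)
    (h : H) (c : C) : leftProj act (leftTwist act (h ⊗ₜ c)) = ε h • c := by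
  simp only [leftTwist_tmul, sw_map, leftProj_tmul, hC.act_act]
  rw [antipode_right_sw h (F := fun z => act (c ⊗ₜ z)) (by fun_prop), hC.act_one']

/-- The antipode of the bosonisation produces elements with the factor from `H` on the left, and of
such a factor the projection keeps only the counit. So the braided antipode is visible inside an
ordinary one. -/
theorem leftProj_antipode (hR : QTri R T)
    (hC : IsModuleBraidedGroup (HopfData.of k H).toBialgData R act 𝓒) (c : C) (h : H) :
    leftProj act ((leftFactor (HopfData.of k H) R 𝓒 act).antipode (c ⊗ₜ h)) =
      ε h • 𝓒.antipode c := by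
  have h0 (x : H) : ε (S' x) = ε x := by
    conv_rhs => rw [← self_linInv_apply hR.bijective_antipode x, counit_antipode']
  simp (disch := fun_prop) only [leftFactor_antipode_tmul, sw_map, leftProj_leftTwist hC, h0,
    Bialgebra.counit_mul, mul_smul, ← sw_smul_right, hR.counit_left_sw, hC.act_one']

theorem leftProj_mul (hC : IsModuleBraidedGroup (HopfData.of k H).toBialgData R act 𝓒)
    (z : C ⊗[k] H) (d : C) (g : H) : leftProj act ((leftAlg R act 𝓒).mul (z ⊗ₜ (d ⊗ₜ g))) =
      act (𝓒.mul (leftProj act z ⊗ₜ d) ⊗ₜ S g) := by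
  revert z; refine Lin.ext_tmul (by fun_prop) (by fun_prop) fun c h => ?_
  simp (disch := fun_prop) only [leftAlg_mul, sw_map, leftProj_tmul, antipode_mul_rev,
    ← hC.act_act]
  have h0 (p q : H) : act (𝓒.mul (c ⊗ₜ act (d ⊗ₜ p)) ⊗ₜ S q) = sw (δ q) fun u v =>
      𝓒.mul (act (c ⊗ₜ S v) ⊗ₜ act (d ⊗ₜ (p * S u))) := by
    simp (disch := fun_prop) only [hC.mul_act_sw, comul_antipode_eq_sw, sw_sw, sw_tmul, hC.act_act]
  simp only [h0, sw_map, sw_tmul_left]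
  rw [← comul_coassoc_sw h (F := fun p u v => act ((𝓒.mul (act (c ⊗ₜ S v) ⊗ₜ
    act (d ⊗ₜ (p * S u)))) ⊗ₜ S g)) (by fun_prop) (by fun_prop) (by fun_prop)]
  have h1 (a v : H) : (sw (δ a) fun p u => act ((𝓒.mul (act (c ⊗ₜ S v) ⊗ₜ
    act (d ⊗ₜ (p * S u)))) ⊗ₜ S g)) = ε a • act ((𝓒.mul (act (c ⊗ₜ S v) ⊗ₜ
    act (d ⊗ₜ 1))) ⊗ₜ S g) := antipode_right_sw a (F := fun z => act ((𝓒.mul (act (c ⊗ₜ S v) ⊗ₜ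
    act (d ⊗ₜ z))) ⊗ₜ S g)) (by fun_prop)
  simp (disch := fun_prop) only [h1, counit_smul_sw, hC.act_one']

/-- The braided antipode is braided antimultiplicative. -/
theorem antipode_mul_sw (hR : QTri R T)
    (hC : IsModuleBraidedGroup (HopfData.of k H).toBialgData R act 𝓒) (c d : C) :
    𝓒.antipode (𝓒.mul (c ⊗ₜ d)) = sw R fun x y =>
      𝓒.mul (act (𝓒.antipode d ⊗ₜ x) ⊗ₜ act (𝓒.antipode c ⊗ₜ y)) := by
  have hX := isBialgebra_leftAlg hR hC
  -- Antimultiplicativity of the ordinary antipode, projected to `C`, becomes the braided rule.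
  have h0 := (isAntipode_leftFactor hR hC).map_mul hX (c ⊗ₜ 1) (d ⊗ₜ 1)
  rw [leftAlg_mul_inl hC] at h0
  have h1 := congrArg (leftProj act) h0
  rw [leftProj_antipode hR hC, Bialgebra.counit_one, one_smul] at h1
  rw [h1]
  have h2 : ∀ z w, leftProj act ((leftAlg R act 𝓒).mul (z ⊗ₜ w)) = sw w fun d g =>
      act (𝓒.mul (leftProj act z ⊗ₜ d) ⊗ₜ S g) := by
    intro z w
    revert w; refine Lin.ext_tmul (by fun_prop) (by fun_prop) fun d g => ?_
    simp (disch := fun_prop) only [leftProj_mul hC, sw_tmul]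
  rw [h2, leftProj_antipode hR hC, Bialgebra.counit_one, one_smul]
  simp (disch := fun_prop) only [leftFactor_antipode_tmul, one_mul, sw_sw, hC.antipode_act']
  rw [hR.linInv_antipode_left_eq_sw (F := fun x y => sw (leftTwist act (x ⊗ₜ
      act (𝓒.antipode c ⊗ₜ y))) fun x y => act ((𝓒.mul (𝓒.antipode d ⊗ₜ x)) ⊗ₜ S y))
      (by fun_prop) (by fun_prop)]
  simp (disch := fun_prop) only [leftTwist_tmul, sw_sw, sw_tmul, hC.act_act, hC.mul_act_sw,
    comul_antipode_eq_sw]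
  have h3 (x y : H) : (sw (δ x) fun p q => sw (δ q) fun u v =>
      𝓒.mul (act (𝓒.antipode d ⊗ₜ S v) ⊗ₜ act (𝓒.antipode c ⊗ₜ (S y * p * S u)))) =
      𝓒.mul (act (𝓒.antipode d ⊗ₜ S x) ⊗ₜ act (𝓒.antipode c ⊗ₜ S y)) := by
    rw [← comul_coassoc_sw x (F := fun p u v => 𝓒.mul (act (𝓒.antipode d ⊗ₜ S v) ⊗ₜ
      act (𝓒.antipode c ⊗ₜ (S y * p * S u)))) (by fun_prop) (by fun_prop) (by fun_prop)]
    have h4 (a v : H) : (sw (δ a) fun p u => 𝓒.mul (act (𝓒.antipode d ⊗ₜ S v) ⊗ₜ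
      act (𝓒.antipode c ⊗ₜ (S y * p * S u)))) = ε a • 𝓒.mul (act (𝓒.antipode d ⊗ₜ S v) ⊗ₜ
      act (𝓒.antipode c ⊗ₜ S y)) := by
      simp only [mul_assoc]
      rw [antipode_right_sw a (F := fun z => 𝓒.mul (act (𝓒.antipode d ⊗ₜ S v) ⊗ₜ
      act (𝓒.antipode c ⊗ₜ (S y * z)))) (by fun_prop), mul_one]
    simp (disch := fun_prop) only [h4, counit_smul_sw]
  simp only [h3]
  exact hR.antipode_antipode_eq_sw (F := fun x y => 𝓒.mul (act (𝓒.antipode d ⊗ₜ x) ⊗ₜ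
    act (𝓒.antipode c ⊗ₜ y))) (by fun_prop) (by fun_prop)

/-- Moving `Δ(S h)` across `R⁻¹` matches the two sides. The twisted coproduct that appears is the
one of `C̄`. -/
theorem map_leftProj_comul (hR : QTri R T)
    (hC : IsModuleBraidedGroup (HopfData.of k H).toBialgData R act 𝓒) (z : C ⊗[k] H) :
    TensorProduct.map (leftProj act) (leftProj act) ((leftAlg R act 𝓒).comul z) =
      sw (𝓒.comul (leftProj act z)) fun c d => sw T fun x y =>
        act (c ⊗ₜ x) ⊗ₜ act (d ⊗ₜ y) := by
  revert z; refine Lin.ext_tmul (by fun_prop) (by fun_prop) fun c h => ?_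
  simp (disch := fun_prop) only [leftAlg_comul, sw_map, TensorProduct.map_tmul, leftProj_tmul,
    antipode_mul_rev, hC.comul_act_sw, sw_sw, sw_tmul, hC.act_act]
  refine sw_congr fun c d => ?_
  rw [hR.quasi_inv_sw (S h) (F := fun x y => act (c ⊗ₜ x) ⊗ₜ act (d ⊗ₜ y)) (by fun_prop)
    (by fun_prop)]
  simp (disch := fun_prop) only [comul_antipode_eq_sw, sw_sw, sw_tmul]
  refine sw_congr fun p q => ?_
  rw [hR.antipode_left_eq_sw (F := fun x y => act (c ⊗ₜ (x * S p)) ⊗ₜ act (d ⊗ₜ (y * S q)))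
    (by fun_prop) (by fun_prop)]

/-- The braided antipode is braided anticomultiplicative. -/
theorem comul_antipode_sw (hR : QTri R T)
    (hC : IsModuleBraidedGroup (HopfData.of k H).toBialgData R act 𝓒) (c : C) {F : C → C → Z}
    (hl : ∀ y, Lin k (fun x => F x y)) (hr : ∀ x, Lin k (fun y => F x y)) :
    (sw (𝓒.comul (𝓒.antipode c)) fun c d => sw T fun x y => F (act (c ⊗ₜ x)) (act (d ⊗ₜ y))) =
      sw (𝓒.comul c) fun c d => F (𝓒.antipode d) (𝓒.antipode c) := by
  have hX := isBialgebra_leftAlg hR hC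
  have h0 := map_leftProj_comul hR hC ((leftFactor (HopfData.of k H) R 𝓒 act).antipode (c ⊗ₜ 1))
  rw [(isAntipode_leftFactor hR hC).comul_antipode hX (c ⊗ₜ 1), leftProj_antipode hR hC,
    Bialgebra.counit_one, one_smul] at h0
  simp (disch := fun_prop) only [leftAlg_comul, comul_one', sw_sw, sw_tmul, sw_map,
    TensorProduct.map_tmul, leftProj_antipode hR hC, Bialgebra.counit_one, one_smul, one_mul,
    TensorProduct.tmul_smul, hR.counit_left_sw, hC.act_one'] at h0
  have h1 := congrArg (fun t => sw t F) h0
  simpa (disch := fun_prop) only [sw_sw, sw_tmul] using h1.symm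

theorem antipode_one_of (hC : IsModuleBraidedGroup (HopfData.of k H).toBialgData R act 𝓒) :
    𝓒.antipode 𝓒.one = 𝓒.one := by
  have := hC.isAntipode.left 𝓒.one
  rwa [hC.isBraidedBialgebra.comul_one, LinearMap.rTensor_tmul, hC.isBraidedBialgebra.mul_one,
    hC.isBraidedBialgebra.counit_one, one_smul] at this

theorem counit_antipode_of (hC : IsModuleBraidedGroup (HopfData.of k H).toBialgData R act 𝓒)
    (c : C) : 𝓒.counit (𝓒.antipode c) = 𝓒.counit c := by
  have h1 := hC.isAntipode.left_sw c (F := 𝓒.counit) (by fun_prop)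
  simp only [hC.isBraidedBialgebra.counit_mul, hC.isBraidedBialgebra.counit_one, smul_eq_mul,
    mul_one] at h1
  rw [← h1, ← hC.isCoalg.smul_counit c (F := fun x => 𝓒.counit (𝓒.antipode x)) (by fun_prop)]
  simp only [smul_eq_mul, mul_comm]

end BraidedAntipode

/-! ### The pairing `ev(S⁻¹c, b)`. -/

section CategoricalPairing

variable {k H C B Z : Type*} [Field k] [Ring H] [HopfAlgebra k H] [AddCommGroup C] [Module k C]
  [AddCommGroup B] [Module k B] [AddCommGroup Z] [Module k Z] {R T : H ⊗[k] H}
  {act : C ⊗[k] H →ₗ[k] C} {𝓒 : HopfData k C} {actB : B ⊗[k] H →ₗ[k] B} {𝓑 : HopfData k B}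
  {ev : C ⊗[k] B →ₗ[k] k}

local notation "δ" => Coalgebra.comul (R := k)
local notation "ε" => Coalgebra.counit (R := k)
local notation "S" => HopfAlgebra.antipode k
local notation "S'" => linInv (HopfAlgebra.antipode k)

/-- Invariance, applied to `c` and `b ◁ S⁻¹h₍₃₎`, leaves `S⁻¹(h₍₃₎)h₍₂₎` acting on `b`, which
collapses. -/
theorem IsCategoricalPairing.act_left (hR : QTri R T)
    (hB : IsModuleBraidedGroup (HopfData.of k H).toBialgData R actB 𝓑)
    (hev : IsCategoricalPairing (HopfData.of k H).toBialgData act actB 𝓒.toBialgData 𝓑.toBialgData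
      ev) (c : C) (b : B) (h : H) : ev (act (c ⊗ₜ h) ⊗ₜ b) = ev (c ⊗ₜ actB (b ⊗ₜ S' h)) := by
  have h0 (c b) (h : H) : (sw (δ h) fun p q => ev (act (c ⊗ₜ p) ⊗ₜ actB (b ⊗ₜ q))) =
      ε h • ev (c ⊗ₜ b) := by
    have := hev.invariant c b h
    simp (disch := fun_prop) only [tensorAct_eq_sw, sw_tmul, sw_map] at this
    rw [this, mul_comm, smul_eq_mul]; rfl
  have h1 : (sw (δ h) fun x z => sw (δ x) fun p q =>
      ev (act (c ⊗ₜ p) ⊗ₜ actB (actB (b ⊗ₜ S' z) ⊗ₜ q))) =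
      ev (c ⊗ₜ actB (b ⊗ₜ S' h)) := by
    simp (disch := fun_prop) only [h0, counit_smul_sw]
  rw [← h1, comul_coassoc_sw h (F := fun p q z =>
    ev (act (c ⊗ₜ p) ⊗ₜ actB (actB (b ⊗ₜ S' z) ⊗ₜ q))) (by fun_prop) (by fun_prop) (by fun_prop)]
  have h2 (p r : H) : (sw (δ r) fun q z =>
      ev (act (c ⊗ₜ p) ⊗ₜ actB (actB (b ⊗ₜ S' z) ⊗ₜ q))) = ε r • ev (act (c ⊗ₜ p) ⊗ₜ b) := by
    simp only [hB.act_act]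
    rw [linInv_antipode_left_sw hR r (F := fun z => ev (act (c ⊗ₜ p) ⊗ₜ actB (b ⊗ₜ z)))
      (by fun_prop), hB.act_one']
  simp (disch := fun_prop) only [h2, smul_counit_sw]

variable (ev 𝓒) in
/-- The pairing `ev(S⁻¹c, b)`. -/
def evInv : C ⊗[k] B →ₗ[k] k := ev ∘ₗ LinearMap.rTensor B (linInv 𝓒.antipode)

theorem evInv_tmul (c : C) (b : B) :
    evInv 𝓒 ev (c ⊗ₜ b) = ev (linInv 𝓒.antipode c ⊗ₜ b) := rfl

/-- The properties of the pairing `ev(S⁻¹c, b)`. -/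
structure InvPairing (T : H ⊗[k] H) (act : C ⊗[k] H →ₗ[k] C) (actB : B ⊗[k] H →ₗ[k] B)
    (𝓒 : HopfData k C) (𝓑 : HopfData k B) (e : C ⊗[k] B →ₗ[k] k) : Prop where
  act_left : ∀ (c : C) (b : B) (h : H), e (act (c ⊗ₜ h) ⊗ₜ b) = e (c ⊗ₜ actB (b ⊗ₜ S' h))
  act_right : ∀ (c : C) (b : B) (h : H), e (c ⊗ₜ actB (b ⊗ₜ h)) = e (act (c ⊗ₜ S h) ⊗ₜ b)
  mul_left : ∀ (c d : C) (b : B), e (𝓒.mul (c ⊗ₜ d) ⊗ₜ b) = sw (𝓑.comul b) fun b₁ b₂ =>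
    sw T fun x y => e (c ⊗ₜ actB (b₁ ⊗ₜ x)) * e (d ⊗ₜ actB (b₂ ⊗ₜ y))
  mul_right : ∀ (c : C) (a b : B), e (c ⊗ₜ 𝓑.mul (a ⊗ₜ b)) = sw (𝓒.comul c) fun c₁ c₂ =>
    sw T fun x y => e (c₁ ⊗ₜ actB (a ⊗ₜ x)) * e (c₂ ⊗ₜ actB (b ⊗ₜ y))
  one_left : ∀ b : B, e (𝓒.one ⊗ₜ b) = 𝓑.counit b
  one_right : ∀ c : C, e (c ⊗ₜ 𝓑.one) = 𝓒.counit c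

/-- The inverse antipode undoes the reversals in a categorical pairing. The braided antipode
reverses products and coproducts only up to the action of `R`, so a copy of `R⁻¹` remains in each
multiplicativity rule. -/
theorem invPairing (hR : QTri R T)
    (hC : IsModuleBraidedGroup (HopfData.of k H).toBialgData R act 𝓒)
    (hS : Function.Bijective 𝓒.antipode)
    (hB : IsModuleBraidedGroup (HopfData.of k H).toBialgData R actB 𝓑)
    (hev : IsCategoricalPairing (HopfData.of k H).toBialgData act actB 𝓒.toBialgData 𝓑.toBialgData
      ev) : InvPairing T act actB 𝓒 𝓑 (evInv 𝓒 ev) := by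
  have hl (c : C) (b : B) (h : H) : evInv 𝓒 ev (act (c ⊗ₜ h) ⊗ₜ b) =
      evInv 𝓒 ev (c ⊗ₜ actB (b ⊗ₜ S' h)) := by
    rw [evInv_tmul, hC.linInv_antipode_act hS, hev.act_left hR hB, evInv_tmul]
  have hml (c d b) : ev (𝓒.mul (c ⊗ₜ d) ⊗ₜ b) = sw (𝓑.comul b) fun b₁ b₂ =>
      ev (d ⊗ₜ b₁) * ev (c ⊗ₜ b₂) := by
    rw [hev.mul_left, mul_map_interchange]
    simp (disch := fun_prop) only [sw_tmul]
  have hmr (c a b) : ev (c ⊗ₜ 𝓑.mul (a ⊗ₜ b)) = sw (𝓒.comul c) fun c₁ c₂ =>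
      ev (c₂ ⊗ₜ a) * ev (c₁ ⊗ₜ b) := by
    rw [hev.mul_right, mul_map_interchange]
    simp (disch := fun_prop) only [sw_tmul, sw_tswap]
  have hevS (c b) : ev (c ⊗ₜ b) = evInv 𝓒 ev (𝓒.antipode c ⊗ₜ b) := by
    rw [evInv_tmul, linInv_apply_self hS]
  refine ⟨hl, fun c b h => by rw [hl, linInv_apply_self hR.bijective_antipode], ?_, ?_, ?_, ?_⟩
  · intro c d b
    -- Every element is a value of the braided antipode, so the reversal rules are needed for `S`
    -- only and not for `S⁻¹`.
    obtain ⟨c, rfl⟩ := hS.2 c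
    obtain ⟨d, rfl⟩ := hS.2 d
    have h0 : 𝓒.mul (𝓒.antipode c ⊗ₜ 𝓒.antipode d) = 𝓒.antipode (sw T fun x y =>
        𝓒.mul (act (d ⊗ₜ y) ⊗ₜ act (c ⊗ₜ x))) := by
      simp only [sw_map, antipode_mul_sw hR hC, hC.antipode_act', hC.act_act]
      rw [hR.inv_mul_sw (F := fun x y => 𝓒.mul (act (𝓒.antipode c ⊗ₜ x) ⊗ₜ
        act (𝓒.antipode d ⊗ₜ y))) (by fun_prop) (by fun_prop), hC.act_one', hC.act_one']
    rw [h0, ← hevS]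
    simp only [sw_tmul_left, sw_map, hml, hevS, hC.antipode_act', hl]
    rw [sw_comm]
    refine sw_congr fun b₁ b₂ => ?_
    exact hR.linInv_antipode_inv_eq_sw (F := fun x y => evInv 𝓒 ev (𝓒.antipode c ⊗ₜ
      actB (b₁ ⊗ₜ x)) * evInv 𝓒 ev (𝓒.antipode d ⊗ₜ actB (b₂ ⊗ₜ y))) (by fun_prop) (by fun_prop)
  · intro c a b
    obtain ⟨c, rfl⟩ := hS.2 c
    rw [← hevS, hmr]
    simp only [hevS]
    rw [← comul_antipode_sw hR hC c (F := fun x y => evInv 𝓒 ev (x ⊗ₜ a) * evInv 𝓒 ev (y ⊗ₜ b))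
      (by fun_prop) (by fun_prop)]
    refine sw_congr fun c d => ?_
    simp only [hl]
    exact hR.linInv_antipode_inv_eq_sw (F := fun x y => evInv 𝓒 ev (c ⊗ₜ
      actB (a ⊗ₜ x)) * evInv 𝓒 ev (d ⊗ₜ actB (b ⊗ₜ y))) (by fun_prop) (by fun_prop)
  · intro b
    rw [← antipode_one_of hC, ← hevS, hev.one_left]
  · intro c
    obtain ⟨c, rfl⟩ := hS.2 c
    rw [← hevS, hev.one_right, counit_antipode_of hC]

end CategoricalPairing

/-! ### The identities in `H` behind the pairing of the bosonisations. -/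

section HopfIdentities

variable {k H Z : Type*} [Field k] [Ring H] [HopfAlgebra k H] [AddCommGroup Z] [Module k Z]
  {R T : H ⊗[k] H}

local notation "δ" => Coalgebra.comul (R := k)
local notation "ε" => Coalgebra.counit (R := k)
local notation "S" => HopfAlgebra.antipode k
local notation "S'" => linInv (HopfAlgebra.antipode k)

namespace QTri

/-- Yang–Baxter reorders the three copies of `R⁻¹`, and quasi-cocommutativity carries the legs of
`h` past them until one of them stands next to `S⁻¹(h₍₁₎)` and cancels it. -/
theorem mul_left_aux (hR : QTri R T) (h : H) {F : H → H → H → Z}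
    (h1 : ∀ y z, Lin k (fun x => F x y z)) (h2 : ∀ x z, Lin k (fun y => F x y z))
    (h3 : ∀ x y, Lin k (fun z => F x y z)) :
    (sw (δ h) fun p q => sw (δ q) fun q₁ r => sw (δ r) fun q₂ q₃ => sw T fun x y =>
      sw T fun c d => sw T fun e f => F (q₁ * (x * c)) (q₂ * (y * e)) (q₃ * (d * f) * S' p)) =
    sw (δ h) fun h₁ h₂ => sw T fun e f => sw T fun c d => sw T fun x y =>
      F (c * h₁ * x) (e * h₂ * y) (f * d) := by
  have s1 (p q₁ r : H) : (sw (δ r) fun q₂ q₃ => sw T fun x y =>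
      sw T fun c d => sw T fun e f => F (q₁ * (x * c)) (q₂ * (y * e)) (q₃ * (d * f) * S' p)) =
      sw (δ r) fun q₂ q₃ => sw T fun e f => sw T fun c d => sw T fun x y =>
        F (q₁ * c * x) (e * q₃ * y) (f * q₂ * d * S' p) := by
    have s2 := hR.quasi_inv_sw r (F := fun u v => sw T fun c d => sw T fun x y =>
      F (q₁ * c * x) (u * y) (v * d * S' p)) (by fun_prop) (by fun_prop)
    rw [← s2]
    refine sw_congr fun q₂ q₃ => ?_
    rw [hR.yangBaxter_inv_sw (F := fun u v w => F (q₁ * u) (q₂ * v) (q₃ * w * S' p)) (by fun_prop)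
      (by fun_prop) (by fun_prop)]
    rw [sw_congr fun _ _ => sw_comm T T _, sw_comm T T, sw_congr fun _ _ => sw_comm T T _]
    simp only [mul_assoc]
  have s3 (p q : H) : (sw (δ q) fun q₁ r => sw (δ r) fun q₂ q₃ => sw T fun e f => sw T fun c d =>
      sw T fun x y => F (q₁ * c * x) (e * q₃ * y) (f * q₂ * d * S' p)) =
      sw (δ q) fun q₁ r => sw (δ r) fun q₂ q₃ => sw T fun e f => sw T fun c d =>
      sw T fun x y => F (c * q₂ * x) (e * q₃ * y) (f * d * (q₁ * S' p)) := by
    rw [← comul_coassoc_sw q (F := fun q₁ q₂ q₃ => sw T fun e f => sw T fun c d =>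
      sw T fun x y => F (q₁ * c * x) (e * q₃ * y) (f * q₂ * d * S' p)) (by fun_prop) (by fun_prop)
      (by fun_prop), ← comul_coassoc_sw q (F := fun q₁ q₂ q₃ => sw T fun e f => sw T fun c d =>
      sw T fun x y => F (c * q₂ * x) (e * q₃ * y) (f * d * (q₁ * S' p))) (by fun_prop)
      (by fun_prop) (by fun_prop)]
    refine sw_congr fun m q₃ => ?_
    simp only [sw_comm (δ m) T]
    refine sw_congr fun e f => ?_
    have s4 := hR.quasi_inv_sw m (F := fun u v => sw T fun x y =>
      F (u * x) (e * q₃ * y) (f * v * S' p)) (by fun_prop) (by fun_prop)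
    simpa only [mul_assoc, sw_comm (δ m) T] using s4
  simp only [s1, s3]
  rw [← comul_coassoc_sw h (F := fun p q₁ r => sw (δ r) fun q₂ q₃ => sw T fun e f =>
    sw T fun c d => sw T fun x y => F (c * q₂ * x) (e * q₃ * y) (f * d * (q₁ * S' p)))
    (by fun_prop) (by fun_prop) (by fun_prop)]
  have s5 (m r : H) : (sw (δ m) fun p q₁ => sw (δ r) fun q₂ q₃ => sw T fun e f =>
      sw T fun c d => sw T fun x y => F (c * q₂ * x) (e * q₃ * y) (f * d * (q₁ * S' p))) =
      ε m • sw (δ r) fun q₂ q₃ => sw T fun e f =>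
      sw T fun c d => sw T fun x y => F (c * q₂ * x) (e * q₃ * y) (f * d * 1) :=
    linInv_antipode_right_sw hR m (F := fun z => sw (δ r) fun q₂ q₃ => sw T fun e f =>
      sw T fun c d => sw T fun x y => F (c * q₂ * x) (e * q₃ * y) (f * d * z)) (by fun_prop)
  simp only [s5]
  rw [counit_smul_sw h (F := fun r => sw (δ r) fun q₂ q₃ => sw T fun e f =>
      sw T fun c d => sw T fun x y => F (c * q₂ * x) (e * q₃ * y) (f * d * 1)) (by fun_prop)]
  simp only [mul_one]

/-- With `F` standing for the product of all evaluations, this is the multiplicativity of the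
pairing in `X`; `h` and `g` are the components in `H` of the two factors. -/
theorem mul_left_identity (hR : QTri R T) (g h : H) {F : H → H → H → Z}
    (h1 : ∀ y z, Lin k (fun x => F x y z)) (h2 : ∀ x z, Lin k (fun y => F x y z))
    (h3 : ∀ x y, Lin k (fun z => F x y z)) :
    (sw (δ h) fun p q => sw T fun x y => sw (δ (g * q)) fun u v => sw (δ (v * y)) fun m n =>
      sw T fun e f => F (u * x) (m * e) (n * f * S' p)) =
    sw T fun x y => sw (δ h) fun p q => sw T fun x' y' => sw (δ g) fun p' q' =>
      sw (δ (p' * x')) fun s t => F (s * (p * x)) (t * (q * y)) (q' * y') := by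
  trans sw (δ g) fun g₁ g' => sw (δ g') fun g₂ g₃ => sw (δ h) fun p q => sw (δ q) fun q₁ r =>
      sw (δ r) fun q₂ q₃ => sw T fun x y => sw T fun c d => sw T fun e f =>
      F (g₁ * (q₁ * (x * c))) (g₂ * (q₂ * (y * e))) (g₃ * (q₃ * (d * f) * S' p))
  · simp (disch := fun_prop) only [comul_mul_eq_sw, sw_sw, sw_tmul]
    simp only [sw_comm T (δ _)]
    rw [sw_comm (δ h) (δ g)]
    refine sw_congr fun g₁ g' => ?_
    simp only [sw_comm (δ _) (δ g')]
    iterate 4 refine sw_congr fun _ _ => ?_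
    rename_i g₂ g₃ p q q₁ r q₂ q₃
    rw [hR.comul_right_inv_sw (F := fun a u v => sw T fun e f =>
      F (g₁ * q₁ * a) (g₂ * q₂ * u * e) (g₃ * q₃ * v * f * S' p)) (by fun_prop) (by fun_prop)
      (by fun_prop)]
    simp only [mul_assoc]
  · have s1 (g₁ g₂ g₃ : H) := hR.mul_left_aux h (F := fun u v w => F (g₁ * u) (g₂ * v) (g₃ * w))
      (by fun_prop) (by fun_prop) (by fun_prop)
    simp only [s1]
    simp (disch := fun_prop) only [comul_mul_eq_sw, sw_sw, sw_tmul]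
    simp only [sw_comm T (δ _)]
    simp only [sw_comm (δ h) (δ _)]
    simp (disch := fun_prop) only [comul_coassoc_sw]
    iterate 3 refine sw_congr fun _ _ => ?_
    rename_i g₁ g' g₂ g₃ p q
    rw [sw_comm T T, sw_congr fun _ _ => sw_comm T T _, sw_comm T T]
    refine sw_congr fun x y => ?_
    rw [hR.comul_left_inv_sw (F := fun u v z => F (g₁ * u * (p * x)) (g₂ * v * (q * y)) (g₃ * z))
      (by fun_prop) (by fun_prop) (by fun_prop)]
    simp only [mul_assoc]

/-- Expanding the coproducts makes a copy of `R` adjacent to a copy of `R⁻¹`. They cancel, and the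
rest is the Yang–Baxter equation. -/
theorem mul_right_aux (hR : QTri R T) {F : H → H → H → H → Z}
    (h1 : ∀ y z w, Lin k (fun x => F x y z w)) (h2 : ∀ x z w, Lin k (fun y => F x y z w))
    (h3 : ∀ x y w, Lin k (fun z => F x y z w)) (h4 : ∀ x y z, Lin k (fun w => F x y z w)) :
    (sw T fun x y => sw (δ x) fun x₁ x₂ => sw (δ y) fun y₁ y₂ => sw R fun u v => sw T fun e f =>
      F x₁ (u * x₂) (v * y₁ * e) (y₂ * f)) =
    sw T fun s₁ s₂ => sw T fun t₁ t₂ => sw T fun x y => sw (δ x) fun x₁ x₂ =>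
      F (x₁ * t₁) s₁ (x₂ * t₂) (s₂ * y) := by
  rw [hR.comul_left_inv_sw (F := fun x₁ x₂ y => sw (δ y) fun y₁ y₂ => sw R fun u v =>
    sw T fun e f => F x₁ (u * x₂) (v * y₁ * e) (y₂ * f)) (by fun_prop) (by fun_prop) (by fun_prop)]
  have s1 (s₁ s₂ t₁ t₂ : H) := hR.comul_left_inv_sw (F := fun x₁ x₂ y =>
    F (x₁ * t₁) s₁ (x₂ * t₂) (s₂ * y)) (by fun_prop) (by fun_prop) (by fun_prop)
  simp only [s1]
  rw [sw_comm T T]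
  simp (disch := fun_prop) only [comul_mul_eq_sw, sw_sw, sw_tmul]
  simp only [sw_comm T (δ _)]
  rw [hR.comul_right_inv_sw (F := fun c p q => sw T fun a b => sw (δ b) fun r s =>
    sw R fun u v => sw T fun e f => F a (u * c) (v * (p * r) * e) (q * s * f)) (by fun_prop)
    (by fun_prop) (by fun_prop)]
  have s2 (c d c' d' : H) := hR.comul_right_inv_sw (F := fun a r s =>
    sw R fun u v => sw T fun e f => F a (u * (c * c')) (v * (d * r) * e) (d' * s * f)) (by fun_prop)
    (by fun_prop) (by fun_prop)
  simp only [s2]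
  simp only [sw_comm T R]
  have s3 := hR.mul_inv_sw (F := fun u v => sw T fun c' d' => sw T fun a b => sw T fun a' b' =>
    sw T fun e f => F (a * a') (u * c') (v * (b * e)) (d' * b' * f)) (by fun_prop) (by fun_prop)
  simp only [mul_assoc, one_mul] at s3 ⊢
  rw [s3]
  have s4 (c d : H) := hR.yangBaxter_inv_sw (F := fun x y z => F x c y (d * z)) (by fun_prop)
    (by fun_prop) (by fun_prop)
  simp only [s4]

/-- The counterpart for products in `Y`. The copy of `R` comes from that product on the left-hand
side and from the coproduct of `X` on the right-hand side. -/
theorem mul_right_identity (hR : QTri R T) (h : H) {F : H → H → H → H → Z}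
    (h1 : ∀ y z w, Lin k (fun x => F x y z w)) (h2 : ∀ x z w, Lin k (fun y => F x y z w))
    (h3 : ∀ x y w, Lin k (fun z => F x y z w)) (h4 : ∀ x y z, Lin k (fun w => F x y z w)) :
    (sw T fun x y => sw (δ h) fun p q => sw (δ (p * x)) fun s t => sw (δ (q * y)) fun m n =>
      sw R fun u v => sw T fun e f => F s (u * t) (v * (m * e)) (n * f)) =
    sw (δ h) fun p q => sw R fun x y => sw T fun t₁ t₂ => sw (δ (p * x)) fun p₁ p₂ =>
      sw T fun s₁ s₂ => sw (δ q) fun q₁ q₂ =>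
        F (p₁ * t₁) (q₁ * s₁) (p₂ * t₂) (q₂ * (s₂ * S' y)) := by
  trans sw (δ h) fun h₁ r => sw (δ r) fun m h₄ => sw (δ m) fun p q => sw T fun x y =>
    sw (δ x) fun x₁ x₂ => sw (δ y) fun y₁ y₂ => sw R fun u v => sw T fun e f =>
      F (h₁ * x₁) ((u * p) * x₂) ((v * q) * (y₁ * e)) (h₄ * (y₂ * f))
  · simp (disch := fun_prop) only [comul_mul_eq_sw, sw_sw, sw_tmul, comul_coassoc_sw]
    simp only [sw_comm T (δ _)]
    iterate 2 refine sw_congr fun _ _ => ?_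
    rename_i h₁ r p q
    simp only [sw_comm _ (δ q), mul_assoc]
  have s1 (h₁ h₄ m : H) : (sw (δ m) fun p q => sw T fun x y =>
    sw (δ x) fun x₁ x₂ => sw (δ y) fun y₁ y₂ => sw R fun u v => sw T fun e f =>
      F (h₁ * x₁) ((u * p) * x₂) ((v * q) * (y₁ * e)) (h₄ * (y₂ * f))) =
      sw (δ m) fun p q => sw T fun s₁ s₂ => sw T fun t₁ t₂ => sw T fun x y =>
        sw (δ x) fun x₁ x₂ =>  F (h₁ * (x₁ * t₁)) (q * s₁) (p * (x₂ * t₂)) (h₄ * (s₂ * y)) := by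
    have s2 (p q : H) := hR.mul_right_aux (F := fun x y z w =>
      F (h₁ * x) (q * y) (p * z) (h₄ * w)) (by fun_prop) (by fun_prop) (by fun_prop) (by fun_prop)
    simp only [← s2]
    have s3 := hR.quasi_sw m (F := fun z w => sw T fun x y =>
      sw (δ x) fun x₁ x₂ => sw (δ y) fun y₁ y₂ => sw T fun e f =>
      F (h₁ * x₁) (z * x₂) (w * (y₁ * e)) (h₄ * (y₂ * f))) (by fun_prop) (by fun_prop)
    simp only [sw_comm R (δ _), sw_comm R T] at s3 ⊢
    simp only [mul_assoc] at s3 ⊢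
    exact s3.symm
  simp only [s1]
  simp (disch := fun_prop) only [comul_mul_eq_sw, sw_sw, sw_tmul, comul_coassoc_sw]
  trans sw (δ h) fun p q => sw (δ p) fun p₁ p₂ => sw (δ q) fun q₁ q₂ => sw R fun x y =>
    sw (δ x) fun x₁ x₂ => sw T fun s₁ s₂ => sw T fun t₁ t₂ =>
      F (p₁ * (x₁ * t₁)) (q₁ * s₁) (p₂ * (x₂ * t₂)) (q₂ * (s₂ * S' y))
  · simp (disch := fun_prop) only [comul_coassoc_sw]
    iterate 3 refine sw_congr fun _ _ => ?_
    rename_i h₁ _ p _ q r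
    have := hR.linInv_antipode_right_eq_sw (F := fun x y => sw (δ x) fun x₁ x₂ =>
      sw T fun s₁ s₂ => sw T fun t₁ t₂ => F (h₁ * (x₁ * t₁)) (q * s₁) (p * (x₂ * t₂))
        (r * (s₂ * y))) (by fun_prop) (by fun_prop)
    rw [this]
    simp only [sw_comm (δ _) T]
    exact (sw_congr fun _ _ => sw_comm T T _).trans (sw_comm T T _)
  · refine sw_congr fun p q => ?_
    simp only [sw_comm _ (δ p)]
    refine sw_congr fun p₁ p₂ => ?_
    simp only [sw_comm _ (δ q)]
    refine sw_congr fun q₁ q₂ => ?_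
    simp only [sw_comm (δ _) T]
    rw [sw_congr fun _ _ => sw_comm T T _]
    simp only [mul_assoc]

end QTri
end HopfIdentities

/-! ### The bosonisations are dually paired. -/

section Pairing

variable {k H A C B Z : Type*} [Field k] [Ring H] [HopfAlgebra k H] [Ring A] [HopfAlgebra k A]
  [AddCommGroup C] [Module k C] [AddCommGroup B] [Module k B] [AddCommGroup Z] [Module k Z]
  {R T : H ⊗[k] H} {pair : H ⊗[k] A →ₗ[k] k} {act : C ⊗[k] H →ₗ[k] C} {β : B →ₗ[k] A ⊗[k] B}
  {𝓒 : HopfData k C} {𝓑 : HopfData k B} {ev : C ⊗[k] B →ₗ[k] k}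

local notation "δ" => Coalgebra.comul (R := k)
local notation "ε" => Coalgebra.counit (R := k)
local notation "S" => HopfAlgebra.antipode k
local notation "S'" => linInv (HopfAlgebra.antipode k)
local notation "◁" => evalAct pair β

theorem factorPairing_tmul (c : C) (h : H) (a : A) (b : B) :
    factorPairing (HopfData.of k H) T pair 𝓒 β ev ((c ⊗ₜ h) ⊗ₜ (a ⊗ₜ b)) =
      sw T fun x y => sw (δ h) fun p q => pair ((p * x) ⊗ₜ a) *
        evInv 𝓒 ev (c ⊗ₜ evalAct pair β (b ⊗ₜ (q * y))) := by
  have h0 : ((HopfData.of k H).op.sqMul tswap ∘ₗ tensorLeft (H ⊗[k] H) (tswap (tswap T)) ∘ₗ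
      (HopfData.of k H).op.comul) h = sw T fun x y => sw (δ h) fun p q => (p * x) ⊗ₜ (q * y) := by
    rw [tswap_tswap]
    simp only [LinearMap.comp_apply, TensorProduct.mk_apply, BialgData.sqMul_tswap_eq_sw, op_mul]
    rfl
  rw [factorPairing, bosonisationPairing]
  simp only [LinearMap.comp_apply, LinearMap.rTensor_tmul, TensorProduct.map_tmul] at h0 ⊢
  rw [h0]
  simp only [sw_tmul_left, sw_tmul_right, sw_map, LinearEquiv.coe_coe, TensorProduct.assoc_tmul,
    LinearMap.lTensor_tmul, LinearMap.comp_apply, TensorProduct.tensorTensorTensorComm_tmul,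
    TensorProduct.map_tmul, TensorProduct.lid_tmul, coevalAct_tmul, TensorProduct.tmul_smul,
    map_smul, smul_eq_mul, evInv_tmul]

/-- In each multiplicativity rule the coproducts of `b` and `c` match term by term, and what remains
is an identity in `H` in which the evaluations enter only as a multilinear map. -/
theorem isHopfPairing_factorPairing (hR : QTri R T)
    (hp : DualPair pair)
    (hB : IsComoduleBraidedGroup (HopfData.of k A).toBialgData pair R β 𝓑)
    (hI : InvPairing T act (evalAct pair β) 𝓒 𝓑 (evInv 𝓒 ev)) :
    IsHopfPairing (leftAlg R act 𝓒) (rightAlg R pair β 𝓑)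
      (factorPairing (HopfData.of k H) T pair 𝓒 β ev) :=
  have hM := hB.isModuleBraidedGroup hp
  {
  mul_left x x' y := by
    revert x; refine Lin.ext_tmul (by fun_prop) (by fun_prop) fun c h => ?_
    revert x'; refine Lin.ext_tmul (by fun_prop) (by fun_prop) fun d g => ?_
    revert y; refine Lin.ext_tmul (k := k) (V := A) (W := B) (by fun_prop) (by fun_prop) fun a b => ?_
    rw [mul_map_interchange, sw_tmul _ _ (by fun_prop) (by fun_prop)]
    -- Only the first factor `t` of the acting element is turned back into a coaction: it is the one
    -- paired with the coaction in the coproduct of `Y`.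
    have hb (b' : B) (t z w : H) : evInv 𝓒 ev (c ⊗ₜ evalAct pair β (b' ⊗ₜ (t * (z * w)))) =
        sw (β b') fun u v => pair (t ⊗ₜ u) * evInv 𝓒 ev (c ⊗ₜ evalAct pair β (v ⊗ₜ (z * w))) := by
      rw [← hM.act_act, evalAct_tmul pair β b' t]
      simp only [sw_tmul_left, sw_tmul_right, sw_map, map_smul, ← TensorProduct.smul_tmul',
        TensorProduct.tmul_smul, smul_eq_mul]
    have key (b₁ b₂ : B) := hR.mul_left_identity g h (F := fun u v w => pair (u ⊗ₜ a) *
      (evInv 𝓒 ev (c ⊗ₜ evalAct pair β (b₁ ⊗ₜ v)) * evInv 𝓒 ev (d ⊗ₜ evalAct pair β (b₂ ⊗ₜ w))))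
      (by fun_prop) (by fun_prop) (by fun_prop)
    trans sw (𝓑.comul b) fun b₁ b₂ => sw (δ h) fun p q => sw T fun x y => sw (δ (g * q)) fun u v =>
      sw (δ (v * y)) fun m n => sw T fun e f => pair ((u * x) ⊗ₜ a) *
        (evInv 𝓒 ev (c ⊗ₜ evalAct pair β (b₁ ⊗ₜ (m * e))) *
          evInv 𝓒 ev (d ⊗ₜ evalAct pair β (b₂ ⊗ₜ (n * f * S' p))))
    · simp (disch := fun_prop) only [leftAlg_mul, sw_map, sw_tmul_left, factorPairing_tmul,
        hI.mul_left, hM.comul_act_sw, hI.act_left, hM.act_act, sw_mul_left, sw_mul_right, sw_sw,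
        sw_tmul]
      simp only [sw_comm _ (𝓑.comul b), mul_assoc]
    · simp only [key]
      have ha (s z : H) := hp.mul_left s z a
      simp (disch := fun_prop) only [rightAlg_comul, sw_sw, sw_tmul, factorPairing_tmul, ha,
        hp.mul_right, hb, sw_mul_left, sw_mul_right]
      simp only [sw_comm _ (δ a)]
      refine sw_congr fun a₁ a₂ => sw_congr fun b₁ b₂ => ?_
      simp only [sw_comm _ (β b₁)]
      refine sw_congr fun u v => ?_
      simp only [sw_comm _ (δ h)]
      refine sw_congr fun p q => ?_
      simp only [sw_comm (δ _) T]
      rw [sw_comm T T]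
      iterate 4 refine sw_congr fun _ _ => ?_
      ring
  mul_right x y y' := by
    revert x; refine Lin.ext_tmul (by fun_prop) (by fun_prop) fun c h => ?_
    revert y; refine Lin.ext_tmul (k := k) (V := A) (W := B) (by fun_prop) (by fun_prop) fun a b => ?_
    revert y'; refine Lin.ext_tmul (k := k) (V := A) (W := B) (by fun_prop) (by fun_prop) fun d b' => ?_
    rw [mul_map_interchange]
    have key (c₁ c₂ : C) := hR.mul_right_identity h (F := fun x y z w => pair (x ⊗ₜ a) *
      (pair (y ⊗ₜ d) * (evInv 𝓒 ev (c₁ ⊗ₜ evalAct pair β (b ⊗ₜ z)) *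
        evInv 𝓒 ev (c₂ ⊗ₜ evalAct pair β (b' ⊗ₜ w)))))
      (by fun_prop) (by fun_prop) (by fun_prop) (by fun_prop)
    trans sw (𝓒.comul c) fun c₁ c₂ => sw T fun x y => sw (δ h) fun p q => sw (δ (p * x)) fun s t =>
      sw (δ (q * y)) fun m n => sw R fun u v => sw T fun e f => pair (s ⊗ₜ a) *
      (pair ((u * t) ⊗ₜ d) * (evInv 𝓒 ev (c₁ ⊗ₜ evalAct pair β (b ⊗ₜ (v * (m * e)))) *
        evInv 𝓒 ev (c₂ ⊗ₜ evalAct pair β (b' ⊗ₜ (n * f)))))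
    · have hd (s z : H) := hp.mul_left s z d
      have hg (c : C) (b : B) (d : A) (h : H) : evInv 𝓒 ev (c ⊗ₜ evalAct pair β (b ⊗ₜ
          (slice pair R d * h))) = sw R fun u v => pair (u ⊗ₜ d) * evInv 𝓒 ev (c ⊗ₜ
            evalAct pair β (b ⊗ₜ (v * h))) := by
        rw [slice_apply]
        simp only [sw_mul_left, sw_tmul_right, sw_map, map_smul, smul_mul_assoc,
          TensorProduct.tmul_smul, smul_eq_mul]
      simp (disch := fun_prop) only [rightAlg_mul, sw_map, sw_tmul_right, factorPairing_tmul,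
        hI.mul_right, hp.mul_right, hM.mul_act_sw, hM.act_act, sw_mul_left, sw_mul_right, sw_sw,
        sw_tmul, mul_assoc, hg, hd]
      simp only [sw_comm _ (𝓒.comul c)]
      refine sw_congr fun c₁ c₂ => ?_
      simp only [sw_comm _ (δ d)]
      refine sw_congr fun d₁ d₂ => ?_
      iterate 2 refine sw_congr fun _ _ => ?_
      rename_i x y p q
      simp only [sw_comm _ (δ (p * x))]
      refine sw_congr fun _ _ => sw_congr fun _ _ => ?_
      rw [sw_comm R T]
      iterate 2 refine sw_congr fun _ _ => ?_
      ring
    · simp only [key]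
      simp (disch := fun_prop) only [leftAlg_comul, sw_sw, sw_tmul, factorPairing_tmul,
        hI.act_left, hM.act_act, sw_mul_left, sw_mul_right]
      iterate 3 refine sw_congr fun _ _ => ?_
      rename_i _ _ p q x y
      simp only [sw_comm _ (δ q)]
      refine sw_congr fun _ _ => ?_
      simp only [sw_comm _ (δ (p * x))]
      refine sw_congr fun _ _ => ?_
      rw [sw_comm T T]
      iterate 2 refine sw_congr fun _ _ => ?_
      simp only [mul_assoc]
      ring
  one_left y := by
    revert y; refine Lin.ext_tmul (k := k) (V := A) (W := B) (by fun_prop) (by fun_prop) fun a b => ?_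
    simp (disch := fun_prop) only [leftAlg_one, factorPairing_tmul, comul_one', sw_tmul, one_mul,
      hI.one_left, hM.counit_act', rightAlg_counit]
    have := hR.counit_right_inv_sw (F := fun x => pair (x ⊗ₜ a) * 𝓑.counit b) (by fun_prop)
    rw [hp.one_left] at this
    rw [← this]
    refine sw_congr fun _ _ => ?_
    rw [smul_eq_mul]
    ring
  one_right x := by
    revert x; refine Lin.ext_tmul (by fun_prop) (by fun_prop) fun c h => ?_
    simp (disch := fun_prop) only [rightAlg_one, factorPairing_tmul, hp.one_right, hM.one_act',
      TensorProduct.tmul_smul, map_smul, hI.one_right, leftAlg_counit, Bialgebra.counit_mul]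
    have h1 : ∀ x y p q : H, ε p * ε x * (ε q * ε y) • 𝓒.counit c =
        (ε x • ε y) * (ε p • ε q) * 𝓒.counit c := fun x y p q => by simp only [smul_eq_mul]; ring
    simp only [h1, ← sw_mul_left, ← sw_mul_right]
    rw [counit_smul_sw h (F := fun x => ε x) (by fun_prop),
      hR.counit_left_inv_sw (F := fun x => ε x) (by fun_prop), Bialgebra.counit_one]
    ring
  }

end Pairing

/-! ### Transport of structure along a surjective homomorphism. -/

section Push

variable {k V W : Type*} [Field k] [AddCommGroup V] [Module k V] [AddCommGroup W] [Module k W]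
  {𝓧 : BialgData k V} {𝓨 : BialgData k W} {f : V →ₗ[k] W}

namespace BialgData

theorem IsHom.map_sqMul (hf : 𝓧.IsHom 𝓨 f) (s t : V ⊗[k] V) :
    TensorProduct.map f f (𝓧.sqMul tswap (s ⊗ₜ t)) =
      𝓨.sqMul tswap (TensorProduct.map f f s ⊗ₜ TensorProduct.map f f t) := by
  simp (disch := fun_prop) only [sqMul_tswap_eq_sw, sw_map, TensorProduct.map_tmul, hf.map_mul,
    sw_map_tensor]

theorem IsHom.map_tswap (s : V ⊗[k] V) :
    tswap (TensorProduct.map f f s) = TensorProduct.map f f (tswap s) := by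
  simp (disch := fun_prop) only [tswap_eq_sw, sw_map_tensor, sw_map, TensorProduct.map_tmul]

/-- Only structure maps are given on the target. All its elements lift, so each axiom is the image
of the same axiom upstairs; this spares every direct computation in the double-bosonisation. -/
theorem IsHom.isBialgebra (hf : 𝓧.IsHom 𝓨 f) (hX : 𝓧.IsBialgebra)
    (hs : Function.Surjective f) : 𝓨.IsBialgebra where
  mul_assoc x y z := by
    obtain ⟨x, rfl⟩ := hs x
    obtain ⟨y, rfl⟩ := hs y
    obtain ⟨z, rfl⟩ := hs z
    simp only [← hf.map_mul, hX.mul_assoc]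
  one_mul x := by
    obtain ⟨x, rfl⟩ := hs x
    rw [← hf.map_one, ← hf.map_mul, hX.one_mul]
  mul_one x := by
    obtain ⟨x, rfl⟩ := hs x
    rw [← hf.map_one, ← hf.map_mul, hX.mul_one]
  coassoc x := by
    obtain ⟨x, rfl⟩ := hs x
    have := congrArg (TensorProduct.map f (TensorProduct.map f f)) (hX.coassoc x)
    simp only [assoc_rTensor_eq_sw, lTensor_comul_eq_sw, sw_map, TensorProduct.map_tmul] at this
    simp (disch := fun_prop) only [hf.map_comul, assoc_rTensor_eq_sw, lTensor_comul_eq_sw,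
      sw_map_tensor]
    exact this
  counit_comul x := by
    obtain ⟨x, rfl⟩ := hs x
    conv_rhs => rw [← hX.counit_comul x]
    simp (disch := fun_prop) only [hf.map_comul, rTensor_eq_sw, sw_map, sw_map_tensor,
      hf.map_counit, TensorProduct.lid_tmul, map_smul]
  comul_counit x := by
    obtain ⟨x, rfl⟩ := hs x
    conv_rhs => rw [← hX.comul_counit x]
    simp (disch := fun_prop) only [hf.map_comul, lTensor_eq_sw, sw_map, sw_map_tensor,
      hf.map_counit, TensorProduct.rid_tmul, map_smul]
  comul_mul x y := by
    obtain ⟨x, rfl⟩ := hs x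
    obtain ⟨y, rfl⟩ := hs y
    rw [← hf.map_mul, hf.map_comul, hX.comul_mul, hf.map_sqMul, ← hf.map_comul, ← hf.map_comul]
  comul_one := by rw [← hf.map_one, hf.map_comul, hX.comul_one, TensorProduct.map_tmul]
  counit_mul x y := by
    obtain ⟨x, rfl⟩ := hs x
    obtain ⟨y, rfl⟩ := hs y
    simp only [← hf.map_mul, hf.map_counit, hX.counit_mul]
  counit_one := by rw [← hf.map_one, hf.map_counit, hX.counit_one]

theorem IsHom.isAntipode (hf : 𝓧.IsHom 𝓨 f) (hs : Function.Surjective f) {S : V →ₗ[k] V}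
    {S' : W →ₗ[k] W} (hS : 𝓧.IsAntipode S) (h : f ∘ₗ S = S' ∘ₗ f) : 𝓨.IsAntipode S' := by
  have h' (x) : S' (f x) = f (S x) := (LinearMap.congr_fun h x).symm
  refine ⟨fun x => ?_, fun x => ?_⟩ <;> obtain ⟨x, rfl⟩ := hs x
  · rw [hf.map_counit, ← hf.map_one, ← map_smul, ← hS.left x]
    simp (disch := fun_prop) only [hf.map_comul, rTensor_eq_sw, sw_map, sw_map_tensor, h',
      hf.map_mul]
  · rw [hf.map_counit, ← hf.map_one, ← map_smul, ← hS.right x]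
    simp (disch := fun_prop) only [hf.map_comul, lTensor_eq_sw, sw_map, sw_map_tensor, h',
      hf.map_mul]

theorem IsHom.isQuasitriangular (hf : 𝓧.IsHom 𝓨 f) (hs : Function.Surjective f)
    {R T : V ⊗[k] V} (hR : 𝓧.IsQuasitriangular R T) :
    𝓨.IsQuasitriangular (TensorProduct.map f f R) (TensorProduct.map f f T) where
  mul_inv := by rw [← hf.map_sqMul, hR.mul_inv, TensorProduct.map_tmul, hf.map_one]
  inv_mul := by rw [← hf.map_sqMul, hR.inv_mul, TensorProduct.map_tmul, hf.map_one]
  comul_left := by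
    have := congrArg (TensorProduct.map (TensorProduct.map f f) f) hR.comul_left
    simp only [r13r23, rTensor_eq_sw, interchange_eq_sw, sw_map, TensorProduct.map_tmul,
      LinearMap.lTensor_tmul, hf.map_mul] at this
    simp (disch := fun_prop) only [r13r23, rTensor_eq_sw, interchange_eq_sw, sw_map,
      LinearMap.lTensor_tmul, hf.map_comul, sw_map_tensor]
    exact this
  comul_right := by
    have := congrArg (TensorProduct.map f (TensorProduct.map f f)) hR.comul_right
    simp only [r13r12, lTensor_eq_sw, interchange_eq_sw, sw_map, TensorProduct.map_tmul,
      LinearEquiv.coe_coe, TensorProduct.comm_tmul, hf.map_mul] at this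
    simp (disch := fun_prop) only [r13r12, lTensor_eq_sw, interchange_eq_sw, sw_map,
      TensorProduct.map_tmul, LinearEquiv.coe_coe, TensorProduct.comm_tmul, hf.map_comul,
      sw_map_tensor]
    exact this
  quasicocomm x := by
    obtain ⟨x, rfl⟩ := hs x
    rw [hf.map_comul, IsHom.map_tswap, ← hf.map_sqMul, hR.quasicocomm, hf.map_sqMul]

end BialgData
end Push

/-! ### Antipode and quasitriangular structure of the double. -/

section DoubleHopf

variable {k X Y Z : Type*} [Field k] [AddCommGroup X] [Module k X] [AddCommGroup Y] [Module k Y]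
  [AddCommGroup Z] [Module k Z] {𝓧 : HopfData k X} {𝓨 : HopfData k Y} {P : X ⊗[k] Y →ₗ[k] k}

/-- The antipode of the generalised double. -/
def doubleAntipode (𝓧 : HopfData k X) (𝓨 : HopfData k Y) (P : X ⊗[k] Y →ₗ[k] k) :
    X ⊗[k] Y →ₗ[k] X ⊗[k] Y :=
  doubleTwist 𝓧.toBialgData 𝓨 P ∘ₗ TensorProduct.map 𝓨.antipode (linInv 𝓧.antipode) ∘ₗ tswap

theorem isAntipode_op (hX : 𝓧.IsBialgebra) (hSX : 𝓧.IsAntipode 𝓧.antipode)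
    (hbij : Function.Bijective 𝓧.antipode) : 𝓧.toBialgData.op.IsAntipode (linInv 𝓧.antipode) :=
  hSX.op hX (self_linInv_apply hbij) (linInv_apply_self hbij)

theorem isAntipode_doubleAntipode (hX : 𝓧.IsBialgebra) (hY : 𝓨.IsBialgebra)
    (hSX : 𝓧.IsAntipode 𝓧.antipode) (hbij : Function.Bijective 𝓧.antipode)
    (hSY : 𝓨.IsAntipode 𝓨.antipode) (hP : IsHopfPairing 𝓧.toBialgData 𝓨.toBialgData P) :
    (generalisedDouble 𝓧 𝓨 P).IsAntipode (doubleAntipode 𝓧 𝓨 P) :=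
  BialgData.IsAntipode.twist hX.op.isAlg hY.isAlg (isAlgTwist_doubleTwist hX hY hSY hP)
    (BialgData.isCoalgTwist_tswap _ _) (isAntipode_op hX hSX hbij) hSY

theorem double_mul_inl (hX : 𝓧.IsBialgebra) (hY : 𝓨.IsBialgebra)
    (hSY : 𝓨.IsAntipode 𝓨.antipode) (hP : IsHopfPairing 𝓧.toBialgData 𝓨.toBialgData P)
    (x x' : X) (y : Y) :
    (generalisedDouble 𝓧 𝓨 P).mul ((x ⊗ₜ 𝓨.one) ⊗ₜ (x' ⊗ₜ y)) = 𝓧.mul (x' ⊗ₜ x) ⊗ₜ y :=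
  BialgData.twist_mul_inl hY.isAlg (isAlgTwist_doubleTwist hX hY hSY hP) x x' y

theorem double_mul_inr (hX : 𝓧.IsBialgebra) (hY : 𝓨.IsBialgebra)
    (hSY : 𝓨.IsAntipode 𝓨.antipode) (hP : IsHopfPairing 𝓧.toBialgData 𝓨.toBialgData P)
    (x : X) (y y' : Y) :
    (generalisedDouble 𝓧 𝓨 P).mul ((x ⊗ₜ y) ⊗ₜ (𝓧.one ⊗ₜ y')) = x ⊗ₜ 𝓨.mul (y ⊗ₜ y') :=
  BialgData.twist_mul_inr hX.op.isAlg (isAlgTwist_doubleTwist hX hY hSY hP) x y y'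

theorem double_mul_inr_inl (hX : 𝓧.IsBialgebra) (hY : 𝓨.IsBialgebra) (x : X) (y : Y) :
    (generalisedDouble 𝓧 𝓨 P).mul ((𝓧.one ⊗ₜ y) ⊗ₜ (x ⊗ₜ 𝓨.one)) =
      doubleTwist 𝓧.toBialgData 𝓨 P (y ⊗ₜ x) :=
  BialgData.twist_mul_inr_inl hX.op.isAlg hY.isAlg x y

theorem double_one : (generalisedDouble 𝓧 𝓨 P).one = 𝓧.one ⊗ₜ 𝓨.one := rfl

theorem double_comul (x : X) (y : Y) : (generalisedDouble 𝓧 𝓨 P).comul (x ⊗ₜ y) =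
    sw (𝓧.comul x) fun x₁ x₂ => sw (𝓨.comul y) fun y₁ y₂ => (x₁ ⊗ₜ y₁) ⊗ₜ (x₂ ⊗ₜ y₂) := by
  rw [generalisedDouble_eq, BialgData.twist_comul]
  simp (disch := fun_prop) only [sw_tswap, sw_tmul]
  rfl

theorem double_counit (x : X) (y : Y) : (generalisedDouble 𝓧 𝓨 P).counit (x ⊗ₜ y) =
    𝓧.counit x * 𝓨.counit y := BialgData.twist_counit _ _ _ _ _ _

theorem doubleAntipode_inl (hX : 𝓧.IsBialgebra) (hY : 𝓨.IsBialgebra)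
    (hSY : 𝓨.IsAntipode 𝓨.antipode) (hP : IsHopfPairing 𝓧.toBialgData 𝓨.toBialgData P) (x : X) :
    doubleAntipode 𝓧 𝓨 P (x ⊗ₜ 𝓨.one) = linInv 𝓧.antipode x ⊗ₜ 𝓨.one := by
  simp only [doubleAntipode, LinearMap.comp_apply, LinearEquiv.coe_coe, TensorProduct.comm_tmul,
    TensorProduct.map_tmul, hSY.map_one hY]
  exact (isAlgTwist_doubleTwist hX hY hSY hP).one_tmul _

theorem doubleAntipode_inr (hX : 𝓧.IsBialgebra) (hY : 𝓨.IsBialgebra)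
    (hSX : 𝓧.IsAntipode 𝓧.antipode) (hbij : Function.Bijective 𝓧.antipode)
    (hSY : 𝓨.IsAntipode 𝓨.antipode) (hP : IsHopfPairing 𝓧.toBialgData 𝓨.toBialgData P) (y : Y) :
    doubleAntipode 𝓧 𝓨 P (𝓧.one ⊗ₜ y) = 𝓧.one ⊗ₜ 𝓨.antipode y := by
  have : linInv 𝓧.antipode 𝓧.one = 𝓧.one :=
    BialgData.IsAntipode.map_one (X := 𝓧.toBialgData.op) hX.op (isAntipode_op hX hSX hbij)
  simp only [doubleAntipode, LinearMap.comp_apply, LinearEquiv.coe_coe, TensorProduct.comm_tmul,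
    TensorProduct.map_tmul, this]
  exact (isAlgTwist_doubleTwist hX hY hSY hP).tmul_one _

section Canonical

variable {t : X ⊗[k] Y}

theorem IsCanonicalElement.right_sw (ht : IsCanonicalElement P t) (y : Y) {F : Y → Z}
    (hF : Lin k F) : (sw t fun f e => P (f ⊗ₜ y) • F e) = F y := by
  have h := LinearMap.congr_fun ht.right y
  rw [slice_apply, LinearMap.id_apply] at h
  have h0 : F = (IsLinearMap.mk' F ⟨hF.add, hF.smul⟩ : Y →ₗ[k] Z) := rfl
  rw [h0]
  conv_rhs => rw [← h]
  simp only [sw_map, map_smul]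

theorem IsCanonicalElement.left_sw (ht : IsCanonicalElement P t) (x : X) {F : X → Z}
    (hF : Lin k F) : (sw t fun f e => P (x ⊗ₜ e) • F f) = F x := by
  have h := LinearMap.congr_fun ht.left x
  rw [slice_apply, LinearMap.id_apply, sw_tswap _ _ (by fun_prop) (by fun_prop)] at h
  have h0 : F = (IsLinearMap.mk' F ⟨hF.add, hF.smul⟩ : X →ₗ[k] Z) := rfl
  rw [h0]
  conv_rhs => rw [← h]
  simp only [sw_map, map_smul, LinearMap.comp_apply, LinearEquiv.coe_coe, TensorProduct.comm_tmul]

/-- Both legs of the coproduct are expanded in the canonical element; the pairing then converts the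
coproduct on `X` into the product on `Y`. -/
theorem IsCanonicalElement.comul_left_sw (ht : IsCanonicalElement P t)
    (hP : IsHopfPairing 𝓧.toBialgData 𝓨.toBialgData P) {F : X → X → Y → Z}
    (h1 : ∀ y z, Lin k (fun x => F x y z)) (h2 : ∀ x z, Lin k (fun y => F x y z))
    (h3 : ∀ x y, Lin k (fun z => F x y z)) :
    (sw t fun f e => sw (𝓧.comul f) fun f₁ f₂ => F f₁ f₂ e) =
      sw t fun f e => sw t fun f' e' => F f f' (𝓨.mul (e ⊗ₜ e')) := by
  have e1 (x y : X) (z : Y) : F x y z = sw t fun f e => sw t fun f' e' =>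
      (P (x ⊗ₜ e) * P (y ⊗ₜ e')) • F f f' z := by
    simp (disch := fun_prop) only [mul_smul, ← sw_smul_right, ht.left_sw]
  rw [sw_congr fun f e => sw_congr fun f₁ f₂ => e1 f₁ f₂ e]
  simp only [sw_comm (𝓧.comul _) t, ← sw_smul_left, ← hP.mul_right_sw]
  rw [sw_comm t t, sw_congr fun _ _ => sw_comm t t _]
  simp (disch := fun_prop) only [ht.right_sw]

theorem IsCanonicalElement.comul_right_sw (ht : IsCanonicalElement P t)
    (hP : IsHopfPairing 𝓧.toBialgData 𝓨.toBialgData P) {F : X → Y → Y → Z}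
    (h1 : ∀ y z, Lin k (fun x => F x y z)) (h2 : ∀ x z, Lin k (fun y => F x y z))
    (h3 : ∀ x y, Lin k (fun z => F x y z)) :
    (sw t fun f e => sw (𝓨.comul e) fun e₁ e₂ => F f e₁ e₂) =
      sw t fun f e => sw t fun f' e' => F (𝓧.mul (f ⊗ₜ f')) e e' := by
  have e1 (x : X) (y z : Y) : F x y z = sw t fun f e => sw t fun f' e' =>
      (P (f ⊗ₜ y) * P (f' ⊗ₜ z)) • F x e e' := by
    simp (disch := fun_prop) only [mul_smul, ← sw_smul_right, ht.right_sw]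
  rw [sw_congr fun f e => sw_congr fun e₁ e₂ => e1 f e₁ e₂]
  simp only [sw_comm (𝓨.comul _) t, ← sw_smul_left, ← hP.mul_left_sw]
  rw [sw_comm t t, sw_congr fun _ _ => sw_comm t t _]
  simp (disch := fun_prop) only [ht.left_sw]

/-- Evaluations on the outer legs of `e` become multiplications around `f`. In this way a reordering
in the double is carried out on the canonical element. -/
theorem IsCanonicalElement.antipode_left_sw (ht : IsCanonicalElement P t) (hX : 𝓧.IsCoalg)
    (hY : 𝓨.IsCoalg) (hSX : 𝓧.IsAntipode 𝓧.antipode) (hSY : 𝓨.IsAntipode 𝓨.antipode)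
    (hP : IsHopfPairing 𝓧.toBialgData 𝓨.toBialgData P) (p q : X) {F : X → Y → Z}
    (h1 : ∀ y, Lin k (fun x => F x y)) (h2 : ∀ x, Lin k (fun y => F x y)) :
    (sw t fun f e => sw (𝓨.comul e) fun e₁ r => sw (𝓨.comul r) fun e₂ e₃ =>
      P (p ⊗ₜ 𝓨.antipode e₁) • P (q ⊗ₜ e₃) • F f e₂) =
    sw t fun f e => F (𝓧.mul (𝓧.antipode p ⊗ₜ 𝓧.mul (f ⊗ₜ q))) e := by
  simp only [← hP.antipode_adjoint hX hY hSX hSY]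
  rw [ht.comul_right_sw hP (F := fun f e₁ r => sw (𝓨.comul r) fun e₂ e₃ =>
      P (𝓧.antipode p ⊗ₜ e₁) • P (q ⊗ₜ e₃) • F f e₂) (by fun_prop) (by fun_prop) (by fun_prop)]
  have h3 (f : X) (e : Y) := ht.comul_right_sw hP (F := fun f' e₂ e₃ =>
      P (𝓧.antipode p ⊗ₜ e) • P (q ⊗ₜ e₃) • F (𝓧.mul (f ⊗ₜ f')) e₂) (by fun_prop) (by fun_prop)
      (by fun_prop)
  simp only [h3]
  simp (disch := fun_prop) only [← sw_smul_right, ht.left_sw]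

theorem IsCanonicalElement.antipode_right_sw (ht : IsCanonicalElement P t)
    (hP : IsHopfPairing 𝓧.toBialgData 𝓨.toBialgData P) (p q : Y) {F : X → Y → Z}
    (h1 : ∀ y, Lin k (fun x => F x y)) (h2 : ∀ x, Lin k (fun y => F x y)) :
    (sw t fun f e => sw (𝓧.comul f) fun f₁ r => sw (𝓧.comul r) fun f₂ f₃ =>
      P (f₁ ⊗ₜ 𝓨.antipode p) • P (f₃ ⊗ₜ q) • F f₂ e) =
    sw t fun f e => F f (𝓨.mul (𝓨.antipode p ⊗ₜ 𝓨.mul (e ⊗ₜ q))) := by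
  rw [ht.comul_left_sw hP (F := fun f₁ r e => sw (𝓧.comul r) fun f₂ f₃ =>
      P (f₁ ⊗ₜ 𝓨.antipode p) • P (f₃ ⊗ₜ q) • F f₂ e) (by fun_prop) (by fun_prop) (by fun_prop)]
  have h3 (f : X) (e : Y) := ht.comul_left_sw hP (F := fun f₂ f₃ e' =>
      P (f ⊗ₜ 𝓨.antipode p) • P (f₃ ⊗ₜ q) • F f₂ (𝓨.mul (e ⊗ₜ e'))) (by fun_prop) (by fun_prop)
      (by fun_prop)
  simp only [h3]
  simp (disch := fun_prop) only [← sw_smul_right, ht.right_sw]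

theorem doubleR_eq_sw (t : X ⊗[k] Y) : doubleR 𝓧.toBialgData 𝓨.toBialgData t =
    sw t fun f e => (f ⊗ₜ 𝓨.one) ⊗ₜ (𝓧.one ⊗ₜ e) := by
  rw [doubleR, map_eq_sw]
  rfl

/-- The coproduct formulas for `R` are duality of product and coproduct. The inverse comes from the
antipode of `X^op`, which is the inverse antipode of `X`. Quasi-cocommutativity is stable under
products, so it is verified on `X` and on `Y`, where an adjacent pair `a · S p` collapses. -/
theorem isQuasitriangular_doubleR (hX : 𝓧.IsBialgebra) (hY : 𝓨.IsBialgebra)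
    (hSX : 𝓧.IsAntipode 𝓧.antipode) (hbij : Function.Bijective 𝓧.antipode)
    (hSY : 𝓨.IsAntipode 𝓨.antipode) (hP : IsHopfPairing 𝓧.toBialgData 𝓨.toBialgData P)
    (ht : IsCanonicalElement P t) :
    (generalisedDouble 𝓧 𝓨 P).IsQuasitriangular (doubleR 𝓧.toBialgData 𝓨.toBialgData t)
      (sw t fun f e => (linInv 𝓧.antipode f ⊗ₜ 𝓨.one) ⊗ₜ (𝓧.one ⊗ₜ e)) := by
  have hS' := isAntipode_op hX hSX hbij
  have hl := double_mul_inl hX hY hSY hP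
  have hr := double_mul_inr hX hY hSY hP
  refine ⟨?_, ?_, ?_, ?_, ?_⟩
  · rw [BialgData.sqMul_tswap_eq_sw, doubleR_eq_sw]
    simp (disch := fun_prop) only [sw_sw, sw_tmul, hl, hr, hX.one_mul]
    rw [← ht.comul_left_sw hP (F := fun f f' e => (𝓧.mul (linInv 𝓧.antipode f' ⊗ₜ f) ⊗ₜ[k] 𝓨.one) ⊗ₜ[k]
      (𝓧.one ⊗ₜ[k] e)) (by fun_prop) (by fun_prop) (by fun_prop)]
    have h1 (x : X) (e : Y) := hS'.right_sw x (F := fun f => (f ⊗ₜ[k] 𝓨.one) ⊗ₜ[k]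
      (𝓧.one ⊗ₜ[k] e)) (by fun_prop)
    simp only [BialgData.sw_op_mul] at h1
    refine (sw_congr fun f e => h1 f e).trans ?_
    change (sw t fun f e => 𝓧.counit f • (𝓧.one ⊗ₜ[k] 𝓨.one) ⊗ₜ[k] (𝓧.one ⊗ₜ[k] e)) = _
    simp only [← hP.one_right]
    rw [ht.right_sw 𝓨.one (F := fun e => (𝓧.one ⊗ₜ[k] 𝓨.one) ⊗ₜ[k] (𝓧.one ⊗ₜ[k] e))
      (by fun_prop)]
    rfl
  · rw [BialgData.sqMul_tswap_eq_sw, doubleR_eq_sw]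
    simp (disch := fun_prop) only [sw_sw, sw_tmul, hl, hr, hX.one_mul]
    rw [← ht.comul_left_sw hP (F := fun f f' e => (𝓧.mul (f' ⊗ₜ linInv 𝓧.antipode f) ⊗ₜ[k] 𝓨.one) ⊗ₜ[k]
      (𝓧.one ⊗ₜ[k] e)) (by fun_prop) (by fun_prop) (by fun_prop)]
    have h1 (x : X) (e : Y) := hS'.left_sw x (F := fun f => (f ⊗ₜ[k] 𝓨.one) ⊗ₜ[k]
      (𝓧.one ⊗ₜ[k] e)) (by fun_prop)
    simp only [BialgData.sw_op_mul] at h1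
    refine (sw_congr fun f e => h1 f e).trans ?_
    change (sw t fun f e => 𝓧.counit f • (𝓧.one ⊗ₜ[k] 𝓨.one) ⊗ₜ[k] (𝓧.one ⊗ₜ[k] e)) = _
    simp only [← hP.one_right]
    rw [ht.right_sw 𝓨.one (F := fun e => (𝓧.one ⊗ₜ[k] 𝓨.one) ⊗ₜ[k] (𝓧.one ⊗ₜ[k] e))
      (by fun_prop)]
    rfl
  · rw [doubleR_eq_sw, BialgData.r13r23, interchange_eq_sw]
    simp (disch := fun_prop) only [rTensor_eq_sw, sw_sw, sw_tmul, sw_map, LinearMap.lTensor_tmul,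
      double_comul, hY.comul_one, sw_tmul_left, hr]
    exact ht.comul_left_sw hP (F := fun f f' e => ((f ⊗ₜ[k] 𝓨.one) ⊗ₜ[k] (f' ⊗ₜ[k] 𝓨.one)) ⊗ₜ[k]
      (𝓧.one ⊗ₜ[k] e)) (by fun_prop) (by fun_prop) (by fun_prop)
  · rw [doubleR_eq_sw, BialgData.r13r12, interchange_eq_sw]
    simp (disch := fun_prop) only [lTensor_eq_sw, sw_sw, sw_tmul, sw_map, TensorProduct.map_tmul,
      LinearEquiv.coe_coe, TensorProduct.comm_tmul, double_comul, hX.comul_one, sw_tmul_right, hl]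
    rw [sw_comm t t]
    exact ht.comul_right_sw hP (F := fun f e e' => (f ⊗ₜ[k] 𝓨.one) ⊗ₜ[k] ((𝓧.one ⊗ₜ[k] e) ⊗ₜ[k]
      (𝓧.one ⊗ₜ[k] e'))) (by fun_prop) (by fun_prop) (by fun_prop)
  · obtain ⟨D, hD⟩ : ∃ D, D = generalisedDouble 𝓧 𝓨 P := ⟨_, rfl⟩
    have hB : D.IsBialgebra := hD ▸ isBialgebra_generalisedDouble hX hY hSY hP
    have hA := hB.isAlg.twist (σ := tswap) hB.isAlg (BialgData.isAlgTwist_tswap D D)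
    obtain ⟨M, hM⟩ : ∃ M, M = D.sqMul tswap := ⟨_, rfl⟩
    have hMa (a b c) : M (M (a ⊗ₜ b) ⊗ₜ c) = M (a ⊗ₜ M (b ⊗ₜ c)) := hM ▸ hA.assoc a b c
    have hMs (a b) : tswap (M (a ⊗ₜ b)) = M (tswap a ⊗ₜ tswap b) := by
      have h1 (x y : X ⊗[k] Y) : tswap (k := k) (x ⊗ₜ[k] y) = y ⊗ₜ x := rfl
      simp (disch := fun_prop) only [hM, BialgData.sqMul_tswap_eq_sw, sw_map, sw_tswap, h1]
    rw [← hD, ← hM]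
    have hmul (a b) (ha : M (tswap (D.comul a) ⊗ₜ doubleR 𝓧.toBialgData 𝓨.toBialgData t) =
        M (doubleR 𝓧.toBialgData 𝓨.toBialgData t ⊗ₜ D.comul a))
        (hb : M (tswap (D.comul b) ⊗ₜ doubleR 𝓧.toBialgData 𝓨.toBialgData t) =
        M (doubleR 𝓧.toBialgData 𝓨.toBialgData t ⊗ₜ D.comul b)) :
        M (tswap (D.comul (D.mul (a ⊗ₜ b))) ⊗ₜ doubleR 𝓧.toBialgData 𝓨.toBialgData t) =
        M (doubleR 𝓧.toBialgData 𝓨.toBialgData t ⊗ₜ D.comul (D.mul (a ⊗ₜ b))) := by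
      rw [hB.comul_mul, ← hM, hMs, hMa, hb, ← hMa, ha, hMa]
    refine Lin.ext_tmul (by fun_prop) (by fun_prop) fun x y => ?_
    have hxy : x ⊗ₜ[k] y = D.mul ((x ⊗ₜ 𝓨.one) ⊗ₜ (𝓧.one ⊗ₜ y)) := by rw [hD, hl, hX.one_mul]
    rw [hxy]
    have hrl := double_mul_inr_inl (P := P) hX hY
    refine hmul _ _ ?_ ?_
    · simp (disch := fun_prop) only [hM, hD, BialgData.sqMul_tswap_eq_sw, doubleR_eq_sw, sw_sw,
        sw_tmul, sw_tswap, double_comul, hY.comul_one, hl, hr, hrl]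
      simp only [doubleTwist_tmul, sw_tmul_right, sw_comm t (𝓧.comul _),
        TensorProduct.tmul_smul]
      have h1 (a p b q : X) := ht.antipode_left_sw hX.isCoalg hY.isCoalg hSX hSY hP p q
        (F := fun f e => (𝓧.mul (a ⊗ₜ f) ⊗ₜ[k] 𝓨.one) ⊗ₜ[k] (b ⊗ₜ[k] e)) (by fun_prop) (by fun_prop)
      simp only [h1, ← hX.mul_assoc, hX.one_mul]
      rw [← hX.isCoalg.coassoc_sw x (F := fun a p r => sw (𝓧.comul r) fun b q => sw t fun f e =>
        (𝓧.mul (𝓧.mul (𝓧.mul (a ⊗ₜ 𝓧.antipode p) ⊗ₜ f) ⊗ₜ q) ⊗ₜ[k] 𝓨.one) ⊗ₜ[k] (b ⊗ₜ[k] e))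
        (by fun_prop) (by fun_prop) (by fun_prop)]
      have h2 (m r : X) := hSX.right_sw m (F := fun z => sw (𝓧.comul r) fun b q => sw t fun f e =>
        (𝓧.mul (𝓧.mul (z ⊗ₜ f) ⊗ₜ q) ⊗ₜ[k] 𝓨.one) ⊗ₜ[k] (b ⊗ₜ[k] e)) (by fun_prop)
      simp (disch := fun_prop) only [h2, hX.one_mul, hX.isCoalg.counit_smul]
    · simp (disch := fun_prop) only [hM, hD, BialgData.sqMul_tswap_eq_sw, doubleR_eq_sw, sw_sw,
        sw_tmul, sw_tswap, double_comul, hX.comul_one, hl, hr, hrl, hX.one_mul]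
      simp only [doubleTwist_tmul, sw_tmul_left, sw_comm t (𝓨.comul _),
        sw_comm (𝓧.comul _) (𝓨.comul _), ← TensorProduct.smul_tmul']
      have h1 (a p b q : Y) := ht.antipode_right_sw hP p q
        (F := fun f e => (f ⊗ₜ[k] b) ⊗ₜ[k] (𝓧.one ⊗ₜ[k] 𝓨.mul (a ⊗ₜ e))) (by fun_prop) (by fun_prop)
      simp only [h1, ← hY.mul_assoc]
      rw [← hY.isCoalg.coassoc_sw y (F := fun a p r => sw (𝓨.comul r) fun b q => sw t fun f e =>
        (f ⊗ₜ[k] b) ⊗ₜ[k] (𝓧.one ⊗ₜ[k] 𝓨.mul (𝓨.mul (𝓨.mul (a ⊗ₜ 𝓨.antipode p) ⊗ₜ e) ⊗ₜ q)))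
        (by fun_prop) (by fun_prop) (by fun_prop)]
      have h2 (m r : Y) := hSY.right_sw m (F := fun z => sw (𝓨.comul r) fun b q => sw t fun f e =>
        (f ⊗ₜ[k] b) ⊗ₜ[k] (𝓧.one ⊗ₜ[k] 𝓨.mul (𝓨.mul (z ⊗ₜ e) ⊗ₜ q))) (by fun_prop)
      simp (disch := fun_prop) only [h2, hY.one_mul, hY.isCoalg.counit_smul]

end Canonical
end DoubleHopf

/-! ### Explicit forms of the projection and of the double-bosonisation. -/

section Projection

variable {k H A C B Z : Type*} [Field k] [Ring H] [HopfAlgebra k H] [Ring A] [HopfAlgebra k A]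
  [AddCommGroup C] [Module k C] [AddCommGroup B] [Module k B] [AddCommGroup Z] [Module k Z]
  {R T : H ⊗[k] H} {pair : H ⊗[k] A →ₗ[k] k} {act : C ⊗[k] H →ₗ[k] C} {β : B →ₗ[k] A ⊗[k] B}
  {actB : B ⊗[k] H →ₗ[k] B} {𝓒 : HopfData k C} {𝓑 : HopfData k B} {ev : C ⊗[k] B →ₗ[k] k}

local notation "δ" => Coalgebra.comul (R := k)
local notation "ε" => Coalgebra.counit (R := k)
local notation "S" => HopfAlgebra.antipode k
local notation "S'" => linInv (HopfAlgebra.antipode k)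

theorem sw_tensorProduct_comm {V W : Type*} [AddCommGroup V] [Module k V] [AddCommGroup W]
    [Module k W] (t : V ⊗[k] W) (F : W → V → Z) (hl : ∀ y, Lin k (fun x => F x y))
    (hr : ∀ x, Lin k (fun y => F x y)) :
    sw (TensorProduct.comm k V W t) F = sw t fun x y => F y x :=
  sw_tswap t F hl hr

theorem merge_tmul (c : C) (h g : H) (b : B) :
    merge (HopfData.of k H).toBialgData ((c ⊗ₜ h) ⊗ₜ (g ⊗ₜ b)) = c ⊗ₜ[k] ((h * g) ⊗ₜ[k] b) := rfl

/-- The map `c ⊗ h ↦ c ◁ S h₍₁₎ ⊗ h₍₂₎` to the bosonisation of `C̄`. -/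
def straighten (act : C ⊗[k] H →ₗ[k] C) : C ⊗[k] H →ₗ[k] C ⊗[k] H :=
  smash (HopfData.of k H).toBialgData (barAct (HopfData.of k H) act) ∘ₗ tswap

theorem barAct_tmul (h : H) (c : C) :
    barAct (HopfData.of k H) act (h ⊗ₜ c) = act (c ⊗ₜ S h) := rfl

theorem straighten_tmul (c : C) (h : H) :
    straighten act (c ⊗ₜ h) = sw (δ h) fun p q => act (c ⊗ₜ S p) ⊗ₜ q := by
  simp only [straighten, LinearMap.comp_apply, LinearEquiv.coe_coe, TensorProduct.comm_tmul,
    smash_tmul, barAct_tmul]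
  rfl

/-- Elements of `X` can be written in the order `h · c`, and `straighten` reads off the components.
In this order the projection merely multiplies `h` by the image of `A`. -/
theorem straighten_leftTwist (hC : IsModuleBraidedGroup (HopfData.of k H).toBialgData R act 𝓒)
    (c : C) (h : H) : straighten act (leftTwist act (h ⊗ₜ c)) = c ⊗ₜ h := by
  simp (disch := fun_prop) only [leftTwist_tmul, sw_map, straighten_tmul, hC.act_act]
  rw [← comul_coassoc_sw h (F := fun p q r => act (c ⊗ₜ[k] (p * S q)) ⊗ₜ[k] r) (by fun_prop)
    (by fun_prop) (by fun_prop)]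
  have h1 (m r : H) := antipode_right_sw (k := k) m (F := fun z => act (c ⊗ₜ[k] z) ⊗ₜ[k] r)
    (by fun_prop)
  simp (disch := fun_prop) only [h1, hC.act_one', counit_smul_sw]

theorem projection_tmul (c : C) (h : H) (a : A) (b : B) :
    projection (HopfData.of k H) R pair act ((c ⊗ₜ h) ⊗ₜ (a ⊗ₜ b)) = sw (δ h) fun p q =>
      act (c ⊗ₜ S p) ⊗ₜ[k] ((q * slice pair R a) ⊗ₜ[k] b) := by
  change merge _ (straighten act (c ⊗ₜ h) ⊗ₜ (slice pair R a ⊗ₜ b)) = _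
  simp only [straighten_tmul, sw_tmul_left, sw_map, merge_tmul]

theorem projection_straighten (x : C ⊗[k] H) (a : A) (b : B) :
    projection (HopfData.of k H) R pair act (x ⊗ₜ (a ⊗ₜ b)) = sw (straighten act x) fun c h =>
      c ⊗ₜ[k] ((h * slice pair R a) ⊗ₜ[k] b) := by
  revert x; refine Lin.ext_tmul (by fun_prop) (by fun_prop) fun c h => ?_
  simp (disch := fun_prop) only [projection_tmul, straighten_tmul, sw_sw, sw_tmul]

theorem bar_comul (c : C) : (bar 𝓒 T act).comul c = sw (𝓒.comul c) fun c₁ c₂ => sw T fun x y =>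
    act (c₁ ⊗ₜ x) ⊗ₜ act (c₂ ⊗ₜ y) := by
  simp only [bar, LinearMap.comp_apply, LinearMap.flip_apply, TensorProduct.mk_apply]
  rw [interchange_eq_sw]
  simp only [sw_map, TensorProduct.map_tmul]

/-- `d ⊗ r ⊗ b ↦ c (h₍₁₎ ▷ d) ⊗ h₍₂₎ r g₍₁₎ ⊗ (b ◁ g₍₂₎) a`. -/
def sandwich (act : C ⊗[k] H →ₗ[k] C) (actB : B ⊗[k] H →ₗ[k] B) (𝓒 : HopfData k C)
    (𝓑 : HopfData k B) (c : C) (h g : H) (a : B) (κ : C ⊗[k] (H ⊗[k] B)) : C ⊗[k] (H ⊗[k] B) :=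
  sw κ fun d w => sw w fun r b => sw (δ h) fun p q => sw (δ g) fun s t =>
    𝓒.mul (act (d ⊗ₜ S p) ⊗ₜ c) ⊗ₜ[k] ((q * (r * s)) ⊗ₜ[k] 𝓑.mul (actB (b ⊗ₜ t) ⊗ₜ a))

@[fun_prop] theorem Lin.sandwich {V : Type*} [AddCommGroup V] [Module k V] (c : C) (h g : H)
    (a : B) {f : V → C ⊗[k] (H ⊗[k] B)} (hf : Lin k f) :
    Lin k (fun v => DoubleBosonisation.sandwich act actB 𝓒 𝓑 c h g a (f v)) := by
  unfold DoubleBosonisation.sandwich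
  fun_prop

@[fun_prop] theorem Lin.sandwich_bosonisation {V : Type*} [AddCommGroup V] [Module k V] (h g : H)
    (a : B) {f : V → C} (hf : Lin k f) (κ : C ⊗[k] (H ⊗[k] B)) :
    Lin k (fun v => DoubleBosonisation.sandwich act actB 𝓒 𝓑 (f v) h g a κ) := by
  unfold DoubleBosonisation.sandwich
  fun_prop

@[fun_prop] theorem Lin.sandwich_left {V : Type*} [AddCommGroup V] [Module k V] (c : C) (g : H)
    (a : B) {f : V → H} (hf : Lin k f) (κ : C ⊗[k] (H ⊗[k] B)) :
    Lin k (fun v => DoubleBosonisation.sandwich act actB 𝓒 𝓑 c (f v) g a κ) := by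
  unfold DoubleBosonisation.sandwich
  fun_prop

theorem sw_sandwich {V W : Type*} [AddCommGroup V] [Module k V] [AddCommGroup W] [Module k W]
    (t : V ⊗[k] W) (F : V → W → C ⊗[k] (H ⊗[k] B)) (c : C) (h g : H) (a : B) :
    sandwich act actB 𝓒 𝓑 c h g a (sw t F) =
      sw t fun x y => sandwich act actB 𝓒 𝓑 c h g a (F x y) := by
  unfold DoubleBosonisation.sandwich
  simp (disch := fun_prop) only [sw_sw]

theorem sandwich_tmul (c d : C) (h r g : H) (a b : B) :
    sandwich act actB 𝓒 𝓑 c h g a (d ⊗ₜ (r ⊗ₜ b)) = sw (δ h) fun p q => sw (δ g) fun s t =>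
      𝓒.mul (act (d ⊗ₜ S p) ⊗ₜ c) ⊗ₜ[k] ((q * (r * s)) ⊗ₜ[k] 𝓑.mul (actB (b ⊗ₜ t) ⊗ₜ a)) := by
  simp (disch := fun_prop) only [sandwich, sw_tmul]

theorem leftBosonisation_bar_mul (Q : H ⊗[k] H) (c d : C) (h g : H) :
    (leftBosonisation (bar 𝓒 T act) (HopfData.of k H) Q (barAct (HopfData.of k H) act)).mul
      ((c ⊗ₜ h) ⊗ₜ (d ⊗ₜ g)) = sw (δ h) fun p q => 𝓒.mul (act (d ⊗ₜ S p) ⊗ₜ c) ⊗ₜ (q * g) := by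
  simp only [leftBosonisation, HopfData.twist, BialgData.twist_mul, smash_tmul, barAct_tmul]
  simp (disch := fun_prop) only [sw_sw, sw_tmul]
  rfl

theorem leftBosonisation_bar_comul (c : C) (h : H) :
    (leftBosonisation (bar 𝓒 T act) (HopfData.of k H) (tswap T) (barAct (HopfData.of k H) act)).comul
      (c ⊗ₜ h) = sw ((bar 𝓒 T act).comul c) fun c₁ c₂ => sw (δ h) fun p q => sw T fun x y =>
        (c₁ ⊗ₜ (x * p)) ⊗ₜ (act (c₂ ⊗ₜ S y) ⊗ₜ q) := by
  simp only [leftBosonisation, HopfData.twist, BialgData.twist_comul, cosmash_tmul, tswap_tswap,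
    barAct_tmul]
  simp (disch := fun_prop) only [sw_sw, sw_tmul, sw_tswap, barAct_tmul]
  rfl

theorem rightBosonisation_mul (h g : H) (b a : B) :
    (rightBosonisation (HopfData.of k H).toBialgData 𝓑.toBialgData R actB).mul
      ((h ⊗ₜ b) ⊗ₜ (g ⊗ₜ a)) = sw (δ g) fun s t => (h * s) ⊗ₜ 𝓑.mul (actB (b ⊗ₜ t) ⊗ₜ a) := by
  rw [rightBosonisation, BialgData.twist_mul]
  simp only [LinearMap.comp_apply, LinearMap.lTensor_tmul]
  change sw ((LinearMap.lTensor H actB) ((TensorProduct.leftComm k B H H) (b ⊗ₜ[k] δ g))) _ = _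
  conv_lhs => rw [← sw_eta (δ g)]
  simp (disch := fun_prop) only [sw_tmul_right, sw_map, TensorProduct.leftComm_tmul,
    LinearMap.lTensor_tmul, sw_sw, sw_tmul]
  rfl

theorem rightBosonisation_comul (h : H) (b : B) :
    (rightBosonisation (HopfData.of k H).toBialgData 𝓑.toBialgData R actB).comul (h ⊗ₜ b) =
      sw (δ h) fun p q => sw (𝓑.comul b) fun b₁ b₂ => sw R fun m n =>
        (p ⊗ₜ actB (b₁ ⊗ₜ m)) ⊗ₜ ((q * n) ⊗ₜ b₂) := by
  rw [rightBosonisation, BialgData.twist_comul]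
  simp only [LinearMap.comp_apply, LinearMap.flip_apply, TensorProduct.mk_apply,
    LinearEquiv.coe_coe, TensorProduct.comm_tmul]
  have h0 (q : H) (b₁ : B) : interchange ((b₁ ⊗ₜ[k] q) ⊗ₜ R) = sw R fun m n =>
      (b₁ ⊗ₜ m) ⊗ₜ (q ⊗ₜ[k] n) := by
    rw [interchange_eq_sw, sw_tmul _ _ (by fun_prop) (by fun_prop)]
  simp only [LinearEquiv.coe_coe] at h0
  simp (disch := fun_prop) only [h0, sw_map, TensorProduct.map_tmul, sw_sw, sw_tmul]
  rfl

/-- Isolating the reordering of `b` and `d` reduces the comparison with `D` to a comparison of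
reorderings. -/
theorem doubleBosonisation_mul (c d : C) (h g : H) (a b : B) :
    (doubleBosonisation (HopfData.of k H) R T 𝓒 𝓑.toBialgData act actB ev).mul
      ((c ⊗ₜ (h ⊗ₜ b)) ⊗ₜ (d ⊗ₜ (g ⊗ₜ a))) =
    sandwich act actB 𝓒 𝓑 c h g a (crossRelation (HopfData.of k H).toBialgData R T (bar 𝓒 T act)
      𝓑.toBialgData (barAct (HopfData.of k H) act) actB ev (b ⊗ₜ d)) := by
  simp only [doubleBosonisation, LinearMap.comp_apply, LinearMap.rTensor_tmul, LinearEquiv.coe_coe,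
    TensorProduct.assoc_symm_tmul, midMap_tmul, sw_map, TensorProduct.map_tmul,
    LinearMap.lTensor_tmul, LinearMap.flip_apply, TensorProduct.mk_apply]
  generalize crossRelation (HopfData.of k H).toBialgData R T (bar 𝓒 T act)
      𝓑.toBialgData (barAct (HopfData.of k H) act) actB ev (b ⊗ₜ d) = κ
  revert κ
  refine Lin.ext_tmul (by fun_prop) (by fun_prop) fun d w => ?_
  revert w
  refine Lin.ext_tmul (by fun_prop) (by fun_prop) fun r b => ?_
  simp (disch := fun_prop) only [sw_tmul, sandwich_tmul]
  rw [leftBosonisation_bar_mul, rightBosonisation_mul]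
  simp only [sw_tmul_left, sw_tmul_right, sw_map, merge_tmul]
  rw [sw_comm]
  refine sw_congr fun p q => sw_congr fun s t => ?_
  change _ ⊗ₜ[k] ((q * 1 * (r * s)) ⊗ₜ[k] _) = _
  rw [mul_one]

/-- The action on `C̄` is `c ◁ S h`, and the antipode turns one of the two copies of `R⁻¹` in the
definition into `R`. -/
theorem doubleBosonisation_comul (hR : QTri R T)
    (hC : IsModuleBraidedGroup (HopfData.of k H).toBialgData R act 𝓒) (c : C) (h : H) (b : B) :
    (doubleBosonisation (HopfData.of k H) R T 𝓒 𝓑.toBialgData act actB ev).comul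
      (c ⊗ₜ (h ⊗ₜ b)) = sw (𝓒.comul c) fun c₁ c₂ => sw T fun x y => sw R fun u v =>
        sw (δ h) fun p q => sw (𝓑.comul b) fun b₁ b₂ => sw R fun m n =>
        (act (c₁ ⊗ₜ x) ⊗ₜ[k] ((u * p) ⊗ₜ[k] actB (b₁ ⊗ₜ m))) ⊗ₜ[k]
          (act (c₂ ⊗ₜ (y * v)) ⊗ₜ[k] ((q * n) ⊗ₜ[k] b₂)) := by
  simp only [doubleBosonisation, LinearMap.comp_apply, TensorProduct.map_tmul,
    LinearMap.flip_apply, TensorProduct.mk_apply]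
  rw [interchange_eq_sw, rightBosonisation_comul, leftBosonisation_bar_comul, bar_comul]
  change TensorProduct.map _ _ (sw (sw _ fun c₁ c₂ => sw (δ 1) _) _) = _
  simp (disch := fun_prop) only [sw_sw, sw_tmul, comul_one', sw_map, TensorProduct.map_tmul,
    merge_tmul, hC.act_act, one_mul, mul_one]
  refine sw_congr fun c₁ c₂ => sw_congr fun x y => ?_
  exact hR.antipode_right_eq_sw (F := fun u v => sw (δ h) fun p q => sw (𝓑.comul b) fun b₁ b₂ =>
    sw R fun m n => (act (c₁ ⊗ₜ x) ⊗ₜ[k] ((u * p) ⊗ₜ[k] actB (b₁ ⊗ₜ m))) ⊗ₜ[k]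
      (act (c₂ ⊗ₜ (y * v)) ⊗ₜ[k] ((q * n) ⊗ₜ[k] b₂))) (by fun_prop) (by fun_prop)

theorem crossForm_tmul (T : H ⊗[k] H) (actC : H ⊗[k] C →ₗ[k] C) (c : C) (b : B) :
    crossForm T actC actB ev (c ⊗ₜ b) = sw T fun x y => sw T fun u v =>
      ev (actC (x ⊗ₜ c) ⊗ₜ actB (b ⊗ₜ u)) • (y ⊗ₜ[k] v) := by
  simp only [crossForm, LinearMap.comp_apply, LinearMap.flip_apply, TensorProduct.mk_apply]
  rw [interchange_eq_sw]
  simp only [sw_tmul_right, sw_map, LinearEquiv.coe_coe, TensorProduct.assoc_symm_tmul,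
    LinearMap.rTensor_tmul, LinearMap.comp_apply, TensorProduct.tensorTensorTensorComm_tmul,
    TensorProduct.map_tmul, TensorProduct.lid_tmul, TensorProduct.comm_tmul]

theorem crossRelation_tmul (b : B) (c : C) :
    crossRelation (HopfData.of k H).toBialgData R T (bar 𝓒 T act)
      𝓑.toBialgData (barAct (HopfData.of k H) act) actB ev (b ⊗ₜ c) =
    sw ((bar 𝓒 T act).comul c) fun c₁ r => sw ((bar 𝓒 T act).comul r) fun c₂ c₃ =>
    sw (𝓑.comul b) fun b₁ s => sw (𝓑.comul s) fun b₂ b₃ =>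
    sw R fun x y => sw R fun u v => sw T fun m n => sw T fun p q =>
      ev (act (c₁ ⊗ₜ S x) ⊗ₜ actB (b₁ ⊗ₜ u)) •
        ev (act (linInv 𝓒.antipode c₃ ⊗ₜ S n) ⊗ₜ actB (b₃ ⊗ₜ q)) •
          (act (c₂ ⊗ₜ S y) ⊗ₜ[k] ((v * m) ⊗ₜ[k] actB (b₂ ⊗ₜ p))) := by
  have hbar : (bar 𝓒 T act).antipode = linInv 𝓒.antipode := rfl
  have hmul (h g : H) (b : B) : LinearMap.rTensor B (HopfData.of k H).mul
      ((TensorProduct.assoc k H H B).symm (h ⊗ₜ (g ⊗ₜ b))) = (h * g) ⊗ₜ b := rfl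
  simp only [crossRelation, LinearMap.comp_apply, LinearEquiv.coe_coe, TensorProduct.comm_tmul,
    splitThree_tmul, sw_map, TensorProduct.map_tmul, LinearMap.lTensor_tmul, crossForm_tmul,
    LinearMap.rTensor_tmul, hbar]
  iterate 4 refine sw_congr fun _ _ => ?_
  simp (disch := fun_prop) only [sw_tensorProduct_comm, sw_tmul_left, sw_tmul_right, sw_map, map_smul,
    ← TensorProduct.smul_tmul', TensorProduct.tmul_smul, LinearMap.lTensor_tmul,
    TensorProduct.tensorTensorTensorComm_tmul, TensorProduct.assoc_tmul, TensorProduct.map_tmul,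
    LinearMap.comp_apply, LinearEquiv.coe_coe, hmul, barAct_tmul]
  simp only [sw_smul_right, sw_comm T R]
  iterate 4 refine sw_congr fun _ _ => ?_
  module


local notation "π" => projection (B := B) (HopfData.of k H) R pair act

/-- The projection of a product, when the first factor lies in `C ⋊ H^op` and the last one in
`A^cop ⋉ B`. -/
theorem projection_mul_mul (hR : QTri R T) (hp : DualPair pair)
    (hC : IsModuleBraidedGroup (HopfData.of k H).toBialgData R act 𝓒) (x p : C ⊗[k] H)
    (q : A ⊗[k] B) (a : A) (b : B) :
    π ((leftAlg R act 𝓒).mul (p ⊗ₜ x) ⊗ₜ (rightAlg R pair β 𝓑).mul (q ⊗ₜ (a ⊗ₜ b))) =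
      sw (straighten act x) fun c h =>
        sandwich act (evalAct pair β) 𝓒 𝓑 c h (slice pair R a) b (π (p ⊗ₜ q)) := by
  revert x; refine Lin.ext_tmul (by fun_prop) (by fun_prop) fun c h => ?_
  revert p; refine Lin.ext_tmul (by fun_prop) (by fun_prop) fun d g => ?_
  revert q; refine Lin.ext_tmul (k := k) (V := A) (W := B) (by fun_prop) (by fun_prop) fun a' b' => ?_
  simp (disch := fun_prop) only [leftAlg_mul, rightAlg_mul, sw_tmul_left, sw_tmul_right, sw_map,
    projection_tmul, straighten_tmul, sw_sw, sw_tmul, comul_mul_eq_sw, antipode_mul_rev,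
    hC.mul_act_sw, hC.act_act, comul_antipode_eq_sw, sw_sandwich, sandwich_tmul, comul_coassoc_sw,
    slice_comul hR hp, slice_mul hR hp]
  simp only [sw_comm _ (δ a)]
  refine sw_congr fun a₁ a₂ => ?_
  trans sw (δ h) fun h₁ u => sw (δ u) fun h₂ h₃ => sw (δ g) fun g₁ r => sw (δ r) fun s v =>
    sw (δ v) fun t g₃ => 𝓒.mul (act (d ⊗ₜ[k] (S t * S h₂)) ⊗ₜ[k] act (c ⊗ₜ[k] (g₁ * S s * S h₁))) ⊗ₜ[k]
      ((h₃ * g₃ * (slice pair R a' * slice pair R a₂)) ⊗ₜ[k]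
        𝓑.mul (evalAct pair β (b' ⊗ₜ[k] slice pair R a₁) ⊗ₜ[k] b))
  · rw [← comul_coassoc_sw h (F := fun h₁ h₂ h₃ => sw (δ g) fun g₁ r => sw (δ r) fun s v =>
      sw (δ v) fun t g₃ => 𝓒.mul (act (d ⊗ₜ[k] (S t * S h₂)) ⊗ₜ[k] act (c ⊗ₜ[k] (g₁ * S s * S h₁))) ⊗ₜ[k]
      ((h₃ * g₃ * (slice pair R a' * slice pair R a₂)) ⊗ₜ[k]
        𝓑.mul (evalAct pair β (b' ⊗ₜ[k] slice pair R a₁) ⊗ₜ[k] b))) (by fun_prop) (by fun_prop)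
      (by fun_prop)]
    simp only [sw_comm _ (δ h)]
    refine sw_congr fun m h₃ => ?_
    simp only [sw_comm _ (δ m)]
    simp (disch := fun_prop) only [comul_coassoc_sw, mul_assoc]
  -- The legs `g₍₁₎ S(g₍₂₎)` now stand next to each other and collapse.
  · simp (disch := fun_prop) only [← comul_coassoc_sw g]
    have h1 (h₁ h₂ h₃ m v : H) := antipode_right_sw (k := k) m (F := fun z => sw (δ v) fun t g₃ =>
      𝓒.mul (act (d ⊗ₜ[k] (S t * S h₂)) ⊗ₜ[k] act (c ⊗ₜ[k] (z * S h₁))) ⊗ₜ[k]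
      ((h₃ * g₃ * (slice pair R a' * slice pair R a₂)) ⊗ₜ[k]
        𝓑.mul (evalAct pair β (b' ⊗ₜ[k] slice pair R a₁) ⊗ₜ[k] b))) (by fun_prop)
    simp (disch := fun_prop) only [h1, counit_smul_sw, one_mul]
    simp only [sw_comm (δ g) (δ _), mul_assoc]


/-- `straighten` separates a projected tensor from its `C ⋊ H^op` part. -/
theorem projection_surjective (hC : IsModuleBraidedGroup (HopfData.of k H).toBialgData R act 𝓒)
    (hR : QTri R T) (hp : DualPair pair) : Function.Surjective π := by
  have h : ∀ u, π ((TensorProduct.map (leftTwist act ∘ₗ tswap) (tensorLeft B 1))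
      ((TensorProduct.assoc k C H B).symm u)) = u := by
    refine Lin.ext_tmul (by fun_prop) (by fun_prop) fun c w => ?_
    revert w; refine Lin.ext_tmul (by fun_prop) (by fun_prop) fun h b => ?_
    simp (disch := fun_prop) only [TensorProduct.assoc_symm_tmul, TensorProduct.map_tmul,
      LinearMap.comp_apply, LinearEquiv.coe_coe, TensorProduct.comm_tmul, TensorProduct.mk_apply,
      projection_straighten, straighten_leftTwist hC, sw_tmul, slice_one hR hp, mul_one]
  exact fun u => ⟨_, h u⟩

theorem projection_one (hC : IsModuleBraidedGroup (HopfData.of k H).toBialgData R act 𝓒)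
    (hR : QTri R T) (hp : DualPair pair) (b : B) :
    π ((𝓒.one ⊗ₜ 1) ⊗ₜ (1 ⊗ₜ b)) = 𝓒.one ⊗ₜ (1 ⊗ₜ b) := by
  simp (disch := fun_prop) only [projection_tmul, comul_one', sw_tmul, antipode_one', hC.act_one',
    slice_one hR hp, mul_one]

theorem projection_counit (hR : QTri R T) (hp : DualPair pair)
    (hC : IsModuleBraidedGroup (HopfData.of k H).toBialgData R act 𝓒) (x : C ⊗[k] H)
    (y : A ⊗[k] B) :
    (doubleBosonisation (HopfData.of k H) R T 𝓒 𝓑.toBialgData act actB ev).counit (π (x ⊗ₜ y)) =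
      (leftAlg R act 𝓒).counit x * (rightAlg R pair β 𝓑).counit y := by
  have h1 (c : C) (h : H) (b : B) :
      (doubleBosonisation (HopfData.of k H) R T 𝓒 𝓑.toBialgData act actB ev).counit
        (c ⊗ₜ (h ⊗ₜ b)) = 𝓒.counit c * (ε h * 𝓑.counit b) := rfl
  revert x; refine Lin.ext_tmul (by fun_prop) (by fun_prop) fun c h => ?_
  revert y; refine Lin.ext_tmul (k := k) (V := A) (W := B) (by fun_prop) (by fun_prop) fun a b => ?_
  simp only [projection_tmul, sw_map, h1, hC.counit_act', leftAlg_counit, rightAlg_counit,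
    Bialgebra.counit_mul, slice_counit hR hp, counit_antipode']
  have h2 : ∀ p q : H, 𝓒.counit c * ε p * (ε q * ε a * 𝓑.counit b) =
      (ε p • ε q) * (𝓒.counit c * (ε a * 𝓑.counit b)) := fun p q => by
    simp only [smul_eq_mul]; ring
  simp only [h2, ← sw_mul_left]
  rw [counit_smul_sw h (F := fun q => ε q) (by fun_prop)]
  ring

end Projection

/-! ### The projection respects coproducts. -/

section ProjectionComul

variable {k H A C B Z : Type*} [Field k] [Ring H] [HopfAlgebra k H] [Ring A] [HopfAlgebra k A]
  [AddCommGroup C] [Module k C] [AddCommGroup B] [Module k B] [AddCommGroup Z] [Module k Z]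
  {R T : H ⊗[k] H} {pair : H ⊗[k] A →ₗ[k] k} {act : C ⊗[k] H →ₗ[k] C} {β : B →ₗ[k] A ⊗[k] B}
  {actB : B ⊗[k] H →ₗ[k] B} {𝓒 : HopfData k C} {𝓑 : HopfData k B} {ev : C ⊗[k] B →ₗ[k] k}

local notation "δ" => Coalgebra.comul (R := k)
local notation "ε" => Coalgebra.counit (R := k)
local notation "S" => HopfAlgebra.antipode k
local notation "S'" => linInv (HopfAlgebra.antipode k)
local notation "π" => projection (B := B) (HopfData.of k H) R pair act

theorem Lin.map_sw {V W Y : Type*} [AddCommGroup V] [Module k V] [AddCommGroup W] [Module k W]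
    [AddCommGroup Y] [Module k Y] {f : Y → Z} (hf : Lin k f) (t : V ⊗[k] W) (F : V → W → Y) :
    f (sw t F) = sw t fun x y => f (F x y) :=
  sw_map (IsLinearMap.mk' f ⟨hf.add, hf.smul⟩) t F

/-- `⟨R⁽¹⁾, b⁽¹⁾⟩ R⁽²⁾ ⊗ b⁽²⁾ = R⁽²⁾ ⊗ b ◁ R⁽¹⁾`. -/
theorem coact_slice_sw (b : B) {F : H → B → Z} (h1 : ∀ y, Lin k (fun x => F x y))
    (h2 : ∀ x, Lin k (fun y => F x y)) :
    (sw (β b) fun u v => F (slice pair R u) v) = sw R fun m n => F n (evalAct pair β (b ⊗ₜ m)) := by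
  simp only [evalAct_tmul, slice_apply, (h1 _).map_sw, (h2 _).map_sw, (h1 _).smul, (h2 _).smul]
  rw [sw_comm]

/-- `h₍₁₎R⁽¹⁾ ⊗ R⁽²⁾S(h₍₂₎) = R⁽¹⁾h₍₂₎ ⊗ S(h₍₁₎)R⁽²⁾`. -/
theorem QTri.comul_mul_antipode_sw (hR : QTri R T) (h : H) {F : H → H → Z}
    (h1 : ∀ y, Lin k (fun x => F x y)) (h2 : ∀ x, Lin k (fun y => F x y)) :
    (sw (δ h) fun p q => sw R fun m n => F (p * m) (n * S q)) =
      sw (δ h) fun p q => sw R fun m n => F (m * q) (S p * n) := by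
  trans sw (δ h) fun p r => sw (δ r) fun q s => sw (δ q) fun u v => sw R fun m n =>
    F (v * m) (S p * (u * n) * S s)
  · simp (disch := fun_prop) only [comul_coassoc_sw]
    rw [← comul_coassoc_sw h (F := fun p u r => sw (δ r) fun v s => sw R fun m n =>
      F (v * m) (S p * (u * n) * S s)) (by fun_prop) (by fun_prop) (by fun_prop)]
    have h0 (q r : H) := antipode_left_sw (k := k) q (F := fun z => sw (δ r) fun v s =>
      sw R fun m n => F (v * m) (z * n * S s)) (by fun_prop)
    simp only [mul_assoc] at h0 ⊢
    simp (disch := fun_prop) only [h0, counit_smul_sw, one_mul]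
  · have e (q p s : H) := hR.quasi_sw q (F := fun a b => F a (S p * b * S s)) (by fun_prop)
      (by fun_prop)
    simp only [e]
    simp (disch := fun_prop) only [comul_coassoc_sw]
    have h0 (p u r : H) := antipode_right_sw (k := k) r (F := fun z =>
      sw R fun m n => F (m * u) (S p * (n * z))) (by fun_prop)
    simp only [mul_assoc] at h0 ⊢
    simp (disch := fun_prop) only [h0, smul_counit_sw, mul_one]

/-- The left-hand side is the part in `H` of the coproduct of `X` followed by the projection; the
right-hand side is the part in `H` of the coproduct of `U` after the projection. The proof moves
`Δ(S h₍₁₎)` across `R⁻¹` and then exchanges the middle legs with `comul_mul_antipode_sw`. -/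
theorem coproduct_identity (hR : QTri R T) (h : H) {F : H → H → H → H → Z}
    (h1 : ∀ y z w, Lin k (fun x => F x y z w)) (h2 : ∀ x z w, Lin k (fun y => F x y z w))
    (h3 : ∀ x y w, Lin k (fun z => F x y z w)) (h4 : ∀ x y z, Lin k (fun w => F x y z w)) :
    (sw (δ h) fun p r => sw R fun x y => sw (δ (p * x)) fun s t => sw (δ r) fun u v =>
      F (S s) t (y * S u) v) =
    sw (δ h) fun p r => sw (δ p) fun s t => sw (δ r) fun u v => sw T fun x y => sw R fun m n =>
      F (S t * x) (m * u) (S s * (y * n)) v := by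
  simp (disch := fun_prop) only [comul_mul_eq_sw, sw_sw, sw_tmul, antipode_mul_rev]
  trans sw (δ h) fun p r => sw (δ p) fun s t => sw (δ r) fun u v => sw T fun x y => sw R fun m n =>
    F (x * S s) (t * m) (y * (n * S u)) v
  · refine sw_congr fun p r => ?_
    simp only [sw_comm R (δ p)]
    refine sw_congr fun s t => ?_
    rw [hR.comul_left_sw (F := fun x₁ x₂ y => sw (δ r) fun u v =>
      F (S x₁ * S s) (t * x₂) (y * S u) v) (by fun_prop) (by fun_prop) (by fun_prop),
      hR.antipode_left_eq_sw (F := fun x y => sw R fun m n => sw (δ r) fun u v =>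
      F (x * S s) (t * m) (y * n * S u) v) (by fun_prop) (by fun_prop)]
    simp only [sw_comm _ (δ r), mul_assoc]
  · have e (p r : H) : (sw (δ p) fun s t => sw T fun x y => sw (δ r) fun u v => sw R fun m n =>
        F (x * S s) (m * u) (y * (S t * n)) v) = sw (δ p) fun s t => sw T fun x y =>
        sw (δ r) fun u v => sw R fun m n => F (S t * x) (m * u) (S s * (y * n)) v := by
      have := hR.quasi_inv_sw (S p) (F := fun x y => sw (δ r) fun u v => sw R fun m n =>
        F x (m * u) (y * n) v) (by fun_prop) (by fun_prop)
      simp (disch := fun_prop) only [comul_antipode_eq_sw, sw_sw, sw_tmul] at this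
      simp only [mul_assoc] at this
      exact this.symm
    simp only [sw_comm T (δ _)] at e
    simp only [sw_comm T (δ _), ← e]
    have e2 (s r : H) (x y : H) : (sw (δ r) fun q v => sw (δ q) fun t u => sw R fun m n =>
        F (x * S s) (t * m) (y * (n * S u)) v) = sw (δ r) fun q v => sw (δ q) fun t u =>
        sw R fun m n => F (x * S s) (m * u) (y * (S t * n)) v := by
      refine sw_congr fun q v => ?_
      exact hR.comul_mul_antipode_sw q (F := fun a b => F (x * S s) a (y * b) v) (by fun_prop)
        (by fun_prop)
    simp (disch := fun_prop) only [comul_coassoc_sw] at e2 ⊢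
    simp only [sw_comm (δ _) T]
    simp only [e2]

/-- `coact_slice_sw` turns the coaction in the coproduct of `Y` into the copy of `R` in the
coproduct of `H ⋉ B`. After that only legs in `H` remain to be compared. -/
theorem projection_comul (hR : QTri R T) (hp : DualPair pair)
    (hC : IsModuleBraidedGroup (HopfData.of k H).toBialgData R act 𝓒)
    (x : C ⊗[k] H)
    (y : A ⊗[k] B) :
    (doubleBosonisation (HopfData.of k H) R T 𝓒 𝓑.toBialgData act (evalAct pair β) ev).comul
      (π (x ⊗ₜ y)) = sw ((leftAlg R act 𝓒).comul x) fun x₁ x₂ =>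
        sw ((rightAlg R pair β 𝓑).comul y) fun y₁ y₂ => π (x₁ ⊗ₜ y₁) ⊗ₜ π (x₂ ⊗ₜ y₂) := by
  revert x; refine Lin.ext_tmul (by fun_prop) (by fun_prop) fun c h => ?_
  revert y; refine Lin.ext_tmul (k := k) (V := A) (W := B) (by fun_prop) (by fun_prop) fun a b => ?_
  simp (disch := fun_prop) only [projection_tmul, sw_map, doubleBosonisation_comul hR hC,
    leftAlg_comul, rightAlg_comul, sw_sw, sw_tmul, sw_tmul_left, sw_tmul_right,
    hC.comul_act_sw, comul_antipode_eq_sw, comul_mul_eq_sw, slice_comul hR hp, hC.act_act,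
    slice_mul hR hp]
  simp only [sw_comm _ (𝓒.comul c)]
  refine sw_congr fun c₁ c₂ => ?_
  simp only [sw_comm _ (δ a)]
  refine sw_congr fun a₁ a₂ => ?_
  simp only [sw_comm _ (𝓑.comul b)]
  refine sw_congr fun b₁ b₂ => ?_
  simp only [sw_comm _ (β b₁)]
  rw [coact_slice_sw b₁ (F := fun g b => sw (δ h) fun x y => sw R fun x₂ y₂ => sw (δ y) fun x₆ y₆ =>
    sw (δ x) fun x₇ y₇ => sw (δ x₂) fun x₈ y₈ => act (c₁ ⊗ₜ[k] S (x₇ * x₈)) ⊗ₜ[k]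
      ((y₇ * y₈ * (slice pair R) a₂) ⊗ₜ[k] b) ⊗ₜ[k] (act (c₂ ⊗ₜ[k] (y₂ * S x₆)) ⊗ₜ[k]
      ((y₆ * ((slice pair R) a₁ * g)) ⊗ₜ[k] b₂))) (by fun_prop) (by fun_prop)]
  have e (m n : H) := coproduct_identity hR h (F := fun x y z w => act (c₁ ⊗ₜ[k] x) ⊗ₜ[k]
    ((y * slice pair R a₂) ⊗ₜ[k] evalAct pair β (b₁ ⊗ₜ[k] m)) ⊗ₜ[k] (act (c₂ ⊗ₜ[k] z) ⊗ₜ[k]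
      ((w * slice pair R a₁ * n) ⊗ₜ[k] b₂))) (by fun_prop) (by fun_prop) (by fun_prop) (by fun_prop)
  simp (disch := fun_prop) only [comul_mul_eq_sw, sw_sw, sw_tmul, antipode_mul_rev, mul_assoc] at e ⊢
  refine Eq.trans ?_ (sw_congr fun m n => ((e m n).symm.trans ?_))
  · rw [sw_comm R (δ h)]
    refine sw_congr fun x y => ?_
    rw [sw_comm R (δ x)]
    refine sw_congr fun s t => ?_
    rw [sw_comm R (δ y)]
    simp only [sw_comm _ (δ y)]
    refine sw_congr fun u v => ?_
    rw [sw_comm R T]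
    refine sw_congr fun _ _ => ?_
    rw [sw_comm R R]
  · refine sw_congr fun p r => sw_congr fun x y => ?_
    simp only [sw_comm _ (δ r)]

end ProjectionComul

/-! ### Values of the pairing on generators. -/

section PairingValues

variable {k H A C B Z : Type*} [Field k] [Ring H] [HopfAlgebra k H] [Ring A] [HopfAlgebra k A]
  [AddCommGroup C] [Module k C] [AddCommGroup B] [Module k B] [AddCommGroup Z] [Module k Z]
  {R T : H ⊗[k] H} {pair : H ⊗[k] A →ₗ[k] k} {act : C ⊗[k] H →ₗ[k] C} {β : B →ₗ[k] A ⊗[k] B}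
  {𝓒 : HopfData k C} {𝓑 : HopfData k B} {ev : C ⊗[k] B →ₗ[k] k}

local notation "δ" => Coalgebra.comul (R := k)
local notation "ε" => Coalgebra.counit (R := k)
local notation "S" => HopfAlgebra.antipode k
local notation "S'" => linInv (HopfAlgebra.antipode k)
local notation "π" => projection (B := B) (HopfData.of k H) R pair act
local notation "Pf" => factorPairing (HopfData.of k H) T pair 𝓒 β ev
local notation "Sx" => HopfData.antipode (leftFactor (HopfData.of k H) R 𝓒 act)

theorem factorPairing_inl (hR : QTri R T) (hp : DualPair pair)
    (hB : IsComoduleBraidedGroup (HopfData.of k A).toBialgData pair R β 𝓑)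
    (hI : InvPairing T act (evalAct pair β) 𝓒 𝓑 (evInv 𝓒 ev)) (c : C) (h : H) (a : A) :
    Pf ((c ⊗ₜ h) ⊗ₜ[k] (a ⊗ₜ 𝓑.one)) = 𝓒.counit c * pair (h ⊗ₜ a) := by
  have hB' := hB.isModuleBraidedGroup hp
  have h1 (p q x y : H) : pair ((p * x) ⊗ₜ a) * (ε (q * y) * 𝓒.counit c) =
      ε y • ε q • (𝓒.counit c * pair ((p * x) ⊗ₜ a)) := by
    rw [Bialgebra.counit_mul]; simp only [smul_eq_mul]; ring
  simp only [factorPairing_tmul, hB'.one_act', TensorProduct.tmul_smul, map_smul, hI.one_right,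
    smul_eq_mul, h1]
  simp only [← smul_eq_mul (a := ε _)]
  simp (disch := fun_prop) only [smul_counit_sw, ← sw_smul_right]
  simp (disch := fun_prop) only [hR.counit_right_inv_sw, mul_one]

theorem factorPairing_inr (hR : QTri R T) (hp : DualPair pair)
    (hI : InvPairing T act (evalAct pair β) 𝓒 𝓑 (evInv 𝓒 ev)) (x : C ⊗[k] H) (b : B) :
    Pf (x ⊗ₜ[k] ((1 : A) ⊗ₜ b)) = evInv 𝓒 ev (leftProj act x ⊗ₜ b) := by
  revert x; refine Lin.ext_tmul (by fun_prop) (by fun_prop) fun c h => ?_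
  have h1 (p q x y : H) : ε (p * x) * evInv 𝓒 ev (c ⊗ₜ evalAct pair β (b ⊗ₜ (q * y))) =
      ε x • ε p • evInv 𝓒 ev (c ⊗ₜ evalAct pair β (b ⊗ₜ (q * y))) := by
    rw [Bialgebra.counit_mul]; simp only [smul_eq_mul]; ring
  simp only [factorPairing_tmul, hp.one_right, h1, leftProj_tmul]
  simp (disch := fun_prop) only [counit_smul_sw, ← sw_smul_right]
  simp (disch := fun_prop) only [hR.counit_left_inv_sw, mul_one, hI.act_right]

theorem factorPairing_one_tmul (hR : QTri R T) (hp : DualPair pair)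
    (hB : IsComoduleBraidedGroup (HopfData.of k A).toBialgData pair R β 𝓑)
    (hI : InvPairing T act (evalAct pair β) 𝓒 𝓑 (evInv 𝓒 ev)) (h : H) (a : A) (b : B) :
    Pf ((𝓒.one ⊗ₜ h) ⊗ₜ[k] (a ⊗ₜ b)) = pair (h ⊗ₜ a) * 𝓑.counit b := by
  have hB' := hB.isModuleBraidedGroup hp
  have h1 (p q x y : H) : pair ((p * x) ⊗ₜ a) * (𝓑.counit b * ε (q * y)) =
      ε y • ε q • (pair ((p * x) ⊗ₜ a) * 𝓑.counit b) := by
    rw [Bialgebra.counit_mul]; simp only [smul_eq_mul]; ring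
  simp only [factorPairing_tmul, hI.one_left, hB'.counit_act', h1]
  simp (disch := fun_prop) only [smul_counit_sw, ← sw_smul_right]
  simp (disch := fun_prop) only [hR.counit_right_inv_sw, mul_one]

theorem factorPairing_tmul_one (c : C) (a : A) (b : B) :
    Pf ((c ⊗ₜ 1) ⊗ₜ[k] (a ⊗ₜ b)) = sw T fun x y => pair (x ⊗ₜ a) *
      evInv 𝓒 ev (c ⊗ₜ evalAct pair β (b ⊗ₜ y)) := by
  simp (disch := fun_prop) only [factorPairing_tmul, comul_one', sw_tmul, one_mul]

theorem factorPairing_antipode_inl (hR : QTri R T) (hp : DualPair pair)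
    (hC : IsModuleBraidedGroup (HopfData.of k H).toBialgData R act 𝓒)
    (hB : IsComoduleBraidedGroup (HopfData.of k A).toBialgData pair R β 𝓑)
    (hI : InvPairing T act (evalAct pair β) 𝓒 𝓑 (evInv 𝓒 ev)) (c : C) (h : H) (a : A) :
    Pf ((Sx (c ⊗ₜ h)) ⊗ₜ[k] (a ⊗ₜ 𝓑.one)) = 𝓒.counit c * pair (S' h ⊗ₜ a) := by
  have h0 (h : H) (c : C) : Pf (leftTwist act (h ⊗ₜ c) ⊗ₜ[k] (a ⊗ₜ 𝓑.one)) =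
      𝓒.counit c * pair (h ⊗ₜ a) := by
    rw [leftTwist_tmul]
    simp only [sw_tmul_left, sw_map, factorPairing_inl hR hp hB hI, hC.counit_act']
    have h1 (p q : H) : 𝓒.counit c * ε p * pair (q ⊗ₜ a) = ε p • (𝓒.counit c * pair (q ⊗ₜ a)) := by
      simp only [smul_eq_mul]; ring
    simp (disch := fun_prop) only [h1, counit_smul_sw]
  rw [leftFactor_antipode_tmul]
  have h2 (x y : H) : 𝓒.counit c * ε y * pair (S' (h * x) ⊗ₜ a) =
      ε y • (𝓒.counit c * pair (S' (h * x) ⊗ₜ a)) := by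
    simp only [smul_eq_mul]; ring
  simp only [sw_tmul_left, sw_map, h0, counit_antipode_of hC, hC.counit_act', h2]
  rw [hR.counit_right_sw (F := fun x => 𝓒.counit c * pair (S' (h * x) ⊗ₜ a)) (by fun_prop), mul_one]

/-- The inverse braided antipode in the pairing cancels the braided antipode inside the antipode of
`X`, so `ev` itself reappears. -/
theorem factorPairing_antipode_inr (hR : QTri R T) (hp : DualPair pair)
    (hC : IsModuleBraidedGroup (HopfData.of k H).toBialgData R act 𝓒)
    (hS : Function.Bijective 𝓒.antipode)
    (hI : InvPairing T act (evalAct pair β) 𝓒 𝓑 (evInv 𝓒 ev)) (c : C) (h : H) (b : B) :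
    Pf ((Sx (c ⊗ₜ h)) ⊗ₜ[k] ((1 : A) ⊗ₜ b)) = ε h * ev (c ⊗ₜ b) := by
  rw [factorPairing_inr hR hp hI, leftProj_antipode hR hC, ← TensorProduct.smul_tmul', map_smul,
    evInv_tmul, linInv_apply_self hS, smul_eq_mul]

theorem factorPairing_antipode_one_tmul (hR : QTri R T) (hp : DualPair pair)
    (hC : IsModuleBraidedGroup (HopfData.of k H).toBialgData R act 𝓒)
    (hB : IsComoduleBraidedGroup (HopfData.of k A).toBialgData pair R β 𝓑)
    (hI : InvPairing T act (evalAct pair β) 𝓒 𝓑 (evInv 𝓒 ev)) (h : H) (a : A) (b : B) :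
    Pf ((Sx (𝓒.one ⊗ₜ h)) ⊗ₜ[k] (a ⊗ₜ b)) = pair (S' h ⊗ₜ a) * 𝓑.counit b := by
  have h0 (h : H) : leftTwist act (h ⊗ₜ 𝓒.one) = 𝓒.one ⊗ₜ h := by
    simp only [leftTwist_tmul, hC.one_act', ← TensorProduct.smul_tmul']
    rw [counit_smul_sw h (F := fun q => 𝓒.one ⊗ₜ q) (by fun_prop)]
  rw [leftFactor_antipode_tmul]
  simp only [hC.one_act', map_smul, antipode_one_of hC, TensorProduct.tmul_smul, h0]
  rw [hR.counit_right_sw (F := fun x => 𝓒.one ⊗ₜ[k] S' (h * x)) (by fun_prop), mul_one,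
    factorPairing_one_tmul hR hp hB hI]

end PairingValues

/-! ### The identities in `H` behind the reorderings. -/

section ReorderingIdentities

variable {k H Z : Type*} [Field k] [Ring H] [HopfAlgebra k H] [AddCommGroup Z] [Module k Z]
  {R T : H ⊗[k] H}

local notation "δ" => Coalgebra.comul (R := k)
local notation "ε" => Coalgebra.counit (R := k)
local notation "S" => HopfAlgebra.antipode k
local notation "S'" => linInv (HopfAlgebra.antipode k)

namespace QTri

/-- The identity behind the reordering of `A` and `C ⋊ H^op` in the double. -/
theorem reorder_left_sw (hR : QTri R T) (h : H) {F : H → H → H → Z}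
    (h1 : ∀ y z, Lin k (fun x => F x y z)) (h2 : ∀ x z, Lin k (fun y => F x y z))
    (h3 : ∀ x y, Lin k (fun z => F x y z)) :
    (sw (δ h) fun p r => sw R fun x y => sw (δ r) fun q s => sw (δ q) fun u v => sw R fun m n =>
      F (s * m * S' (p * x)) (y * S u) (v * n)) =
    sw (δ h) fun p q => sw R fun m n => sw R fun x y => F (m * x) (S (y * p)) (n * q) := by
  trans sw (δ h) fun p r => sw (δ r) fun u s => sw (δ s) fun v w => sw R fun m n => sw R fun x y =>
    F (m * (v * x) * S' p) (S (u * y)) (n * w)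
  · refine sw_congr fun p r => ?_
    have e (x y : H) : (sw (δ r) fun q s => sw (δ q) fun u v => sw R fun m n =>
        F (s * m * S' (p * x)) (y * S u) (v * n)) = sw (δ r) fun u s => sw (δ s) fun v w =>
        sw R fun m n => F (m * v * (S' x * S' p)) (y * S u) (n * w) := by
      rw [comul_coassoc_sw r (F := fun u v s => sw R fun m n =>
        F (s * m * S' (p * x)) (y * S u) (v * n)) (by fun_prop) (by fun_prop) (by fun_prop)]
      refine sw_congr fun u s => ?_
      simp only [linInv_antipode_mul hR]
      exact hR.quasi_sw s (F := fun z w => F (z * (S' x * S' p)) (y * S u) w) (by fun_prop)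
        (by fun_prop)
    simp only [e]
    rw [hR.linInv_antipode_left_eq_sw (F := fun x y => sw (δ r) fun u s => sw (δ s) fun v w =>
        sw R fun m n => F (m * v * (x * S' p)) (y * S u) (n * w)) (by fun_prop) (by fun_prop)]
    simp only [sw_comm R (δ _), antipode_mul_rev, mul_assoc]
    refine sw_congr fun u s => sw_congr fun v w => ?_
    rw [sw_comm]
  · have e (p r : H) : (sw (δ r) fun u s => sw (δ s) fun v w => sw R fun m n => sw R fun x y =>
        F (m * (v * x) * S' p) (S (u * y)) (n * w)) = sw (δ r) fun u s => sw (δ s) fun v w =>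
        sw R fun x y => sw R fun m n => F (m * x * (u * S' p)) (S (y * v)) (n * w) := by
      rw [← comul_coassoc_sw r (F := fun u v w => sw R fun m n => sw R fun x y =>
        F (m * (v * x) * S' p) (S (u * y)) (n * w)) (by fun_prop) (by fun_prop) (by fun_prop),
        ← comul_coassoc_sw r (F := fun u v w => sw R fun x y => sw R fun m n =>
        F (m * x * (u * S' p)) (S (y * v)) (n * w)) (by fun_prop) (by fun_prop) (by fun_prop)]
      refine sw_congr fun q w => ?_
      have := hR.quasi_sw q (F := fun z t => sw R fun m n => F (m * z * S' p) (S t) (n * w))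
        (by fun_prop) (by fun_prop)
      simp only [mul_assoc] at this ⊢
      exact (sw_congr fun u v => sw_comm R R _).trans this
    simp only [e]
    -- A leg of `h` has been brought next to `S⁻¹(h₍₁₎)`, and the two collapse.
    rw [← comul_coassoc_sw h (F := fun p u s => sw (δ s) fun v w => sw R fun x y =>
      sw R fun m n => F (m * x * (u * S' p)) (S (y * v)) (n * w)) (by fun_prop) (by fun_prop)
      (by fun_prop)]
    have h0 (q s : H) := linInv_antipode_right_sw hR q (F := fun z => sw (δ s) fun v w =>
      sw R fun x y => sw R fun m n => F (m * x * z) (S (y * v)) (n * w)) (by fun_prop)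
    simp (disch := fun_prop) only [h0, counit_smul_sw, mul_one]
    refine sw_congr fun v w => ?_
    rw [sw_comm]

/-- `R⁽¹⁾T⁽¹⁾ ⊗ R⁽²⁾T'⁽¹⁾ ⊗ T'⁽²⁾T⁽²⁾ = T⁽¹⁾R⁽¹⁾ ⊗ T'⁽¹⁾R⁽²⁾ ⊗ T⁽²⁾T'⁽²⁾` for `T = R⁻¹`. -/
theorem yangBaxter_mixed_sw (hR : QTri R T) {F : H → H → H → Z}
    (h1 : ∀ y z, Lin k (fun x => F x y z)) (h2 : ∀ x z, Lin k (fun y => F x y z))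
    (h3 : ∀ x y, Lin k (fun z => F x y z)) :
    (sw T fun a b => sw T fun c d => sw R fun x y => F (x * a) (y * c) (d * b)) =
      sw T fun a b => sw T fun c d => sw R fun x y => F (a * x) (c * y) (b * d) := by
  trans sw T fun a b => sw (δ a) fun p q => sw R fun x y => F (x * p) (y * q) b
  · exact (hR.comul_left_inv_sw (F := fun p q b => sw R fun x y => F (x * p) (y * q) b)
      (by fun_prop) (by fun_prop) (by fun_prop)).symm
  · have e (a b : H) := hR.quasi_sw a (F := fun x y => F x y b) (by fun_prop) (by fun_prop)
    simp only [← e]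
    rw [hR.comul_left_inv_sw (F := fun p q b => sw R fun x y => F (q * x) (p * y) b)
      (by fun_prop) (by fun_prop) (by fun_prop), sw_comm]

/-- The reordering of `B` and `C` in the double, as an identity in `H`. -/
theorem reorder_cross_sw (hR : QTri R T) {F : H → H → H → H → H → H → Z}
    (h1 : ∀ b c d e f, Lin k (fun a => F a b c d e f))
    (h2 : ∀ a c d e f, Lin k (fun b => F a b c d e f))
    (h3 : ∀ a b d e f, Lin k (fun c => F a b c d e f))
    (h4 : ∀ a b c e f, Lin k (fun d => F a b c d e f))
    (h5 : ∀ a b c d f, Lin k (fun e => F a b c d e f))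
    (h6 : ∀ a b c d e, Lin k (fun f => F a b c d e f))
    (hF : ∀ a b c d e f g, F a b c d (e * g) f = F a b c d e (f * S' g)) :
    (sw R fun x y => sw T fun z w => sw (δ x) fun x₁ x₂ => sw (δ z) fun z₁ z₂ => sw R fun m n =>
      F (z₁ * m) (S x₁) (x₂ * n) z₂ y w) =
    sw T fun i j => sw T fun u v => sw T fun a b => sw T fun r s => sw R fun m n =>
      F (m * a) i (n * r) u j (v * (s * b)) := by
  trans sw R fun x y => sw (δ x) fun x₁ x₂ => sw T fun z w => sw (δ z) fun z₁ z₂ => sw R fun m n =>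
      F (z₁ * m) (S x₁) (x₂ * n) z₂ y w
  · refine sw_congr fun x y => ?_
    rw [sw_comm]
  rw [hR.comul_left_sw (F := fun x₁ x₂ y => sw T fun z w => sw (δ z) fun z₁ z₂ => sw R fun m n =>
      F (z₁ * m) (S x₁) (x₂ * n) z₂ y w) (by fun_prop) (by fun_prop) (by fun_prop),
    hR.antipode_left_eq_sw (F := fun x y => sw R fun x' y' => sw T fun z w => sw (δ z) fun z₁ z₂ =>
      sw R fun m n => F (z₁ * m) x (x' * n) z₂ (y * y') w) (by fun_prop) (by fun_prop)]
  refine sw_congr fun i j => ?_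
  -- `hF` abstracts adjointness: in the application the fifth slot acts on `C` and the sixth on `B`,
  -- with `S⁻¹` passing between them.
  simp only [hF]
  rw [hR.linInv_antipode_right_eq_sw (F := fun r s => sw T fun z w => sw (δ z) fun z₁ z₂ =>
      sw R fun m n => F (z₁ * m) i (r * n) z₂ j (w * s)) (by fun_prop) (by fun_prop)]
  have e (r s : H) := hR.comul_left_inv_sw (F := fun z₁ z₂ w =>
      sw R fun m n => F (z₁ * m) i (r * n) z₂ j (w * s)) (by fun_prop) (by fun_prop) (by fun_prop)
  simp only [e]
  have e2 (u v : H) := hR.yangBaxter_mixed_sw (F := fun x y z => F x i y u j (v * z)) (by fun_prop)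
    (by fun_prop) (by fun_prop)
  simp only [e2]
  trans sw T fun r s => sw T fun u v => sw T fun a b => sw R fun m n =>
    F (a * m) i (r * n) u j (v * b * s)
  · refine sw_congr fun r s => ?_
    rw [sw_comm]
  · rw [sw_comm]
    refine sw_congr fun u v => ?_
    rw [sw_comm]
    simp only [mul_assoc]

/-- The cross relation of the double-bosonisation, as an identity in `H`. -/
theorem cross_relation_sw (hR : QTri R T) {F : H → H → H → H → H → H → Z}
    (h1 : ∀ b c d e f, Lin k (fun a => F a b c d e f))
    (h2 : ∀ a c d e f, Lin k (fun b => F a b c d e f))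
    (_ : ∀ a b d e f, Lin k (fun c => F a b c d e f))
    (_ : ∀ a b c e f, Lin k (fun d => F a b c d e f))
    (h5 : ∀ a b c d f, Lin k (fun e => F a b c d e f))
    (h6 : ∀ a b c d e, Lin k (fun f => F a b c d e f))
    (hF : ∀ a b c d e f g, F a b c d (e * g) f = F a b c d e (f * S' g)) :
    (sw T fun x y => sw (δ y) fun p q => sw T fun c d => sw R fun g h => sw R fun m n =>
      sw T fun r s => sw T fun u v =>
      F (m * S' (x * S g)) (p * c * S h) (n * r) u (q * d * S s) v) =
    sw T fun i j => sw T fun u v => sw T fun a b => sw T fun r s => sw R fun m n =>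
      F (m * a) i (n * r) u j (v * (s * b)) := by
  rw [hR.comul_right_inv_sw (F := fun x p q => sw T fun c d => sw R fun g h => sw R fun m n =>
      sw T fun r s => sw T fun u v =>
      F (m * S' (x * S g)) (p * c * S h) (n * r) u (q * d * S s) v) (by fun_prop) (by fun_prop)
      (by fun_prop),
    hR.yangBaxter_inv_sw (F := fun x y z => sw R fun g h => sw R fun m n =>
      sw T fun r s => sw T fun u v =>
      F (m * S' (x * S g)) (y * S h) (n * r) u (z * S s) v) (by fun_prop) (by fun_prop)
      (by fun_prop)]
  have e1 (a b c d e f : H) := hR.antipode_antipode_eq_sw (F := fun g h => sw R fun m n =>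
      sw T fun r s => sw T fun u v =>
      F (m * S' (c * a * g)) (e * b * h) (n * r) u (f * d * S s) v) (by fun_prop) (by fun_prop)
  simp only [e1]
  -- After Yang–Baxter a copy of `R⁻¹` on the first two legs of `c` meets the copy of `R` acting on
  -- these legs in the cross relation, and they cancel.
  have e2 (c d e f : H) := hR.inv_mul_sw (F := fun g h => sw R fun m n =>
      sw T fun r s => sw T fun u v =>
      F (m * S' (c * g)) (e * h) (n * r) u (f * d * S s) v) (by fun_prop) (by fun_prop)
  have e3 : (sw T fun a b => sw T fun c d => sw T fun e f => sw R fun g h => sw R fun m n =>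
      sw T fun r s => sw T fun u v =>
      F (m * S' (c * a * g)) (e * b * h) (n * r) u (f * d * S s) v) =
      sw T fun c d => sw T fun e f => sw T fun a b => sw R fun g h => sw R fun m n =>
      sw T fun r s => sw T fun u v =>
      F (m * S' (c * (a * g))) (e * (b * h)) (n * r) u (f * d * S s) v := by
    rw [sw_comm]
    refine sw_congr fun c d => ?_
    rw [sw_comm]
    simp only [mul_assoc]
  rw [e3]
  simp only [e2, mul_one]
  simp only [mul_assoc, hF, linInv_antipode_mul hR, linInv_apply_self hR.bijective_antipode]
  have e4 (i j : H) := hR.linInv_antipode_inv_eq_sw (F := fun a b => sw R fun m n =>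
      sw T fun r s => sw T fun u v => F (m * a) i (n * r) u j (v * (s * b))) (by fun_prop)
      (by fun_prop)
  rw [sw_comm]
  simp only [e4]
  refine sw_congr fun i j => ?_
  simp only [sw_comm R T]
  trans sw T fun a b => sw T fun u v => sw T fun r s => sw R fun m n =>
    F (m * a) i (n * r) u j (v * (s * b))
  · refine sw_congr fun r s => ?_
    rw [sw_comm]
  · rw [sw_comm]

end QTri

end ReorderingIdentities

/-! ### The actions of `H` on both sides of `C ⊗ H ⊗ B`. -/

section Actions

variable {k H C B Z : Type*} [Field k] [Ring H] [HopfAlgebra k H]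
  [AddCommGroup C] [Module k C] [AddCommGroup B] [Module k B] [AddCommGroup Z] [Module k Z]
  {R T : H ⊗[k] H} {act : C ⊗[k] H →ₗ[k] C}
  {actB : B ⊗[k] H →ₗ[k] B} {𝓒 : HopfData k C} {𝓑 : HopfData k B}

local notation "δ" => Coalgebra.comul (R := k)
local notation "ε" => Coalgebra.counit (R := k)
local notation "S" => HopfAlgebra.antipode k

/-- The left action `h · (d ⊗ r ⊗ b) = h₍₁₎ ▷ d ⊗ h₍₂₎ r ⊗ b`. -/
def leftMul (act : C ⊗[k] H →ₗ[k] C) (h : H) (κ : C ⊗[k] (H ⊗[k] B)) : C ⊗[k] (H ⊗[k] B) :=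
  sw κ fun d w => sw w fun r b => sw (δ h) fun p q => act (d ⊗ₜ S p) ⊗ₜ[k] ((q * r) ⊗ₜ[k] b)

/-- The right action `(d ⊗ r ⊗ b) · h = d ⊗ r h₍₁₎ ⊗ b ◁ h₍₂₎`. -/
def rightMul (actB : B ⊗[k] H →ₗ[k] B) (h : H) (κ : C ⊗[k] (H ⊗[k] B)) : C ⊗[k] (H ⊗[k] B) :=
  sw κ fun d w => sw w fun r b => sw (δ h) fun p q => d ⊗ₜ[k] ((r * p) ⊗ₜ[k] actB (b ⊗ₜ q))

@[fun_prop] theorem Lin.leftMul {V : Type*} [AddCommGroup V] [Module k V] (h : H)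
    {f : V → C ⊗[k] (H ⊗[k] B)} (hf : Lin k f) :
    Lin k (fun v => DoubleBosonisation.leftMul act h (f v)) := by
  unfold DoubleBosonisation.leftMul
  fun_prop

@[fun_prop] theorem Lin.rightMul {V : Type*} [AddCommGroup V] [Module k V] (h : H)
    {f : V → C ⊗[k] (H ⊗[k] B)} (hf : Lin k f) :
    Lin k (fun v => DoubleBosonisation.rightMul actB h (f v)) := by
  unfold DoubleBosonisation.rightMul
  fun_prop

@[fun_prop] theorem Lin.rightMul_left {V : Type*} [AddCommGroup V] [Module k V]
    {f : V → H} (hf : Lin k f) (κ : C ⊗[k] (H ⊗[k] B)) :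
    Lin k (fun v => DoubleBosonisation.rightMul actB (f v) κ) := by
  unfold DoubleBosonisation.rightMul
  fun_prop

theorem leftMul_tmul (h r : H) (d : C) (b : B) : leftMul act h (d ⊗ₜ (r ⊗ₜ b)) =
    sw (δ h) fun p q => act (d ⊗ₜ S p) ⊗ₜ[k] ((q * r) ⊗ₜ[k] b) := by
  simp (disch := fun_prop) only [leftMul, sw_tmul]

theorem rightMul_tmul (h r : H) (d : C) (b : B) : rightMul actB h (d ⊗ₜ (r ⊗ₜ b)) =
    sw (δ h) fun p q => d ⊗ₜ[k] ((r * p) ⊗ₜ[k] actB (b ⊗ₜ q)) := by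
  simp (disch := fun_prop) only [rightMul, sw_tmul]

theorem ext_tmul₃ {f g : C ⊗[k] (H ⊗[k] B) → Z} (hf : Lin k f) (hg : Lin k g)
    (h : ∀ c r b, f (c ⊗ₜ (r ⊗ₜ b)) = g (c ⊗ₜ (r ⊗ₜ b))) : ∀ κ, f κ = g κ := by
  refine Lin.ext_tmul hf hg fun d w => ?_
  revert w
  exact Lin.ext_tmul (by fun_prop) (by fun_prop) fun r b => h d r b

/-- Factors of `H` next to the reordered middle can be absorbed into it. This matches the product of
`U` with projected reorderings that carry coefficients from `A` and `H`. -/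
theorem sandwich_mul (hC : IsModuleBraidedGroup (HopfData.of k H).toBialgData R act 𝓒)
    (hB : IsModuleBraidedGroup (HopfData.of k H).toBialgData R actB 𝓑) (c : C) (h h' g g' : H)
    (a : B) (κ : C ⊗[k] (H ⊗[k] B)) : sandwich act actB 𝓒 𝓑 c (h * h') (g' * g) a κ =
      sandwich act actB 𝓒 𝓑 c h g a (leftMul act h' (rightMul actB g' κ)) := by
  revert κ
  refine ext_tmul₃ (by fun_prop) (by fun_prop) fun d r b => ?_
  simp (disch := fun_prop) only [rightMul_tmul, leftMul_tmul, sandwich_tmul, Lin.map_sw (f :=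
    leftMul act _), Lin.map_sw (f := sandwich act actB 𝓒 𝓑 c h g a), comul_mul_eq_sw, sw_sw,
    sw_tmul, antipode_mul_rev, hC.act_act, hB.act_act, mul_assoc]
  simp only [sw_comm _ (δ g')]
  refine sw_congr fun _ _ => ?_
  simp only [sw_comm _ (δ h')]

end Actions

/-! ### The reordering in the double, projected. -/

section Reordering

variable {k H A C B Z : Type*} [Field k] [Ring H] [HopfAlgebra k H] [Ring A] [HopfAlgebra k A]
  [AddCommGroup C] [Module k C] [AddCommGroup B] [Module k B] [AddCommGroup Z] [Module k Z]
  {R T : H ⊗[k] H} {pair : H ⊗[k] A →ₗ[k] k} {act : C ⊗[k] H →ₗ[k] C} {β : B →ₗ[k] A ⊗[k] B}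
  {𝓒 : HopfData k C} {𝓑 : HopfData k B} {ev : C ⊗[k] B →ₗ[k] k}

local notation "δ" => Coalgebra.comul (R := k)
local notation "ε" => Coalgebra.counit (R := k)
local notation "S" => HopfAlgebra.antipode k
local notation "S'" => linInv (HopfAlgebra.antipode k)
local notation "π" => projection (B := B) (HopfData.of k H) R pair act
local notation "Pf" => factorPairing (HopfData.of k H) T pair 𝓒 β ev
local notation "Sx" => HopfData.antipode (leftFactor (HopfData.of k H) R 𝓒 act)

variable (R T pair act β 𝓒 𝓑 ev) in
/-- The reordering of `A^cop ⋉ B` and `C ⋊ H^op` in their double. -/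
abbrev factorTwist : (A ⊗[k] B) ⊗[k] (C ⊗[k] H) →ₗ[k] (C ⊗[k] H) ⊗[k] (A ⊗[k] B) :=
  doubleTwist (leftAlg R act 𝓒) (rightFactor (HopfData.of k A) R pair 𝓑 β) Pf

local notation "τ" => factorTwist R T pair act β 𝓒 𝓑 ev

/-- The antipode is moved to `X` by adjointness, because its pairings with `A` and with `B` there
have closed forms. -/
theorem factorTwist_tmul (hR : QTri R T) (hp : DualPair pair) (hA : QComm pair R)
    (hC : IsModuleBraidedGroup (HopfData.of k H).toBialgData R act 𝓒)
    (hB : IsComoduleBraidedGroup (HopfData.of k A).toBialgData pair R β 𝓑)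
    (hI : InvPairing T act (evalAct pair β) 𝓒 𝓑 (evInv 𝓒 ev)) (x : C ⊗[k] H) (y : A ⊗[k] B) :
    τ (y ⊗ₜ x) = sw ((leftAlg R act 𝓒).comul x) fun x₁ r => sw ((leftAlg R act 𝓒).comul r)
      fun x₂ x₃ => sw ((rightAlg R pair β 𝓑).comul y) fun y₁ s =>
      sw ((rightAlg R pair β 𝓑).comul s) fun y₂ y₃ =>
        Pf (Sx x₁ ⊗ₜ y₁) • Pf (x₃ ⊗ₜ y₃) • (x₂ ⊗ₜ y₂) := by
  have h (x₁ : C ⊗[k] H) (y₁ : A ⊗[k] B) : Pf (x₁ ⊗ₜ (rightFactor (HopfData.of k A) R pair 𝓑 β).antipode y₁) =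
      Pf (Sx x₁ ⊗ₜ y₁) :=
    ((isHopfPairing_factorPairing hR hp hB hI).antipode_adjoint (isCoalg_leftAlg hR hC)
      (isCoalg_rightAlg hB) (isAntipode_leftFactor hR hC) (isAntipode_rightFactor hR hp hA hB)
      x₁ y₁).symm
  rw [factorTwist, doubleTwist_tmul]
  simp only [h]
  rfl

theorem leftAlg_comul_inr (hR : QTri R T)
    (hC : IsModuleBraidedGroup (HopfData.of k H).toBialgData R act 𝓒) (h : H) :
    (leftAlg R act 𝓒).comul (𝓒.one ⊗ₜ h) = sw (δ h) fun p q => (𝓒.one ⊗ₜ p) ⊗ₜ (𝓒.one ⊗ₜ q) := by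
  rw [leftAlg_comul, hC.isBraidedBialgebra.comul_one, sw_tmul _ _ (by fun_prop) (by fun_prop)]
  refine sw_congr fun p q => ?_
  simp only [hC.one_act', ← TensorProduct.smul_tmul', TensorProduct.tmul_smul]
  rw [hR.counit_right_sw (F := fun x => (𝓒.one ⊗ₜ (p * x)) ⊗ₜ (𝓒.one ⊗ₜ q)) (by fun_prop), mul_one]

theorem rightAlg_comul_inl
    (hB : IsComoduleBraidedGroup (HopfData.of k A).toBialgData pair R β 𝓑) (a : A) :
    (rightAlg R pair β 𝓑).comul (a ⊗ₜ 𝓑.one) =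
      sw (δ a) fun p q => (q ⊗ₜ 𝓑.one) ⊗ₜ (p ⊗ₜ 𝓑.one) := by
  rw [rightAlg_comul, hB.isBraidedBialgebra.comul_one]
  simp (disch := fun_prop) only [sw_tmul, hB.coact_one', mul_one]

section Partial

variable (hR : QTri R T) (hp : DualPair pair)
  (hC : IsModuleBraidedGroup (HopfData.of k H).toBialgData R act 𝓒)
  (hB : IsComoduleBraidedGroup (HopfData.of k A).toBialgData pair R β 𝓑)
  (hI : InvPairing T act (evalAct pair β) 𝓒 𝓑 (evInv 𝓒 ev))
include hR hp hC hB hI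

/-- This lemma and the next four contract one half of the reordering formula when one of the
elements is a generator: a component of the other factor is seen only through its counit. -/
theorem pair_comul_inl_sw (c : C) (h : H) (a : A) {F : C ⊗[k] H → Z} (hF : Lin k F) :
    (sw ((leftAlg R act 𝓒).comul (c ⊗ₜ h)) fun x₁ x₂ => Pf (x₂ ⊗ₜ (a ⊗ₜ 𝓑.one)) • F x₁) =
      sw (δ h) fun p q => pair (q ⊗ₜ a) • F (c ⊗ₜ p) := by
  have e (c₂ : C) (x y q : H) (z : Z) : (𝓒.counit c₂ * ε y * pair (q ⊗ₜ a)) • z =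
      𝓒.counit c₂ • ε y • pair (q ⊗ₜ a) • z := by module
  simp (disch := fun_prop) only [leftAlg_comul, sw_sw, sw_tmul, factorPairing_inl hR hp hB hI,
    hC.counit_act', mul_smul, ← sw_smul_right]
  have e1 (c₁ : C) (p q : H) := hR.counit_right_sw (F := fun x => pair (q ⊗ₜ a) • F (c₁ ⊗ₜ (p * x)))
    (by fun_prop)
  simp only [e1, mul_one]
  exact hC.isCoalg.smul_counit c (F := fun c => sw (δ h) fun p q => pair (q ⊗ₜ a) • F (c ⊗ₜ p))
    (by fun_prop)

theorem pair_antipode_comul_inl_sw (c : C) (h : H) (a : A) {F : C ⊗[k] H → Z} (hF : Lin k F) :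
    (sw ((leftAlg R act 𝓒).comul (c ⊗ₜ h)) fun x₁ x₂ => Pf (Sx x₁ ⊗ₜ (a ⊗ₜ 𝓑.one)) • F x₂) =
      sw (δ h) fun p q => sw R fun x y => pair (S' (p * x) ⊗ₜ a) • F (act (c ⊗ₜ y) ⊗ₜ q) := by
  simp (disch := fun_prop) only [leftAlg_comul, sw_sw, sw_tmul,
    factorPairing_antipode_inl hR hp hC hB hI, mul_smul, ← sw_smul_right]
  exact hC.isCoalg.counit_smul c (F := fun c => sw (δ h) fun p q => sw R fun x y =>
    pair (S' (p * x) ⊗ₜ a) • F (act (c ⊗ₜ y) ⊗ₜ q)) (by fun_prop)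

theorem pair_comul_inr_sw (h : H) (a : A) (b : B) {F : A ⊗[k] B → Z} (hF : Lin k F) :
    (sw ((rightAlg R pair β 𝓑).comul (a ⊗ₜ b)) fun y₁ y₂ => Pf ((𝓒.one ⊗ₜ h) ⊗ₜ y₂) • F y₁) =
      sw (δ a) fun a₁ a₂ => sw (β b) fun u v => pair (h ⊗ₜ (a₁ * u)) • F (a₂ ⊗ₜ v) := by
  simp (disch := fun_prop) only [rightAlg_comul, sw_sw, sw_tmul,
    factorPairing_one_tmul hR hp hB hI, mul_comm (pair _), mul_smul, ← sw_smul_right]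
  refine sw_congr fun a₁ a₂ => ?_
  exact hB.isBraidedBialgebra.isCoalg.smul_counit b (F := fun b => sw (β b) fun u v =>
    pair (h ⊗ₜ (a₁ * u)) • F (a₂ ⊗ₜ v)) (by fun_prop)

theorem pair_antipode_comul_inr_sw (h : H) (b : B) {F : A ⊗[k] B → Z} (hF : Lin k F) :
    (sw ((rightAlg R pair β 𝓑).comul (1 ⊗ₜ b)) fun y₁ y₂ => Pf (Sx (𝓒.one ⊗ₜ h) ⊗ₜ y₁) • F y₂) =
      ε h • F (1 ⊗ₜ b) := by
  have e : ε (S' h) = ε h := by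
    conv_rhs => rw [← self_linInv_apply hR.bijective_antipode h, counit_antipode']
  have e1 (b₁ b₂ : B) := hB.coact_counit_sw b₁ (F := fun u => F (u ⊗ₜ b₂)) (by fun_prop)
  simp (disch := fun_prop) only [rightAlg_comul, sw_sw, sw_tmul, comul_one', one_mul,
    factorPairing_antipode_one_tmul hR hp hC hB hI, mul_smul, hp.one_right, e, ← sw_smul_right, e1]
  congr 1
  exact hB.isBraidedBialgebra.isCoalg.counit_smul b (F := fun b => F (1 ⊗ₜ b)) (by fun_prop)

theorem pair_antipode_comul_tmul_one_sw (hS : Function.Bijective 𝓒.antipode) (c : C) (b : B)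
    {F : C ⊗[k] H → Z} (hF : Lin k F) :
    (sw ((leftAlg R act 𝓒).comul (c ⊗ₜ 1)) fun x₁ x₂ => Pf (Sx x₁ ⊗ₜ ((1 : A) ⊗ₜ b)) • F x₂) =
      sw (𝓒.comul c) fun c₁ c₂ => ev (c₁ ⊗ₜ b) • F (c₂ ⊗ₜ 1) := by
  simp (disch := fun_prop) only [leftAlg_comul, sw_sw, sw_tmul, comul_one', one_mul,
    factorPairing_antipode_inr hR hp hC hS hI, mul_smul]
  refine sw_congr fun c₁ c₂ => ?_
  rw [hR.counit_left_sw (F := fun y => ev (c₁ ⊗ₜ b) • F (act (c₂ ⊗ₜ y) ⊗ₜ 1)) (by fun_prop),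
    hC.act_one']

end Partial

/-- Both evaluations in the reordering involve only the pairing of `H` with `A`, and together with
`slice` they become copies of `R`. By `reorder_left_sw`, `a` passes through `X` as its image in `H`
would. -/
theorem projection_factorTwist_inl (hR : QTri R T) (hp : DualPair pair) (hA : QComm pair R)
    (hC : IsModuleBraidedGroup (HopfData.of k H).toBialgData R act 𝓒)
    (hB : IsComoduleBraidedGroup (HopfData.of k A).toBialgData pair R β 𝓑)
    (hI : InvPairing T act (evalAct pair β) 𝓒 𝓑 (evInv 𝓒 ev)) (x : C ⊗[k] H) (a : A) :
    π (τ ((a ⊗ₜ 𝓑.one) ⊗ₜ x)) = sw (straighten act x) fun c h =>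
      leftMul act (slice pair R a) (c ⊗ₜ (h ⊗ₜ 𝓑.one)) := by
  revert x
  refine Lin.ext_tmul (by fun_prop) (by fun_prop) fun c h => ?_
  rw [factorTwist_tmul hR hp hA hC hB hI]
  simp (disch := fun_prop) only [rightAlg_comul_inl hB, sw_sw, sw_tmul]
  simp only [sw_comm ((leftAlg R act 𝓒).comul _) (δ _), ← sw_smul_right]
  simp (disch := fun_prop) only [pair_comul_inl_sw hR hp hC hB hI,
    pair_antipode_comul_inl_sw hR hp hC hB hI]
  have key := hR.reorder_left_sw h (F := fun x y z => pair (x ⊗ₜ a) •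
    (act (c ⊗ₜ y) ⊗ₜ[k] (z ⊗ₜ[k] 𝓑.one))) (by fun_prop) (by fun_prop) (by fun_prop)
  refine Eq.trans ?_ (key.trans ?_)
  · simp (disch := fun_prop) only [sw_map, map_smul, projection_tmul, hp.mul_left, slice_apply,
      sw_mul_left, sw_mul_right, sw_tmul_left, sw_tmul_right, sw_smul_left, sw_smul_right,
      mul_smul_comm, smul_mul_assoc, TensorProduct.tmul_smul, ← TensorProduct.smul_tmul',
      hC.act_act]
    simp only [sw_comm _ (δ a)]
    refine sw_congr fun a₁ a₂ => sw_congr fun p r => sw_congr fun x y => ?_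
    simp only [sw_comm _ (δ a₁)]
    refine sw_congr fun _ _ => sw_congr fun _ _ => sw_congr fun _ _ => sw_congr fun _ _ => ?_
    module
  · simp (disch := fun_prop) only [straighten_tmul, sw_sw, sw_tmul, leftMul_tmul,
      slice_comul hR hp, hC.act_act, ← antipode_mul_rev, hp.mul_left]
    simp (disch := fun_prop) only [slice_apply, sw_map, map_smul,
      sw_mul_left, sw_mul_right, sw_tmul_left, sw_tmul_right, sw_smul_left, sw_smul_right,
      mul_smul_comm, smul_mul_assoc, TensorProduct.tmul_smul, ← TensorProduct.smul_tmul']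
    refine sw_congr fun p q => ?_
    simp only [sw_comm _ (δ a)]
    refine sw_congr fun a₁ a₂ => ?_
    refine sw_congr fun _ _ => sw_congr fun _ _ => ?_
    module

/-- The evaluation with the antipode degenerates to a counit, and the other one is the action of
`h₍₂₎` on `b`. -/
theorem projection_factorTwist_inr (hR : QTri R T) (hp : DualPair pair) (hA : QComm pair R)
    (hC : IsModuleBraidedGroup (HopfData.of k H).toBialgData R act 𝓒)
    (hB : IsComoduleBraidedGroup (HopfData.of k A).toBialgData pair R β 𝓑)
    (hI : InvPairing T act (evalAct pair β) 𝓒 𝓑 (evInv 𝓒 ev)) (h : H) (b : B) :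
    π (τ ((1 ⊗ₜ b) ⊗ₜ (𝓒.one ⊗ₜ h))) = sw (δ h) fun p q =>
      𝓒.one ⊗ₜ (p ⊗ₜ evalAct pair β (b ⊗ₜ q)) := by
  rw [factorTwist_tmul hR hp hA hC hB hI]
  simp (disch := fun_prop) only [leftAlg_comul_inr hR hC, sw_sw, sw_tmul, ← sw_smul_right]
  have e (p q h : H) := pair_antipode_comul_inr_sw hR hp hC hB hI h b (F := fun s =>
    sw ((rightAlg R pair β 𝓑).comul s) fun y₂ y₃ => Pf ((𝓒.one ⊗ₜ q) ⊗ₜ y₃) •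
      ((𝓒.one ⊗ₜ[k] p) ⊗ₜ[k] y₂)) (by fun_prop)
  have e2 (p q : H) (a : A) (b : B) := pair_comul_inr_sw hR hp hC hB hI q a b (F := fun y =>
      ((𝓒.one ⊗ₜ[k] p) ⊗ₜ[k] y)) (by fun_prop)
  simp only [e, e2]
  have e3 (p : H) := hC.one_act' (S p)
  simp (disch := fun_prop) only [comul_one', sw_tmul, one_mul, sw_map, map_smul, projection_tmul,
    slice_one hR hp, mul_one, hC.one_act', counit_antipode', ← TensorProduct.smul_tmul',
    counit_smul_sw, ← sw_smul_right, evalAct_tmul, sw_tmul_right, TensorProduct.tmul_smul]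

theorem coact_pair_sw (b : B) (h : H) {F : B → Z} (hF : Lin k F) :
    (sw (β b) fun u v => pair (h ⊗ₜ u) • F v) = F (evalAct pair β (b ⊗ₜ h)) := by
  simp only [evalAct_tmul, hF.map_sw, hF.smul]

theorem coact_comul_slice_sw (hp : DualPair pair) (b : B) (h : H) {F : H → B → Z}
    (h1 : ∀ y, Lin k (fun x => F x y)) (h2 : ∀ x, Lin k (fun y => F x y)) :
    (sw (β b) fun u v => sw (δ u) fun u₁ u₂ => pair (h ⊗ₜ u₁) • F (slice pair R u₂) v) =
      sw R fun m n => F n (evalAct pair β (b ⊗ₜ (h * m))) := by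
  simp only [evalAct_tmul, slice_apply, (h1 _).map_sw, (h2 _).map_sw, (h1 _).smul, (h2 _).smul,
    hp.mul_left, sw_smul_left, sw_smul_right, mul_smul]
  rw [sw_comm R (β b)]
  refine sw_congr fun u v => ?_
  rw [sw_comm]

/-- The reordering of `B` and `C` in the double projects to the one in the double-bosonisation. -/
theorem projection_factorTwist_cross (hR : QTri R T) (hp : DualPair pair) (hA : QComm pair R)
    (hC : IsModuleBraidedGroup (HopfData.of k H).toBialgData R act 𝓒)
    (hB : IsComoduleBraidedGroup (HopfData.of k A).toBialgData pair R β 𝓑)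
    (hS : Function.Bijective 𝓒.antipode)
    (hI : InvPairing T act (evalAct pair β) 𝓒 𝓑 (evInv 𝓒 ev)) (c : C) (b : B) :
    π (τ ((1 ⊗ₜ b) ⊗ₜ (c ⊗ₜ 1))) = crossRelation (HopfData.of k H).toBialgData R T (bar 𝓒 T act)
      𝓑.toBialgData (barAct (HopfData.of k H) act) (evalAct pair β) ev (b ⊗ₜ c) := by
  rw [factorTwist_tmul hR hp hA hC hB hI, crossRelation_tmul]
  simp (disch := fun_prop) only [rightAlg_comul, sw_sw, sw_tmul, comul_one', one_mul]
  simp only [sw_comm ((leftAlg R act 𝓒).comul _) (𝓑.comul _), sw_comm ((leftAlg R act 𝓒).comul _) (β _),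
    sw_comm ((leftAlg R act 𝓒).comul _) (δ _), ← sw_smul_right]
  simp (disch := fun_prop) only [pair_antipode_comul_tmul_one_sw hR hp hC hB hI hS]
  simp (disch := fun_prop) only [leftAlg_comul, sw_sw, sw_tmul, comul_one', one_mul,
    factorPairing_tmul_one, sw_map, map_smul, projection_tmul, sw_smul_left, sw_smul_right, hp.mul_right]
  have hact (c : C) (h : H) (b : B) : ev (act (c ⊗ₜ h) ⊗ₜ b) =
      ev (c ⊗ₜ evalAct pair β (b ⊗ₜ S' h)) := by
    have e (c : C) (b : B) : ev (c ⊗ₜ b) = evInv 𝓒 ev (𝓒.antipode c ⊗ₜ b) := by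
      rw [evInv_tmul, linInv_apply_self hS]
    rw [e, e, hC.antipode_act', hI.act_left]
  have hB' := hB.isModuleBraidedGroup hp
  -- Both reorderings are brought to this common expression, by `reorder_cross_sw` from the double
  -- and by `cross_relation_sw` from the double-bosonisation.
  trans sw (𝓑.comul b) fun b₁ s => sw (𝓑.comul s) fun b₂ b₃ => sw (𝓒.comul c) fun c₁ r =>
    sw (𝓒.comul r) fun c₂ c₃ => sw T fun i j => sw T fun u v => sw T fun a b => sw T fun r s =>
    sw R fun m n => ev (c₁ ⊗ₜ evalAct pair β (b₁ ⊗ₜ (m * a))) •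
      evInv 𝓒 ev (act (c₃ ⊗ₜ j) ⊗ₜ evalAct pair β (b₃ ⊗ₜ (v * (s * b)))) •
        (act (c₂ ⊗ₜ i) ⊗ₜ[k] ((n * r) ⊗ₜ[k] evalAct pair β (b₂ ⊗ₜ u)))
  · trans sw (𝓑.comul b) fun b₁ s => sw (𝓑.comul s) fun b₂ b₃ => sw (𝓒.comul c) fun c₁ r =>
      sw (𝓒.comul r) fun c₂ c₃ => sw R fun x y => sw T fun z w => sw (δ x) fun x₁ x₂ =>
      sw (δ z) fun z₁ z₂ => sw (β b₁) fun u v => sw (δ u) fun u₁ u₂ => pair (z₁ ⊗ₜ u₁) •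
      sw (β b₂) fun u' v' => pair (z₂ ⊗ₜ u') • ev (c₁ ⊗ₜ v) •
      evInv 𝓒 ev (act (c₃ ⊗ₜ y) ⊗ₜ evalAct pair β (b₃ ⊗ₜ w)) •
        (act (c₂ ⊗ₜ S x₁) ⊗ₜ[k] ((x₂ * slice pair R u₂) ⊗ₜ[k] v'))
    · refine sw_congr fun b₁ s => ?_
      simp only [sw_mul_left, sw_smul_left, sw_smul_right, sw_comm _ (β b₁)]
      refine sw_congr fun u v => ?_
      simp only [sw_comm _ (δ u)]
      simp only [sw_comm _ (𝓑.comul s)]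
      refine sw_congr fun b₂ b₃ => ?_
      simp only [sw_comm _ (β b₂)]
      refine sw_congr fun u' v' => ?_
      refine sw_congr fun u₁ u₂ => sw_congr fun c₁ r => sw_congr fun c₂ c₃ => sw_congr fun x y =>
        sw_congr fun z w => sw_congr fun x₁ x₂ => ?_
      refine sw_congr fun z₁ z₂ => ?_
      module
    · refine sw_congr fun b₁ s => sw_congr fun b₂ b₃ => sw_congr fun c₁ r => sw_congr fun c₂ c₃ => ?_
      refine Eq.trans ?_ (hR.reorder_cross_sw (F := fun α β' γ θ ζ η =>
        ev (c₁ ⊗ₜ evalAct pair β (b₁ ⊗ₜ α)) • evInv 𝓒 ev (act (c₃ ⊗ₜ ζ) ⊗ₜ evalAct pair β (b₃ ⊗ₜ η)) •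
        (act (c₂ ⊗ₜ β') ⊗ₜ[k] (γ ⊗ₜ[k] evalAct pair β (b₂ ⊗ₜ θ)))) (by fun_prop) (by fun_prop)
        (by fun_prop) (by fun_prop) (by fun_prop) (by fun_prop) ?_)
      · refine sw_congr fun x y => sw_congr fun z w => sw_congr fun x₁ x₂ => sw_congr fun z₁ z₂ => ?_
        have e1 (u₂ : A) (v : B) := coact_pair_sw (pair := pair) (β := β) b₂ z₂ (F := fun v' =>
          ev (c₁ ⊗ₜ v) • evInv 𝓒 ev (act (c₃ ⊗ₜ y) ⊗ₜ evalAct pair β (b₃ ⊗ₜ w)) •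
          (act (c₂ ⊗ₜ S x₁) ⊗ₜ[k] ((x₂ * slice pair R u₂) ⊗ₜ[k] v'))) (by fun_prop)
        simp only [e1]
        exact coact_comul_slice_sw hp b₁ z₁ (F := fun n v =>
          ev (c₁ ⊗ₜ v) • evInv 𝓒 ev (act (c₃ ⊗ₜ y) ⊗ₜ evalAct pair β (b₃ ⊗ₜ w)) •
          (act (c₂ ⊗ₜ S x₁) ⊗ₜ[k] ((x₂ * n) ⊗ₜ[k] evalAct pair β (b₂ ⊗ₜ z₂)))) (by fun_prop)
          (by fun_prop)
      · intro α β' γ θ ζ η g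
        rw [← hC.act_act, hI.act_left, hB'.act_act]
  · have hE (c : C) (h : H) (b : B) : ev (act (linInv 𝓒.antipode c ⊗ₜ h) ⊗ₜ b) =
        evInv 𝓒 ev (act (c ⊗ₜ h) ⊗ₜ b) := by rw [evInv_tmul, hC.linInv_antipode_act hS]
    simp (disch := fun_prop) only [bar_comul, sw_sw, sw_tmul, hC.comul_act_sw, hC.act_act,
      hC.linInv_antipode_act hS, hE]
    simp only [sw_comm _ (𝓑.comul b)]
    refine sw_congr fun b₁ s => ?_
    simp only [sw_comm _ (𝓑.comul s)]
    refine sw_congr fun b₂ b₃ => sw_congr fun c₁ r => ?_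
    simp only [sw_comm _ (𝓒.comul r)]
    refine sw_congr fun c₂ c₃ => ?_
    refine (hR.cross_relation_sw (F := fun α β' γ θ ζ η =>
        ev (c₁ ⊗ₜ evalAct pair β (b₁ ⊗ₜ α)) • evInv 𝓒 ev (act (c₃ ⊗ₜ ζ) ⊗ₜ evalAct pair β (b₃ ⊗ₜ η)) •
        (act (c₂ ⊗ₜ β') ⊗ₜ[k] (γ ⊗ₜ[k] evalAct pair β (b₂ ⊗ₜ θ)))) (by fun_prop) (by fun_prop)
        (by fun_prop) (by fun_prop) (by fun_prop) (by fun_prop) ?_).symm.trans ?_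
    · intro α β' γ θ ζ η g
      rw [← hC.act_act, hI.act_left, hB'.act_act]
    · simp only [mul_assoc, ← hB'.act_act, ← hact]

end Reordering

/-! ### From generators to arbitrary reorderings. -/

section ProjectionHom

variable {k H A C B Z : Type*} [Field k] [Ring H] [HopfAlgebra k H] [Ring A] [HopfAlgebra k A]
  [AddCommGroup C] [Module k C] [AddCommGroup B] [Module k B] [AddCommGroup Z] [Module k Z]
  {R T : H ⊗[k] H} {pair : H ⊗[k] A →ₗ[k] k} {act : C ⊗[k] H →ₗ[k] C} {β : B →ₗ[k] A ⊗[k] B}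
  {𝓒 : HopfData k C} {𝓑 : HopfData k B} {ev : C ⊗[k] B →ₗ[k] k}

local notation "δ" => Coalgebra.comul (R := k)
local notation "ε" => Coalgebra.counit (R := k)
local notation "S" => HopfAlgebra.antipode k
local notation "S'" => linInv (HopfAlgebra.antipode k)
local notation "π" => projection (B := B) (HopfData.of k H) R pair act
local notation "Pf" => factorPairing (HopfData.of k H) T pair 𝓒 β ev
local notation "τ" => factorTwist R T pair act β 𝓒 𝓑 ev

variable (R T pair act β 𝓒 𝓑 ev) in
/-- The cross relation of the double-bosonisation. -/
abbrev crossTwist : B ⊗[k] C →ₗ[k] C ⊗[k] (H ⊗[k] B) :=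
  crossRelation (HopfData.of k H).toBialgData R T (bar 𝓒 T act) 𝓑.toBialgData
    (barAct (HopfData.of k H) act) (evalAct pair β) ev

local notation "κ" => crossTwist R T pair act β 𝓒 𝓑 ev

variable (hR : QTri R T) (hp : DualPair pair) (hA : QComm pair R)
  (hC : IsModuleBraidedGroup (HopfData.of k H).toBialgData R act 𝓒)
  (hB : IsComoduleBraidedGroup (HopfData.of k A).toBialgData pair R β 𝓑)
  (hS : Function.Bijective 𝓒.antipode)
  (hI : InvPairing T act (evalAct pair β) 𝓒 𝓑 (evInv 𝓒 ev))
include hR hp hA hC hB hI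

theorem isAlgTwist_factorTwist : BialgData.IsAlgTwist (leftAlg R act 𝓒).op (rightAlg R pair β 𝓑) τ :=
  isAlgTwist_doubleTwist (𝓧 := leftFactor (HopfData.of k H) R 𝓒 act)
    (𝓨 := rightFactor (HopfData.of k A) R pair 𝓑 β) (isBialgebra_leftAlg hR hC)
    (isBialgebra_rightAlg hR hp hA hB) (isAntipode_rightFactor hR hp hA hB)
    (isHopfPairing_factorPairing hR hp hB hI)

theorem projection_mul_inr (p : C ⊗[k] H) (q : A ⊗[k] B) (a : A) (b : B) :
    π (p ⊗ₜ (rightAlg R pair β 𝓑).mul (q ⊗ₜ (a ⊗ₜ b))) =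
      sandwich act (evalAct pair β) 𝓒 𝓑 𝓒.one 1 (slice pair R a) b (π (p ⊗ₜ q)) := by
  have := projection_mul_mul (β := β) (𝓑 := 𝓑) hR hp hC (𝓒.one ⊗ₜ 1) p q a b
  rw [← leftAlg_one (R := R) (act := act), (isAlg_leftAlg hC).mul_one, leftAlg_one, straighten_tmul] at this
  rw [this]
  simp (disch := fun_prop) only [comul_one', sw_tmul, antipode_one', hC.act_one']

theorem projection_mul_inl (x p : C ⊗[k] H) (q : A ⊗[k] B) :
    π ((leftAlg R act 𝓒).mul (p ⊗ₜ x) ⊗ₜ q) = sw (straighten act x) fun c h =>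
      sandwich act (evalAct pair β) 𝓒 𝓑 c h 1 𝓑.one (π (p ⊗ₜ q)) := by
  have := projection_mul_mul (β := β) (𝓑 := 𝓑) hR hp hC x p q 1 𝓑.one
  rw [← rightAlg_one (R := R) (pair := pair) (β := β), (isAlg_rightAlg hR hp hB).mul_one, slice_one hR hp] at this
  exact this

/-- `a ⊗ b` is the product of `a` and `b`. By the distributive law `b` passes `x` first, and then
`a` passes each resulting element of `X` as its image in `H`. -/
theorem projection_factorTwist_left (a : A) (b : B) (x : C ⊗[k] H) :
    π (τ ((a ⊗ₜ b) ⊗ₜ x)) = leftMul act (slice pair R a) (π (τ ((1 ⊗ₜ b) ⊗ₜ x))) := by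
  have hB' := hB.isModuleBraidedGroup hp
  have hm : (rightAlg R pair β 𝓑).mul ((a ⊗ₜ 𝓑.one) ⊗ₜ (1 ⊗ₜ b)) = a ⊗ₜ b := by
    simp (disch := fun_prop) only [rightAlg_mul, comul_one', sw_tmul, mul_one, slice_one hR hp,
      hB'.act_one', hB'.isAlg.one_mul]
  rw [← hm, (isAlgTwist_factorTwist hR hp hA hC hB hI).mul_tmul]
  generalize τ ((1 ⊗ₜ b) ⊗ₜ x) = z
  simp only [sw_map]
  revert z
  refine Lin.ext_tmul (by fun_prop) (by fun_prop) fun p q => ?_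
  rw [sw_tmul _ _ (by fun_prop) (by fun_prop)]
  revert q; refine Lin.ext_tmul (k := k) (V := A) (W := B) (by fun_prop) (by fun_prop) fun a' b' => ?_
  simp only [projection_mul_inr hR hp hA hC hB hI]
  rw [← sw_sandwich, ← sw_map, sw_eta, projection_factorTwist_inl hR hp hA hC hB hI, projection_straighten]
  generalize straighten act p = z
  revert z
  refine Lin.ext_tmul (by fun_prop) (by fun_prop) fun c h => ?_
  simp (disch := fun_prop) only [sw_tmul, leftMul_tmul, sw_sandwich, sandwich_tmul, comul_one',
    antipode_one', hC.act_one', hC.isAlg.mul_one, hB'.one_act', one_mul, mul_assoc]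
  refine sw_congr fun p q => ?_
  have e (t : H) : 𝓑.mul ((ε t • 𝓑.one) ⊗ₜ b') = ε t • b' := by
    rw [← TensorProduct.smul_tmul', map_smul, hB'.isAlg.one_mul]
  simp only [e, TensorProduct.tmul_smul]
  exact smul_counit_sw (slice pair R a') (F := fun s => act (c ⊗ₜ S p) ⊗ₜ[k] ((q * (h * s)) ⊗ₜ[k] b'))
    (by fun_prop)

-- In the order `h · c` the distributive law for `X^op` lets `b` pass `c` first, which is the cross
-- relation, and what remains of `b` then passes `h`. An element of `A` produced on the way acts
-- through its image in `H`.
include hS in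
theorem projection_factorTwist_right (b : B) (c : C) (h : H) :
    π (τ ((1 ⊗ₜ b) ⊗ₜ (leftTwist act (h ⊗ₜ c)))) = rightMul (evalAct pair β) h (κ (b ⊗ₜ c)) := by
  have hB' := hB.isModuleBraidedGroup hp
  have hm : leftTwist act (h ⊗ₜ c) =
      (leftAlg R act 𝓒).op.mul ((c ⊗ₜ 1) ⊗ₜ (𝓒.one ⊗ₜ h)) := by
    rw [BialgData.sw_op_mul, leftAlg_mul, leftTwist_tmul]
    simp only [hC.isAlg.one_mul, one_mul]
  rw [hm, (isAlgTwist_factorTwist hR hp hA hC hB hI).tmul_mul,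
    ← projection_factorTwist_cross hR hp hA hC hB hS hI]
  generalize τ ((1 ⊗ₜ b) ⊗ₜ (c ⊗ₜ 1)) = z
  simp only [sw_map]
  revert z
  refine Lin.ext_tmul (by fun_prop) (by fun_prop) fun p q => ?_
  rw [sw_tmul _ _ (by fun_prop) (by fun_prop)]
  simp only [BialgData.sw_op_mul, projection_mul_inl hR hp hA hC hB hI]
  rw [sw_comm]
  simp only [← sw_sandwich, ← sw_map, sw_eta]
  revert q; refine Lin.ext_tmul (k := k) (V := A) (W := B) (by fun_prop) (by fun_prop) fun a b => ?_
  rw [projection_factorTwist_left hR hp hA hC hB hI, projection_factorTwist_inr hR hp hA hC hB hI,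
    projection_straighten]
  generalize straighten act p = z
  revert z
  refine Lin.ext_tmul (by fun_prop) (by fun_prop) fun c g => ?_
  have e (s t : H) (w : H ⊗[k] B) :
      𝓒.mul (act ((ε s • 𝓒.one) ⊗ₜ S t) ⊗ₜ c) ⊗ₜ[k] w = ε t • ε s • (c ⊗ₜ w) := by
    simp only [← TensorProduct.smul_tmul', map_smul, hC.one_act', hC.isAlg.one_mul,
      counit_antipode']
    rw [smul_comm]
  simp (disch := fun_prop) only [sw_tmul, leftMul_tmul, sw_sandwich, sandwich_tmul, comul_one',
    rightMul_tmul, Lin.map_sw (f := leftMul act _), hB'.act_one', hB'.isAlg.mul_one, hC.one_act',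
    counit_antipode', e, counit_smul_sw, ← sw_smul_right, mul_one, mul_assoc]

include hS in
theorem projection_factorTwist (a : A) (b : B) (x : C ⊗[k] H) :
    π (τ ((a ⊗ₜ b) ⊗ₜ x)) = sw (straighten act x) fun c h =>
      leftMul act (slice pair R a) (rightMul (evalAct pair β) h (κ (b ⊗ₜ c))) := by
  obtain ⟨z, rfl⟩ := (bijective_leftTwist hC).surjective x
  revert z
  refine Lin.ext_tmul (by fun_prop) (by fun_prop) fun h c => ?_
  rw [projection_factorTwist_left hR hp hA hC hB hI, projection_factorTwist_right hR hp hA hC hB hS hI,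
    straighten_leftTwist hC, sw_tmul _ _ (by fun_prop) (by fun_prop)]

end ProjectionHom

/-! ### Homomorphisms from the double and its antipode. -/

section DoubleHom

variable {k X Y Z : Type*} [Field k] [AddCommGroup X] [Module k X] [AddCommGroup Y] [Module k Y]
  [AddCommGroup Z] [Module k Z] {𝓧 : HopfData k X} {𝓨 : HopfData k Y} {P : X ⊗[k] Y →ₗ[k] k}
  {𝓩 : BialgData k Z} {f : X ⊗[k] Y →ₗ[k] Z}

/-- If `f` identifies `z` with `S y`, then after the antipode `y` may be replaced by `S z`. This is
used to remove `A` in favour of `H` inside `π ∘ S_D`. -/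
theorem comp_doubleAntipode_tmul_mul (hX : 𝓧.IsBialgebra) (hY : 𝓨.IsBialgebra)
    (hSX : 𝓧.IsAntipode 𝓧.antipode) (hbij : Function.Bijective 𝓧.antipode)
    (hSY : 𝓨.IsAntipode 𝓨.antipode) (hP : IsHopfPairing 𝓧.toBialgData 𝓨.toBialgData P)
    (hf : (generalisedDouble 𝓧 𝓨 P).IsHom 𝓩 f) {z : X} {y : Y}
    (h : f (z ⊗ₜ 𝓨.one) = f (𝓧.one ⊗ₜ 𝓨.antipode y)) (x : X) (y' : Y) :
    f (doubleAntipode 𝓧 𝓨 P (x ⊗ₜ 𝓨.mul (y ⊗ₜ y'))) =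
      f (doubleAntipode 𝓧 𝓨 P (𝓧.mul (𝓧.antipode z ⊗ₜ x) ⊗ₜ y')) := by
  have hD := isBialgebra_generalisedDouble hX hY hSY hP
  have hSD := isAntipode_doubleAntipode hX hY hSX hbij hSY hP
  have h1 : x ⊗ₜ 𝓨.mul (y ⊗ₜ y') = (generalisedDouble 𝓧 𝓨 P).mul
      ((generalisedDouble 𝓧 𝓨 P).mul ((x ⊗ₜ 𝓨.one) ⊗ₜ (𝓧.one ⊗ₜ y)) ⊗ₜ (𝓧.one ⊗ₜ y')) := by
    rw [double_mul_inl hX hY hSY hP, double_mul_inr hX hY hSY hP, hX.one_mul]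
  have h2 : 𝓧.mul (𝓧.antipode z ⊗ₜ x) ⊗ₜ y' = (generalisedDouble 𝓧 𝓨 P).mul
      ((generalisedDouble 𝓧 𝓨 P).mul ((x ⊗ₜ 𝓨.one) ⊗ₜ (𝓧.antipode z ⊗ₜ 𝓨.one)) ⊗ₜ
        (𝓧.one ⊗ₜ y')) := by
    rw [double_mul_inl hX hY hSY hP, double_mul_inr hX hY hSY hP, hY.one_mul]
  have h3 : f (doubleAntipode 𝓧 𝓨 P (𝓧.antipode z ⊗ₜ 𝓨.one)) =
      f (doubleAntipode 𝓧 𝓨 P (𝓧.one ⊗ₜ y)) := by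
    rw [doubleAntipode_inl hX hY hSY hP, doubleAntipode_inr hX hY hSX hbij hSY hP, ← h,
      linInv_apply_self hbij]
  rw [h1, h2]
  simp only [hSD.map_mul hD, hf.map_mul, h3]

end DoubleHom

/-! ### The projection is a Hopf algebra map. -/

section ProjectionAntipode

variable {k H A C B Z : Type*} [Field k] [Ring H] [HopfAlgebra k H] [Ring A] [HopfAlgebra k A]
  [AddCommGroup C] [Module k C] [AddCommGroup B] [Module k B] [AddCommGroup Z] [Module k Z]
  {R T : H ⊗[k] H} {pair : H ⊗[k] A →ₗ[k] k} {act : C ⊗[k] H →ₗ[k] C} {β : B →ₗ[k] A ⊗[k] B}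
  {𝓒 : HopfData k C} {𝓑 : HopfData k B} {ev : C ⊗[k] B →ₗ[k] k}

local notation "δ" => Coalgebra.comul (R := k)
local notation "ε" => Coalgebra.counit (R := k)
local notation "S" => HopfAlgebra.antipode k
local notation "S'" => linInv (HopfAlgebra.antipode k)
local notation "π" => projection (B := B) (HopfData.of k H) R pair act
local notation "Pf" => factorPairing (HopfData.of k H) T pair 𝓒 β ev
local notation "Sx" => HopfData.antipode (leftFactor (HopfData.of k H) R 𝓒 act)
local notation "Sy" => HopfData.antipode (rightFactor (HopfData.of k A) R pair 𝓑 β)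

variable (R T pair act β 𝓒 𝓑 ev) in
/-- The double of the two bosonisations. -/
abbrev factorDouble : BialgData k ((C ⊗[k] H) ⊗[k] (A ⊗[k] B)) :=
  generalisedDouble (leftFactor (HopfData.of k H) R 𝓒 act)
    (rightFactor (HopfData.of k A) R pair 𝓑 β) Pf

variable (R T pair act β 𝓒 𝓑 ev) in
/-- The antipode of the double of the two bosonisations. -/
abbrev factorDoubleAntipode :
    (C ⊗[k] H) ⊗[k] (A ⊗[k] B) →ₗ[k] (C ⊗[k] H) ⊗[k] (A ⊗[k] B) :=
  doubleAntipode (leftFactor (HopfData.of k H) R 𝓒 act)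
    (rightFactor (HopfData.of k A) R pair 𝓑 β) Pf

variable (act) in
/-- The section `c ⊗ h ⊗ b ↦ (c ◁ h₍₁₎ ⊗ h₍₂₎) ⊗ (1 ⊗ b)` of the projection. -/
def projectionSection : C ⊗[k] (H ⊗[k] B) →ₗ[k] (C ⊗[k] H) ⊗[k] (A ⊗[k] B) :=
  TensorProduct.map (leftTwist act ∘ₗ tswap) (tensorLeft B 1) ∘ₗ
    (TensorProduct.assoc k C H B).symm.toLinearMap

local notation "𝓓" => factorDouble R T pair act β 𝓒 𝓑 ev
local notation "SD" => factorDoubleAntipode R T pair act β 𝓒 𝓑 ev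
local notation "𝓤" => doubleBosonisation (HopfData.of k H) R T 𝓒 (HopfData.toBialgData 𝓑) act
  (evalAct pair β) ev

variable (hR : QTri R T) (hp : DualPair pair) (hA : QComm pair R)
  (hC : IsModuleBraidedGroup (HopfData.of k H).toBialgData R act 𝓒)
  (hB : IsComoduleBraidedGroup (HopfData.of k A).toBialgData pair R β 𝓑)
  (hS : Function.Bijective 𝓒.antipode)
  (hI : InvPairing T act (evalAct pair β) 𝓒 𝓑 (evInv 𝓒 ev))

theorem leftFactor_one : (leftFactor (HopfData.of k H) R 𝓒 act).one = 𝓒.one ⊗ₜ 1 := rfl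

theorem leftFactor_mul : (leftFactor (HopfData.of k H) R 𝓒 act).mul = (leftAlg R act 𝓒).mul := rfl

theorem rightFactor_one : (rightFactor (HopfData.of k A) R pair 𝓑 β).one = 1 ⊗ₜ 𝓑.one := rfl

theorem rightFactor_mul :
    (rightFactor (HopfData.of k A) R pair 𝓑 β).mul = (rightAlg R pair β 𝓑).mul := rfl

local notation "τ" => factorTwist R T pair act β 𝓒 𝓑 ev
local notation "κ" => crossTwist R T pair act β 𝓒 𝓑 ev

-- In both algebras a product is a sandwich around a reordered middle, and `projection_factorTwist`
-- identifies the middles. The coefficients from `A` and `H` left over in the double are those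
-- absorbed by `sandwich_mul`.
include hR hp hA hC hB hS hI in
theorem isHom_projection : (𝓓).IsHom 𝓤 π where
  map_mul u v := by
    have hB' := hB.isModuleBraidedGroup hp
    revert u
    refine Lin.ext_tmul (by fun_prop) (by fun_prop) fun x y => ?_
    revert v
    refine Lin.ext_tmul (by fun_prop) (by fun_prop) fun x' y' => ?_
    revert y; refine Lin.ext_tmul (k := k) (V := A) (W := B) (by fun_prop) (by fun_prop) fun a b => ?_
    revert y'; refine Lin.ext_tmul (k := k) (V := A) (W := B) (by fun_prop) (by fun_prop) fun a' b' => ?_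
    rw [factorDouble, generalisedDouble_eq, BialgData.twist_mul]
    change π (sw (τ ((a ⊗ₜ b) ⊗ₜ x')) fun p q => (leftAlg R act 𝓒).mul (p ⊗ₜ x) ⊗ₜ
      (rightAlg R pair β 𝓑).mul (q ⊗ₜ (a' ⊗ₜ b'))) = _
    simp only [sw_map, projection_mul_mul hR hp hC]
    rw [sw_comm]
    simp only [← sw_sandwich, ← sw_map, sw_eta, projection_factorTwist hR hp hA hC hB hS hI,
      projection_straighten]
    generalize straighten act x = z
    generalize straighten act x' = z'
    revert z
    refine Lin.ext_tmul (by fun_prop) (by fun_prop) fun c h => ?_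
    revert z'
    refine Lin.ext_tmul (by fun_prop) (by fun_prop) fun d g => ?_
    simp (disch := fun_prop) only [sw_tmul]
    rw [doubleBosonisation_mul, sandwich_mul hC hB']

  map_one := by
    rw [double_one, leftFactor_one, rightFactor_one, projection_one hC hR hp 𝓑.one]
    rfl
  map_comul u := by
    revert u
    refine Lin.ext_tmul (by fun_prop) (by fun_prop) fun x y => ?_
    rw [projection_comul hR hp hC, double_comul]
    simp only [sw_map, TensorProduct.map_tmul]
    rfl
  map_counit u := by
    revert u
    refine Lin.ext_tmul (by fun_prop) (by fun_prop) fun x y => ?_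
    rw [projection_counit hR hp hC, double_counit]
    rfl

include hR hp hA hC hB in
theorem leftFactor_antipode_inr (h : H) : Sx (𝓒.one ⊗ₜ h) = 𝓒.one ⊗ₜ S' h := by
  have h0 (h : H) : leftTwist act (h ⊗ₜ 𝓒.one) = 𝓒.one ⊗ₜ h := by
    simp only [leftTwist_tmul, hC.one_act', ← TensorProduct.smul_tmul']
    rw [counit_smul_sw h (F := fun q => 𝓒.one ⊗ₜ q) (by fun_prop)]
  rw [leftFactor_antipode_tmul]
  simp only [hC.one_act', map_smul, antipode_one_of hC, TensorProduct.tmul_smul, h0]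
  rw [hR.counit_right_sw (F := fun x => 𝓒.one ⊗ₜ[k] S' (h * x)) (by fun_prop), mul_one]

include hR hp hA hC hB in
theorem rightFactor_antipode_inl (a : A) : Sy (a ⊗ₜ 𝓑.one) = S' a ⊗ₜ 𝓑.one := by
  have hτ := isAlgTwist_rightTwist hR hp hB
  have hB' := hB.isModuleBraidedGroup hp
  change rightTwist R pair β (TensorProduct.map 𝓑.antipode (S' : A →ₗ[k] A)
    (rightCotwist β (a ⊗ₜ 𝓑.one))) = _
  rw [rightCotwist_tmul, hB.coact_one', sw_tmul _ _ (by fun_prop) (by fun_prop), mul_one,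
    TensorProduct.map_tmul, antipode_one_of hB']
  exact hτ.one_tmul _

include hR hC in
theorem leftAlg_mul_section (g : H) (x : C ⊗[k] H) :
    (leftAlg R act 𝓒).mul ((𝓒.one ⊗ₜ g) ⊗ₜ x) = sw (straighten act x) fun c h =>
      leftTwist act ((h * g) ⊗ₜ c) := by
  have hm (c : C) (h : H) : leftTwist act (h ⊗ₜ c) =
      (leftAlg R act 𝓒).mul ((𝓒.one ⊗ₜ h) ⊗ₜ (c ⊗ₜ 1)) := by
    rw [leftAlg_mul, leftTwist_tmul]
    simp only [hC.isAlg.one_mul, one_mul]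
  obtain ⟨z, rfl⟩ := (bijective_leftTwist hC).surjective x
  revert z
  refine Lin.ext_tmul (by fun_prop) (by fun_prop) fun h c => ?_
  rw [straighten_leftTwist hC, sw_tmul _ _ (by fun_prop) (by fun_prop), hm, hm,
    ← (isBialgebra_leftAlg hR hC).mul_assoc, leftAlg_mul_inr hC]

include hR hp hB in
theorem rightAlg_mul_tmul (a : A) (b : B) :
    (rightAlg R pair β 𝓑).mul ((a ⊗ₜ 𝓑.one) ⊗ₜ (1 ⊗ₜ b)) = a ⊗ₜ b := by
  have hB' := hB.isModuleBraidedGroup hp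
  simp (disch := fun_prop) only [rightAlg_mul, comul_one', sw_tmul, mul_one, slice_one hR hp,
    hB'.act_one', hB'.isAlg.one_mul]

include hR hp hC in
theorem projection_inl_one (h : H) : π ((𝓒.one ⊗ₜ h) ⊗ₜ (1 ⊗ₜ 𝓑.one)) = 𝓒.one ⊗ₜ (h ⊗ₜ 𝓑.one) := by
  have h5 : straighten act (𝓒.one ⊗ₜ h) = 𝓒.one ⊗ₜ h := by
    simp only [straighten_tmul, hC.one_act', ← TensorProduct.smul_tmul', counit_antipode']
    exact counit_smul_sw h (F := fun q => 𝓒.one ⊗ₜ q) (by fun_prop)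
  simp (disch := fun_prop) only [projection_straighten, h5, sw_tmul, slice_one hR hp, mul_one]

include hR hp hC in
theorem projection_one_tmul (a : A) (b : B) :
    π ((𝓒.one ⊗ₜ 1) ⊗ₜ (a ⊗ₜ b)) = 𝓒.one ⊗ₜ (slice pair R a ⊗ₜ b) := by
  have h5 : straighten act (𝓒.one ⊗ₜ 1) = 𝓒.one ⊗ₜ (1 : H) := by
    simp (disch := fun_prop) only [straighten_tmul, comul_one', sw_tmul, hC.one_act',
      antipode_one', Bialgebra.counit_one, one_smul]
  simp (disch := fun_prop) only [projection_straighten, h5, sw_tmul, one_mul]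

include hR hp hC hB in
theorem projectionSection_projection (x : C ⊗[k] H) (a : A) (b : B) :
    projectionSection act (π (x ⊗ₜ (a ⊗ₜ b))) =
      (leftAlg R act 𝓒).mul ((𝓒.one ⊗ₜ slice pair R a) ⊗ₜ x) ⊗ₜ ((1 : A) ⊗ₜ[k] b) := by
  rw [leftAlg_mul_section hR hC, projection_straighten]
  simp only [sw_map, sw_tmul_left]
  rfl

-- An element and the section of its projection differ by moving `a` from `A` to its image in `H`.
-- The preceding criterion applies to `a` and `S(slice a)`, because `slice` intertwines the antipode
-- of `A^cop` with that of `H`. Hence the antipode of the double induces one on `U`.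
include hR hp hA hC hB hS hI in
theorem projection_factorDoubleAntipode :
    π ∘ₗ SD = (π ∘ₗ SD ∘ₗ projectionSection act) ∘ₗ π := by
  refine LinearMap.ext ?_
  refine Lin.ext_tmul (by fun_prop) (by fun_prop) fun x y => ?_
  revert y; refine Lin.ext_tmul (k := k) (V := A) (W := B) (by fun_prop) (by fun_prop) fun a b => ?_
  have h1 : Sx (𝓒.one ⊗ₜ S (slice pair R a)) = 𝓒.one ⊗ₜ slice pair R a := by
    rw [leftFactor_antipode_inr hR hp hA hC hB, linInv_apply_self hR.bijective_antipode]
  have h4 : slice pair R (S' a) = S (slice pair R a) := by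
    rw [← slice_antipode hR hp, self_linInv_apply (hA.bijective_antipode hR hp)]
  have h := comp_doubleAntipode_tmul_mul (𝓧 := leftFactor (HopfData.of k H) R 𝓒 act)
    (𝓨 := rightFactor (HopfData.of k A) R pair 𝓑 β) (isBialgebra_leftAlg hR hC)
    (isBialgebra_rightAlg hR hp hA hB) (isAntipode_leftFactor hR hC)
    (bijective_antipode_leftFactor hR hC hS) (isAntipode_rightFactor hR hp hA hB)
    (isHopfPairing_factorPairing hR hp hB hI) (isHom_projection hR hp hA hC hB hS hI)
    (z := 𝓒.one ⊗ₜ S (slice pair R a)) (y := a ⊗ₜ 𝓑.one)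
  rw [leftFactor_one, rightFactor_one, rightFactor_antipode_inl hR hp hA hC hB,
    projection_inl_one hR hp hC, projection_one_tmul hR hp hC, h4, h1, leftFactor_mul,
    rightFactor_mul] at h
  simp only [LinearMap.comp_apply]
  rw [projectionSection_projection hR hp hC hB, ← h rfl x (1 ⊗ₜ b), rightAlg_mul_tmul hR hp hB]

end ProjectionAntipode

/-! ### Canonical elements of non-degenerate pairings. -/

section CanonicalElement

variable {k X Y Z : Type*} [Field k] [AddCommGroup X] [Module k X] [AddCommGroup Y] [Module k Y]
  [AddCommGroup Z] [Module k Z] {P : X ⊗[k] Y →ₗ[k] k} {t : X ⊗[k] Y}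

theorem isCanonicalElement_of_sw (h1 : ∀ y, (sw t fun f e => P (f ⊗ₜ y) • e) = y)
    (h2 : ∀ x, (sw t fun f e => P (x ⊗ₜ e) • f) = x) : IsCanonicalElement P t where
  right := LinearMap.ext fun y => by rw [slice_apply, h1]; rfl
  left := LinearMap.ext fun x => by
    rw [slice_apply, sw_tswap _ _ (by fun_prop) (by fun_prop)]
    exact h2 x

/-- Injectivity on both sides forces equal dimensions, so `X` is identified with the dual of `Y`,
and a basis of `Y` with its coordinate forms gives the tensor. -/
theorem exists_isCanonicalElement [FiniteDimensional k X] [FiniteDimensional k Y]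
    (h : (TensorProduct.curry P).Nondegenerate) : ∃ t, IsCanonicalElement P t := by
  have hl : Function.Injective (TensorProduct.curry P) := LinearMap.ker_eq_bot.1
    (LinearMap.separatingLeft_iff_ker_eq_bot.1 h.1)
  have hr : Function.Injective (TensorProduct.curry P).flip := LinearMap.ker_eq_bot.1
    (LinearMap.separatingRight_iff_flip_ker_eq_bot.1 h.2)
  have h1 := LinearMap.finrank_le_finrank_of_injective hl
  have h2 := LinearMap.finrank_le_finrank_of_injective hr
  have h3 : Module.finrank k X = Module.finrank k (Y →ₗ[k] k) := by
    have e1 : Module.finrank k (X →ₗ[k] k) = Module.finrank k X := Subspace.dual_finrank_eq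
    have e2 : Module.finrank k (Y →ₗ[k] k) = Module.finrank k Y := Subspace.dual_finrank_eq
    omega
  let E := LinearEquiv.ofInjectiveOfFinrankEq _ hl h3
  let b := Module.finBasis k Y
  have hE (x : X) (y : Y) : P (x ⊗ₜ y) = E x y := rfl
  refine ⟨∑ i, E.symm (b.coord i) ⊗ₜ b i, isCanonicalElement_of_sw (fun y => ?_) fun x => ?_⟩
  · have hF : Lin₂ k fun (f : X) (e : Y) => P (f ⊗ₜ y) • e :=
      ⟨fun _ => by fun_prop, fun _ => by fun_prop⟩
    rw [hF.sw_eq, map_sum]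
    simp [hE, b.sum_repr]
  · have hF : Lin₂ k fun (f : X) (e : Y) => P (x ⊗ₜ e) • f :=
      ⟨fun _ => by fun_prop, fun _ => by fun_prop⟩
    rw [hF.sw_eq, map_sum]
    simp only [TensorProduct.lift.tmul, LinearMap.mk₂_apply, hE, ← map_smul, ← map_sum]
    rw [LinearEquiv.symm_apply_eq]
    refine b.ext fun j => ?_
    simp [Finsupp.single_apply]

/-- Expanding `v e` in the canonical element and then contracting the other copy slides an operator
to its adjoint. -/
theorem IsCanonicalElement.adjoint_sw (ht : IsCanonicalElement P t) {u : X → X} {v : Y → Y}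
    (h : ∀ x y, P (u x ⊗ₜ y) = P (x ⊗ₜ v y)) {F : X → Y → Z}
    (h1 : ∀ y, Lin k (fun x => F x y)) (h2 : ∀ x, Lin k (fun y => F x y)) :
    (sw t fun f e => F (u f) e) = sw t fun f e => F f (v e) := by
  have e1 (x : X) (y : Y) : F x (v y) = sw t fun f e => P (u f ⊗ₜ y) • F x e := by
    simp (disch := fun_prop) only [h, ht.right_sw]
  rw [sw_congr fun x y => e1 x y, sw_comm t t]
  simp (disch := fun_prop) only [ht.left_sw]

end CanonicalElement

/-! ### Adjointness of the braided antipodes. -/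

section CategoricalPairing

variable {k H C B : Type*} [Field k] [Ring H] [HopfAlgebra k H] [AddCommGroup C] [Module k C]
  [AddCommGroup B] [Module k B] {R T : H ⊗[k] H} {act : C ⊗[k] H →ₗ[k] C}
  {actB : B ⊗[k] H →ₗ[k] B} {𝓒 : HopfData k C} {𝓑 : HopfData k B} {ev : C ⊗[k] B →ₗ[k] k}

/-- With opposite product and coproduct on `C` the axioms of a categorical pairing become those of
an ordinary one. The convolution argument uses no compatibility of product and coproduct, so it
holds for braided groups too. -/
theorem IsCategoricalPairing.antipode_adjoint
    (hev : IsCategoricalPairing (HopfData.of k H).toBialgData act actB 𝓒.toBialgData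
      𝓑.toBialgData ev)
    (hC : IsModuleBraidedGroup (HopfData.of k H).toBialgData R act 𝓒)
    (hB : IsModuleBraidedGroup (HopfData.of k H).toBialgData R actB 𝓑) (c : C) (b : B) :
    ev (𝓒.antipode c ⊗ₜ b) = ev (c ⊗ₜ 𝓑.antipode b) := by
  have hp : IsHopfPairing 𝓒.toBialgData.op.cop 𝓑.toBialgData ev :=
    ⟨fun x y => hev.mul_left y x, hev.mul_right, hev.one_left, hev.one_right⟩
  have hS : 𝓒.toBialgData.op.cop.IsAntipode 𝓒.antipode := by
    refine ⟨fun x => ?_, fun x => ?_⟩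
    · refine Eq.trans ?_ (hC.isAntipode.right x)
      simp only [BialgData.op, BialgData.cop, LinearMap.comp_apply]
      generalize 𝓒.comul x = z
      induction z using TensorProduct.induction_on with
      | zero => simp
      | tmul => simp
      | add _ _ h1 h2 => simp only [map_add, h1, h2]
    · refine Eq.trans ?_ (hC.isAntipode.left x)
      simp only [BialgData.op, BialgData.cop, LinearMap.comp_apply]
      generalize 𝓒.comul x = z
      induction z using TensorProduct.induction_on with
      | zero => simp
      | tmul => simp
      | add _ _ h1 h2 => simp only [map_add, h1, h2]
  have hc := hC.isCoalg.cop
  exact hp.antipode_adjoint ⟨hc.coassoc, hc.counit_comul, hc.comul_counit⟩ hB.isCoalg hS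
    hB.isAntipode c b

end CategoricalPairing

/-! ### The canonical element of the bosonisations and its image. -/

section CanonicalFactor

variable {k H A C B Z : Type*} [Field k] [Ring H] [HopfAlgebra k H] [Ring A] [HopfAlgebra k A]
  [AddCommGroup C] [Module k C] [AddCommGroup B] [Module k B] [AddCommGroup Z] [Module k Z]
  {R T : H ⊗[k] H} {pair : H ⊗[k] A →ₗ[k] k} {act : C ⊗[k] H →ₗ[k] C} {β : B →ₗ[k] A ⊗[k] B}
  {𝓒 : HopfData k C} {𝓑 : HopfData k B} {ev : C ⊗[k] B →ₗ[k] k} {s : C ⊗[k] B} {t : H ⊗[k] A}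

local notation "δ" => Coalgebra.comul (R := k)
local notation "ε" => Coalgebra.counit (R := k)
local notation "S" => HopfAlgebra.antipode k
local notation "S'" => linInv (HopfAlgebra.antipode k)
local notation "π" => projection (B := B) (HopfData.of k H) R pair act
local notation "Pf" => factorPairing (HopfData.of k H) T pair 𝓒 β ev

/-- Writing `R = (id ⊗ S)R⁻¹` for both copies turns the second leg into `S` of a product, and `R⁻¹R
= 1` applies. -/
theorem QTri.mul_antipode_mul_sw (hR : QTri R T) {F : H → H → Z}
    (h1 : ∀ y, Lin k (fun x => F x y)) (h2 : ∀ x, Lin k (fun y => F x y)) :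
    (sw R fun a b => sw R fun c d => F (a * c) (S d * b)) = F 1 1 := by
  rw [← hR.antipode_right_eq_sw (F := fun a b => sw R fun c d => F (a * c) (S d * b))
    (by fun_prop) (by fun_prop)]
  have := hR.inv_mul_sw (F := fun a b => F a (S b)) (by fun_prop) (by fun_prop)
  simpa only [antipode_mul_rev, antipode_one'] using this

theorem QTri.mul_mul_antipode_sw (hR : QTri R T) {F : H → H → Z}
    (h1 : ∀ y, Lin k (fun x => F x y)) (h2 : ∀ x, Lin k (fun y => F x y)) :
    (sw R fun a b => sw R fun c d => F (a * c) (d * S b)) = F 1 1 := by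
  have h3 (a b : H) := hR.antipode_right_eq_sw (F := fun c d => F (a * c) (d * S b))
    (by fun_prop) (by fun_prop)
  simp only [← h3]
  have := hR.mul_inv_sw (F := fun a b => F a (S b)) (by fun_prop) (by fun_prop)
  simpa only [antipode_mul_rev, antipode_one'] using this

/-- In the order `h · c` the legs of `h` that act on `c` cancel, and the pairing factorises up to a
single copy of `R`. -/
theorem factorPairing_leftTwist (hR : QTri R T)
    (hC : IsModuleBraidedGroup (HopfData.of k H).toBialgData R act 𝓒)
    (hI : InvPairing T act (evalAct pair β) 𝓒 𝓑 (evInv 𝓒 ev)) (c : C) (h : H) (a : A) (b : B) :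
    Pf (leftTwist act (h ⊗ₜ c) ⊗ₜ (a ⊗ₜ b)) =
      sw R fun u v => pair ((u * h) ⊗ₜ a) * evInv 𝓒 ev (act (c ⊗ₜ v) ⊗ₜ b) := by
  rw [leftTwist_tmul]
  simp (disch := fun_prop) only [sw_map, sw_tmul_left, factorPairing_tmul, hI.act_right,
    hC.act_act]
  have h1 (p q : H) := hR.quasi_inv_sw q (F := fun u v => pair (u ⊗ₜ a) *
    evInv 𝓒 ev (act (c ⊗ₜ (p * S v)) ⊗ₜ b)) (by fun_prop) (by fun_prop)
  simp only [sw_comm T, h1]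
  simp only [antipode_mul_rev]
  rw [← comul_coassoc_sw h (F := fun p m n => sw T fun x y => pair ((x * n) ⊗ₜ a) *
    evInv 𝓒 ev (act (c ⊗ₜ (p * (S m * S y))) ⊗ₜ b)) (by fun_prop) (by fun_prop) (by fun_prop)]
  simp only [← mul_assoc]
  have h2 (m n : H) := antipode_right_sw (k := k) m (F := fun z => sw T fun x y =>
    pair ((x * n) ⊗ₜ a) * evInv 𝓒 ev (act (c ⊗ₜ (z * S y)) ⊗ₜ b)) (by fun_prop)
  simp only [h2]
  rw [counit_smul_sw h (F := fun n => sw T fun x y => pair ((x * n) ⊗ₜ a) *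
    evInv 𝓒 ev (act (c ⊗ₜ (1 * S y)) ⊗ₜ b)) (by fun_prop)]
  simp only [one_mul]
  exact hR.antipode_right_eq_sw (F := fun x y => pair ((x * h) ⊗ₜ a) *
    evInv 𝓒 ev (act (c ⊗ₜ y) ⊗ₜ b)) (by fun_prop) (by fun_prop)

variable (R act 𝓒) in
/-- The canonical element of the pairing of the bosonisations, from those of the pairings of `C`
with `B` and of `H` with `A`. -/
def factorCanonical (s : C ⊗[k] B) (t : H ⊗[k] A) : (C ⊗[k] H) ⊗[k] (A ⊗[k] B) :=
  sw s fun f e => sw t fun p q => sw R fun u v =>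
    leftTwist act ((u * p) ⊗ₜ act (𝓒.antipode f ⊗ₜ S v)) ⊗ₜ (q ⊗ₜ e)

variable (hR : QTri R T) (hp : DualPair pair)
  (hC : IsModuleBraidedGroup (HopfData.of k H).toBialgData R act 𝓒)
  (hS : Function.Bijective 𝓒.antipode)
  (hI : InvPairing T act (evalAct pair β) 𝓒 𝓑 (evInv 𝓒 ev))

-- The pairing in the order `h · c` is a product up to one copy of `R`, so the product of the two
-- canonical elements is corrected by a copy of `R` with an antipode, which cancels it. The braided
-- antipode on `C` compensates the inverse one in the pairing.
include hR hC hS hI in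
theorem isCanonicalElement_factorCanonical (hs : IsCanonicalElement ev s)
    (ht : IsCanonicalElement pair t) : IsCanonicalElement Pf (factorCanonical R act 𝓒 s t) := by
  have e1 (c : C) (b : B) : evInv 𝓒 ev (𝓒.antipode c ⊗ₜ b) = ev (c ⊗ₜ b) := by
    rw [evInv_tmul, linInv_apply_self hS]
  refine isCanonicalElement_of_sw ?_ ?_
  · refine Lin.ext_tmul (by fun_prop) (by fun_prop) fun a b => ?_
    simp (disch := fun_prop) only [factorCanonical, sw_sw, sw_tmul,
      factorPairing_leftTwist hR hC hI, hC.act_act]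
    have h1 (f : C) (e : B) (p : H) (q : A) := hR.mul_antipode_mul_sw (F := fun x y =>
      (pair ((x * p) ⊗ₜ a) * evInv 𝓒 ev (act (𝓒.antipode f ⊗ₜ y) ⊗ₜ b)) • (q ⊗ₜ[k] e))
      (by fun_prop) (by fun_prop)
    simp only [sw_smul_left, ← mul_assoc]
    rw [sw_congr fun f e => sw_congr fun p q => (sw_comm R R _).trans (h1 f e p q)]
    simp only [one_mul, hC.act_one', e1]
    simp (disch := fun_prop) only [mul_smul, smul_comm (pair _), ← sw_smul_right, ht.right_sw]
    simp (disch := fun_prop) only [← TensorProduct.tmul_smul, ← sw_tmul_right, hs.right_sw]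
  · intro x
    obtain ⟨z, rfl⟩ := (bijective_leftTwist hC).surjective x
    revert z
    refine Lin.ext_tmul (by fun_prop) (by fun_prop) fun h c => ?_
    simp (disch := fun_prop) only [factorCanonical, sw_sw, sw_tmul,
      factorPairing_leftTwist hR hC hI]
    simp only [sw_smul_left, sw_comm t R, sw_comm s R, mul_smul, smul_comm (pair _),
      ← sw_smul_right, evInv_tmul]
    simp (disch := fun_prop) only [ht.left_sw, hs.left_sw, self_linInv_apply hS, hC.act_act,
      ← mul_assoc]
    have h1 := hR.mul_mul_antipode_sw (F := fun x y => leftTwist act ((x * h) ⊗ₜ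
      act (c ⊗ₜ[k] y))) (by fun_prop) (by fun_prop)
    rw [h1, one_mul, hC.act_one']

theorem doubleBosonisationR_eq_sw {actB : B ⊗[k] H →ₗ[k] B} :
    doubleBosonisationR (HopfData.of k H).toBialgData R 𝓒.toBialgData 𝓑 actB s =
      sw s fun f e => sw R fun u v => sw R fun x y =>
        (f ⊗ₜ ((u * x) ⊗ₜ 𝓑.one)) ⊗ₜ (𝓒.one ⊗ₜ (y ⊗ₜ actB (𝓑.antipode e ⊗ₜ v))) := by
  rw [doubleBosonisationR, BialgData.r13r12, interchange_eq_sw, interchange_eq_sw]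
  simp (disch := fun_prop) only [map_eq_sw, sw_sw, sw_tmul, of_mul, tswap_eq_sw]
  rfl

-- The canonical element of `H` and `A` is contracted by `slice` to a copy of `R`. Then `f ↦ S f ◁ S
-- v` slides to its adjoint `e ↦ S e ◁ v` on `B`, with `S f` and `S e` the braided antipodes.
include hR hp hC in
theorem map_projection_doubleR (hB : IsComoduleBraidedGroup (HopfData.of k A).toBialgData pair R β 𝓑)
    (hev : IsCategoricalPairing (HopfData.of k H).toBialgData act (evalAct pair β)
      𝓒.toBialgData 𝓑.toBialgData ev) (hs : IsCanonicalElement ev s)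
    (ht : IsCanonicalElement pair t) :
    TensorProduct.map π π (doubleR (leftFactor (HopfData.of k H) R 𝓒 act).toBialgData
        (rightFactor (HopfData.of k A) R pair 𝓑 β).toBialgData (factorCanonical R act 𝓒 s t)) =
      doubleBosonisationR (HopfData.of k H).toBialgData R 𝓒.toBialgData 𝓑 (evalAct pair β) s := by
  have hB' := hB.isModuleBraidedGroup hp
  rw [doubleBosonisationR_eq_sw, doubleR_eq_sw, leftFactor_one, rightFactor_one]
  simp (disch := fun_prop) only [factorCanonical, sw_sw, sw_tmul, sw_map, TensorProduct.map_tmul,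
    projection_one_tmul hR hp hC]
  simp (disch := fun_prop) only [projection_straighten, straighten_leftTwist hC, sw_tmul,
    slice_one hR hp, mul_one]
  simp only [slice_apply, sw_tmul_left, sw_tmul_right, ← TensorProduct.smul_tmul',
    TensorProduct.tmul_smul, sw_comm t R]
  simp (disch := fun_prop) only [ht.left_sw, sw_comm s R]
  refine sw_congr fun u v => sw_congr fun x y => ?_
  exact hs.adjoint_sw (u := fun f => act (𝓒.antipode f ⊗ₜ S v))
    (v := fun e => evalAct pair β (𝓑.antipode e ⊗ₜ v))
    (F := fun f e => (f ⊗ₜ ((u * x) ⊗ₜ 𝓑.one)) ⊗ₜ (𝓒.one ⊗ₜ (y ⊗ₜ e)))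
    (fun f e => by
      rw [hev.act_left hR hB', linInv_apply_self hR.bijective_antipode,
        hev.antipode_adjoint hC hB', hB'.antipode_act']) (by fun_prop) (by fun_prop)

end CanonicalFactor

end DoubleBosonisation

end

/-! ### Assembly of the theorem. -/

open DoubleBosonisation in
theorem theoremA2
    {k : Type*} [Field k]
    -- a quasitriangular Hopf algebra `H`
    {H : Type*} [Ring H] [HopfAlgebra k H] (R Rinv : H ⊗[k] H)
    (hR : (HopfData.of k H).IsQuasitriangular R Rinv)
    -- a Hopf algebra `A` dually paired with `H`, dual quasitriangular by evaluation of `R`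
    {A : Type*} [Ring A] [HopfAlgebra k A] (pair : H ⊗[k] A →ₗ[k] k)
    (hpair : IsHopfPairing (HopfData.of k H).toBialgData (HopfData.of k A).toBialgData pair)
    (hA : (HopfData.of k A).IsQuasicommutative (evalForm pair R))
    -- a braided group `B` of left `A`-comodules
    {B : Type*} [AddCommGroup B] [Module k B] (𝓑 : HopfData k B) (β : B →ₗ[k] A ⊗[k] B)
    (hB : IsComoduleBraidedGroup (HopfData.of k A).toBialgData pair R β 𝓑)
    -- a braided group `C` of right `H`-modules, with bijective antipode
    {C : Type*} [AddCommGroup C] [Module k C] (𝓒 : HopfData k C) (act : C ⊗[k] H →ₗ[k] C)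
    (hC : IsModuleBraidedGroup (HopfData.of k H).toBialgData R act 𝓒)
    (hS : Function.Bijective 𝓒.antipode)
    -- a categorical duality pairing of `C` and `B`
    (ev : C ⊗[k] B →ₗ[k] k)
    (hev : IsCategoricalPairing (HopfData.of k H).toBialgData act (evalAct pair β)
      𝓒.toBialgData 𝓑.toBialgData ev) :
    let 𝓗 := HopfData.of k H
    let 𝓐 := HopfData.of k A
    let 𝓧 := leftFactor 𝓗 R 𝓒 act
    let 𝓨 := rightFactor 𝓐 R pair 𝓑 β
    let P := factorPairing 𝓗 Rinv pair 𝓒 β ev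
    let 𝓓 := generalisedDouble 𝓧 𝓨 P
    let 𝓤 := doubleBosonisation 𝓗 R Rinv 𝓒 𝓑.toBialgData act (evalAct pair β) ev
    let π := projection (B := B) 𝓗 R pair act
    -- `C ⋊ H^op` and `A^cop ⋉ B` are dually paired Hopf algebras
    (𝓧.IsBialgebra ∧ 𝓧.IsAntipode 𝓧.antipode) ∧
    (𝓨.IsBialgebra ∧ 𝓨.IsAntipode 𝓨.antipode) ∧
    IsHopfPairing 𝓧.toBialgData 𝓨.toBialgData P ∧
    -- their double and `U(C̄, H, B)` are Hopf algebras, and `π` is a surjective Hopf algebra map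
    𝓓.IsBialgebra ∧ 𝓤.IsBialgebra ∧
    (∃ SD SU, 𝓓.IsAntipode SD ∧ 𝓤.IsAntipode SU ∧ π ∘ₗ SD = SU ∘ₗ π) ∧
    𝓓.IsHom 𝓤 π ∧ Function.Surjective π ∧
    -- in the finite-dimensional non-degenerate case `π` maps Drinfeld's quasitriangular structure
    -- of the double to that of `U(C̄, H, B)`
    (FiniteDimensional k H → FiniteDimensional k A → FiniteDimensional k B →
      FiniteDimensional k C →
      (TensorProduct.curry pair).Nondegenerate → (TensorProduct.curry ev).Nondegenerate →
      ∃ (t : (C ⊗[k] H) ⊗[k] (A ⊗[k] B)) (s : C ⊗[k] B),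
        IsCanonicalElement P t ∧ IsCanonicalElement ev s ∧
        (∃ RDinv, 𝓓.IsQuasitriangular (doubleR 𝓧.toBialgData 𝓨.toBialgData t) RDinv) ∧
        (∃ RUinv, 𝓤.IsQuasitriangular
          (doubleBosonisationR 𝓗.toBialgData R 𝓒.toBialgData 𝓑 (evalAct pair β) s) RUinv) ∧
        TensorProduct.map π π (doubleR 𝓧.toBialgData 𝓨.toBialgData t) =
          doubleBosonisationR 𝓗.toBialgData R 𝓒.toBialgData 𝓑 (evalAct pair β) s) := by
  intro 𝓗 𝓐 𝓧 𝓨 P 𝓓 𝓤 π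
  have hR' := hR.qTri
  have hp := hpair.dualPair
  have hA' := hA.qComm
  have hB' := hB.isModuleBraidedGroup hp
  have hI := invPairing hR' hC hS hB' hev
  have hX : 𝓧.IsBialgebra := isBialgebra_leftAlg hR' hC
  have hY : 𝓨.IsBialgebra := isBialgebra_rightAlg hR' hp hA' hB
  have hSX : 𝓧.IsAntipode 𝓧.antipode := isAntipode_leftFactor hR' hC
  have hSY : 𝓨.IsAntipode 𝓨.antipode := isAntipode_rightFactor hR' hp hA' hB
  have hbij : Function.Bijective 𝓧.antipode := bijective_antipode_leftFactor hR' hC hS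
  have hP : IsHopfPairing 𝓧.toBialgData 𝓨.toBialgData P :=
    isHopfPairing_factorPairing hR' hp hB hI
  have hD : 𝓓.IsBialgebra := isBialgebra_generalisedDouble hX hY hSY hP
  have hSD : 𝓓.IsAntipode (doubleAntipode 𝓧 𝓨 P) :=
    isAntipode_doubleAntipode hX hY hSX hbij hSY hP
  have hπ : 𝓓.IsHom 𝓤 π := isHom_projection hR' hp hA' hC hB hS hI
  have hs : Function.Surjective π := projection_surjective hC hR' hp
  have hSU : π ∘ₗ doubleAntipode 𝓧 𝓨 P =
      (π ∘ₗ doubleAntipode 𝓧 𝓨 P ∘ₗ projectionSection act) ∘ₗ π :=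
    projection_factorDoubleAntipode hR' hp hA' hC hB hS hI
  -- The axioms of `U` are inherited along `π`; its antipode is the section followed by the antipode
  -- of the double and by `π`.
  refine ⟨⟨hX, hSX⟩, ⟨hY, hSY⟩, hP, hD, hπ.isBialgebra hD hs,
    ⟨_, _, hSD, hπ.isAntipode hs hSD hSU, hSU⟩, hπ, hs, fun _ _ _ _ hp₀ hev₀ => ?_⟩
  obtain ⟨t, ht⟩ := exists_isCanonicalElement hp₀
  obtain ⟨s, hs'⟩ := exists_isCanonicalElement hev₀
  -- The explicit canonical element makes the image of Drinfeld's element computable. Its existence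
  -- also expresses that the pairing of `X` and `Y` is non-degenerate.
  have hc : IsCanonicalElement P (factorCanonical R act 𝓒 s t) :=
    isCanonicalElement_factorCanonical hR' hC hS hI hs' ht
  have hq := isQuasitriangular_doubleR hX hY hSX hbij hSY hP hc
  have hm : TensorProduct.map π π
      (doubleR 𝓧.toBialgData 𝓨.toBialgData (factorCanonical R act 𝓒 s t)) =
        doubleBosonisationR 𝓗.toBialgData R 𝓒.toBialgData 𝓑 (evalAct pair β) s :=
    map_projection_doubleR hR' hp hC hB hev hs' ht
  -- The image of a quasitriangular structure under the surjection is quasitriangular, and `hm`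
  -- identifies this image with the stated element.
  exact ⟨_, s, hc, hs', ⟨_, hq⟩, ⟨_, hm ▸ hπ.isQuasitriangular hs hq⟩, hm⟩
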